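/- **Theorem (Phase III: spectral-tail learning).** Let $a>1$. For $d\ge1$ put $H_{d,a}=\sum_{j=1}^d j^{-a}$, $\lambda_i=i^{-a}/H_{d,a}$, $Q=\mathrm{diag}(\lambda_1,\dots,\lambda_d)$ and $\langle v,w\rangle_Q=v^\top Qw$. Let $w^\star=g/\|Q^{1/2}g\|$ with $g\sim\mathcal N(0,I_d)$, and let $w(t)\in\mathbb R^d$, $t\ge0$, solve the gradient flow $\dot w=-\nabla\mathcal L(w)$ of $$\mathcal L(w)=\mathbb E_{x\sim\mathcal N(0,Q)}\bigl[(\langle x,w\rangle^2-\langle x,w^\star\rangle^2)^2\bigr],$$ where $w(0)$ is uniform on the unit sphere and independent of $g$. For a sign choice $v\in\{w^\star,-w^\star\}$ and a time $T_2\ge 0$ write $$\mathrm{MSE}(t)=\tfrac1d\sum_{i=1}^d(w_i(t)-v_i)^2,\quad \pi_i=\frac{(w_i(T_2)-v_i)^2}{\sum_j(w_j(T_2)-v_j)^2},\quad \widehat S_d(\tau)=\sum_{i=1}^d\pi_ie^{-16\lambda_i\tau},\quad s_\star^{(2)}=\tfrac1d\sum_{i=1}^d\lambda_i^2(w_i^\star)^2,$$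 and let $S_d(\tau)=\frac1d\sum_{i=1}^d e^{-16\lambda_i\tau}$, $\beta_d=16/H_{d,a}$, $x_d=(\beta_d\tau)^{1/a}$. 1. For all $\eta,c,K>0$ there are $C>0$ and $d_0$, depending only on $a,\eta,c,K$, such that for all $d\ge d_0$ and all $\varepsilon$ with $c\,d^{-(a-1)/2}\le\varepsilon<1$, outside an event of probability at most $\eta$ the flow exists for all times and is such that: - for some $v\in\{w^\star,-w^\star\}$ there is a time $T_2\ge 0$ with $\langle w(T_2),v\rangle_Q\in[1-\varepsilon,1]$ and $\langle w(T_2),w(T_2)\rangle_Q\in[1-\varepsilon,1]$, with $T_2\le C\bigl(\log d+\varepsilon^{-2a/(a-1)}\log(1/\varepsilon)\bigr)$ and $T_2\le K d^a$; - for each $v\in\{w^\star,-w^\star\}$ and every $T_2\in[0,Kd^a]$ with $\langle w(T_2),v\rangle_Q\in[1-\varepsilon,1]$ and $\langle w(T_2),w(T_2)\rangle_Q\in[1-\varepsilon,1]$, and every $\tau\ge0$, $$\Bigl|\mathrm{MSE}(T_2+\tau)-\mathrm{MSE}(T_2)\,\widehat S_d(\tau)\Bigr|\le C\varepsilon\,\mathrm{MSE}(T_2)\,\widehat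 S_d(\tau)+C\,\varepsilon^2\tau^2\,\tfrac1d\,s_\star^{(2)}\qquad\text{and}\qquad \widehat S_d(\tau)\le C\,S_d(\tau).$$ 2. There is $C=C(a)$ such that $\bigl|S_d(\tau)-(1-\tfrac{16}{d}\tau)\bigr|\le C\tau^2/d$ for all $d\ge1$ and $\tau\ge0$ with $\beta_d\tau\le1$. 3. For $1\ll x_d\ll d$, $S_d(\tau)=1-\Gamma(1-\tfrac1a)\frac{x_d}{d}+o(\frac{x_d}{d})$: for every $\delta>0$ there are $M,\kappa>0$ such that $\bigl|S_d(\tau)-1+\Gamma(1-\tfrac1a)\frac{x_d}{d}\bigr|\le\delta\frac{x_d}{d}$ for all $d\ge1$, $\tau\ge0$ with $M\le x_d\le\kappa d$. 4. For every $c>0$, if $d\ge1$, $\tau\ge0$ and $x_d\ge c\,d$, then $S_d(\tau)\le\exp(-\beta_d\tau d^{-a})$. -/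

import Mathlib

namespace PhaseRetrieval

noncomputable section

open MeasureTheory ProbabilityTheory

/-- The parameter space `ℝ^d` with its Euclidean structure. -/
abbrev Vec (d : ℕ) := EuclideanSpace ℝ (Fin d)

/-- `H_{d,a} = ∑_{j=1}^d j^{-a}`. -/
def harmonicSum (a : ℝ) (d : ℕ) : ℝ := ∑ j ∈ Finset.Icc 1 d, (j : ℝ) ^ (-a)

/-- The power-law eigenvalues `λ_i = i^{-a} / H_{d,a}`. The index `i : Fin d` starts at `0`,
so it stands for the `(i+1)`-st eigenvalue. -/
def eigenvalue (a : ℝ) (d : ℕ) (i : Fin d) : ℝ := ((i : ℝ) + 1) ^ (-a) / harmonicSum a d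

/-- The covariance matrix `Q = diag(λ_1, …, λ_d)`. -/
def covariance (a : ℝ) (d : ℕ) : Matrix (Fin d) (Fin d) ℝ := Matrix.diagonal (eigenvalue a d)

/-- `⟨v, w⟩_Q = vᵀ Q w`. -/
def qInner (a : ℝ) (d : ℕ) (v w : Vec d) : ℝ := ∑ i, eigenvalue a d i * v i * w i

/-- The population loss `E_x[(⟨x, w⟩² - ⟨x, w⋆⟩²)²]` for `x ~ N(0, Q)`. -/
def loss (a : ℝ) (d : ℕ) (wStar w : Vec d) : ℝ :=
  ∫ x, ((inner ℝ x w) ^ 2 - (inner ℝ x wStar) ^ 2) ^ 2 ∂(multivariateGaussian 0 (covariance a d))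

/-- `w : [0, ∞) → ℝ^d` is the gradient flow `w' = -∇L(w)` started at `w₀`
(values of `w` at negative times are irrelevant). -/
def IsGradientFlow {d : ℕ} (L : Vec d → ℝ) (w₀ : Vec d) (w : ℝ → Vec d) : Prop :=
  w 0 = w₀ ∧ ∀ t, 0 ≤ t → HasDerivWithinAt w (-(gradient L (w t))) (Set.Ici 0) t

/-- The target `w⋆ = g / ‖Q^{1/2} g‖` built from the vector `g`. -/
def target (a : ℝ) (d : ℕ) (g : Vec d) : Vec d := (Real.sqrt (qInner a d g g))⁻¹ • g

/-- The uniform probability measure on the unit sphere of `ℝ^d`: normalized surface measure. -/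
def sphereUniform (d : ℕ) : Measure (Metric.sphere (0 : Vec d) 1) :=
  ((volume : Measure (Vec d)).toSphere Set.univ)⁻¹ • (volume : Measure (Vec d)).toSphere

/-- The joint law of the pair `(g, w(0))`: `g ~ N(0, I_d)` generates the target, and `w(0)` is
uniform on the unit sphere and independent of `g`. -/
def initialLaw (d : ℕ) : Measure (Vec d × Metric.sphere (0 : Vec d) 1) :=
  (stdGaussian (Vec d)).prod (sphereUniform d)

/-- Both summary statistics `u = ⟨w, v⟩_Q` and `s = ⟨w, w⟩_Q` lie in `[1 - ε, 1]`. -/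
def StatsConverged (a : ℝ) (d : ℕ) (ε : ℝ) (v w : Vec d) : Prop :=
  qInner a d w v ∈ Set.Icc (1 - ε) 1 ∧ qInner a d w w ∈ Set.Icc (1 - ε) 1

/-- The mean squared error `(1/d) ∑_i (w_i - v_i)²`. -/
def mse (d : ℕ) (v w : Vec d) : ℝ := (1 / (d : ℝ)) * ∑ i, (w i - v i) ^ 2

/-- The weights `π_i = e_i² / ∑_j e_j²` of the coordinate errors `e_i = w_i - v_i`. -/
def errorWeight (d : ℕ) (v w : Vec d) (i : Fin d) : ℝ :=
  (w i - v i) ^ 2 / ∑ j, (w j - v j) ^ 2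

/-- `Ŝ_d(τ) = ∑_i π_i exp(-16 λ_i τ)`. -/
def weightedAverage (a : ℝ) (d : ℕ) (v w : Vec d) (τ : ℝ) : ℝ :=
  ∑ i, errorWeight d v w i * Real.exp (-16 * eigenvalue a d i * τ)

/-- `S_d(τ) = (1/d) ∑_i exp(-16 λ_i τ)`. -/
def uniformAverage (a : ℝ) (d : ℕ) (τ : ℝ) : ℝ :=
  (1 / (d : ℝ)) * ∑ i : Fin d, Real.exp (-16 * eigenvalue a d i * τ)

/-- `s⋆^{(2)} = (1/d) ∑_i λ_i² (w⋆_i)²`. -/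
def sStarTwo (a : ℝ) (d : ℕ) (v : Vec d) : ℝ :=
  (1 / (d : ℝ)) * ∑ i, eigenvalue a d i ^ 2 * v i ^ 2

/-- `β_d = 16 / H_{d,a}`. -/
def betaRate (a : ℝ) (d : ℕ) : ℝ := 16 / harmonicSum a d

/-- `x_d = (β_d τ)^{1/a}`. -/
def xScale (a : ℝ) (d : ℕ) (τ : ℝ) : ℝ := (betaRate a d * τ) ^ (1 / a)

end

end PhaseRetrieval

/-!
# Spectral-tail learning in phase retrieval with a power-law spectrum

**Reduction to two statistics.** By polarization only fourth moments of one-dimensional Gaussians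
enter the loss, which is a function of `s = ⟨w, w⟩_Q` and `u = ⟨w, v⟩_Q` alone (`loss_eq`). Its
gradient flow reads `w_i' = λ_i ((4 - 12 s) w_i + 8 u v_i)` in coordinates (`IsFlow`), the same
equation for the targets `v` and `-v`. It exists for all times because the loss controls `s`
(`exists_gradientFlow`).

**Typical data.** All estimates are deterministic on the event `IsTypical`: initial, final and dyadic
blocks of coordinates of the target have a mass comparable to their length, `s` is of order `1/d`
initially, and the initial point is not almost orthogonal to the top eigenvector of the linearization
`4 Q + 8 (Qv)(Qv)ᵀ` at the origin. Chernoff bounds for Gaussian sums of squares give the first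
property (`exists_isRegular`); for the others the uniform measure on the sphere is compared with a
Gaussian on cones (`sphereUniform_le_stdGaussian`), the top eigenvalue being a measurable function
of the target as the root of a secular equation (`topRoot`, `exists_isTypical`).

**Reaching the basin.** After a bounded time the top eigenvector dominates (`IsFlow.linear_phase`);
its entries are nonnegative multiples of the entries of `v` up to one sign, which selects the target.
From then on `w_i = q_i v_i + e^{λ_i P} n_i` with `q_i ≥ 0` and a homogeneous part that stays small
(`IsSplit`). The top mode grows exponentially until `s = 1/3`, at time `O(log d)` (`IsFlow.escape`),
and a Łojasiewicz inequality restricted to the fast modes brings the loss into the basin within a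
bounded time (`IsFlow.descend`, `IsFlow.reaches_basin`).

**Decay in the basin.** Write `α = 1 - 1/a`. A mode is learned only after a time of order `1/λ_i`.
Truncating the Łojasiewicz inequality at the scale `λ_i t ~ 1` yields loss `= O(t^{-α})`
(`IsSettled.statL_decay`), and the decrease of the gradient norm along the flow improves this to
`|∇L|² = O(t^{-α-1})` (`IsSettled.gradSq_decay`). The loss alone does not make `s ≤ 1`; but
`⟨v, w⟩' = 12 u (1 - s)`, whose increments see the slow modes only, so `1 - s` cannot stay above `ε`,
and `s` cannot stay above `1`, since the modes still to be learned then outweigh any overshoot of the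
others. Hence both statistics lie in `[1 - ε, 1]` at some time of the order `log d + ε^{-1/α}`
(`IsTypical.exists_converged`).

**Comparison of the errors.** After an `ε`-convergence time, `|1 - s|` and `|1 - u|` are
`O(ε d^{α/2})` (`IsTypical.exists_deviation_le`): for `ε ≥ d^{-α}` by monotonicity of the loss, and
otherwise because such a time is at least of order `ε^{-1/α}` and `d`, so that the gradient bound
applies to `3 u (1 - s)`, which is the inner product of `v` with the rescaled gradient. The error
`e_i = w_i - v_i` solves `e_i' = -8 λ_i e_i` up to a forcing of this relative size, so the squared
errors differ from `∑ e_i(T₂)² e^{-16 λ_i τ}` by at most `O(ε d^{α/2}) ∑ min(1, λ_i τ) U_i`, where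
`U_i` bounds the errors along the whole flow (`IsTypical.exists_majorant`). For `τ ≤ d/ε` the last sum
is `O(d^{(1 + 1/a)/2})` and the product is `O(ε d)`, while the slow half of the modes keeps the
linearized error of order `d` (`IsTypical.exists_err_ge`); for larger `τ` the quadratic term of the
bound exceeds the trivial one. The bound `Ŝ ≤ C S` is a summation by parts.

**The uniform average.** `S_d` is expanded for small times, bounded by its slowest mode for large
times, and in between compared with `∫₀^∞ (1 - exp(-y^{-a})) dy = Γ(1 - 1/a)`.
-/


namespace PhaseRetrieval

open MeasureTheory ProbabilityTheory Set

/-! ### The power-law spectrum -/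

lemma harmonicSum_eq (a : ℝ) (d : ℕ) : harmonicSum a d = ∑ i : Fin d, ((i : ℝ) + 1) ^ (-a) := by
  rw [harmonicSum, Fin.sum_univ_eq_sum_range (fun i : ℕ => ((i : ℝ) + 1) ^ (-a)) d,
    Finset.range_eq_Ico]
  have h := Finset.sum_Ico_add' (fun j : ℕ => (j : ℝ) ^ (-a)) 0 d 1
  push_cast at h
  rw [h]
  rfl

lemma one_le_harmonicSum {a : ℝ} {d : ℕ} (hd : 1 ≤ d) : 1 ≤ harmonicSum a d := by
  have h := Finset.single_le_sum (f := fun j : ℕ => (j : ℝ) ^ (-a)) (s := Finset.Icc 1 d)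
    (fun j _ => by positivity) (Finset.mem_Icc.2 ⟨le_rfl, hd⟩)
  simpa [harmonicSum] using h

lemma harmonicSum_pos {a : ℝ} {d : ℕ} (hd : 1 ≤ d) : 0 < harmonicSum a d :=
  lt_of_lt_of_le one_pos (one_le_harmonicSum hd)

/-- Comparison with the integral of `y ↦ min (1, τ y^{-a})`, whose value is
`τ^{1/a} a / (a - 1)`. -/
lemma sum_min_one_rpow_le {a : ℝ} (ha : 1 < a) (d : ℕ) {τ : ℝ} (hτ : 0 < τ) :
    ∑ i : Fin d, min 1 (τ * ((i : ℝ) + 1) ^ (-a)) ≤ a / (a - 1) * τ ^ (1 / a) := by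
  set y := τ ^ (1 / a) with hy
  have hy0 : 0 < y := by positivity
  have ha0 : 0 < a := by linarith
  have hya : τ * y ^ (-a) = 1 := by
    rw [hy, ← Real.rpow_mul hτ.le]
    have : 1 / a * -a = -1 := by field_simp
    rw [this, Real.rpow_neg_one, mul_inv_cancel₀ hτ.ne']
  let f : ℝ → ℝ := fun x => τ * (max x y) ^ (-a)
  have hf : Antitone f := fun x z hxz => by
    have h1 : max x y ≤ max z y := max_le_max_right _ hxz
    have h2 : 0 < max x y := lt_max_of_lt_right hy0
    exact mul_le_mul_of_nonneg_left
      (Real.rpow_le_rpow_of_nonpos h2 h1 (by linarith)) hτ.le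
  have h1 : ∑ i : Fin d, min 1 (τ * ((i : ℝ) + 1) ^ (-a)) ≤ ∑ i ∈ Finset.range d, f (0 + ((i + 1 : ℕ) : ℝ)) := by
    rw [Fin.sum_univ_eq_sum_range (fun i : ℕ => min 1 (τ * ((i : ℝ) + 1) ^ (-a))) d]
    refine Finset.sum_le_sum fun i _ => ?_
    simp only [f, zero_add]; push_cast
    rcases le_total ((i : ℝ) + 1) y with h | h
    · rw [max_eq_right h, hya]; exact min_le_left _ _
    · rw [max_eq_left h]; exact min_le_right _ _
  refine h1.trans ((AntitoneOn.sum_le_integral (hf.antitoneOn _)).trans ?_)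
  have hint : ∀ p q : ℝ, IntervalIntegrable f volume p q := fun p q => hf.intervalIntegrable
  have hcalc : ∀ z, y ≤ z → ∫ x in (0:ℝ)..z, f x ≤ a / (a - 1) * y := by
    intro z hz
    rw [← intervalIntegral.integral_add_adjacent_intervals (hint 0 y) (hint y z)]
    have e1 : ∫ x in (0:ℝ)..y, f x = y := by
      rw [intervalIntegral.integral_congr (g := fun _ => (1 : ℝ))]
      · simp
      · intro x hx
        rw [uIcc_of_le hy0.le] at hx
        simp only [f, max_eq_right hx.2, hya]
    have e2 : ∫ x in y..z, f x = τ * ((z ^ (-a + 1) - y ^ (-a + 1)) / (-a + 1)) := by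
      rw [intervalIntegral.integral_congr (g := fun x => τ * x ^ (-a))]
      · rw [intervalIntegral.integral_const_mul, integral_rpow]
        right
        refine ⟨by linarith, ?_⟩
        rw [uIcc_of_le hz]; intro h; linarith [h.1]
      · intro x hx
        rw [uIcc_of_le hz] at hx
        simp only [f, max_eq_left hx.1]
    have e3 : τ * y ^ (-a + 1) = y := by
      rw [Real.rpow_add hy0, Real.rpow_one, ← mul_assoc, hya, one_mul]
    have hz0 : 0 ≤ τ * z ^ (-a + 1) := by
      have : 0 ≤ z := by linarith
      positivity
    rw [e1, e2]
    have e4 : ∀ Z Y : ℝ, τ * ((Z - Y) / (-a + 1)) = (τ * Y - τ * Z) / (a - 1) := by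
      intro Z Y
      have : a - 1 ≠ 0 := by linarith
      rw [show -a + 1 = -(a - 1) by ring]
      field_simp
      ring
    have ha1 : 0 < a - 1 := by linarith
    rw [e4, e3, show a / (a - 1) * y = y + y / (a - 1) by field_simp; ring]
    gcongr
    linarith
  rw [zero_add]
  refine le_trans ?_ (hcalc (max (d : ℝ) y) (le_max_right _ _))
  refine intervalIntegral.integral_mono_interval le_rfl (by positivity) (le_max_left _ _) ?_ (hint _ _)
  filter_upwards with x
  have : 0 ≤ max x y := le_max_of_le_right hy0.le
  simp only [f, Pi.zero_apply]; positivity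

lemma harmonicSum_le {a : ℝ} (ha : 1 < a) (d : ℕ) : harmonicSum a d ≤ a / (a - 1) := by
  have h := sum_min_one_rpow_le ha d (τ := 1) one_pos
  rw [Real.one_rpow, mul_one] at h
  refine le_trans (le_of_eq ?_) h
  rw [harmonicSum_eq]
  refine Finset.sum_congr rfl fun i _ => ?_
  rw [one_mul, min_eq_right]
  exact Real.rpow_le_one_of_one_le_of_nonpos (by linarith [(Nat.cast_nonneg (α := ℝ) (i : ℕ))]) (by linarith)

lemma eigenvalue_pos {a : ℝ} {d : ℕ} (i : Fin d) : 0 < eigenvalue a d i := by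
  have := harmonicSum_pos (a := a) (d := d) (by have := i.2; omega)
  unfold eigenvalue; positivity

lemma sum_eigenvalue {a : ℝ} {d : ℕ} (hd : 1 ≤ d) : ∑ i, eigenvalue a d i = 1 := by
  unfold eigenvalue
  rw [← Finset.sum_div, ← harmonicSum_eq, div_self (harmonicSum_pos hd).ne']

lemma eigenvalue_le {a : ℝ} {d : ℕ} (i : Fin d) : eigenvalue a d i ≤ ((i : ℝ) + 1) ^ (-a) :=
  div_le_self (by positivity) (one_le_harmonicSum (by have := i.2; omega))

lemma le_eigenvalue {a : ℝ} (ha : 1 < a) {d : ℕ} (i : Fin d) :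
    (a - 1) / a * ((i : ℝ) + 1) ^ (-a) ≤ eigenvalue a d i := by
  have hH := harmonicSum_pos (a := a) (d := d) (by have := i.2; omega)
  have h := harmonicSum_le ha d
  have ha1 : 0 < a - 1 := by linarith
  unfold eigenvalue
  rw [le_div_iff₀ hH]
  have : (a - 1) / a * harmonicSum a d ≤ 1 := by
    calc (a - 1) / a * harmonicSum a d ≤ (a - 1) / a * (a / (a - 1)) := by gcongr
      _ = 1 := by field_simp
  have hp : 0 ≤ ((i : ℝ) + 1) ^ (-a) := by positivity
  nlinarith

lemma eigenvalue_le_one {a : ℝ} (ha : 1 < a) {d : ℕ} (i : Fin d) : eigenvalue a d i ≤ 1 :=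
  (eigenvalue_le i).trans (Real.rpow_le_one_of_one_le_of_nonpos
    (by linarith [(Nat.cast_nonneg (α := ℝ) (i : ℕ))]) (by linarith))

lemma eigenvalue_anti {a : ℝ} (ha : 1 < a) {d : ℕ} {i j : Fin d} (h : i ≤ j) :
    eigenvalue a d j ≤ eigenvalue a d i := by
  have hH := harmonicSum_pos (a := a) (d := d) (by have := i.2; omega)
  unfold eigenvalue
  gcongr ?_ / _
  refine Real.rpow_le_rpow_of_nonpos (by positivity) ?_ (by linarith)
  have : (i : ℕ) ≤ j := h
  gcongr

lemma sum_min_eigenvalue_le {a : ℝ} (ha : 1 < a) (d : ℕ) {τ : ℝ} (hτ : 0 < τ) :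
    ∑ i, min 1 (eigenvalue a d i * τ) ≤ a / (a - 1) * τ ^ (1 / a) := by
  refine le_trans (Finset.sum_le_sum fun i _ => ?_) (sum_min_one_rpow_le ha d hτ)
  refine min_le_min_left _ ?_
  rw [mul_comm]
  exact mul_le_mul_of_nonneg_left (eigenvalue_le i) hτ.le

/-! ### The uniform spectral average -/

lemma uniformAverage_small_time {a : ℝ} (ha : 1 < a) {d : ℕ} (hd : 1 ≤ d) {τ : ℝ} (hτ : 0 ≤ τ) :
    |uniformAverage a d τ - (1 - 16 / (d : ℝ) * τ)| ≤ 128 * (τ ^ 2 / d) := by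
  have hd0 : (0 : ℝ) < d := by exact_mod_cast hd
  have key : uniformAverage a d τ - (1 - 16 / (d : ℝ) * τ) =
      (1 / (d : ℝ)) * ∑ i : Fin d, (Real.exp (-16 * eigenvalue a d i * τ) - 1
        + 16 * τ * eigenvalue a d i) := by
    rw [Finset.sum_add_distrib, Finset.sum_sub_distrib, ← Finset.mul_sum, sum_eigenvalue hd]
    simp only [uniformAverage, Finset.sum_const, Finset.card_univ, Fintype.card_fin, nsmul_eq_mul]
    generalize ∑ i : Fin d, Real.exp (-16 * eigenvalue a d i * τ) = S
    field_simp
    ring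
  have hterm : ∀ i : Fin d, 0 ≤ Real.exp (-16 * eigenvalue a d i * τ) - 1
        + 16 * τ * eigenvalue a d i ∧ Real.exp (-16 * eigenvalue a d i * τ) - 1
        + 16 * τ * eigenvalue a d i ≤ 128 * τ ^ 2 * eigenvalue a d i := by
    intro i
    have h0 := eigenvalue_pos (a := a) i
    have h1 := eigenvalue_le_one ha i
    constructor
    · nlinarith [Real.add_one_le_exp (-16 * eigenvalue a d i * τ)]
    · have hx : 0 ≤ 16 * eigenvalue a d i * τ := by positivity
      have h2 : Real.exp (-(16 * eigenvalue a d i * τ)) ≤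
          1 - 16 * eigenvalue a d i * τ + (16 * eigenvalue a d i * τ) ^ 2 / 2 := by
        have := Real.quadratic_le_exp_of_nonneg hx
        rw [Real.exp_neg, inv_le_comm₀ (Real.exp_pos _)]
        · refine le_trans ?_ this
          rw [inv_le_comm₀]
          · rw [inv_eq_one_div, div_le_iff₀ (by positivity)]
            set x := 16 * eigenvalue a d i * τ
            nlinarith [sq_nonneg x, sq_nonneg (x ^ 2), sq_nonneg (x-1)]
          · set x := 16 * eigenvalue a d i * τ
            nlinarith [sq_nonneg x, sq_nonneg (x ^ 2), sq_nonneg (x-1)]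
          · positivity
        · set x := 16 * eigenvalue a d i * τ
          nlinarith [sq_nonneg x, sq_nonneg (x ^ 2), sq_nonneg (x-1)]
      have h3 : -16 * eigenvalue a d i * τ = -(16 * eigenvalue a d i * τ) := by ring
      rw [h3]
      have h4 : eigenvalue a d i ^ 2 ≤ eigenvalue a d i := by nlinarith
      nlinarith [sq_nonneg τ, mul_le_mul_of_nonneg_left h4 (sq_nonneg τ)]
  rw [key, abs_of_nonneg (mul_nonneg (by positivity) (Finset.sum_nonneg fun i _ => (hterm i).1))]
  calc (1 / (d : ℝ)) * ∑ i : Fin d, (Real.exp (-16 * eigenvalue a d i * τ) - 1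
        + 16 * τ * eigenvalue a d i)
      ≤ (1 / (d : ℝ)) * ∑ i : Fin d, 128 * τ ^ 2 * eigenvalue a d i := by
        gcongr with i; exact (hterm i).2
    _ = 128 * (τ ^ 2 / d) := by
        rw [← Finset.mul_sum, sum_eigenvalue hd]; ring

lemma uniformAverage_large_time {a : ℝ} (ha : 1 < a) {d : ℕ} (hd : 1 ≤ d) {τ : ℝ} (hτ : 0 ≤ τ) :
    uniformAverage a d τ ≤ Real.exp (-(betaRate a d * τ * (d : ℝ) ^ (-a))) := by
  have hd0 : (0 : ℝ) < d := by exact_mod_cast hd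
  have hH := harmonicSum_pos (a := a) hd
  have hterm : ∀ i : Fin d, Real.exp (-16 * eigenvalue a d i * τ) ≤
      Real.exp (-(betaRate a d * τ * (d : ℝ) ^ (-a))) := by
    intro i
    apply Real.exp_le_exp.2
    have h1 : (d : ℝ) ^ (-a) ≤ ((i : ℝ) + 1) ^ (-a) :=
      Real.rpow_le_rpow_of_nonpos (by positivity)
        (by exact_mod_cast (Nat.succ_le_of_lt i.2)) (by linarith)
    have h2 : betaRate a d * τ * (d : ℝ) ^ (-a) ≤ betaRate a d * τ * ((i : ℝ) + 1) ^ (-a) := by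
      unfold betaRate; gcongr
    have h3 : betaRate a d * τ * ((i : ℝ) + 1) ^ (-a) = 16 * eigenvalue a d i * τ := by
      unfold betaRate eigenvalue; ring
    linarith
  calc uniformAverage a d τ ≤ (1 / (d : ℝ)) * ∑ i : Fin d,
        Real.exp (-(betaRate a d * τ * (d : ℝ) ^ (-a))) := by
        exact mul_le_mul_of_nonneg_left (Finset.sum_le_sum fun i _ => hterm i) (by positivity)
    _ = _ := by simp; field_simp

/-- Layer-cake evaluation of `∫₀^∞ (1 - exp(-y^{-a})) dy`. -/
lemma lintegral_one_sub_exp_rpow {a : ℝ} (ha : 1 < a) :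
    ∫⁻ y in Ioi (0 : ℝ), ENNReal.ofReal (1 - Real.exp (-(y ^ (-a)))) =
      ENNReal.ofReal (Real.Gamma (1 - 1 / a)) := by
  have ha0 : 0 < a := by linarith
  have hs : 0 < 1 - 1 / a := by
    rw [sub_pos, div_lt_one ha0]; exact ha
  have h := lintegral_comp_eq_lintegral_meas_le_mul (volume.restrict (Ioi (0 : ℝ)))
    (f := fun y => y ^ (-a)) (g := fun t => Real.exp (-t))
    ((ae_restrict_iff' measurableSet_Ioi).2 (Filter.Eventually.of_forall fun y (hy : 0 < y) => by
      simp only [Pi.zero_apply]; positivity))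
    (by fun_prop) (fun t _ => (by fun_prop : Continuous fun t : ℝ => Real.exp (-t)).intervalIntegrable _ _)
    (Filter.Eventually.of_forall fun t => (Real.exp_pos _).le)
  have hi : ∀ z : ℝ, ∫ t in (0:ℝ)..z, Real.exp (-t) = 1 - Real.exp (-z) := by
    intro z
    rw [intervalIntegral.integral_comp_neg (fun t => Real.exp t), integral_exp]; simp
  simp only [hi] at h
  rw [h, Real.Gamma_eq_integral hs, ofReal_integral_eq_lintegral_ofReal
    (Real.GammaIntegral_convergent hs)
    ((ae_restrict_iff' measurableSet_Ioi).2 (Filter.Eventually.of_forall fun y (hy : 0 < y) => by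
      simp only [Pi.zero_apply]; positivity))]
  refine setLIntegral_congr_fun measurableSet_Ioi fun t (ht : 0 < t) => ?_
  have hset : {y : ℝ | t ≤ y ^ (-a)} ∩ Ioi 0 = Ioc 0 (t ^ (-(1 / a))) := by
    ext y
    simp only [mem_inter_iff, mem_ofPred_eq, mem_Ioi, mem_Ioc]
    constructor
    · rintro ⟨h1, h2⟩
      refine ⟨h2, ?_⟩
      have := Real.rpow_le_rpow_of_nonpos ht h1 (show -(1 / a) ≤ 0 by
        have : 0 < 1 / a := by positivity
        linarith)
      rwa [← Real.rpow_mul h2.le, show -a * -(1 / a) = 1 by field_simp, Real.rpow_one] at this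
    · rintro ⟨h1, h2⟩
      refine ⟨?_, h1⟩
      have := Real.rpow_le_rpow_of_nonpos h1 h2 (show -a ≤ 0 by linarith)
      rwa [← Real.rpow_mul ht.le, show -(1 / a) * -a = 1 by field_simp, Real.rpow_one] at this
  have hm : MeasurableSet {y : ℝ | t ≤ y ^ (-a)} :=
    measurableSet_le measurable_const (by fun_prop)
  rw [Measure.restrict_apply hm, hset, Real.volume_Ioc, sub_zero,
    ← ENNReal.ofReal_mul (by positivity), mul_comm]
  congr 2
  rw [show 1 - 1 / a - 1 = -(1 / a) by ring]

lemma integrableOn_one_sub_exp_rpow {a : ℝ} (ha : 1 < a) :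
    IntegrableOn (fun y : ℝ => 1 - Real.exp (-(y ^ (-a)))) (Ioi 0) := by
  refine ⟨by fun_prop, ?_⟩
  rw [hasFiniteIntegral_iff_ofReal]
  · rw [lintegral_one_sub_exp_rpow ha]; exact ENNReal.ofReal_lt_top
  · refine (ae_restrict_iff' measurableSet_Ioi).2 (Filter.Eventually.of_forall fun y (hy : 0 < y) => ?_)
    have : 0 < y ^ (-a) := by positivity
    simp only [Pi.zero_apply, sub_nonneg, Real.exp_le_one_iff]; linarith

lemma integral_one_sub_exp_rpow {a : ℝ} (ha : 1 < a) :
    ∫ y in Ioi (0 : ℝ), (1 - Real.exp (-(y ^ (-a)))) = Real.Gamma (1 - 1 / a) := by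
  have hs : 0 < 1 - 1 / a := by
    rw [sub_pos, div_lt_one (by linarith)]; exact ha
  rw [integral_eq_lintegral_of_nonneg_ae, lintegral_one_sub_exp_rpow ha,
    ENNReal.toReal_ofReal (Real.Gamma_pos_of_pos hs).le]
  · refine (ae_restrict_iff' measurableSet_Ioi).2 (Filter.Eventually.of_forall fun y (hy : 0 < y) => ?_)
    have : 0 < y ^ (-a) := by positivity
    simp only [Pi.zero_apply, sub_nonneg, Real.exp_le_one_iff]; linarith
  · fun_prop

lemma uniformAverage_middle_time {a : ℝ} (ha : 1 < a) {δ : ℝ} (hδ : 0 < δ) :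
    ∃ M : ℝ, 0 < M ∧ ∃ κ : ℝ, 0 < κ ∧ ∀ d : ℕ, 1 ≤ d → ∀ τ : ℝ, 0 ≤ τ →
      M ≤ xScale a d τ → xScale a d τ ≤ κ * d →
        |uniformAverage a d τ - (1 - Real.Gamma (1 - 1 / a) * (xScale a d τ / d))|
          ≤ δ * (xScale a d τ / d) := by
  have ha0 : 0 < a := by linarith
  have ha1 : 0 < a - 1 := by linarith
  refine ⟨2 / δ, by positivity, (δ * (a - 1) / 2) ^ (1 / (a - 1)), by positivity, ?_⟩
  intro d hd τ hτ hM hκ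
  set x := xScale a d τ with hx
  have hd0 : (0 : ℝ) < d := by exact_mod_cast hd
  have hx0 : 0 < x := lt_of_lt_of_le (by positivity) hM
  have hH := harmonicSum_pos (a := a) hd
  have hxa : x ^ a = betaRate a d * τ := by
    rw [hx, xScale, ← Real.rpow_mul (by unfold betaRate; positivity), one_div,
      inv_mul_cancel₀ ha0.ne', Real.rpow_one]
  -- the summand `φ(j) = 1 - exp(-(j/x)^{-a})`
  let φ : ℝ → ℝ := fun y => 1 - Real.exp (-((x⁻¹ * y) ^ (-a)))
  have hφint : IntegrableOn φ (Ioi 0) := by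
    have := (integrableOn_Ioi_comp_mul_left_iff (fun y : ℝ => 1 - Real.exp (-(y ^ (-a)))) 0
      (a := x⁻¹) (by positivity)).2 (by simpa using integrableOn_one_sub_exp_rpow ha)
    exact this
  have hφI : ∫ y in Ioi 0, φ y = x * Real.Gamma (1 - 1 / a) := by
    have := integral_comp_mul_left_Ioi (fun y : ℝ => 1 - Real.exp (-(y ^ (-a)))) 0
      (b := x⁻¹) (by positivity)
    rw [mul_zero, integral_one_sub_exp_rpow ha, inv_inv, smul_eq_mul] at this
    exact this
  have hφ0 : ∀ y, 0 < y → 0 ≤ φ y := fun y hy => by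
    have : 0 < (x⁻¹ * y) ^ (-a) := by positivity
    simp only [φ, sub_nonneg, Real.exp_le_one_iff]; linarith
  have hφ1 : ∀ y, φ y ≤ 1 := fun y => by
    simp only [φ]; linarith [Real.exp_pos (-((x⁻¹ * y) ^ (-a)))]
  have hφanti : ∀ y z, 0 < y → y ≤ z → φ z ≤ φ y := fun y z hy hyz => by
    simp only [φ]
    have : (x⁻¹ * z) ^ (-a) ≤ (x⁻¹ * y) ^ (-a) :=
      Real.rpow_le_rpow_of_nonpos (by positivity) (by gcongr) (by linarith)
    have := Real.exp_le_exp.2 (neg_le_neg this)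
    linarith
  have hφtail : ∀ y, 0 < y → φ y ≤ x ^ a * y ^ (-a) := fun y hy => by
    have h1 := Real.add_one_le_exp (-((x⁻¹ * y) ^ (-a)))
    have h2 : (x⁻¹ * y) ^ (-a) = x ^ a * y ^ (-a) := by
      rw [Real.mul_rpow (by positivity) hy.le, Real.inv_rpow hx0.le, ← Real.rpow_neg hx0.le, neg_neg]
    simp only [φ]; rw [h2] at h1 ⊢; linarith
  have key : uniformAverage a d τ - (1 - Real.Gamma (1 - 1 / a) * (x / d)) =
      (1 / (d : ℝ)) * (x * Real.Gamma (1 - 1 / a) - ∑ i ∈ Finset.range d, φ ((i : ℝ) + 1)) := by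
    rw [← Fin.sum_univ_eq_sum_range (fun i : ℕ => φ ((i : ℝ) + 1)) d]
    simp only [φ, uniformAverage, Finset.sum_sub_distrib, Finset.sum_const, Finset.card_univ,
      Fintype.card_fin, nsmul_eq_mul]
    have : ∀ i : Fin d, -16 * eigenvalue a d i * τ = -((x⁻¹ * ((i : ℝ) + 1)) ^ (-a)) := by
      intro i
      rw [Real.mul_rpow (by positivity) (by positivity), Real.inv_rpow hx0.le,
        ← Real.rpow_neg hx0.le, neg_neg, hxa]
      unfold eigenvalue betaRate; ring
    simp only [this]
    field_simp
    ring
  have hup : ∑ i ∈ Finset.range d, φ ((i : ℝ) + 1) ≤ x * Real.Gamma (1 - 1 / a) := by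
    let ψ : ℝ → ℝ := fun y => if y ≤ 0 then 1 else φ y
    have hψ : Antitone ψ := by
      intro y z hyz
      simp only [ψ]
      split_ifs with h1 h2 h2
      · exact le_rfl
      · exact absurd (hyz.trans h1) h2
      · exact hφ1 _
      · exact hφanti _ _ (not_le.1 h2) hyz
    have h := AntitoneOn.sum_le_integral (x₀ := 0) (a := d) (hψ.antitoneOn (Icc 0 (0 + d)))
    calc ∑ i ∈ Finset.range d, φ ((i : ℝ) + 1)
        = ∑ i ∈ Finset.range d, ψ (0 + ((i + 1 : ℕ) : ℝ)) := by
          refine Finset.sum_congr rfl fun i _ => ?_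
          simp only [ψ, zero_add]; push_cast
          rw [if_neg (not_le.2 (by positivity))]
      _ ≤ _ := h
      _ = ∫ y in Ioc (0 : ℝ) d, φ y := by
          rw [zero_add, intervalIntegral.integral_of_le hd0.le]
          refine setIntegral_congr_fun measurableSet_Ioc fun y hy => ?_
          simp only [ψ, if_neg (not_le.2 hy.1)]
      _ ≤ ∫ y in Ioi 0, φ y := by
          refine setIntegral_mono_set hφint ?_ (Filter.Eventually.of_forall fun y hy => hy.1)
          exact (ae_restrict_iff' measurableSet_Ioi).2 (Filter.Eventually.of_forall fun y hy => hφ0 y hy)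
      _ = _ := hφI
  have hlow : x * Real.Gamma (1 - 1 / a) - 1 - x ^ a * (d : ℝ) ^ (1 - a) / (a - 1)
      ≤ ∑ i ∈ Finset.range d, φ ((i : ℝ) + 1) := by
    have h := AntitoneOn.integral_le_sum (x₀ := 1) (a := d) (f := φ)
      (fun y hy z _ hyz => hφanti y z (by linarith [hy.1]) hyz)
    have hint : ∀ p q : ℝ, 0 ≤ p → p ≤ q → IntegrableOn φ (Ioc p q) := fun p q hp _ =>
      hφint.mono_set fun y hy => lt_of_le_of_lt hp hy.1
    have hsplit : ∫ y in Ioi 0, φ y = (∫ y in Ioc (0:ℝ) 1, φ y) +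
        ((∫ y in Ioc (1:ℝ) (1 + d), φ y) + ∫ y in Ioi (1 + d : ℝ), φ y) := by
      have u1 : Ioc (1:ℝ) (1 + d) ∪ Ioi (1 + d : ℝ) = Ioi 1 := Ioc_union_Ioi_eq_Ioi (by linarith)
      have u2 : Ioc (0:ℝ) 1 ∪ Ioi (1 : ℝ) = Ioi 0 := Ioc_union_Ioi_eq_Ioi (by norm_num)
      rw [← setIntegral_union Ioc_disjoint_Ioi_same measurableSet_Ioi (hint _ _ (by norm_num) (by linarith))
        (hφint.mono_set (Ioi_subset_Ioi (by linarith))), u1,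
        ← setIntegral_union Ioc_disjoint_Ioi_same measurableSet_Ioi (hint _ _ le_rfl (by norm_num))
        (hφint.mono_set (Ioi_subset_Ioi (by norm_num))), u2]
    have h1 : ∫ y in Ioc (0:ℝ) 1, φ y ≤ 1 := by
      calc ∫ y in Ioc (0:ℝ) 1, φ y ≤ ∫ y in Ioc (0:ℝ) 1, (1 : ℝ) :=
            setIntegral_mono_on (hint _ _ le_rfl (by norm_num)) (by simp) measurableSet_Ioc
              fun y _ => hφ1 y
        _ = 1 := by simp
    have h2 : ∫ y in Ioi (1 + d : ℝ), φ y ≤ x ^ a * (d : ℝ) ^ (1 - a) / (a - 1) := by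
      have hti : IntegrableOn (fun y : ℝ => x ^ a * y ^ (-a)) (Ioi (d : ℝ)) :=
        (integrableOn_Ioi_rpow_of_lt (by linarith) hd0).const_mul _
      have hsub : Ioi (1 + d : ℝ) ⊆ Ioi (d : ℝ) := Ioi_subset_Ioi (by linarith)
      calc ∫ y in Ioi (1 + d : ℝ), φ y ≤ ∫ y in Ioi (1 + d : ℝ), x ^ a * y ^ (-a) :=
            setIntegral_mono_on (hφint.mono_set (Ioi_subset_Ioi (by linarith)))
              (hti.mono_set hsub) measurableSet_Ioi
              fun y hy => hφtail y (lt_trans (by linarith) (show (1 + d : ℝ) < y from hy))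
        _ ≤ ∫ y in Ioi (d : ℝ), x ^ a * y ^ (-a) := by
            refine setIntegral_mono_set hti ?_ (Filter.Eventually.of_forall hsub)
            refine (ae_restrict_iff' measurableSet_Ioi).2 (Filter.Eventually.of_forall fun y hy => ?_)
            have : 0 < y := lt_trans hd0 hy
            simp only [Pi.zero_apply]; positivity
        _ = x ^ a * (d : ℝ) ^ (1 - a) / (a - 1) := by
            rw [integral_const_mul, integral_Ioi_rpow_of_lt (by linarith) hd0,
              show -a + 1 = 1 - a by ring, show (1 - a) = -(a - 1) by ring]
            field_simp
    rw [intervalIntegral.integral_of_le (by linarith)] at h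
    have h3 : ∑ i ∈ Finset.range d, φ (1 + (i : ℝ)) = ∑ i ∈ Finset.range d, φ ((i : ℝ) + 1) := by
      simp only [add_comm]
    rw [hφI] at hsplit
    linarith
  have hone : 1 ≤ δ / 2 * x := by
    rw [div_le_iff₀ hδ] at hM; linarith
  have htail : x ^ a * (d : ℝ) ^ (1 - a) / (a - 1) ≤ δ / 2 * x := by
    have h1 : x ^ (a - 1) ≤ δ * (a - 1) / 2 * (d : ℝ) ^ (a - 1) := by
      have := Real.rpow_le_rpow hx0.le hκ ha1.le
      rwa [Real.mul_rpow (by positivity) hd0.le, ← Real.rpow_mul (by positivity), one_div,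
        inv_mul_cancel₀ ha1.ne', Real.rpow_one] at this
    have h2 : x ^ a = x ^ (a - 1) * x := by
      rw [← Real.rpow_add_one hx0.ne']; congr 1; ring
    have h3 : (d : ℝ) ^ (a - 1) * (d : ℝ) ^ (1 - a) = 1 := by
      rw [← Real.rpow_add hd0]; simp
    rw [div_le_iff₀ ha1, h2]
    calc x ^ (a - 1) * x * (d : ℝ) ^ (1 - a)
        ≤ (δ * (a - 1) / 2 * (d : ℝ) ^ (a - 1)) * x * (d : ℝ) ^ (1 - a) := by gcongr
      _ = δ / 2 * x * (a - 1) * ((d : ℝ) ^ (a - 1) * (d : ℝ) ^ (1 - a)) := by ring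
      _ = _ := by rw [h3, mul_one]
  rw [key, abs_of_nonneg (mul_nonneg (by positivity) (by linarith))]
  calc (1 / (d : ℝ)) * (x * Real.Gamma (1 - 1 / a) - ∑ i ∈ Finset.range d, φ ((i : ℝ) + 1))
      ≤ (1 / (d : ℝ)) * (δ * x) := by gcongr; linarith
    _ = _ := by ring

end PhaseRetrieval

namespace PhaseRetrieval

open MeasureTheory ProbabilityTheory Set

/-! ### The population loss and its gradient flow -/

lemma integral_pow_four_gaussianReal (v : NNReal) : ∫ x, x ^ 4 ∂(gaussianReal 0 v) = 3 * (v : ℝ) ^ 2 := by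
  have h := iteratedDeriv_mgf_zero (X := id) (μ := gaussianReal 0 v)
    (by rw [integrableExpSet_id_gaussianReal]; simp) 4
  have e : (fun x : ℝ => x ^ 4) = (id : ℝ → ℝ) ^ 4 := by ext; simp
  rw [e, ← h, mgf_id_gaussianReal]
  have key : ∀ (p p' : ℝ → ℝ), (∀ t, HasDerivAt p (p' t) t) →
      deriv (fun t : ℝ => p t * Real.exp (0 * t + v * t ^ 2 / 2)) =
        fun t => (p' t + p t * (v * t)) * Real.exp (0 * t + v * t ^ 2 / 2) := by
    intro p p' hp
    ext t
    have h1 : HasDerivAt (fun t : ℝ => 0 * t + v * t ^ 2 / 2) (v * t) t := by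
      have := ((hasDerivAt_id t).const_mul 0).add (((hasDerivAt_pow 2 t).const_mul (v : ℝ)).div_const 2)
      convert! this using 1
      simp; ring
    have := ((hp t).mul h1.exp).deriv
    rw [show (fun t : ℝ => p t * Real.exp (0 * t + v * t ^ 2 / 2)) =
      p * fun t => Real.exp (0 * t + v * t ^ 2 / 2) from rfl, this]; ring
  have s0 : (fun t : ℝ => Real.exp (0 * t + v * t ^ 2 / 2)) =
    fun t => (1 : ℝ) * Real.exp (0 * t + v * t ^ 2 / 2) := by ext; simp
  rw [s0]
  simp only [iteratedDeriv_succ, iteratedDeriv_zero]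
  rw [key (fun _ => 1) (fun _ => 0) (fun t => hasDerivAt_const t 1)]
  rw [key (fun t => 0 + 1 * (v * t)) (fun _ => v) (fun t => by
    simpa using ((hasDerivAt_id t).const_mul (v : ℝ)))]
  rw [key (fun t => v + (0 + 1 * (v * t)) * (v * t)) (fun t => 2 * v ^ 2 * t) (fun t => by
    have := ((hasDerivAt_pow 2 t).const_mul ((v : ℝ) ^ 2)).const_add (v : ℝ)
    convert! this using 1
    · ext; ring
    · simp; ring)]
  rw [key (fun t => 2 * v ^ 2 * t + (v + (0 + 1 * (v * t)) * (v * t)) * (v * t))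
    (fun t => 3 * v ^ 2 + 3 * v ^ 3 * t ^ 2) (fun t => by
    have := ((hasDerivAt_id t).const_mul (3 * (v : ℝ) ^ 2)).add ((hasDerivAt_pow 3 t).const_mul ((v : ℝ) ^ 3))
    convert! this using 1
    · ext; simp; ring
    · simp; ring)]
  simp

lemma covariance_posSemidef (a : ℝ) (d : ℕ) : (covariance a d).PosSemidef :=
  Matrix.PosSemidef.diagonal fun i => (eigenvalue_pos i).le

lemma integrable_inner_pow {d : ℕ} (m : Measure (Vec d)) [IsGaussian m] (y : Vec d) (n : ℕ) :
    Integrable (fun x => (inner ℝ x y) ^ n) m := by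
  have h : MemLp (fun x : Vec d => inner ℝ x y) n m :=  by
    have := (IsGaussian.memLp_id m n (by simp)).continuousLinearMap_comp (innerSL ℝ y)
    simpa [real_inner_comm] using this
  rcases eq_or_ne n 0 with rfl | hn
  · simp
  · refine (integrable_norm_iff (h.1.pow n)).1 ?_
    simpa [norm_pow] using h.integrable_norm_pow hn

lemma integral_inner_pow_four (a : ℝ) (d : ℕ) (y : Vec d) :
    ∫ x, (inner ℝ x y) ^ 4 ∂(multivariateGaussian 0 (covariance a d)) = 3 * qInner a d y y ^ 2 := by
  have h := IsGaussian.map_eq_gaussianReal (μ := multivariateGaussian 0 (covariance a d)) (innerSL ℝ y)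
  have hv : Var[innerSL ℝ y; multivariateGaussian 0 (covariance a d)] = qInner a d y y := by
    have h1 := covarianceBilin_multivariateGaussian (μ := 0) (covariance_posSemidef a d) y y
    rw [covarianceBilin_self IsGaussian.memLp_two_id] at h1
    have : (fun u : Vec d => inner ℝ y u) = innerSL ℝ y := by ext; simp
    rw [← this, h1]
    simp [covariance, qInner, dotProduct, Matrix.mulVec_diagonal]
    exact Finset.sum_congr rfl fun i _ => by ring
  have hq : 0 ≤ qInner a d y y := hv ▸ variance_nonneg _ _
  have hm : (multivariateGaussian 0 (covariance a d))[innerSL ℝ y] = 0 := by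
    rw [(innerSL ℝ y).integral_comp_id_comm IsGaussian.integrable_id]
    rw [integral_id_multivariateGaussian, map_zero]
  rw [hm, hv] at h
  have := integral_pow_four_gaussianReal (qInner a d y y).toNNReal
  rw [← h, integral_map (by fun_prop) (by fun_prop), Real.coe_toNNReal _ hq] at this
  rw [← this]
  refine integral_congr_ae (Filter.Eventually.of_forall fun x => ?_)
  simp [real_inner_comm]

lemma qInner_add_left (a : ℝ) (d : ℕ) (x y z : Vec d) :
    qInner a d (x + y) z = qInner a d x z + qInner a d y z := by
  simp only [qInner, PiLp.add_apply, ← Finset.sum_add_distrib]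
  exact Finset.sum_congr rfl fun i _ => by ring

lemma qInner_smul_left (a : ℝ) (d : ℕ) (c : ℝ) (x z : Vec d) :
    qInner a d (c • x) z = c * qInner a d x z := by
  simp only [qInner, PiLp.smul_apply, smul_eq_mul, Finset.mul_sum]
  exact Finset.sum_congr rfl fun i _ => by ring

lemma qInner_comm (a : ℝ) (d : ℕ) (x y : Vec d) : qInner a d x y = qInner a d y x :=
  Finset.sum_congr rfl fun i _ => by ring

lemma qInner_sq_le (a : ℝ) (d : ℕ) (x y : Vec d) :
    qInner a d x y ^ 2 ≤ qInner a d x x * qInner a d y y := by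
  have h := Finset.sum_mul_sq_le_sq_mul_sq Finset.univ
    (fun i => √(eigenvalue a d i) * x i) (fun i => √(eigenvalue a d i) * y i)
  have e : ∀ p q : Vec d, ∑ i, (√(eigenvalue a d i) * p i) * (√(eigenvalue a d i) * q i)
      = qInner a d p q := fun p q => Finset.sum_congr rfl fun i _ => by
    have := Real.mul_self_sqrt (eigenvalue_pos (a := a) i).le
    linear_combination (p i * q i) * this
  simp only [sq] at h ⊢
  simpa only [e] using h

/-- The population loss in terms of the summary statistics: by polarization only the fourth
moments of one-dimensional marginals are needed. -/
lemma loss_eq (a : ℝ) (d : ℕ) (v w : Vec d) :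
    loss a d v w = 3 * qInner a d w w ^ 2 + 3 * qInner a d v v ^ 2
      - 2 * qInner a d w w * qInner a d v v - 4 * qInner a d w v ^ 2 := by
  set m := multivariateGaussian 0 (covariance a d) with hm
  have e : ∀ x : Vec d, ((inner ℝ x w) ^ 2 - (inner ℝ x v) ^ 2) ^ 2 =
      (4 / 3) * (inner ℝ x w) ^ 4 + (4 / 3) * (inner ℝ x v) ^ 4
        - (1 / 6) * (inner ℝ x (w + v)) ^ 4 - (1 / 6) * (inner ℝ x (w + (-1 : ℝ) • v)) ^ 4 := by
    intro x
    rw [inner_add_right, inner_add_right, inner_smul_right]; ring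
  have I := fun y => integrable_inner_pow m y 4
  unfold loss
  simp only [e]
  rw [integral_sub, integral_sub, integral_add, integral_const_mul, integral_const_mul,
    integral_const_mul, integral_const_mul]
  · simp only [integral_inner_pow_four]
    have h1 : qInner a d (w + v) (w + v) =
        qInner a d w w + 2 * qInner a d w v + qInner a d v v := by
      rw [qInner_add_left, qInner_comm a d w, qInner_comm a d v, qInner_add_left, qInner_add_left,
        qInner_comm a d v w]; ring
    have h2 : qInner a d (w + (-1 : ℝ) • v) (w + (-1 : ℝ) • v) =
        qInner a d w w - 2 * qInner a d w v + qInner a d v v := by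
      rw [qInner_add_left, qInner_smul_left, qInner_comm a d w, qInner_comm a d v, qInner_add_left,
        qInner_add_left, qInner_smul_left, qInner_smul_left, qInner_comm a d v w]; ring
    rw [h1, h2]; ring
  · exact (I _).const_mul _
  · exact (I _).const_mul _
  · exact ((I _).const_mul _).add ((I _).const_mul _)
  · exact (I _).const_mul _
  · exact (((I _).const_mul _).add ((I _).const_mul _)).sub ((I _).const_mul _)
  · exact (I _).const_mul _

/-- The negative gradient of the loss, in coordinates. -/
noncomputable def flowField (a : ℝ) (d : ℕ) (v w : Vec d) : Vec d :=
  WithLp.toLp 2 fun i => eigenvalue a d i *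
    ((4 * qInner a d v v - 12 * qInner a d w w) * w i + 8 * qInner a d w v * v i)

lemma hasGradientAt_loss (a : ℝ) (d : ℕ) (v w : Vec d) :
    HasGradientAt (loss a d v) (-(flowField a d v w)) w := by
  have hs : HasFDerivAt (fun w : Vec d => qInner a d w w)
      (∑ i, (2 * eigenvalue a d i * w i) • (EuclideanSpace.proj i : Vec d →L[ℝ] ℝ)) w := by
    unfold qInner
    refine HasFDerivAt.fun_sum fun i _ => ?_
    have h := (EuclideanSpace.proj i : Vec d →L[ℝ] ℝ).hasFDerivAt (x := w)
    have := (h.const_mul (eigenvalue a d i)).mul h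
    convert! this using 1
    ext y; simp; ring
  have hu : HasFDerivAt (fun w : Vec d => qInner a d w v)
      (∑ i, (eigenvalue a d i * v i) • (EuclideanSpace.proj i : Vec d →L[ℝ] ℝ)) w := by
    unfold qInner
    refine HasFDerivAt.fun_sum fun i _ => ?_
    have h := (EuclideanSpace.proj i : Vec d →L[ℝ] ℝ).hasFDerivAt (x := w)
    have := (h.const_mul (eigenvalue a d i)).mul_const (v i)
    convert! this using 1
    ext y; simp; ring
  rw [hasGradientAt_iff_hasFDerivAt]
  have e : loss a d v = fun w => 3 * qInner a d w w ^ 2 + 3 * qInner a d v v ^ 2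
      - 2 * qInner a d w w * qInner a d v v - 4 * qInner a d w v ^ 2 := funext (loss_eq a d v)
  rw [e]
  have := ((((hs.pow 2).const_mul 3).add_const (3 * qInner a d v v ^ 2)).sub
    ((hs.const_mul 2).mul_const (qInner a d v v))).sub ((hu.pow 2).const_mul 4)
  convert! this using 1
  ext y
  simp [flowField, PiLp.inner_apply, Finset.mul_sum]
  rw [← Finset.sum_neg_distrib, ← Finset.sum_sub_distrib, ← Finset.sum_sub_distrib]
  exact Finset.sum_congr rfl fun i _ => by ring

lemma gradient_loss (a : ℝ) (d : ℕ) (v w : Vec d) :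
    gradient (loss a d v) w = -(flowField a d v w) :=
  (hasGradientAt_loss a d v w).gradient

lemma loss_ge (a : ℝ) (d : ℕ) (v w : Vec d) :
    3 * (qInner a d w w - qInner a d v v) ^ 2 ≤ loss a d v w := by
  have h := qInner_sq_le a d w v
  rw [loss_eq]
  linear_combination 4 * h

lemma contDiff_flowField (a : ℝ) (d : ℕ) (v : Vec d) : ContDiff ℝ 1 (flowField a d v) := by
  unfold flowField qInner
  rw [contDiff_piLp]
  intro i
  simp only
  fun_prop

/-- Global existence of a solution of an autonomous equation whose field is Lipschitz and bounded. -/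
lemma exists_solution_of_bounded {E : Type*} [NormedAddCommGroup E] [NormedSpace ℝ E]
    [CompleteSpace E] {F : E → E} {K : NNReal} (hK : LipschitzWith K F) {C : NNReal}
    (hC : ∀ x, ‖F x‖ ≤ C) (x₀ : E) :
    ∃ w : ℝ → E, w 0 = x₀ ∧ ∀ t, 0 ≤ t → HasDerivWithinAt w (F (w t)) (Ici 0) t := by
  have hloc : ∀ n : ℕ, ∃ α : ℝ → E, α 0 = x₀ ∧
      ∀ t ∈ Icc (0 : ℝ) n, HasDerivWithinAt α (F (α t)) (Icc (0 : ℝ) n) t := by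
    intro n
    have hP : IsPicardLindelof (fun _ => F) (tmin := 0) (tmax := n)
        ⟨0, le_rfl, Nat.cast_nonneg n⟩ x₀ (C * n) 0 C K :=
      { lipschitzOnWith := fun t _ => hK.lipschitzOnWith
        continuousOn := fun x _ => continuousOn_const
        norm_le := fun t _ x _ => hC x
        mul_max_le := by simp }
    exact hP.exists_eq_forall_mem_Icc_hasDerivWithinAt₀
  choose α hα0 hα using hloc
  have huniq : ∀ m n : ℕ, m ≤ n → EqOn (α m) (α n) (Icc (0 : ℝ) m) := by
    intro m n hmn
    have hsub : Icc (0 : ℝ) m ⊆ Icc (0 : ℝ) n := Icc_subset_Icc_right (by exact_mod_cast hmn)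
    refine ODE_solution_unique_of_mem_Icc_right (v := fun _ => F) (s := fun _ => univ)
      (fun t _ => hK.lipschitzOnWith)
      (fun t ht => (hα m t ht).continuousWithinAt) (fun t ht => ?_) (fun t _ => mem_univ _)
      (fun t ht => ((hα n t (hsub ht)).mono hsub).continuousWithinAt) (fun t ht => ?_)
      (fun t _ => mem_univ _) (by rw [hα0, hα0])
    · refine (hα m t (Ico_subset_Icc_self ht)).mono_of_mem_nhdsWithin ?_
      exact Icc_mem_nhdsGE_of_mem ht
    · refine (hα n t (hsub (Ico_subset_Icc_self ht))).mono_of_mem_nhdsWithin ?_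
      refine Icc_mem_nhdsGE_of_mem ⟨ht.1, lt_of_lt_of_le ht.2 (by exact_mod_cast hmn)⟩
  let w : ℝ → E := fun t => α (⌈t⌉₊) t
  have hw : ∀ n : ℕ, ∀ t ∈ Icc (0 : ℝ) n, w t = α n t := by
    intro n t ht
    exact huniq _ n (Nat.ceil_le.2 ht.2) ⟨ht.1, Nat.le_ceil t⟩
  refine ⟨w, by simp [w, hα0], fun t ht => ?_⟩
  obtain ⟨n, hn⟩ := exists_nat_gt t
  have hmem : t ∈ Icc (0 : ℝ) n := ⟨ht, hn.le⟩
  have h1 := (hα n t hmem).congr (fun r hr => hw n r hr) (hw n t hmem)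
  rw [← hw n t hmem] at h1
  refine h1.mono_of_mem_nhdsWithin ?_
  have : Iio (n : ℝ) ∈ nhds t := Iio_mem_nhds hn
  filter_upwards [self_mem_nhdsWithin, mem_nhdsWithin_of_mem_nhds this] with r hr hr'
  exact ⟨hr, hr'.le⟩

lemma exists_gradientFlow (a : ℝ) (d : ℕ) (v w₀ : Vec d) :
    ∃ w : ℝ → Vec d, IsGradientFlow (loss a d v) w₀ w := by
  set S := qInner a d v v + √(loss a d v w₀ / 3) with hS
  set R := √(∑ i, S / eigenvalue a d i) + 1 with hR
  have hR0 : 0 < R := by positivity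
  -- a bound on the loss confines the point to a fixed ball
  have hconf : ∀ x : Vec d, loss a d v x ≤ loss a d v w₀ → ‖x‖ ≤ R := by
    intro x hx
    have h1 := (loss_ge a d v x).trans hx
    have h2 : qInner a d x x ≤ S := by
      have : qInner a d x x - qInner a d v v ≤ √(loss a d v w₀ / 3) :=
        Real.le_sqrt_of_sq_le (by rw [le_div_iff₀ three_pos]; linarith)
      linarith
    rw [EuclideanSpace.norm_eq]
    refine (Real.sqrt_le_sqrt (Finset.sum_le_sum fun i _ => ?_)).trans (by rw [hR]; linarith)
    have hl := eigenvalue_pos (a := a) i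
    rw [le_div_iff₀ hl, Real.norm_eq_abs, sq_abs]
    refine le_trans ?_ h2
    have := Finset.single_le_sum (f := fun i => eigenvalue a d i * x i * x i)
      (fun j _ => by
        have := eigenvalue_pos (a := a) j
        nlinarith [sq_nonneg (x j)]) (Finset.mem_univ i)
    unfold qInner
    nlinarith
  let χ : ContDiffBump (0 : Vec d) := ⟨R, R + 1, hR0, by linarith⟩
  let F : Vec d → Vec d := fun x => χ x • flowField a d v x
  have hF : ContDiff ℝ 1 F := χ.contDiff.smul (contDiff_flowField a d v)
  have hFc : HasCompactSupport F := χ.hasCompactSupport.smul_right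
  obtain ⟨K, hK⟩ := hF.lipschitzWith_of_hasCompactSupport hFc (by simp)
  obtain ⟨C, hC⟩ := hFc.exists_bound_of_continuous hF.continuous
  obtain ⟨w, hw0, hw⟩ := exists_solution_of_bounded hK (C := C.toNNReal)
    (fun x => (hC x).trans (Real.le_coe_toNNReal C)) w₀
  have hmono : ∀ t, 0 ≤ t → loss a d v (w t) ≤ loss a d v w₀ := by
    have hd : ∀ t ∈ Ici (0 : ℝ), HasDerivWithinAt (fun t => loss a d v (w t))
        (-(χ (w t) * ‖flowField a d v (w t)‖ ^ 2)) (Ici 0) t := by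
      intro t ht
      have h1 := (hasGradientAt_loss a d v (w t)).hasFDerivAt
      have := h1.comp_hasDerivWithinAt t (hw t ht)
      convert! this using 1
      simp [F]
    have hanti := antitoneOn_of_hasDerivWithinAt_nonpos (convex_Ici (0 : ℝ))
      (fun t ht => (hd t ht).continuousWithinAt)
      (fun t ht => (hd t (interior_subset ht)).mono interior_subset)
      (fun t _ => by
        have := χ.nonneg (x := w t)
        rw [neg_nonpos]; positivity)
    intro t ht
    simpa [hw0] using hanti (mem_Ici.2 le_rfl) (mem_Ici.2 ht) ht
  refine ⟨w, hw0, fun t ht => ?_⟩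
  have h := hw t ht
  have h1 : χ (w t) = 1 := χ.one_of_mem_closedBall (by
    simpa using hconf _ (hmono t ht))
  rw [gradient_loss, neg_neg]
  simpa [F, h1] using h

end PhaseRetrieval

namespace PhaseRetrieval

open MeasureTheory ProbabilityTheory Set

/-! ### Comparison principles on an interval -/

/-- A function that starts nonnegative stays so if `f' ≥ K f` wherever `f < 0`. -/
lemma nonneg_of_deriv_ge {f f' : ℝ → ℝ} {a b K : ℝ} (hc : ContinuousOn f (Icc a b))
    (hd : ∀ t ∈ Ico a b, HasDerivAt f (f' t) t) (h0 : 0 ≤ f a)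
    (h : ∀ t ∈ Ico a b, f t < 0 → K * f t ≤ f' t) : ∀ t ∈ Icc a b, 0 ≤ f t := by
  intro t ht
  by_contra! hneg
  -- a fence `-ε exp((|K| + 1)(t - a))` that cannot be crossed
  have key : ∀ ε > 0, -f t ≤ ε * Real.exp ((|K| + 1) * (t - a)) := by
    intro ε hε
    refine image_le_of_deriv_right_lt_deriv_boundary (f := fun t => -f t) (f' := fun t => -f' t)
      (B := fun t => ε * Real.exp ((|K| + 1) * (t - a)))
      (B' := fun t => ε * (Real.exp ((|K| + 1) * (t - a)) * (|K| + 1)))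
      hc.neg (fun x hx => (hd x hx).neg.hasDerivWithinAt) ?_ ?_ ?_ ht
    · simp; linarith
    · intro x
      have h1 : HasDerivAt (fun t => (|K| + 1) * (t - a)) (|K| + 1) x := by
        simpa using ((hasDerivAt_id x).sub_const a).const_mul (|K| + 1)
      exact h1.exp.const_mul ε
    · intro x hx hfx
      have hB : 0 < ε * Real.exp ((|K| + 1) * (x - a)) := by positivity
      have h1 := h x hx (by linarith)
      have h2 : K * (ε * Real.exp ((|K| + 1) * (x - a))) ≤ |K| * (ε * Real.exp ((|K| + 1) * (x - a))) := by
        gcongr; exact le_abs_self K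
      have h3 : f x = -(ε * Real.exp ((|K| + 1) * (x - a))) := by linarith
      rw [h3] at h1
      linarith
  have := key (-f t / 2 / Real.exp ((|K| + 1) * (t - a))) (by
    have := Real.exp_pos ((|K| + 1) * (t - a))
    apply div_pos _ this; linarith)
  rw [div_mul_cancel₀ _ (Real.exp_pos _).ne'] at this
  linarith

lemma le_exp_of_deriv_le {f f' : ℝ → ℝ} {a b : ℝ} (K c : ℝ) (hc : ContinuousOn f (Icc a b))
    (hd : ∀ t ∈ Ico a b, HasDerivAt f (f' t) t)
    (h : ∀ t ∈ Ico a b, f' t ≤ K * (f t + c)) {t : ℝ} (ht : t ∈ Icc a b) :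
    f t + c ≤ (f a + c) * Real.exp (K * (t - a)) := by
  have hE : ∀ x, HasDerivAt (fun t => (f a + c) * Real.exp (K * (t - a)))
      ((f a + c) * (Real.exp (K * (x - a)) * K)) x := by
    intro x
    have h1 : HasDerivAt (fun t => K * (t - a)) K x := by
      simpa using ((hasDerivAt_id x).sub_const a).const_mul K
    exact h1.exp.const_mul _
  have := nonneg_of_deriv_ge (K := K) (f := fun t => (f a + c) * Real.exp (K * (t - a)) - (f t + c))
    (f' := fun x => (f a + c) * (Real.exp (K * (x - a)) * K) - f' x) (a := a) (b := b)
    (ContinuousOn.sub (fun x _ => (hE x).continuousAt.continuousWithinAt) (hc.add continuousOn_const))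
    (fun x hx => (hE x).sub ((hd x hx).add_const c)) (by simp)
    (fun x hx _ => by have := h x hx; nlinarith) t ht
  linarith

lemma ge_exp_of_deriv_ge {f f' : ℝ → ℝ} {a b : ℝ} (K c : ℝ) (hc : ContinuousOn f (Icc a b))
    (hd : ∀ t ∈ Ico a b, HasDerivAt f (f' t) t)
    (h : ∀ t ∈ Ico a b, K * (f t + c) ≤ f' t) {t : ℝ} (ht : t ∈ Icc a b) :
    (f a + c) * Real.exp (K * (t - a)) ≤ f t + c := by
  have := le_exp_of_deriv_le (f := fun t => -f t) (f' := fun t => -f' t) K (-c) hc.neg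
    (fun t ht => (hd t ht).neg) (fun t ht => by have := h t ht; linarith) ht
  linarith

lemma le_add_mul_of_deriv_le {f f' : ℝ → ℝ} {a b : ℝ} (c : ℝ) (hc : ContinuousOn f (Icc a b))
    (hd : ∀ t ∈ Ico a b, HasDerivAt f (f' t) t)
    (h : ∀ t ∈ Ico a b, f' t ≤ c) {t : ℝ} (ht : t ∈ Icc a b) :
    f t ≤ f a + c * (t - a) := by
  have := nonneg_of_deriv_ge (K := 0) (f := fun t => f a + c * (t - a) - f t)
    (f' := fun x => c - f' x) (a := a) (b := b)
    (ContinuousOn.sub (by fun_prop) hc)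
    (fun x hx => by
      have h1 : HasDerivAt (fun t => f a + c * (t - a)) c x := by
        simpa using (((hasDerivAt_id x).sub_const a).const_mul c).const_add (f a)
      exact h1.sub (hd x hx)) (by simp)
    (fun x hx _ => by have := h x hx; linarith) t ht
  linarith

/-- Two-sided bound for a solution of `y' = l (p y + f)` with `p ≤ 4` and `|f| ≤ F`. -/
lemma abs_le_of_linear_ode {y y' : ℝ → ℝ} {a b l F : ℝ} (hl : 0 ≤ l) (hF : 0 ≤ F) {p f : ℝ → ℝ}
    (hc : ContinuousOn y (Icc a b)) (hd : ∀ t ∈ Ico a b, HasDerivAt y (y' t) t)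
    (hy : ∀ t ∈ Ico a b, y' t = l * (p t * y t + f t)) (hp : ∀ t ∈ Ico a b, p t ≤ 4)
    (hf : ∀ t ∈ Ico a b, |f t| ≤ F) {t : ℝ} (ht : t ∈ Icc a b) :
    |y t| ≤ Real.exp (4 * l * (t - a)) * (|y a| + l * F * (t - a)) := by
  let B : ℝ → ℝ := fun t => Real.exp (4 * l * (t - a)) * (|y a| + l * F * (t - a))
  let B' : ℝ → ℝ := fun t => Real.exp (4 * l * (t - a)) * (4 * l) * (|y a| + l * F * (t - a)) +
    Real.exp (4 * l * (t - a)) * (l * F)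
  have hB : ∀ x, HasDerivAt B (B' x) x := by
    intro x
    have h1 : HasDerivAt (fun t => 4 * l * (t - a)) (4 * l) x := by
      simpa using ((hasDerivAt_id x).sub_const a).const_mul (4 * l)
    have h2 : HasDerivAt (fun t => |y a| + l * F * (t - a)) (l * F) x := by
      simpa using (((hasDerivAt_id x).sub_const a).const_mul (l * F)).const_add |y a|
    exact h1.exp.mul h2
  have hBc : Continuous B := continuous_iff_continuousAt.2 fun x => (hB x).continuousAt
  have hBn : ∀ x ∈ Ico a b, 0 ≤ B x ∧ 4 * l * B x + l * F ≤ B' x := by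
    intro x hx
    have h0 : 0 ≤ x - a := by linarith [hx.1]
    refine ⟨by simp only [B]; positivity, ?_⟩
    have : 1 ≤ Real.exp (4 * l * (x - a)) := Real.one_le_exp (by positivity)
    simp only [B, B']
    nlinarith [mul_nonneg hl hF]
  have hBa : B a = |y a| := by simp [B]
  rw [abs_le]
  constructor
  · have := nonneg_of_deriv_ge (K := 4 * l) (f := fun t => B t + y t) (f' := fun t => B' t + y' t)
      (hBc.continuousOn.add hc) (fun x hx => (hB x).add (hd x hx))
      (by simp only [hBa]; linarith [neg_abs_le (y a)])
      (fun x hx hneg => by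
        obtain ⟨h1, h2⟩ := hBn x hx
        rw [hy x hx]
        have h3 := (abs_le.1 (hf x hx)).1
        have h4 := hp x hx
        have hyneg : y x ≤ 0 := by linarith
        nlinarith [mul_le_mul_of_nonneg_left h3 hl, mul_nonneg hl (mul_nonneg (sub_nonneg.2 h4) (neg_nonneg.2 hyneg))]) t ht
    simp only [B] at this; linarith
  · have := nonneg_of_deriv_ge (K := 4 * l) (f := fun t => B t - y t) (f' := fun t => B' t - y' t)
      (hBc.continuousOn.sub hc) (fun x hx => (hB x).sub (hd x hx))
      (by simp only [hBa]; linarith [le_abs_self (y a)])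
      (fun x hx hneg => by
        obtain ⟨h1, h2⟩ := hBn x hx
        rw [hy x hx]
        have h3 := (abs_le.1 (hf x hx)).2
        have h4 := hp x hx
        have hyneg : 0 ≤ y x := by linarith
        nlinarith [mul_le_mul_of_nonneg_left h3 hl, mul_nonneg hl (mul_nonneg (sub_nonneg.2 h4) hyneg)]) t ht
    simp only [B] at this; linarith

lemma exists_first_hit {f : ℝ → ℝ} {a b c : ℝ} (hab : a ≤ b) (hf : ContinuousOn f (Icc a b))
    (ha : f a < c) (hb : c ≤ f b) : ∃ t ∈ Ioc a b, f t = c ∧ ∀ r ∈ Ico a t, f r < c := by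
  have hS : IsCompact {r ∈ Icc a b | c ≤ f r} := by
    have : IsClosed (Icc a b ∩ f ⁻¹' Ici c) := hf.preimage_isClosed_of_isClosed isClosed_Icc isClosed_Ici
    exact isCompact_Icc.of_isClosed_subset this inter_subset_left
  obtain ⟨t, ht, hmin⟩ := hS.exists_isLeast ⟨b, ⟨hab, le_rfl⟩, hb⟩
  have hlt : ∀ r ∈ Ico a t, f r < c := fun r hr => by
    by_contra! h
    exact absurd (hmin ⟨⟨hr.1, hr.2.le.trans ht.1.2⟩, h⟩) (not_le.2 hr.2)
  have hat : a < t := lt_of_le_of_ne ht.1.1 (by rintro rfl; linarith [ht.2])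
  refine ⟨t, ⟨hat, ht.1.2⟩, le_antisymm ?_ ht.2, hlt⟩
  obtain ⟨x, hx, hxc⟩ := intermediate_value_Icc hat.le (hf.mono (Icc_subset_Icc_right ht.1.2))
    (⟨ha.le, ht.2⟩ : c ∈ Icc (f a) (f t))
  rcases hx.2.lt_or_eq with h | h
  · exact absurd (hlt x ⟨hx.1, h⟩) (by linarith)
  · rw [← h, hxc]

lemma pos_of_bootstrap {f : ℝ → ℝ} {a b : ℝ} (hf : ContinuousOn f (Icc a b))
    (h : ∀ t ∈ Icc a b, (∀ r ∈ Ico a t, 0 < f r) → 0 < f t) : ∀ t ∈ Icc a b, 0 < f t := by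
  intro t ht
  by_contra! hneg
  have ha : 0 < f a := h a ⟨le_rfl, ht.1.trans ht.2⟩ (fun r hr => absurd hr.2 (not_lt.2 hr.1))
  obtain ⟨x, hx, hx0, hxr⟩ := exists_first_hit (f := fun t => -f t) (c := 0) ht.1
    (hf.mono (Icc_subset_Icc_right ht.2)).neg (by linarith) (by linarith)
  have := h x ⟨hx.1.le, hx.2.trans ht.2⟩ (fun r hr => by have := hxr r hr; linarith)
  linarith

/-! ### The flow in coordinates -/

section Flow

variable {d : ℕ} {l v : Fin d → ℝ}

/-- The summary statistic `s = ∑ λ_i w_i²`. -/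
def statS (l : Fin d → ℝ) (w : Fin d → ℝ) : ℝ := ∑ i, l i * w i ^ 2

/-- The summary statistic `u = ∑ λ_i w_i v_i`. -/
def statU (l v : Fin d → ℝ) (w : Fin d → ℝ) : ℝ := ∑ i, l i * w i * v i

/-- The loss as a function of the summary statistics, for a target of unit `Q`-norm. -/
def statL (l v : Fin d → ℝ) (w : Fin d → ℝ) : ℝ :=
  3 * (1 - statS l w) ^ 2 + 4 * (statS l w - statU l v w ^ 2)

/-- A solution on `[0, ∞)` of `w_i' = λ_i ((4 - 12 s) w_i + 8 u v_i)`, extended continuously to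
negative times. -/
structure IsFlow (l v : Fin d → ℝ) (w : ℝ → Fin d → ℝ) : Prop where
  cont : ∀ i, Continuous fun t => w t i
  deriv : ∀ t, 0 ≤ t → ∀ i, HasDerivAt (fun t => w t i)
    (l i * ((4 - 12 * statS l (w t)) * w t i + 8 * statU l v (w t) * v i)) t

/-- `∑ λ_i² ((3 s - 1) w_i - 2 u v_i)²`, a sixteenth of the squared norm of the gradient. -/
def gradSq (l v : Fin d → ℝ) (w : Fin d → ℝ) : ℝ :=
  ∑ i, l i ^ 2 * ((3 * statS l w - 1) * w i - 2 * statU l v w * v i) ^ 2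

lemma statS_nonneg (hl : ∀ i, 0 < l i) (w : Fin d → ℝ) : 0 ≤ statS l w :=
  Finset.sum_nonneg fun i _ => mul_nonneg (hl i).le (sq_nonneg _)

lemma weighted_sum_sq_le (hl : ∀ i, 0 ≤ l i) (x y : Fin d → ℝ) :
    (∑ i, l i * x i * y i) ^ 2 ≤ (∑ i, l i * x i ^ 2) * ∑ i, l i * y i ^ 2 := by
  have h := Finset.sum_mul_sq_le_sq_mul_sq Finset.univ
    (fun i => √(l i) * x i) (fun i => √(l i) * y i)
  have e : ∀ p q : Fin d → ℝ, ∑ i, (√(l i) * p i) * (√(l i) * q i)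
      = ∑ i, l i * p i * q i := fun p q => Finset.sum_congr rfl fun i _ => by
    have := Real.mul_self_sqrt (hl i)
    linear_combination (p i * q i) * this
  simp only [sq] at h ⊢
  rw [e x y, e x x, e y y] at h
  simpa only [mul_assoc] using h

lemma statU_sq_le (hl : ∀ i, 0 < l i) (hv : ∑ i, l i * v i ^ 2 = 1) (w : Fin d → ℝ) :
    statU l v w ^ 2 ≤ statS l w := by
  have := weighted_sum_sq_le (fun i => (hl i).le) w v
  rwa [hv, mul_one] at this

namespace IsFlow

variable {w : ℝ → Fin d → ℝ}

lemma shift (h : IsFlow l v w) {c : ℝ} (hc : 0 ≤ c) : IsFlow l v fun t => w (t + c) where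
  cont i := (h.cont i).comp (by fun_prop)
  deriv t ht i := by
    have := h.deriv (t + c) (by linarith) i
    exact HasDerivAt.comp_add_const (f := fun t => w t i) t c this

lemma neg_target (h : IsFlow l v w) : IsFlow l (fun i => -v i) w where
  cont := h.cont
  deriv t ht i := by
    have := h.deriv t ht i
    convert! this using 1
    simp only [statU, mul_neg, Finset.sum_neg_distrib]; ring

lemma continuous_statS (h : IsFlow l v w) : Continuous fun t => statS l (w t) := by
  have := h.cont
  unfold statS; fun_prop

lemma continuous_statU (h : IsFlow l v w) : Continuous fun t => statU l v (w t) := by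
  have := h.cont
  unfold statU; fun_prop

lemma continuous_statL (h : IsFlow l v w) : Continuous fun t => statL l v (w t) := by
  have := h.continuous_statS
  have := h.continuous_statU
  unfold statL; fun_prop

lemma hasDerivAt_statS (h : IsFlow l v w) {t : ℝ} (ht : 0 ≤ t) :
    HasDerivAt (fun t => statS l (w t)) (2 * ((4 - 12 * statS l (w t)) * ∑ i, l i ^ 2 * w t i ^ 2
      + 8 * statU l v (w t) * ∑ i, l i ^ 2 * w t i * v i)) t := by
  have := HasDerivAt.fun_sum (u := Finset.univ) fun i _ => ((h.deriv t ht i).pow 2).const_mul (l i)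
  refine this.congr_deriv ?_
  rw [Finset.mul_sum, Finset.mul_sum, ← Finset.sum_add_distrib, Finset.mul_sum]
  exact Finset.sum_congr rfl fun i _ => by push_cast; ring

lemma hasDerivAt_statU (h : IsFlow l v w) {t : ℝ} (ht : 0 ≤ t) :
    HasDerivAt (fun t => statU l v (w t)) ((4 - 12 * statS l (w t)) * ∑ i, l i ^ 2 * w t i * v i
      + 8 * statU l v (w t) * ∑ i, l i ^ 2 * v i ^ 2) t := by
  have := HasDerivAt.fun_sum (u := Finset.univ) fun i _ =>
    ((h.deriv t ht i).const_mul (l i)).mul_const (v i)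
  refine this.congr_deriv ?_
  rw [Finset.mul_sum, Finset.mul_sum, ← Finset.sum_add_distrib]
  exact Finset.sum_congr rfl fun i _ => by ring

lemma hasDerivAt_statL (h : IsFlow l v w) {t : ℝ} (ht : 0 ≤ t) :
    HasDerivAt (fun t => statL l v (w t)) (-16 * gradSq l v (w t)) t := by
  have hS := h.hasDerivAt_statS ht
  have hU := h.hasDerivAt_statU ht
  have := (((hS.const_sub 1).pow 2).const_mul 3).add ((hS.sub (hU.pow 2)).const_mul 4)
  refine this.congr_deriv ?_
  have e : gradSq l v (w t) = (3 * statS l (w t) - 1) ^ 2 * (∑ i, l i ^ 2 * w t i ^ 2)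
      - 4 * (3 * statS l (w t) - 1) * statU l v (w t) * (∑ i, l i ^ 2 * w t i * v i)
      + 4 * statU l v (w t) ^ 2 * ∑ i, l i ^ 2 * v i ^ 2 := by
    unfold gradSq
    rw [Finset.mul_sum, Finset.mul_sum, Finset.mul_sum, ← Finset.sum_sub_distrib,
      ← Finset.sum_add_distrib]
    exact Finset.sum_congr rfl fun i _ => by ring
  rw [e]; push_cast; ring

lemma statL_anti (h : IsFlow l v w) {r t : ℝ} (hr : 0 ≤ r) (hrt : r ≤ t) :
    statL l v (w t) ≤ statL l v (w r) := by
  have := le_add_mul_of_deriv_le (a := r) (b := t) 0 h.continuous_statL.continuousOn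
    (fun x hx => h.hasDerivAt_statL (hr.trans hx.1))
    (fun x _ => by
      have : 0 ≤ gradSq l v (w x) := Finset.sum_nonneg fun i _ => by positivity
      linarith) (right_mem_Icc.2 hrt)
  linarith

end IsFlow

lemma statL_ge (hl : ∀ i, 0 < l i) (hv : ∑ i, l i * v i ^ 2 = 1) (w : Fin d → ℝ) :
    3 * (1 - statS l w) ^ 2 ≤ statL l v w := by
  have := statU_sq_le hl hv w
  unfold statL; linarith

lemma statS_le_two (hl : ∀ i, 0 < l i) (hv : ∑ i, l i * v i ^ 2 = 1) {w : Fin d → ℝ}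
    (hL : statL l v w ≤ 3) : statS l w ≤ 2 := by
  have := statL_ge hl hv w
  nlinarith

/-- The `Q`-norm of the residual `a = (3 s - 1) w - 2 u v` of the gradient. -/
lemma sum_residual_sq (hv : ∑ i, l i * v i ^ 2 = 1) (w : Fin d → ℝ) :
    ∑ i, l i * ((3 * statS l w - 1) * w i - 2 * statU l v w * v i) ^ 2 =
      (3 * statS l w - 1) ^ 2 * (statS l w - statU l v w ^ 2)
        + 9 * statU l v w ^ 2 * (1 - statS l w) ^ 2 := by
  have : ∀ A B : ℝ, ∑ i, l i * (A * w i - B * v i) ^ 2 =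
      A ^ 2 * statS l w - 2 * A * B * statU l v w + B ^ 2 * 1 := by
    intro A B
    rw [← hv]; unfold statS statU
    rw [Finset.mul_sum, Finset.mul_sum, Finset.mul_sum, ← Finset.sum_sub_distrib,
      ← Finset.sum_add_distrib]
    exact Finset.sum_congr rfl fun i _ => by ring
  rw [this]; ring

/-- Polyak–Łojasiewicz type bound in the `Q`-norm, valid away from the saddles `u = 0`. -/
lemma residual_ge (hl : ∀ i, 0 < l i) (hv : ∑ i, l i * v i ^ 2 = 1) {w : Fin d → ℝ} {c : ℝ}
    (hc0 : 0 ≤ c) (hc1 : c ≤ 1 / 4) (hu : 3 * c ≤ statU l v w ^ 2) (hL : statL l v w ≤ 3) :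
    c * statL l v w ≤
      ∑ i, l i * ((3 * statS l w - 1) * w i - 2 * statU l v w * v i) ^ 2 := by
  rw [sum_residual_sq hv]
  have h1 := statU_sq_le hl hv w
  unfold statL at hL ⊢
  set s := statS l w
  set u2 := statU l v w ^ 2
  have hd : 0 ≤ s - u2 := by linarith
  rcases le_total (1 / 9) ((1 - s) ^ 2) with h | h
  · have e1 : 0 ≤ (3 * s - 1) ^ 2 * (s - u2) := by positivity
    nlinarith [mul_le_mul_of_nonneg_left h (by linarith : 0 ≤ 9 * u2)]
  · have h2 : 1 ≤ (3 * s - 1) ^ 2 := by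
      have := abs_le_of_sq_le_sq' (show (1 - s) ^ 2 ≤ (1 / 3) ^ 2 by linarith) (by norm_num)
      nlinarith [this.1, this.2]
    have e1 : s - u2 ≤ (3 * s - 1) ^ 2 * (s - u2) := le_mul_of_one_le_left hd h2
    have e2 : 27 * c * (1 - s) ^ 2 ≤ 9 * u2 * (1 - s) ^ 2 := by
      have := sq_nonneg (1 - s)
      nlinarith
    nlinarith [sq_nonneg (1 - s), mul_nonneg hc0 (sq_nonneg (1 - s)), mul_nonneg hd hc0,
      mul_nonneg hd (by linarith : 0 ≤ 1 / 4 - c)]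

/-- Spectral truncation at scale `τ`: modes with `λ_i τ ≤ 1` are dropped from the gradient. -/
lemma gradSq_ge (hl : ∀ i, 0 < l i) (w : Fin d → ℝ) {τ : ℝ} (hτ : 0 < τ) :
    (∑ i, l i * ((3 * statS l w - 1) * w i - 2 * statU l v w * v i) ^ 2
      - ∑ i with l i * τ ≤ 1, l i * ((3 * statS l w - 1) * w i - 2 * statU l v w * v i) ^ 2) / τ
      ≤ gradSq l v w := by
  rw [← Finset.sum_filter_add_sum_filter_not Finset.univ (fun i => l i * τ ≤ 1)
    (fun i => l i * ((3 * statS l w - 1) * w i - 2 * statU l v w * v i) ^ 2), add_sub_cancel_left,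
    Finset.sum_div]
  refine le_trans (Finset.sum_le_sum fun i hi => ?_)
    (Finset.sum_le_sum_of_subset_of_nonneg (Finset.filter_subset _ _) fun i _ _ => by positivity)
  have h1 : 1 < l i * τ := by simpa using hi
  have h2 := hl i
  rw [div_le_iff₀ hτ]
  nlinarith [sq_nonneg ((3 * statS l w - 1) * w i - 2 * statU l v w * v i),
    mul_nonneg h2.le (sq_nonneg ((3 * statS l w - 1) * w i - 2 * statU l v w * v i))]

lemma residual_sq_le {s u x y : ℝ} (hs0 : 0 ≤ s) (hs : s ≤ 2) (hu : u ^ 2 ≤ s) :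
    ((3 * s - 1) * x - 2 * u * y) ^ 2 ≤ 50 * x ^ 2 + 16 * y ^ 2 := by
  have h1 : ((3 * s - 1) * x - 2 * u * y) ^ 2 ≤ 2 * ((3 * s - 1) * x) ^ 2 + 2 * (2 * u * y) ^ 2 := by
    nlinarith [sq_nonneg ((3 * s - 1) * x + 2 * u * y)]
  have h2 : (3 * s - 1) ^ 2 ≤ 25 := by nlinarith
  have h3 : u ^ 2 ≤ 2 := by linarith
  nlinarith [sq_nonneg x, sq_nonneg y, mul_le_mul_of_nonneg_right h2 (sq_nonneg x),
    mul_le_mul_of_nonneg_right h3 (sq_nonneg y)]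

end Flow

/-- A gradient flow of the loss is, for a normalized target, a flow in coordinates. -/
lemma IsGradientFlow.exists_isFlow {a : ℝ} {d : ℕ} {v w₀ : Vec d} {w : ℝ → Vec d}
    (hv : qInner a d v v = 1) (h : IsGradientFlow (loss a d v) w₀ w) :
    ∃ x : ℝ → Fin d → ℝ, IsFlow (eigenvalue a d) (fun i => v i) x ∧ (∀ i, x 0 i = w₀ i) ∧
      ∀ t, 0 ≤ t → ∀ i, x t i = w t i := by
  -- extension to negative times by the tangent line
  set D := flowField a d v (w 0) with hD
  let x : ℝ → Fin d → ℝ := fun t i => if 0 ≤ t then w t i else w 0 i + t * D i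
  have hS : ∀ y : Vec d, statS (eigenvalue a d) (fun i => y i) = qInner a d y y := fun y =>
    Finset.sum_congr rfl fun i _ => by ring
  have hU : ∀ y : Vec d, statU (eigenvalue a d) (fun i => v i) (fun i => y i) = qInner a d y v :=
    fun y => rfl
  have hxw : ∀ t, 0 ≤ t → x t = fun i => w t i := fun t ht => by
    ext i; simp [x, ht]
  have hw : ∀ t, 0 ≤ t → ∀ i, HasDerivWithinAt (fun t => w t i) (flowField a d v (w t) i) (Ici 0) t := by
    intro t ht i
    have := h.2 t ht
    rw [gradient_loss, neg_neg] at this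
    exact (EuclideanSpace.proj i : Vec d →L[ℝ] ℝ).hasFDerivAt.comp_hasDerivWithinAt t this
  have hder : ∀ t, 0 ≤ t → ∀ i, HasDerivAt (fun t => x t i) (flowField a d v (w t) i) t := by
    intro t ht i
    have hR : HasDerivWithinAt (fun t => x t i) (flowField a d v (w t) i) (Ici 0) t :=
      (hw t ht i).congr (fun r hr => by simp [hxw r hr]) (by simp [hxw t ht])
    rcases ht.eq_or_lt with rfl | hpos
    · have hL : HasDerivWithinAt (fun t => x t i) (D i) (Iic 0) 0 := by
        have h1 : HasDerivAt (fun t : ℝ => w 0 i + t * D i) (D i) 0 := by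
          simpa using ((hasDerivAt_id (0 : ℝ)).mul_const (D i)).const_add (w 0 i)
        refine h1.hasDerivWithinAt.congr (fun r hr => ?_) (by simp [x])
        rcases (mem_Iic.1 hr).eq_or_lt with rfl | hr
        · simp [x]
        · simp [x, not_le.2 hr]
      have := hL.union hR
      rw [Iic_union_Ici] at this
      exact hasDerivWithinAt_univ.1 this
    · exact hR.hasDerivAt (Ici_mem_nhds hpos)
  refine ⟨x, ⟨fun i => ?_, fun t ht i => ?_⟩, fun i => by simp [x, h.1], fun t ht i => by simp [hxw t ht]⟩
  · rw [continuous_iff_continuousAt]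
    intro t
    rcases le_or_gt 0 t with ht | ht
    · exact (hder t ht i).continuousAt
    · have : (fun t => x t i) =ᶠ[nhds t] fun t => w 0 i + t * D i := by
        filter_upwards [Iio_mem_nhds ht] with r hr
        simp [x, not_le.2 (mem_Iio.1 hr)]
      exact ContinuousAt.congr (by fun_prop) this.symm
  · have := hder t ht i
    rw [hxw t ht, hS, hU]
    simpa [flowField, hv] using this

end PhaseRetrieval

namespace PhaseRetrieval

open MeasureTheory ProbabilityTheory Set Matrix

/-! ### The linearized flow at the origin -/

section Linear

variable {d : ℕ} {l v : Fin d → ℝ}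

/-- The linearization `4 Q + 8 (Qv)(Qv)ᵀ` of the flow at the origin. -/
def linOp (l v : Fin d → ℝ) (y : Fin d → ℝ) : Fin d → ℝ :=
  fun i => 4 * l i * y i + 8 * (l i * v i) * ((fun i => l i * v i) ⬝ᵥ y)

/-- The eigenvector `(μ - 4 Q)⁻¹ Q v` of `linOp` for an eigenvalue `μ` above the spectrum of
`4 Q`. -/
noncomputable def topVec (l v : Fin d → ℝ) (μ : ℝ) : Fin d → ℝ := fun i => l i * v i / (μ - 4 * l i)

/-- `μ` lies above `4 Q` and solves the secular equation `8 ∑ (λ_i v_i)² / (μ - 4 λ_i) = 1`: it is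
the top eigenvalue of `linOp`. -/
structure IsTop (l v : Fin d → ℝ) (i₀ : Fin d) (μ : ℝ) : Prop where
  gap : 0 < μ - 4 * l i₀
  secular : 8 * ∑ i, (l i * v i) ^ 2 / (μ - 4 * l i) = 1

lemma linOp_dot (x y : Fin d → ℝ) : x ⬝ᵥ linOp l v y = 4 * (∑ i, l i * x i * y i)
    + 8 * ((fun i => l i * v i) ⬝ᵥ x) * ((fun i => l i * v i) ⬝ᵥ y) := by
  have : x ⬝ᵥ linOp l v y = ∑ i, (4 * (l i * x i * y i)
      + 8 * ((l i * v i) * x i) * ((fun i => l i * v i) ⬝ᵥ y)) :=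
    Finset.sum_congr rfl fun i _ => by simp only [linOp]; ring
  rw [this, Finset.sum_add_distrib, ← Finset.mul_sum, ← Finset.sum_mul, ← Finset.mul_sum]
  rfl

lemma linOp_symm (x y : Fin d → ℝ) : x ⬝ᵥ linOp l v y = linOp l v x ⬝ᵥ y := by
  rw [dotProduct_comm (linOp l v x), linOp_dot, linOp_dot]
  have : ∑ i, l i * x i * y i = ∑ i, l i * y i * x i := Finset.sum_congr rfl fun i _ => by ring
  rw [this]; ring

lemma linOp_add (x y : Fin d → ℝ) : linOp l v (x + y) = linOp l v x + linOp l v y := by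
  ext i; simp only [linOp, dotProduct_add, Pi.add_apply]; ring

lemma linOp_smul (c : ℝ) (x : Fin d → ℝ) : linOp l v (c • x) = c • linOp l v x := by
  ext i; simp only [linOp, dotProduct_smul, Pi.smul_apply, smul_eq_mul]; ring

variable {i₀ : Fin d} {μ : ℝ}

namespace IsTop

lemma gap_pos (h : IsTop l v i₀ μ) (hmax : ∀ i, l i ≤ l i₀) (i : Fin d) : 0 < μ - 4 * l i := by
  have := hmax i; have := h.gap; linarith

lemma dot_topVec (h : IsTop l v i₀ μ) : 8 * ((fun i => l i * v i) ⬝ᵥ topVec l v μ) = 1 := by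
  rw [← h.secular]; congr 1
  exact Finset.sum_congr rfl fun i _ => by simp only [topVec]; ring

lemma linOp_topVec (h : IsTop l v i₀ μ) (hmax : ∀ i, l i ≤ l i₀) :
    linOp l v (topVec l v μ) = μ • topVec l v μ := by
  ext i
  have h1 := h.dot_topVec
  have h2 := h.gap_pos hmax i
  simp only [linOp, Pi.smul_apply, smul_eq_mul]
  have : 8 * (l i * v i) * ((fun i => l i * v i) ⬝ᵥ topVec l v μ) = l i * v i := by
    linear_combination (l i * v i) * h1
  rw [this]; simp only [topVec]; field_simp; ring

/-- Off the top eigenvector the linearization is bounded by `4 λ_max`. -/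
lemma linOp_dot_le (h : IsTop l v i₀ μ) (hmax : ∀ i, l i ≤ l i₀) {r : Fin d → ℝ}
    (hr : topVec l v μ ⬝ᵥ r = 0) : r ⬝ᵥ linOp l v r ≤ 4 * l i₀ * (r ⬝ᵥ r) := by
  have hg := h.gap_pos hmax
  have e1 : (fun i => l i * v i) ⬝ᵥ r =
      ∑ i, 4 * (l i₀ - l i) * (l i * v i / (μ - 4 * l i)) * r i := by
    have : (fun i => l i * v i) ⬝ᵥ r =
      ∑ i, (4 * (l i₀ - l i) * (l i * v i / (μ - 4 * l i)) * r i
        + (μ - 4 * l i₀) * (topVec l v μ i * r i)) := Finset.sum_congr rfl fun i _ => by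
      have hm : l i * v i / (μ - 4 * l i) * (μ - 4 * l i) = l i * v i :=
        div_mul_cancel₀ _ (hg i).ne'
      simp only [topVec]; linear_combination (-r i) * hm
    rw [this, Finset.sum_add_distrib, ← Finset.mul_sum]
    rw [show ∑ i, topVec l v μ i * r i = 0 from hr]; ring
  have e2 := weighted_sum_sq_le (l := fun i => 4 * (l i₀ - l i))
    (fun i => by linarith [hmax i]) (fun i => l i * v i / (μ - 4 * l i)) r
  rw [← e1] at e2
  have e3 : ∑ i, 4 * (l i₀ - l i) * (l i * v i / (μ - 4 * l i)) ^ 2 ≤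
      ∑ i, (l i * v i) ^ 2 / (μ - 4 * l i) := by
    refine Finset.sum_le_sum fun i _ => ?_
    rw [div_pow, ← mul_div_assoc, div_le_div_iff₀ (by have := hg i; positivity) (hg i)]
    have h1 : 4 * (l i₀ - l i) ≤ μ - 4 * l i := by linarith [h.gap]
    have h2 := mul_le_mul_of_nonneg_right h1 (mul_nonneg (sq_nonneg (l i * v i)) (hg i).le)
    nlinarith
  have e4 : 0 ≤ ∑ i, 4 * (l i₀ - l i) * r i ^ 2 :=
    Finset.sum_nonneg fun i _ => mul_nonneg (by linarith [hmax i]) (sq_nonneg _)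
  have e5 : 8 * ((fun i => l i * v i) ⬝ᵥ r) ^ 2 ≤ ∑ i, 4 * (l i₀ - l i) * r i ^ 2 := by
    have := mul_le_mul_of_nonneg_right e3 e4
    have hs := h.secular
    nlinarith
  have e6 : ∑ i, 4 * (l i₀ - l i) * r i ^ 2 = 4 * l i₀ * (r ⬝ᵥ r) - 4 * ∑ i, l i * r i * r i := by
    rw [dotProduct, Finset.mul_sum, Finset.mul_sum, ← Finset.sum_sub_distrib]
    exact Finset.sum_congr rfl fun i _ => by ring
  rw [linOp_dot]
  nlinarith

lemma dot_linOp_nonneg (hl : ∀ i, 0 < l i) (r : Fin d → ℝ) : 0 ≤ r ⬝ᵥ linOp l v r := by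
  rw [linOp_dot]
  have : 0 ≤ ∑ i, l i * r i * r i := Finset.sum_nonneg fun i _ => by
    have := hl i; nlinarith [sq_nonneg (r i)]
  nlinarith [sq_nonneg ((fun i => l i * v i) ⬝ᵥ r)]

lemma topVec_dot_linOp (h : IsTop l v i₀ μ) (hmax : ∀ i, l i ≤ l i₀) (y : Fin d → ℝ) :
    topVec l v μ ⬝ᵥ linOp l v y = μ * (topVec l v μ ⬝ᵥ y) := by
  rw [linOp_symm, h.linOp_topVec hmax, smul_dotProduct, smul_eq_mul]

lemma linOp_dot_linOp_le (h : IsTop l v i₀ μ) (hl : ∀ i, 0 < l i) (hmax : ∀ i, l i ≤ l i₀)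
    {r : Fin d → ℝ} (hr : topVec l v μ ⬝ᵥ r = 0) :
    linOp l v r ⬝ᵥ linOp l v r ≤ 4 * l i₀ * (r ⬝ᵥ linOp l v r) := by
  have hr' : topVec l v μ ⬝ᵥ linOp l v r = 0 := by rw [h.topVec_dot_linOp hmax, hr, mul_zero]
  have h1 := h.linOp_dot_le hmax hr'
  have hL : 0 < 4 * l i₀ := by have := hl i₀; linarith
  -- positivity of the form at `4 λ_max r - B r`
  have h2 := dot_linOp_nonneg (v := v) hl ((4 * l i₀) • r + (-1 : ℝ) • linOp l v r)
  rw [linOp_add, linOp_smul, linOp_smul] at h2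
  simp only [add_dotProduct, dotProduct_add, smul_dotProduct, dotProduct_smul, smul_eq_mul] at h2
  have h3 : r ⬝ᵥ linOp l v (linOp l v r) = linOp l v r ⬝ᵥ linOp l v r := linOp_symm _ _
  rw [h3] at h2
  have h4 : 4 * l i₀ * (linOp l v r ⬝ᵥ linOp l v r) ≤
      4 * l i₀ * (4 * l i₀ * (r ⬝ᵥ linOp l v r)) := by nlinarith
  exact le_of_mul_le_mul_left h4 hL

lemma gap_ge (h : IsTop l v i₀ μ) (hmax : ∀ i, l i ≤ l i₀) :
    8 * (l i₀ * v i₀) ^ 2 ≤ μ - 4 * l i₀ := by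
  have h1 := Finset.single_le_sum (f := fun i => (l i * v i) ^ 2 / (μ - 4 * l i))
    (fun i _ => div_nonneg (sq_nonneg _) (h.gap_pos hmax i).le) (Finset.mem_univ i₀)
  have h2 := h.secular
  have h3 : (l i₀ * v i₀) ^ 2 / (μ - 4 * l i₀) ≤ 1 / 8 := by
    linarith
  rw [div_le_iff₀ h.gap] at h3
  linarith

lemma gap_le (h : IsTop l v i₀ μ) (hl : ∀ i, 0 < l i) (hmax : ∀ i, l i ≤ l i₀)
    (hv : ∑ i, l i * v i ^ 2 = 1) : μ - 4 * l i₀ ≤ 8 * l i₀ := by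
  have h1 : ∑ i, (l i * v i) ^ 2 / (μ - 4 * l i) ≤ ∑ i, l i₀ * (l i * v i ^ 2) / (μ - 4 * l i₀) := by
    refine Finset.sum_le_sum fun i _ => ?_
    refine div_le_div₀ ?_ ?_ h.gap (by linarith [hmax i])
    · have := (hl i).le; have := (hl i₀).le; positivity
    · have := mul_le_mul_of_nonneg_right (hmax i) (mul_nonneg (hl i).le (sq_nonneg (v i)))
      nlinarith
  rw [← Finset.sum_div, ← Finset.mul_sum, hv, mul_one] at h1
  have h2 := h.secular
  have h3 : 1 / 8 ≤ l i₀ / (μ - 4 * l i₀) := by linarith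
  rw [le_div_iff₀ h.gap] at h3
  linarith

lemma topVec_sq_le (h : IsTop l v i₀ μ) (hmax : ∀ i, l i ≤ l i₀) :
    8 * (μ - 4 * l i₀) * (topVec l v μ ⬝ᵥ topVec l v μ) ≤ 1 := by
  rw [← h.dot_topVec, mul_assoc, dotProduct, dotProduct, Finset.mul_sum]
  refine mul_le_mul_of_nonneg_left (Finset.sum_le_sum fun i _ => ?_) (by norm_num)
  have hg := h.gap_pos hmax i
  have h1 : topVec l v μ i * topVec l v μ i * (μ - 4 * l i) = l i * v i * topVec l v μ i := by
    simp only [topVec]; field_simp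
  rw [← h1]
  nlinarith [mul_self_nonneg (topVec l v μ i), hmax i]

lemma topVec_sq_ge (h : IsTop l v i₀ μ) (hl : ∀ i, 0 < l i) (hmax : ∀ i, l i ≤ l i₀)
    (hv : ∑ i, l i * v i ^ 2 = 1) : v i₀ ^ 2 / 64 ≤ topVec l v μ ⬝ᵥ topVec l v μ := by
  have h1 := Finset.single_le_sum (f := fun i => topVec l v μ i * topVec l v μ i)
    (fun i _ => mul_self_nonneg _) (Finset.mem_univ i₀)
  refine le_trans ?_ h1
  have h2 := h.gap_le hl hmax hv
  have h3 := hl i₀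
  simp only [topVec]
  rw [← sq, div_pow, mul_pow, div_le_div_iff₀ (by norm_num) (by have := h.gap; positivity)]
  have : (μ - 4 * l i₀) ^ 2 ≤ (8 * l i₀) ^ 2 := pow_le_pow_left₀ h.gap.le h2 2
  nlinarith [mul_le_mul_of_nonneg_left this (sq_nonneg (v i₀))]

end IsTop

lemma sum_sq_weight_le (hl : ∀ i, 0 < l i) (hl1 : ∀ i, l i ≤ 1) (x : Fin d → ℝ) :
    ∑ i, l i ^ 2 * x i ^ 2 ≤ ∑ i, l i * x i ^ 2 :=
  Finset.sum_le_sum fun i _ => by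
    have : l i ^ 2 ≤ l i := by nlinarith [hl i, hl1 i]
    gcongr

namespace IsFlow

variable {w : ℝ → Fin d → ℝ}

lemma statS_growth (h : IsFlow l v w) (hl : ∀ i, 0 < l i) (hl1 : ∀ i, l i ≤ 1)
    (hv : ∑ i, l i * v i ^ 2 = 1) {t : ℝ} (ht : 0 ≤ t) :
    statS l (w t) ≤ statS l (w 0) * Real.exp (24 * t) := by
  have := le_exp_of_deriv_le (a := 0) (b := t) 24 0 h.continuous_statS.continuousOn
    (fun x hx => h.hasDerivAt_statS hx.1) (fun x hx => ?_) (right_mem_Icc.2 ht)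
  · simpa using this
  have h1 := sum_sq_weight_le hl hl1 (w x)
  have h2 := sum_sq_weight_le hl hl1 v
  have h3 := weighted_sum_sq_le (l := fun i => l i ^ 2) (fun i => sq_nonneg _) (w x) v
  have h4 := statU_sq_le hl hv (w x)
  have h0 := statS_nonneg hl (w x)
  have h6 : 0 ≤ ∑ i, l i ^ 2 * w x i ^ 2 := Finset.sum_nonneg fun i _ => by positivity
  have h7 : 0 ≤ ∑ i, l i ^ 2 * v i ^ 2 := Finset.sum_nonneg fun i _ => by positivity
  rw [hv] at h2
  change _ ≤ statS l (w x) at h1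
  set m := ∑ i, l i ^ 2 * w x i * v i
  set n2 := ∑ i, l i ^ 2 * w x i ^ 2
  set u := statU l v (w x)
  set s := statS l (w x)
  have h5 : m ^ 2 ≤ s := by nlinarith
  have h8 : u * m ≤ s := by nlinarith [sq_nonneg (u - m)]
  nlinarith [mul_nonneg h0 h6]

lemma sum_sq_growth (h : IsFlow l v w) (hl : ∀ i, 0 < l i) (hl1 : ∀ i, l i ≤ 1)
    (hv : ∑ i, l i * v i ^ 2 = 1) {t : ℝ} (ht : 0 ≤ t) :
    ∑ i, w t i ^ 2 ≤ (∑ i, w 0 i ^ 2) * Real.exp (24 * t) := by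
  have hd : ∀ x ∈ Ico 0 t, HasDerivAt (fun t => ∑ i, w t i ^ 2)
      (2 * ((4 - 12 * statS l (w x)) * statS l (w x) + 8 * statU l v (w x) ^ 2)) x := by
    intro x hx
    have := HasDerivAt.fun_sum (u := Finset.univ) fun i _ => ((h.deriv x hx.1 i).pow 2)
    refine this.congr_deriv ?_
    have e : ∀ A B : ℝ, (A * statS l (w x) + B * statU l v (w x)) =
        ∑ i, (A * (l i * w x i ^ 2) + B * (l i * w x i * v i)) := fun A B => by
      rw [Finset.sum_add_distrib, ← Finset.mul_sum, ← Finset.mul_sum]; rfl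
    rw [sq (statU l v (w x)), ← mul_assoc, e, Finset.mul_sum]
    exact Finset.sum_congr rfl fun i _ => by push_cast; ring
  have := le_exp_of_deriv_le (a := 0) (b := t) 24 0
    (by have := h.cont; fun_prop) hd (fun x hx => ?_) (right_mem_Icc.2 ht)
  · simpa using this
  have h1 : statS l (w x) ≤ ∑ i, w x i ^ 2 := Finset.sum_le_sum fun i _ => by
    nlinarith [hl1 i, sq_nonneg (w x i)]
  have h4 := statU_sq_le hl hv (w x)
  have h0 := statS_nonneg hl (w x)
  nlinarith

/-- The component of the flow along the top eigenvector `ξ` of the linearization grows at rate `μ`,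
and the component orthogonal to it at rate at most `4 λ_max < μ`, up to errors governed by a bound
`σ` on `s`. -/
lemma linear_phase_aux (h : IsFlow l v w) (hl : ∀ i, 0 < l i) (hmax : ∀ i, l i ≤ l i₀)
    (hl1 : l i₀ ≤ 1) (hv : ∑ i, l i * v i ^ 2 = 1) (hμ : IsTop l v i₀ μ)
    {σ T : ℝ} (hT : 0 ≤ T) (hσ : ∀ t ∈ Icc 0 T, statS l (w t) ≤ σ) (hv0 : v i₀ ≠ 0) :
    (∃ c : ℝ, 0 ≤ c ∧ c ^ 2 ≤ 576 * σ ^ 3 / (v i₀ ^ 2 * l i₀ ^ 2) ∧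
      (|topVec l v μ ⬝ᵥ w 0 / (topVec l v μ ⬝ᵥ topVec l v μ)| - c) * Real.exp (μ * T) ≤
        |topVec l v μ ⬝ᵥ w T / (topVec l v μ ⬝ᵥ topVec l v μ)|) ∧
    ∑ i, l i * (w T i - topVec l v μ ⬝ᵥ w T / (topVec l v μ ⬝ᵥ topVec l v μ) * topVec l v μ i) ^ 2
      ≤ (3 * statS l (w 0) + 6 * σ ^ 2 / l i₀) * Real.exp (8 * l i₀ * T) := by
  set ξ := topVec l v μ with hξ
  set X := ξ ⬝ᵥ ξ with hX
  have hX64 : v i₀ ^ 2 / 64 ≤ X := hμ.topVec_sq_ge hl hmax hv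
  have hv2 : 0 < v i₀ ^ 2 := by positivity
  have hX0 : 0 < X := by linarith
  have hL := hl i₀
  have hl1' : ∀ i, l i ≤ 1 := fun i => (hmax i).trans hl1
  have hμ0 : 4 * l i₀ ≤ μ := by linarith [hμ.gap]
  have hμp : 0 < μ := by linarith
  have hσ0 : 0 ≤ σ := (statS_nonneg hl _).trans (hσ 0 ⟨le_rfl, hT⟩)
  let p : ℝ → Fin d → ℝ := fun t i => l i * w t i
  have hp : ∀ t ∈ Icc 0 T, p t ⬝ᵥ p t ≤ statS l (w t) := fun t _ => by
    have := sum_sq_weight_le hl hl1' (w t)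
    refine le_trans (le_of_eq (Finset.sum_congr rfl fun i _ => ?_)) this
    simp only [p]; ring
  have hw' : ∀ t, 0 ≤ t → ∀ i, HasDerivAt (fun t => w t i)
      ((linOp l v (w t) + (-(12 * statS l (w t))) • p t) i) t := by
    intro t ht i
    refine (h.deriv t ht i).congr_deriv ?_
    have : (fun i => l i * v i) ⬝ᵥ w t = statU l v (w t) :=
      Finset.sum_congr rfl fun i _ => by ring
    simp only [linOp, this, Pi.add_apply, Pi.smul_apply, smul_eq_mul, p]; ring
  have hdot : ∀ (y : Fin d → ℝ) t, 0 ≤ t → HasDerivAt (fun t => y ⬝ᵥ w t)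
      (y ⬝ᵥ (linOp l v (w t) + (-(12 * statS l (w t))) • p t)) t := fun y t ht =>
    HasDerivAt.fun_sum fun i _ => (hw' t ht i).const_mul (y i)
  have hcont : ∀ y : Fin d → ℝ, Continuous fun t => y ⬝ᵥ w t := fun y => by
    have := h.cont
    unfold dotProduct; fun_prop
  constructor
  · refine ⟨3 * (8 * √(σ ^ 3) / (|v i₀| * l i₀)), by positivity, ?_, ?_⟩
    · rw [mul_pow, div_pow, mul_pow, mul_pow, Real.sq_sqrt (by positivity), sq_abs]
      apply le_of_eq; ring
    set c := 3 * (8 * √(σ ^ 3) / (|v i₀| * l i₀)) with hc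
    -- the perturbation of `z' = μ z`
    have hpert : ∀ t ∈ Icc 0 T, |12 * statS l (w t) * (ξ ⬝ᵥ p t) / X| ≤ μ * c := by
      intro t ht
      have h1 : (ξ ⬝ᵥ p t) ^ 2 ≤ X * (p t ⬝ᵥ p t) := by
        have := Finset.sum_mul_sq_le_sq_mul_sq Finset.univ ξ (p t)
        simpa only [dotProduct, sq, hX] using this
      have h2 := hσ t ht
      have h3 := hp t ht
      have h0 := statS_nonneg hl (w t)
      have h4 : (12 * statS l (w t) * (ξ ⬝ᵥ p t) / X) ^ 2 ≤ (μ * c) ^ 2 := by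
        rw [div_pow, div_le_iff₀ (by positivity)]
        have e1 : (12 * statS l (w t) * (ξ ⬝ᵥ p t)) ^ 2 ≤ 144 * σ ^ 2 * (X * σ) := by
          have a1 : statS l (w t) ^ 2 ≤ σ ^ 2 := pow_le_pow_left₀ h0 h2 2
          have a2 : (ξ ⬝ᵥ p t) ^ 2 ≤ X * σ := h1.trans (mul_le_mul_of_nonneg_left (h3.trans h2) hX0.le)
          calc (12 * statS l (w t) * (ξ ⬝ᵥ p t)) ^ 2
              = 144 * (statS l (w t) ^ 2 * (ξ ⬝ᵥ p t) ^ 2) := by ring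
            _ ≤ 144 * (σ ^ 2 * (X * σ)) := by gcongr
            _ = _ := by ring
        have e2 : 576 * σ ^ 3 * 16 ≤ (μ * c) ^ 2 * v i₀ ^ 2 := by
          have : c ^ 2 * (v i₀ ^ 2 * l i₀ ^ 2) = 576 * σ ^ 3 := by
            rw [hc, mul_pow, div_pow, mul_pow, mul_pow, Real.sq_sqrt (by positivity), sq_abs]
            field_simp; ring
          have : 16 * l i₀ ^ 2 ≤ μ ^ 2 := by nlinarith
          calc 576 * σ ^ 3 * 16 = c ^ 2 * v i₀ ^ 2 * (16 * l i₀ ^ 2) := by linarith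
            _ ≤ c ^ 2 * v i₀ ^ 2 * μ ^ 2 := by gcongr
            _ = _ := by ring
        have e3 : (μ * c) ^ 2 * (v i₀ ^ 2 / 64) * X ≤ (μ * c) ^ 2 * X * X := by
          have := mul_le_mul_of_nonneg_left hX64 (mul_nonneg (sq_nonneg (μ * c)) hX0.le)
          nlinarith
        nlinarith [mul_le_mul_of_nonneg_right e2 hX0.le]
      exact abs_le_of_sq_le_sq h4 (by positivity)
    have hz : ∀ t, 0 ≤ t → HasDerivAt (fun t => ξ ⬝ᵥ w t / X)
        (μ * (ξ ⬝ᵥ w t / X) - 12 * statS l (w t) * (ξ ⬝ᵥ p t) / X) t := by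
      intro t ht
      refine ((hdot ξ t ht).div_const X).congr_deriv ?_
      rw [dotProduct_add, hμ.topVec_dot_linOp hmax, dotProduct_smul, smul_eq_mul]; ring
    have hzc : Continuous fun t => ξ ⬝ᵥ w t / X := (hcont ξ).div_const X
    rcases le_total 0 (ξ ⬝ᵥ w 0 / X) with h0 | h0
    · have := ge_exp_of_deriv_ge μ (-c) hzc.continuousOn (fun t ht => hz t ht.1)
        (fun t ht => by
          have := (abs_le.1 (hpert t (Ico_subset_Icc_self ht))).2
          linarith) (right_mem_Icc.2 hT)
      have h2 := le_abs_self (ξ ⬝ᵥ w T / X)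
      rw [abs_of_nonneg h0]
      have hc0 : 0 ≤ c := by positivity
      simp only [sub_zero] at this
      rw [sub_eq_add_neg]; linarith
    · have := le_exp_of_deriv_le μ c hzc.continuousOn (fun t ht => hz t ht.1)
        (fun t ht => by
          have := (abs_le.1 (hpert t (Ico_subset_Icc_self ht))).1
          linarith) (right_mem_Icc.2 hT)
      have h2 := neg_abs_le (ξ ⬝ᵥ w T / X)
      rw [abs_of_nonpos h0]
      have hc0 : 0 ≤ c := by positivity
      simp only [sub_zero] at this
      linarith
  · -- The energy `⟨r, B r⟩` of the component `r` orthogonal to `ξ`, with `B` the linearization,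
    -- satisfies `E' ≤ 8 λ_max E + O(σ²)`.
    let E : ℝ → ℝ := fun t => w t ⬝ᵥ linOp l v (w t) - μ / X * (ξ ⬝ᵥ w t) ^ 2
    let r : ℝ → Fin d → ℝ := fun t => w t + (-(ξ ⬝ᵥ w t / X)) • ξ
    have hr : ∀ t, ξ ⬝ᵥ r t = 0 := fun t => by
      simp only [r, dotProduct_add, dotProduct_smul, smul_eq_mul, ← hX]; field_simp; ring
    have hBr : ∀ t, linOp l v (r t) = linOp l v (w t) + (-(ξ ⬝ᵥ w t / X) * μ) • ξ := fun t => by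
      simp only [r, linOp_add, linOp_smul, hμ.linOp_topVec hmax, smul_smul, hξ]
    have hEr : ∀ t, E t = r t ⬝ᵥ linOp l v (r t) := fun t => by
      rw [hBr]
      have e1 : ξ ⬝ᵥ linOp l v (w t) = μ * (ξ ⬝ᵥ w t) := hμ.topVec_dot_linOp hmax _
      have e2 : w t ⬝ᵥ ξ = ξ ⬝ᵥ w t := dotProduct_comm _ _
      have e3 : ξ ⬝ᵥ ξ = X := rfl
      simp only [r, E, dotProduct_add, add_dotProduct, dotProduct_smul, smul_dotProduct, smul_eq_mul,
        e1, e2, e3]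
      field_simp; ring
    have hEd : ∀ t, 0 ≤ t → HasDerivAt E (2 * (linOp l v (r t) ⬝ᵥ linOp l v (r t))
        - 24 * statS l (w t) * (p t ⬝ᵥ linOp l v (r t))) t := by
      intro t ht
      have h1 : HasDerivAt (fun t => w t ⬝ᵥ linOp l v (w t))
          (2 * ((linOp l v (w t) + (-(12 * statS l (w t))) • p t) ⬝ᵥ linOp l v (w t))) t := by
        have e : (fun t => w t ⬝ᵥ linOp l v (w t)) =
            fun t => 4 * (∑ i, l i * w t i * w t i) + 8 * ((fun i => l i * v i) ⬝ᵥ w t)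
              * ((fun i => l i * v i) ⬝ᵥ w t) := funext fun t => linOp_dot _ _
        rw [e]
        have a1 := HasDerivAt.fun_sum (u := Finset.univ) fun i _ =>
          (((hw' t ht i).const_mul (l i)).mul (hw' t ht i))
        have a2 := hdot (fun i => l i * v i) t ht
        refine ((a1.const_mul 4).add ((a2.const_mul 8).mul a2)).congr_deriv ?_
        rw [linOp_dot]
        have : ∀ y : Fin d → ℝ, ∑ i, (l i * y i * w t i + l i * w t i * y i) =
            2 * ∑ i, l i * y i * w t i := fun y => by
          rw [Finset.mul_sum]; exact Finset.sum_congr rfl fun i _ => by ring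
        rw [this]; ring
      have h2 := ((hdot ξ t ht).pow 2).const_mul (μ / X)
      refine (h1.sub h2).congr_deriv ?_
      have h3 : ξ ⬝ᵥ linOp l v (r t) = 0 := by
        rw [hξ, hμ.topVec_dot_linOp hmax, ← hξ, hr, mul_zero]
      have h4 : linOp l v (w t) = linOp l v (r t) + (ξ ⬝ᵥ w t / X * μ) • ξ := by
        rw [hBr, add_assoc, ← add_smul]; simp
      have h5 : ξ ⬝ᵥ (linOp l v (w t) + (-(12 * statS l (w t))) • p t) =
          (linOp l v (w t) + (-(12 * statS l (w t))) • p t) ⬝ᵥ ξ := dotProduct_comm _ _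
      rw [h5]
      set y := linOp l v (w t) + (-(12 * statS l (w t))) • p t with hy
      have h6 : y ⬝ᵥ linOp l v (w t) = y ⬝ᵥ linOp l v (r t) + ξ ⬝ᵥ w t / X * μ * (y ⬝ᵥ ξ) := by
        rw [h4, dotProduct_add, dotProduct_smul, smul_eq_mul]
      have h7 : y ⬝ᵥ linOp l v (r t) = linOp l v (r t) ⬝ᵥ linOp l v (r t)
          - 12 * statS l (w t) * (p t ⬝ᵥ linOp l v (r t)) := by
        rw [hy, h4, add_dotProduct, add_dotProduct, smul_dotProduct, smul_dotProduct, h3]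
        simp only [smul_eq_mul]; ring
      rw [h6, h7]; field_simp; ring
    have hEc : Continuous E := by
      have := h.cont
      have h2 := hcont ξ
      have e : E = fun t => 4 * (∑ i, l i * w t i * w t i) + 8 * ((fun i => l i * v i) ⬝ᵥ w t)
          * ((fun i => l i * v i) ⬝ᵥ w t) - μ / X * (ξ ⬝ᵥ w t) ^ 2 :=
        funext fun t => by simp only [E, linOp_dot]
      have h3 := hcont (fun i => l i * v i)
      rw [e]; fun_prop
    have hE12 : ∀ t, E t ≤ 12 * statS l (w t) := fun t => by
      have e : ∑ i, l i * w t i * w t i = statS l (w t) := Finset.sum_congr rfl fun i _ => by ring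
      have e2 : (fun i => l i * v i) ⬝ᵥ w t = statU l v (w t) :=
        Finset.sum_congr rfl fun i _ => by ring
      have h4 := statU_sq_le hl hv (w t)
      have : 0 ≤ μ / X * (ξ ⬝ᵥ w t) ^ 2 := by positivity
      simp only [E, linOp_dot, e, e2]; nlinarith
    have hmain := le_exp_of_deriv_le (a := 0) (b := T) (8 * l i₀) (21 * σ ^ 2 / l i₀) hEc.continuousOn
      (fun t ht => hEd t ht.1) (fun t ht => by
        have h1 := hμ.linOp_dot_linOp_le hl hmax (hr t)
        rw [← hEr] at h1
        have h2 := hE12 t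
        have h3 := hσ t (Ico_subset_Icc_self ht)
        have h4 := hp t (Ico_subset_Icc_self ht)
        have h0 := statS_nonneg hl (w t)
        have hE0 : 0 ≤ E t := by rw [hEr]; exact IsTop.dot_linOp_nonneg hl _
        have h5 : (p t ⬝ᵥ linOp l v (r t)) ^ 2 ≤
            (p t ⬝ᵥ p t) * (linOp l v (r t) ⬝ᵥ linOp l v (r t)) := by
          have := Finset.sum_mul_sq_le_sq_mul_sq Finset.univ (p t) (linOp l v (r t))
          simpa only [dotProduct, sq] using this
        have h6 : linOp l v (r t) ⬝ᵥ linOp l v (r t) ≤ 48 * statS l (w t) := by nlinarith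
        have h7 : (p t ⬝ᵥ linOp l v (r t)) ^ 2 ≤ (7 * statS l (w t)) ^ 2 := by
          have h8 : 0 ≤ linOp l v (r t) ⬝ᵥ linOp l v (r t) := Finset.sum_nonneg fun i _ => mul_self_nonneg _
          calc _ ≤ statS l (w t) * (48 * statS l (w t)) :=
                h5.trans (mul_le_mul h4 h6 h8 h0)
            _ ≤ _ := by nlinarith
        have h8 := (abs_le_of_sq_le_sq' h7 (by positivity)).1
        have h9 : statS l (w t) ^ 2 ≤ σ ^ 2 := pow_le_pow_left₀ h0 h3 2
        have h10 : 8 * l i₀ * (E t + 21 * σ ^ 2 / l i₀) = 8 * l i₀ * E t + 168 * σ ^ 2 := by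
          field_simp; ring
        rw [h10]
        nlinarith [mul_le_mul_of_nonneg_left h8 h0]) (right_mem_Icc.2 hT)
    simp only [sub_zero] at hmain
    have hfin : 4 * ∑ i, l i * (w T i - ξ ⬝ᵥ w T / X * ξ i) ^ 2 ≤ E T := by
      rw [hEr, linOp_dot]
      have e : ∑ i, l i * r T i * r T i = ∑ i, l i * (w T i - ξ ⬝ᵥ w T / X * ξ i) ^ 2 :=
        Finset.sum_congr rfl fun i _ => by
          simp only [r, Pi.add_apply, Pi.smul_apply, smul_eq_mul]; ring
      rw [e]; nlinarith [sq_nonneg ((fun i => l i * v i) ⬝ᵥ r T)]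
    have h1 := hE12 0
    have h2 : 0 ≤ 21 * σ ^ 2 / l i₀ := by positivity
    have h3 : (E 0 + 21 * σ ^ 2 / l i₀) * Real.exp (8 * l i₀ * T) ≤
        (12 * statS l (w 0) + 21 * σ ^ 2 / l i₀) * Real.exp (8 * l i₀ * T) := by gcongr
    have h4 : (12 * statS l (w 0) + 21 * σ ^ 2 / l i₀) * Real.exp (8 * l i₀ * T) ≤
        4 * ((3 * statS l (w 0) + 6 * σ ^ 2 / l i₀) * Real.exp (8 * l i₀ * T)) := by
      rw [← mul_assoc]; gcongr
      have : 21 * σ ^ 2 / l i₀ ≤ 24 * σ ^ 2 / l i₀ := by gcongr; norm_num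
      have e : 4 * (6 * σ ^ 2 / l i₀) = 24 * σ ^ 2 / l i₀ := by ring
      linarith
    linarith

end IsFlow

end Linear

end PhaseRetrieval

namespace PhaseRetrieval

open MeasureTheory ProbabilityTheory Set Matrix

section Linear

variable {d : ℕ} {l v : Fin d → ℝ} {i₀ : Fin d} {μ : ℝ}

/-- Cauchy–Schwarz in the `Q`-norm bounds the component along the top eigenvector. -/
lemma IsTop.sq_dot_topVec_le (h : IsTop l v i₀ μ) (hl : ∀ i, 0 < l i) (hmax : ∀ i, l i ≤ l i₀)
    (hv : ∑ i, l i * v i ^ 2 = 1) (y : Fin d → ℝ) :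
    (topVec l v μ ⬝ᵥ y) ^ 2 * (μ - 4 * l i₀) ^ 2 ≤ statS l y := by
  have e : topVec l v μ ⬝ᵥ y = ∑ i, l i * (v i / (μ - 4 * l i)) * y i :=
    Finset.sum_congr rfl fun i _ => by simp only [topVec]; ring
  have h1 := weighted_sum_sq_le (fun i => (hl i).le) (fun i => v i / (μ - 4 * l i)) y
  rw [← e] at h1
  have h2 : (∑ i, l i * (v i / (μ - 4 * l i)) ^ 2) * (μ - 4 * l i₀) ^ 2 ≤ 1 := by
    rw [← hv, Finset.sum_mul]
    refine Finset.sum_le_sum fun i _ => ?_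
    have h3 := h.gap_pos hmax i
    have h4 : (μ - 4 * l i₀) ^ 2 ≤ (μ - 4 * l i) ^ 2 :=
      pow_le_pow_left₀ h.gap.le (by linarith [hmax i]) 2
    have h5 : (v i / (μ - 4 * l i)) ^ 2 * (μ - 4 * l i) ^ 2 = v i ^ 2 := by
      rw [← mul_pow, div_mul_cancel₀ _ h3.ne']
    calc l i * (v i / (μ - 4 * l i)) ^ 2 * (μ - 4 * l i₀) ^ 2
        ≤ l i * (v i / (μ - 4 * l i)) ^ 2 * (μ - 4 * l i) ^ 2 := by have := hl i; gcongr
      _ = _ := by rw [mul_assoc, h5]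
  have h0 := statS_nonneg hl y
  calc (topVec l v μ ⬝ᵥ y) ^ 2 * (μ - 4 * l i₀) ^ 2
      ≤ (∑ i, l i * (v i / (μ - 4 * l i)) ^ 2) * statS l y * (μ - 4 * l i₀) ^ 2 := by
        gcongr; exact h1
    _ = ((∑ i, l i * (v i / (μ - 4 * l i)) ^ 2) * (μ - 4 * l i₀) ^ 2) * statS l y := by ring
    _ ≤ 1 * statS l y := by gcongr
    _ = _ := one_mul _

set_option maxHeartbeats 1600000 in
/-- After a time `t₀` depending only on the constants, the flow is aligned with the top
eigenvector of the linearization up to a relative error `κ`, while still of size `D^{-1/2}`. -/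
lemma IsFlow.linear_phase {β A κ : ℝ} (hβ : 0 < β) (hA : 1 ≤ A) (hκ : 0 < κ) :
    ∃ t₀ c R D₀ : ℝ, 0 ≤ t₀ ∧ 0 < c ∧ 0 < R ∧ 1 ≤ D₀ ∧ ∀ (d : ℕ) (l v : Fin d → ℝ) (i₀ : Fin d)
      (μ : ℝ) (w : ℝ → Fin d → ℝ) (D : ℝ), IsFlow l v w → (∀ i, 0 < l i) → (∀ i, l i ≤ l i₀) →
      l i₀ ≤ 1 → ∑ i, l i * v i ^ 2 = 1 → IsTop l v i₀ μ → β ≤ l i₀ → β ≤ v i₀ ^ 2 → D₀ ≤ D →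
      statS l (w 0) ≤ A / D →
      topVec l v μ ⬝ᵥ topVec l v μ ≤ A * D * (topVec l v μ ⬝ᵥ w 0) ^ 2 →
      ∑ i, w 0 i ^ 2 ≤ 1 →
      ∃ z : ℝ, c ≤ D * z ^ 2 ∧ |z| ≤ μ - 4 * l i₀ ∧
        ∑ i, l i * (w t₀ i - z * topVec l v μ i) ^ 2 ≤ κ ^ 2 * z ^ 2 ∧
        ∑ i, (w t₀ i - z * topVec l v μ i) ^ 2 ≤ R ∧ statS l (w t₀) < 1 / 3 := by
  -- The time makes the gain `e^{2 (μ - 4 λ_max) T} ≥ 2 (8 β³) T` of the top component over the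
  -- remainder exceed the initial ratio; it does not depend on `D`, so `s` stays of order `1 / D`.
  set T := A ^ 2 / (64 * β ^ 6 * κ ^ 2) with hT
  have hA0 : 0 < A := by linarith
  have hT0 : 0 < T := by positivity
  set G := Real.exp (24 * T) with hG
  have hG0 : 0 < G := Real.exp_pos _
  refine ⟨T, 16 * β ^ 3 / A, G, 1 + 36 * G ^ 3 * A ^ 4 / β ^ 6 + 6 * G ^ 2 * A / β + G * A / β ^ 14
    + 4 * G * A, hT0.le, by positivity, hG0, ?_, ?_⟩
  · have : 0 ≤ 36 * G ^ 3 * A ^ 4 / β ^ 6 + 6 * G ^ 2 * A / β + G * A / β ^ 14 + 4 * G * A := by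
      positivity
    linarith
  intro d l v i₀ μ w D h hl hmax hl1 hv hμ hβl hβv hD hs0 hX hw1
  have p1 : 0 ≤ 36 * G ^ 3 * A ^ 4 / β ^ 6 := by positivity
  have p2 : 0 ≤ 6 * G ^ 2 * A / β := by positivity
  have p3 : 0 ≤ G * A / β ^ 14 := by positivity
  have p4 : 0 ≤ 4 * G * A := by positivity
  have hD1 : 1 ≤ D := by linarith
  have hD0 : 0 < D := by linarith
  have d1 : 36 * G ^ 3 * A ^ 4 ≤ D * β ^ 6 := by
    rw [← div_le_iff₀ (by positivity)]; linarith
  have d2 : 6 * G ^ 2 * A ≤ D * β := by rw [← div_le_iff₀ (by positivity)]; linarith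
  have d3 : G * A ≤ D * β ^ 14 := by rw [← div_le_iff₀ (by positivity)]; linarith
  have d4 : 4 * G * A ≤ D := by linarith
  have hl1' : ∀ i, l i ≤ 1 := fun i => (hmax i).trans hl1
  have hL := hl i₀
  have hv2 : 0 < v i₀ ^ 2 := by linarith
  have hv0 : v i₀ ≠ 0 := by intro h0; rw [h0] at hv2; norm_num at hv2
  set σ := G * A / D with hσdef
  have hσ0 : 0 < σ := by positivity
  have hσ : ∀ t ∈ Icc 0 T, statS l (w t) ≤ σ := by
    intro t ht
    refine (h.statS_growth hl hl1' hv ht.1).trans ?_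
    have : Real.exp (24 * t) ≤ G := Real.exp_le_exp.2 (by linarith [ht.2])
    calc _ ≤ A / D * G := by
          have := statS_nonneg hl (w 0); gcongr
      _ = σ := by rw [hσdef]; ring
  obtain ⟨⟨c, hc0, hc, hz⟩, hr⟩ := h.linear_phase_aux hl hmax hl1 hv hμ hT0.le hσ hv0
  have hX64 := hμ.topVec_sq_ge hl hmax hv
  have hX8 := hμ.topVec_sq_le hmax
  have hgap := hμ.gap_ge hmax
  have hcs := hμ.sq_dot_topVec_le hl hmax hv (w T)
  set ξ := topVec l v μ with hξ
  set X := ξ ⬝ᵥ ξ with hXdef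
  have hX0 : 0 < X := by linarith
  set g := μ - 4 * l i₀ with hg
  have hg8 : 8 * β ^ 3 ≤ g := by
    refine le_trans ?_ hgap
    have : β * β * β ≤ l i₀ * l i₀ * v i₀ ^ 2 := by gcongr
    nlinarith
  have hg0 : 0 < g := lt_of_lt_of_le (by positivity) hg8
  set z₀ := ξ ⬝ᵥ w 0 / X with hz₀
  set z := ξ ⬝ᵥ w T / X with hzdef
  have hz₀sq : 64 * β ^ 3 ≤ z₀ ^ 2 * (A * D) := by
    have e1 : 64 * β ^ 3 * X ≤ 1 := by nlinarith
    have e2 : z₀ ^ 2 * (A * D) * X ^ 2 = A * D * (ξ ⬝ᵥ w 0) ^ 2 := by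
      rw [hz₀]; field_simp
    have e3 : 64 * β ^ 3 * X ^ 2 ≤ z₀ ^ 2 * (A * D) * X ^ 2 := by
      rw [e2]; refine le_trans ?_ hX; nlinarith
    exact le_of_mul_le_mul_right e3 (by positivity)
  -- the nonlinear error is of order `D^{-3/2}`, the component `z₀` at least of order `D^{-1/2}`
  have hcz : c ≤ |z₀| / 2 := by
    have e1 : c ^ 2 * (D ^ 3 * β ^ 3) ≤ 576 * (G * A) ^ 3 := by
      have : 576 * σ ^ 3 / (v i₀ ^ 2 * l i₀ ^ 2) ≤ 576 * σ ^ 3 / (β * β ^ 2) := by gcongr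
      have h2 := hc.trans this
      rw [le_div_iff₀ (by positivity)] at h2
      calc c ^ 2 * (D ^ 3 * β ^ 3) = c ^ 2 * (β * β ^ 2) * D ^ 3 := by ring
        _ ≤ 576 * σ ^ 3 * D ^ 3 := by gcongr
        _ = _ := by rw [hσdef]; field_simp
    have e2 : c ^ 2 * (D ^ 3 * β ^ 3 * A) ≤ 16 * β ^ 6 * D ^ 2 := by
      calc c ^ 2 * (D ^ 3 * β ^ 3 * A) = c ^ 2 * (D ^ 3 * β ^ 3) * A := by ring
        _ ≤ 576 * (G * A) ^ 3 * A := by gcongr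
        _ = 16 * (36 * G ^ 3 * A ^ 4) := by ring
        _ ≤ 16 * (D * β ^ 6) := by gcongr
        _ ≤ 16 * (D ^ 2 * β ^ 6) := by gcongr; nlinarith
        _ = _ := by ring
    have e3 : c ^ 2 ≤ (|z₀| / 2) ^ 2 := by
      rw [div_pow, sq_abs]
      have e4 : c ^ 2 * (D ^ 3 * β ^ 3 * A) ≤ z₀ ^ 2 / 2 ^ 2 * (D ^ 3 * β ^ 3 * A) := by
        refine e2.trans ?_
        calc 16 * β ^ 6 * D ^ 2 = (64 * β ^ 3) * (β ^ 3 * D ^ 2 / 4) := by ring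
          _ ≤ z₀ ^ 2 * (A * D) * (β ^ 3 * D ^ 2 / 4) := by gcongr
          _ = _ := by ring
      exact le_of_mul_le_mul_right e4 (by positivity)
    exact (pow_le_pow_iff_left₀ hc0 (by positivity) two_ne_zero).1 e3
  have hzlow : |z₀| / 2 * Real.exp (μ * T) ≤ |z| := by
    refine le_trans ?_ hz
    gcongr; linarith
  have hzlow2 : 16 * β ^ 3 * Real.exp (2 * (μ * T)) ≤ z ^ 2 * (A * D) := by
    have e1 : (|z₀| / 2 * Real.exp (μ * T)) ^ 2 ≤ z ^ 2 := by
      rw [← sq_abs z]; exact pow_le_pow_left₀ (by positivity) hzlow 2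
    have e2 : Real.exp (2 * (μ * T)) = Real.exp (μ * T) ^ 2 := by
      rw [← Real.exp_nat_mul]; norm_num
    rw [mul_pow, div_pow, sq_abs] at e1
    rw [e2]
    calc 16 * β ^ 3 * Real.exp (μ * T) ^ 2 = 64 * β ^ 3 * (Real.exp (μ * T) ^ 2 / 4) := by ring
      _ ≤ z₀ ^ 2 * (A * D) * (Real.exp (μ * T) ^ 2 / 4) := by gcongr
      _ = z₀ ^ 2 / 2 ^ 2 * Real.exp (μ * T) ^ 2 * (A * D) := by ring
      _ ≤ _ := by gcongr
  have hμ0 : 0 < μ := by linarith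
  refine ⟨z, ?_, ?_, ?_, ?_, ?_⟩
  · rw [div_le_iff₀ hA0]
    have : 1 ≤ Real.exp (2 * (μ * T)) := Real.one_le_exp (by positivity)
    have h2 : 16 * β ^ 3 * 1 ≤ 16 * β ^ 3 * Real.exp (2 * (μ * T)) := by gcongr
    linarith
  · have h1 : z ^ 2 * (X ^ 2 * g ^ 2) ≤ σ := by
      have : z ^ 2 * (X ^ 2 * g ^ 2) = (ξ ⬝ᵥ w T) ^ 2 * g ^ 2 := by rw [hzdef]; field_simp
      rw [this]; exact hcs.trans (hσ T ⟨hT0.le, le_rfl⟩)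
    have h2 : σ ≤ g ^ 2 * (X ^ 2 * g ^ 2) := by
      rw [hσdef, div_le_iff₀ hD0]
      refine d3.trans ?_
      have hXβ : β / 64 ≤ X := by linarith
      calc D * β ^ 14 = (8 * β ^ 3) ^ 2 * ((β / 64) ^ 2 * (8 * β ^ 3) ^ 2) * D := by ring
        _ ≤ _ := by gcongr
    have h3 : z ^ 2 ≤ g ^ 2 := le_of_mul_le_mul_right (h1.trans h2) (by positivity)
    exact abs_le_of_sq_le_sq h3 hg0.le
  · refine hr.trans ?_
    have e1 : 3 * statS l (w 0) + 6 * σ ^ 2 / l i₀ ≤ 4 * A / D := by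
      have a1 : 6 * σ ^ 2 / l i₀ ≤ 6 * σ ^ 2 / β := by gcongr
      have a2 : 6 * σ ^ 2 / β ≤ A / D := by
        rw [hσdef, div_pow, div_le_div_iff₀ hβ hD0, ← mul_div_assoc, div_mul_eq_mul_div,
          div_le_iff₀ (by positivity)]
        calc 6 * (G * A) ^ 2 * D = (6 * G ^ 2 * A) * (A * D) := by ring
          _ ≤ (D * β) * (A * D) := by gcongr
          _ = _ := by ring
      have a3 : 4 * A / D = 3 * (A / D) + A / D := by ring
      linarith
    have e2 : Real.exp (8 * l i₀ * T) * (16 * β ^ 3 * T) ≤ Real.exp (2 * (μ * T)) := by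
      have : 2 * (μ * T) = 8 * l i₀ * T + 2 * (g * T) := by rw [hg]; ring
      rw [this, Real.exp_add]
      gcongr
      have h3 := Real.add_one_le_exp (2 * (g * T))
      have : 8 * β ^ 3 * T ≤ g * T := by gcongr
      linarith
    have e3 : 4 * A / D * Real.exp (8 * l i₀ * T) * (16 * β ^ 3 * T * (16 * β ^ 3))
        ≤ κ ^ 2 * z ^ 2 * (16 * β ^ 3 * T * (16 * β ^ 3)) := by
      calc 4 * A / D * Real.exp (8 * l i₀ * T) * (16 * β ^ 3 * T * (16 * β ^ 3))
          = 4 * A / D * (16 * β ^ 3 * (Real.exp (8 * l i₀ * T) * (16 * β ^ 3 * T))) := by ring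
        _ ≤ 4 * A / D * (16 * β ^ 3 * Real.exp (2 * (μ * T))) := by gcongr
        _ ≤ 4 * A / D * (z ^ 2 * (A * D)) := by gcongr
        _ = _ := by rw [hT]; field_simp; ring
    calc _ ≤ 4 * A / D * Real.exp (8 * l i₀ * T) := by gcongr
      _ ≤ _ := le_of_mul_le_mul_right e3 (by positivity)
  · have e : ∑ i, (w T i - z * ξ i) ^ 2 = ∑ i, w T i ^ 2 - z ^ 2 * X := by
      have : ∑ i, (w T i - z * ξ i) ^ 2 = ∑ i, w T i ^ 2 - 2 * z * (ξ ⬝ᵥ w T) + z ^ 2 * X := by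
        rw [hXdef, dotProduct, dotProduct, Finset.mul_sum, Finset.mul_sum, ← Finset.sum_sub_distrib,
          ← Finset.sum_add_distrib]
        exact Finset.sum_congr rfl fun i _ => by ring
      have h2 : ξ ⬝ᵥ w T = z * X := by rw [hzdef]; field_simp
      rw [this, h2]; ring
    have h1 := h.sum_sq_growth hl hl1' hv hT0.le
    have h2 : (∑ i, w 0 i ^ 2) * Real.exp (24 * T) ≤ 1 * G := by gcongr
    have : 0 ≤ z ^ 2 * X := by positivity
    rw [e]; linarith
  · have := hσ T ⟨hT0.le, le_rfl⟩
    have h2 : σ ≤ 1 / 4 := by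
      rw [hσdef, div_le_iff₀ hD0]; linarith
    linarith

end Linear

end PhaseRetrieval

namespace PhaseRetrieval

open MeasureTheory ProbabilityTheory Set Matrix

/-! ### Splitting the flow into a signal part and a decaying part -/

section Split

variable {d : ℕ} {l v : Fin d → ℝ} {i₀ : Fin d} {μ : ℝ} {w q : ℝ → Fin d → ℝ} {P : ℝ → ℝ}
  {r : Fin d → ℝ}

/-- The splitting `w_i = q_i v_i + e^{λ_i P} r_i` of the flow, where `P' = 4 - 12 s`: the first part
is driven by the target, the second solves the homogeneous equation. -/
structure IsSplit (l v : Fin d → ℝ) (w q : ℝ → Fin d → ℝ) (P : ℝ → ℝ) (r : Fin d → ℝ) :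
    Prop where
  P_zero : P 0 = 0
  derivP : ∀ t, HasDerivAt P (4 - 12 * statS l (w t)) t
  cont : ∀ i, Continuous fun t => q t i
  derivq : ∀ t i, HasDerivAt (fun t => q t i)
    (l i * ((4 - 12 * statS l (w t)) * q t i + 8 * statU l v (w t))) t
  eq : ∀ t, 0 ≤ t → ∀ i, w t i = q t i * v i + Real.exp (l i * P t) * r i

/-- Any splitting of the initial point extends to the flow, by variation of constants. -/
lemma IsFlow.exists_isSplit (h : IsFlow l v w) (hl : ∀ i, 0 < l i) {q₀ : Fin d → ℝ}
    (h0 : ∀ i, w 0 i = q₀ i * v i + r i) :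
    ∃ q P, IsSplit l v w q P r ∧ ∀ i, q 0 i = q₀ i := by
  have hs := h.continuous_statS
  have hu := h.continuous_statU
  have hpc : Continuous fun t => 4 - 12 * statS l (w t) := by fun_prop
  let P : ℝ → ℝ := fun t => ∫ x in (0 : ℝ)..t, (4 - 12 * statS l (w x))
  have hP : ∀ t, HasDerivAt P (4 - 12 * statS l (w t)) t := fun t =>
    (hpc.integral_hasStrictDerivAt 0 t).hasDerivAt
  have hPc : Continuous P := continuous_iff_continuousAt.2 fun t => (hP t).continuousAt
  have hic : ∀ i, Continuous fun x => 8 * l i * (Real.exp (-(l i * P x)) * statU l v (w x)) :=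
    fun i => by fun_prop
  let q : ℝ → Fin d → ℝ := fun t i => Real.exp (l i * P t) *
    (q₀ i + ∫ x in (0 : ℝ)..t, 8 * l i * (Real.exp (-(l i * P x)) * statU l v (w x)))
  have hE : ∀ t i, HasDerivAt (fun t => Real.exp (l i * P t))
      (l i * (4 - 12 * statS l (w t)) * Real.exp (l i * P t)) t := fun t i =>
    ((hP t).const_mul (l i)).exp.congr_deriv (by ring)
  have hq : ∀ t i, HasDerivAt (fun t => q t i)
      (l i * ((4 - 12 * statS l (w t)) * q t i + 8 * statU l v (w t))) t := by
    intro t i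
    have h2 := ((hic i).integral_hasStrictDerivAt 0 t).hasDerivAt
    refine ((hE t i).mul (h2.const_add (q₀ i))).congr_deriv ?_
    have : Real.exp (l i * P t) * Real.exp (-(l i * P t)) = 1 := by
      rw [← Real.exp_add, add_neg_cancel, Real.exp_zero]
    simp only [q]
    linear_combination (8 * l i * statU l v (w t)) * this
  have hP0 : P 0 = 0 := by simp [P]
  have hq0 : ∀ i, q 0 i = q₀ i := fun i => by simp [q, hP0]
  refine ⟨q, P, ⟨hP0, hP, fun i => continuous_iff_continuousAt.2 fun t => (hq t i).continuousAt, hq,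
    fun t ht i => ?_⟩, hq0⟩
  have hc : Continuous fun t => w t i - (q t i * v i + Real.exp (l i * P t) * r i) := by
    have h1 := h.cont i
    have h2 : Continuous fun t => q t i := continuous_iff_continuousAt.2 fun t => (hq t i).continuousAt
    fun_prop
  have := abs_le_of_linear_ode (hl i).le le_rfl (a := 0) (b := t)
    (p := fun t => 4 - 12 * statS l (w t)) (f := fun _ => 0) hc.continuousOn
    (fun x hx => (h.deriv x hx.1 i).sub (((hq x i).mul_const (v i)).add ((hE x i).mul_const (r i))))
    (fun x _ => by ring) (fun x _ => by have := statS_nonneg hl (w x); linarith) (fun x _ => by simp)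
    (right_mem_Icc.2 ht)
  simp only [hP0, hq0, h0, mul_zero, Real.exp_zero, one_mul, sub_self, abs_zero, zero_mul, add_zero,
    abs_nonpos_iff] at this
  linarith

namespace IsSplit

lemma q_nonneg (h : IsSplit l v w q P r) (hl : ∀ i, 0 < l i) {b : ℝ} {i : Fin d} (h0 : 0 ≤ q 0 i)
    (hu : ∀ t ∈ Ico 0 b, 0 < statU l v (w t)) : ∀ t ∈ Icc 0 b, 0 ≤ q t i :=
  nonneg_of_deriv_ge (K := 4 * l i) (h.cont i).continuousOn (fun t _ => h.derivq t i) h0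
    fun t ht hneg => by
      have h1 := statS_nonneg hl (w t)
      have h2 := hu t ht
      have h3 := hl i
      have h4 : 4 * q t i ≤ (4 - 12 * statS l (w t)) * q t i + 8 * statU l v (w t) := by nlinarith
      calc 4 * l i * q t i = l i * (4 * q t i) := by ring
        _ ≤ _ := mul_le_mul_of_nonneg_left h4 h3.le

/-- A positive `u` only increases `q_i` above the solution of the homogeneous equation. -/
lemma exp_mul_le (h : IsSplit l v w q P r) (hl : ∀ i, 0 < l i) {b : ℝ} {i : Fin d}
    (hu : ∀ t ∈ Ico 0 b, 0 < statU l v (w t)) :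
    ∀ t ∈ Icc 0 b, Real.exp (l i * P t) * q 0 i ≤ q t i := by
  have hE : ∀ t, HasDerivAt (fun t => Real.exp (l i * P t) * q 0 i)
      (l i * (4 - 12 * statS l (w t)) * (Real.exp (l i * P t) * q 0 i)) t := fun t =>
    (((h.derivP t).const_mul (l i)).exp.mul_const (q 0 i)).congr_deriv (by ring)
  have hEc : Continuous fun t => Real.exp (l i * P t) * q 0 i :=
    continuous_iff_continuousAt.2 fun t => (hE t).continuousAt
  have := nonneg_of_deriv_ge (K := 4 * l i) (a := 0) (b := b)
    (f := fun t => q t i - Real.exp (l i * P t) * q 0 i)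
    ((h.cont i).sub hEc).continuousOn (fun t _ => (h.derivq t i).sub (hE t))
    (by simp [h.P_zero])
    fun t ht hneg => by
      have h1 := statS_nonneg hl (w t)
      have h2 := hu t ht
      have h3 := hl i
      set y := q t i - Real.exp (l i * P t) * q 0 i with hy
      have h4 : 4 * y ≤ (4 - 12 * statS l (w t)) * y + 8 * statU l v (w t) := by nlinarith
      calc 4 * l i * y = l i * (4 * y) := by ring
        _ ≤ l i * ((4 - 12 * statS l (w t)) * y + 8 * statU l v (w t)) :=
          mul_le_mul_of_nonneg_left h4 h3.le
        _ = _ := by rw [hy]; ring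
  intro t ht; have := this t ht; linarith

/-- As long as `s ≤ 1/3` the mode of the largest eigenvalue leads. -/
lemma q_le_top (h : IsSplit l v w q P r) (hl : ∀ i, 0 < l i) (hmax : ∀ i, l i ≤ l i₀) {b : ℝ}
    {i : Fin d} (h0 : q 0 i ≤ q 0 i₀) (h00 : 0 ≤ q 0 i₀)
    (hu : ∀ t ∈ Ico 0 b, 0 < statU l v (w t)) (hs : ∀ t ∈ Ico 0 b, statS l (w t) ≤ 1 / 3) :
    ∀ t ∈ Icc 0 b, q t i ≤ q t i₀ := by
  have := nonneg_of_deriv_ge (K := 4 * l i) (a := 0) (b := b) (f := fun t => q t i₀ - q t i)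
    ((h.cont i₀).sub (h.cont i)).continuousOn (fun t _ => (h.derivq t i₀).sub (h.derivq t i))
    (by simpa using h0)
    fun t ht hneg => by
      have h1 := statS_nonneg hl (w t)
      have h2 := hu t ht
      have h3 := hl i
      have h4 := hs t ht
      have h5 := h.q_nonneg hl h00 hu t (Ico_subset_Icc_self ht)
      set p := 4 - 12 * statS l (w t) with hp
      have hp0 : 0 ≤ p := by linarith
      have hp4 : p ≤ 4 := by linarith
      have h6 : 0 ≤ (l i₀ - l i) * (p * q t i₀ + 8 * statU l v (w t)) :=
        mul_nonneg (by linarith [hmax i]) (by positivity)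
      have h7 : 4 * l i * (q t i₀ - q t i) ≤ l i * (p * (q t i₀ - q t i)) := by
        have : 4 * (q t i₀ - q t i) ≤ p * (q t i₀ - q t i) := by nlinarith
        nlinarith
      nlinarith
  intro t ht; have := this t ht; linarith

/-- The driven part dominates: a lower bound for `u` by the top mode. -/
lemma statU_ge (h : IsSplit l v w q P r) (hl : ∀ i, 0 < l i) (hmax : ∀ i, l i ≤ l i₀)
    (hv : ∑ i, l i * v i ^ 2 = 1) {z κ t : ℝ} (hz : 0 < z) (hκ : 0 ≤ κ)
    (hκ0 : 16 * κ ≤ l i₀ * v i₀ ^ 2) (hq0 : ∀ i, 0 ≤ q 0 i) (hqz : z / 8 ≤ q 0 i₀)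
    (hr : ∑ i, l i * r i ^ 2 ≤ κ ^ 2 * z ^ 2) (ht : 0 ≤ t) (hP : 0 ≤ P t)
    (hu : ∀ x ∈ Ico 0 t, 0 < statU l v (w x)) :
    ∑ i, l i * (Real.exp (l i * P t) * r i) ^ 2 ≤ (8 * κ * q t i₀) ^ 2 ∧
    Real.exp (l i₀ * P t) * z ≤ 8 * q t i₀ ∧
    l i₀ * v i₀ ^ 2 / 2 * q t i₀ ≤ statU l v (w t) := by
  set E := Real.exp (l i₀ * P t) with hE
  have hE0 : 0 < E := Real.exp_pos _
  have hq : ∀ i, 0 ≤ q t i := fun i => h.q_nonneg hl (hq0 i) hu t ⟨ht, le_rfl⟩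
  have h1 : E * z ≤ 8 * q t i₀ := by
    have := h.exp_mul_le hl (i := i₀) hu t ⟨ht, le_rfl⟩
    nlinarith
  have h2 : ∑ i, l i * (Real.exp (l i * P t) * r i) ^ 2 ≤ E ^ 2 * (κ ^ 2 * z ^ 2) := by
    refine le_trans (Finset.sum_le_sum fun i _ => ?_)
      (((Finset.mul_sum ..).symm.le).trans (mul_le_mul_of_nonneg_left hr (sq_nonneg E)))
    have : Real.exp (l i * P t) ≤ E := Real.exp_le_exp.2 (by have := hmax i; gcongr)
    calc l i * (Real.exp (l i * P t) * r i) ^ 2 = Real.exp (l i * P t) ^ 2 * (l i * r i ^ 2) := by ring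
      _ ≤ E ^ 2 * (l i * r i ^ 2) := by have := hl i; gcongr
  have h3 : E ^ 2 * (κ ^ 2 * z ^ 2) ≤ (8 * κ * q t i₀) ^ 2 := by
    calc E ^ 2 * (κ ^ 2 * z ^ 2) = (κ * (E * z)) ^ 2 := by ring
      _ ≤ (κ * (8 * q t i₀)) ^ 2 := by gcongr
      _ = _ := by ring
  refine ⟨h2.trans h3, h1, ?_⟩
  have e : statU l v (w t) = ∑ i, l i * q t i * v i ^ 2
      + ∑ i, l i * (Real.exp (l i * P t) * r i) * v i := by
    rw [← Finset.sum_add_distrib]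
    exact Finset.sum_congr rfl fun i _ => by rw [h.eq t ht]; ring
  have h4 := weighted_sum_sq_le (fun i => (hl i).le) (fun i => Real.exp (l i * P t) * r i) v
  rw [hv, mul_one] at h4
  have h5 := (abs_le_of_sq_le_sq' (h4.trans (h2.trans h3)) (by have := hq i₀; positivity)).1
  have h6 : l i₀ * q t i₀ * v i₀ ^ 2 ≤ ∑ i, l i * q t i * v i ^ 2 :=
    Finset.single_le_sum (f := fun i => l i * q t i * v i ^ 2)
      (fun i _ => by have := hl i; have := hq i; positivity) (Finset.mem_univ i₀)
  have h7 : 8 * κ * q t i₀ ≤ l i₀ * v i₀ ^ 2 / 2 * q t i₀ := by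
    have := hq i₀; gcongr; linarith
  rw [e]; nlinarith

end IsSplit

set_option maxHeartbeats 1600000 in
/-- Escape from the saddle: within time `O(log D)` the flow reaches `s = 1/3`, with `u` bounded
below and the homogeneous part small. -/
lemma IsFlow.escape (h : IsFlow l v w) (hl : ∀ i, 0 < l i) (hmax : ∀ i, l i ≤ l i₀)
    (hl1 : l i₀ ≤ 1) (hv : ∑ i, l i * v i ^ 2 = 1) (hμ : IsTop l v i₀ μ) {β κ z c D R : ℝ}
    (hβ : 0 < β) (hβl : β ≤ l i₀) (hβv : β ≤ v i₀ ^ 2) (hκ : 0 ≤ κ) (hκβ : 16 * κ ≤ β ^ 2)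
    (hz : 0 < z) (hzμ : z ≤ μ - 4 * l i₀) (hcD : c ≤ D * z ^ 2) (hD : 1 ≤ D)
    (hD2 : 256 / β ^ 4 < c * D)
    (hr : ∑ i, l i * (w 0 i - z * topVec l v μ i) ^ 2 ≤ κ ^ 2 * z ^ 2)
    (hR : ∑ i, (w 0 i - z * topVec l v μ i) ^ 2 ≤ R) (hs : statS l (w 0) < 1 / 3) :
    ∃ t, 0 ≤ t ∧ t ≤ Real.log D / (4 * β ^ 3) ∧ statS l (w t) = 1 / 3 ∧ 0 < statU l v (w t) ∧
      β ^ 4 / 27 ≤ statU l v (w t) ^ 2 ∧ ∃ q n : Fin d → ℝ, (∀ i, w t i = q i * v i + n i) ∧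
        (∀ i, 0 ≤ q i) ∧ (∀ i, q i ≤ 2 / β ^ 2) ∧ (∀ i, q i ≤ l i * (1 + (8 / β ^ 2 + 8) * t)) ∧
        ∑ i, l i * n i ^ 2 ≤ (16 * κ / β ^ 2) ^ 2 ∧
        ∑ i, n i ^ 2 ≤ Real.exp 2 * R + 2 / β ^ 5 + 2 / β ^ 5 := by
  set r : Fin d → ℝ := fun i => w 0 i - z * topVec l v μ i with hrdef
  have hg := hμ.gap_pos hmax
  have hL := hl i₀
  obtain ⟨q, P, hq, hq0⟩ := h.exists_isSplit hl (q₀ := fun i => z * (l i / (μ - 4 * l i))) (r := r)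
    (fun i => by simp only [hrdef, topVec]; ring)
  have hq0n : ∀ i, 0 ≤ q 0 i := fun i => by
    rw [hq0]; have := hl i; have := hg i; positivity
  have hq0z : z / 8 ≤ q 0 i₀ := by
    rw [hq0, div_eq_mul_inv]
    gcongr
    rw [le_div_iff₀ hμ.gap]
    have := hμ.gap_le hl hmax hv
    linarith
  have hq0l : ∀ i, q 0 i ≤ l i := fun i => by
    rw [hq0, ← mul_div_assoc, div_le_iff₀ (hg i), mul_comm]
    have := hl i
    gcongr; linarith [hmax i]
  have hq0top : ∀ i, q 0 i ≤ q 0 i₀ := fun i => by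
    rw [hq0, hq0]
    have := hmax i
    have := hμ.gap
    have := hl i
    gcongr
  have hν : β ^ 2 ≤ l i₀ * v i₀ ^ 2 := by rw [sq]; gcongr
  have hκ0 : 16 * κ ≤ l i₀ * v i₀ ^ 2 := by linarith
  have hβ1 : β ≤ 1 := by linarith
  -- facts at a time before which `s ≤ 1/3`
  have key : ∀ b, 0 ≤ b → (∀ t ∈ Ico 0 b, statS l (w t) ≤ 1 / 3) → (∀ t ∈ Icc 0 b, 0 ≤ P t) ∧
      ∀ t ∈ Icc 0 b, 0 < statU l v (w t) := by
    intro b hb hsb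
    have hP : ∀ t ∈ Icc 0 b, 0 ≤ P t := nonneg_of_deriv_ge (K := 0)
      (continuous_iff_continuousAt.2 fun t => (hq.derivP t).continuousAt).continuousOn
      (fun t _ => hq.derivP t) hq.P_zero.ge (fun t ht _ => by have := hsb t ht; linarith)
    refine ⟨hP, pos_of_bootstrap h.continuous_statU.continuousOn fun t ht hpos => ?_⟩
    obtain ⟨-, h2, h3⟩ := hq.statU_ge hl hmax hv hz hκ hκ0 hq0n hq0z hr ht.1 (hP t ht) hpos
    have : 0 < q t i₀ := by have := Real.exp_pos (l i₀ * P t); nlinarith [mul_pos this hz]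
    have hν0 : 0 < l i₀ * v i₀ ^ 2 := lt_of_lt_of_le (by positivity) hν
    exact lt_of_lt_of_le (by positivity) h3
  have hq3 : ∀ b, 0 ≤ b → (∀ t ∈ Ico 0 b, statS l (w t) ≤ 1 / 3) → statS l (w b) ≤ 1 / 3 →
      q b i₀ ≤ 2 / β ^ 2 := by
    intro b hb hsb hs3
    obtain ⟨hP, hpos⟩ := key b hb hsb
    obtain ⟨-, h2, h3⟩ := hq.statU_ge hl hmax hv hz hκ hκ0 hq0n hq0z hr hb (hP b ⟨hb, le_rfl⟩)
      (fun x hx => hpos x (Ico_subset_Icc_self hx))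
    have h4 := statU_sq_le hl hv (w b)
    have h5 : statU l v (w b) ≤ 1 := by nlinarith
    have h6 : 0 ≤ q b i₀ := hq.q_nonneg hl (hq0n i₀) (fun x hx => hpos x (Ico_subset_Icc_self hx)) b
      ⟨hb, le_rfl⟩
    rw [le_div_iff₀ (by positivity)]
    nlinarith
  -- While `s < 1/3`, the leading multiple grows at rate at least `4 β³` but stays below `2 / β²`.
  have hhit : ∃ b ∈ Icc 0 (Real.log D / (4 * β ^ 3)), 1 / 3 ≤ statS l (w b) := by
    by_contra! hcon
    set b := Real.log D / (4 * β ^ 3) with hb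
    have hb0 : 0 ≤ b := by have := Real.log_nonneg hD; positivity
    have hsb : ∀ t ∈ Ico 0 b, statS l (w t) ≤ 1 / 3 := fun t ht => (hcon t (Ico_subset_Icc_self ht)).le
    obtain ⟨hP, hpos⟩ := key b hb0 hsb
    have hgrow := ge_exp_of_deriv_ge (a := 0) (b := b) (4 * β ^ 3) 0 (hq.cont i₀).continuousOn
      (fun t _ => hq.derivq t i₀) (fun t ht => by
        have htI := Ico_subset_Icc_self ht
        obtain ⟨-, -, h3⟩ := hq.statU_ge hl hmax hv hz hκ hκ0 hq0n hq0z hr ht.1 (hP t htI)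
          (fun x hx => hpos x ⟨hx.1, (hx.2.trans ht.2).le⟩)
        have h6 : 0 ≤ q t i₀ := hq.q_nonneg hl (hq0n i₀)
          (fun x hx => hpos x (Ico_subset_Icc_self hx)) t htI
        have h7 := hsb t ht
        have h8 : 4 * β ^ 2 * q t i₀ ≤ (4 - 12 * statS l (w t)) * q t i₀ + 8 * statU l v (w t) := by
          have : 0 ≤ (4 - 12 * statS l (w t)) * q t i₀ := mul_nonneg (by linarith) h6
          nlinarith
        calc 4 * β ^ 3 * (q t i₀ + 0) = β * (4 * β ^ 2 * q t i₀) := by ring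
          _ ≤ l i₀ * (4 * β ^ 2 * q t i₀) := by gcongr
          _ ≤ _ := by gcongr) (right_mem_Icc.2 hb0)
    simp only [add_zero, sub_zero] at hgrow
    have hexp : Real.exp (4 * β ^ 3 * b) = D := by
      rw [hb, mul_div_cancel₀ _ (by positivity), Real.exp_log (by linarith)]
    rw [hexp] at hgrow
    have h9 := hq3 b hb0 hsb (hcon b ⟨hb0, le_rfl⟩).le
    have h10 : z / 8 * D ≤ 2 / β ^ 2 := le_trans (by gcongr) (hgrow.trans h9)
    have h11 : z * D ≤ 16 / β ^ 2 := by
      have : 16 / β ^ 2 = 8 * (2 / β ^ 2) := by ring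
      linarith
    have h12 : (z * D) ^ 2 ≤ (16 / β ^ 2) ^ 2 := by
      have : 0 ≤ z * D := by positivity
      gcongr
    have h13 : (16 / β ^ 2) ^ 2 = 256 / β ^ 4 := by rw [div_pow, ← pow_mul]; norm_num
    have h14 : c * D ≤ (z * D) ^ 2 := by nlinarith
    linarith
  obtain ⟨b, hb, hsb⟩ := hhit
  obtain ⟨t, ht, hst, hlt⟩ := exists_first_hit hb.1 h.continuous_statS.continuousOn hs hsb
  have ht0 : 0 ≤ t := ht.1.le
  have hlt' : ∀ x ∈ Ico 0 t, statS l (w x) ≤ 1 / 3 := fun x hx => (hlt x hx).le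
  obtain ⟨hP, hpos⟩ := key t ht0 hlt'
  have hpos' : ∀ x ∈ Ico 0 t, 0 < statU l v (w x) := fun x hx => hpos x (Ico_subset_Icc_self hx)
  have htI : t ∈ Icc 0 t := ⟨ht0, le_rfl⟩
  obtain ⟨hn, hEz, hu⟩ := hq.statU_ge hl hmax hv hz hκ hκ0 hq0n hq0z hr ht0 (hP t htI) hpos'
  have hqt := hq3 t ht0 hlt' hst.le
  have hq00 : 0 ≤ q t i₀ := hq.q_nonneg hl (hq0n i₀) hpos' t htI
  have hqtop : ∀ x ∈ Icc 0 t, ∀ i, q x i ≤ q x i₀ := fun x hx i =>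
    hq.q_le_top hl hmax (hq0top i) (hq0n i₀) hpos' hlt' x hx
  have hnn : ∑ i, l i * (Real.exp (l i * P t) * r i) ^ 2 ≤ (16 * κ / β ^ 2) ^ 2 := by
    refine hn.trans ?_
    calc (8 * κ * q t i₀) ^ 2 ≤ (8 * κ * (2 / β ^ 2)) ^ 2 := by gcongr
      _ = _ := by ring
  refine ⟨t, ht0, ht.2.trans hb.2, hst, hpos t htI, ?_, fun i => q t i,
    fun i => Real.exp (l i * P t) * r i, hq.eq t ht0, fun i => hq.q_nonneg hl (hq0n i) hpos' t htI,
    fun i => (hqtop t htI i).trans hqt, fun i => ?_, hnn, ?_⟩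
  · -- `1/3 = s ≤ (3 q₀ / 2)²`
    have e1 : statS l (w t) ≤ 9 / 4 * q t i₀ ^ 2 := by
      have hx : ∀ i, l i * w t i ^ 2 ≤ 3 / 2 * (q t i₀ ^ 2 * (l i * v i ^ 2))
          + 3 * (l i * (Real.exp (l i * P t) * r i) ^ 2) := fun i => by
        rw [hq.eq t ht0]
        have a1 : q t i ^ 2 ≤ q t i₀ ^ 2 :=
          pow_le_pow_left₀ (hq.q_nonneg hl (hq0n i) hpos' t htI) (hqtop t htI i) 2
        have a2 : 0 ≤ l i * v i ^ 2 := mul_nonneg (hl i).le (sq_nonneg _)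
        have a3 := mul_le_mul_of_nonneg_right a1 a2
        have a4 := mul_nonneg (hl i).le (sq_nonneg (q t i * v i - 2 * (Real.exp (l i * P t) * r i)))
        nlinarith
      have := Finset.sum_le_sum fun i (_ : i ∈ Finset.univ) => hx i
      rw [Finset.sum_add_distrib, ← Finset.mul_sum, ← Finset.mul_sum, ← Finset.mul_sum, hv] at this
      change statS l (w t) ≤ _ at this
      have e2 : (8 * κ * q t i₀) ^ 2 ≤ 1 / 4 * q t i₀ ^ 2 := by
        rw [mul_pow]; gcongr
        have : 8 * κ ≤ 1 / 2 := by nlinarith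
        calc (8 * κ) ^ 2 ≤ (1 / 2) ^ 2 := by gcongr
          _ = _ := by norm_num
      linarith
    rw [hst] at e1
    have e2 : β ^ 2 / 2 * q t i₀ ≤ statU l v (w t) := le_trans (by gcongr) hu
    have e3 : (β ^ 2 / 2 * q t i₀) ^ 2 ≤ statU l v (w t) ^ 2 := pow_le_pow_left₀ (by positivity) e2 2
    have e4 : β ^ 4 * (1 / 3) ≤ β ^ 4 * (9 / 4 * q t i₀ ^ 2) := by gcongr
    nlinarith
  · have := le_add_mul_of_deriv_le (a := 0) (b := t) (l i * (8 / β ^ 2 + 8)) (hq.cont i).continuousOn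
      (fun x _ => hq.derivq x i) (fun x hx => by
        have hxI := Ico_subset_Icc_self hx
        have a1 := hq3 x hx.1 (fun y hy => hlt' y ⟨hy.1, hy.2.trans hx.2⟩) (hlt' x hx)
        have a2 := hqtop x hxI i
        have a3 := hq.q_nonneg hl (hq0n i) hpos' x hxI
        have a4 := statS_nonneg hl (w x)
        have a5 : statU l v (w x) ≤ 1 := by
          have := statU_sq_le hl hv (w x); have := hlt' x hx; nlinarith
        have a6 : 8 / β ^ 2 = 4 * (2 / β ^ 2) := by ring
        have a7 : (4 - 12 * statS l (w x)) * q x i ≤ 4 * q x i := by nlinarith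
        exact mul_le_mul_of_nonneg_left (by linarith) (hl i).le) htI
    simp only [sub_zero] at this
    have := hq0l i
    linarith
  · set E := Real.exp (l i₀ * P t) with hE
    have hPt := hP t htI
    have hE1 : 1 ≤ E := Real.one_le_exp (by positivity)
    have hEz2 : E * z ≤ 16 / β ^ 2 := by
      have : 16 / β ^ 2 = 8 * (2 / β ^ 2) := by ring
      linarith
    have hPz : P t * z ≤ 16 / β ^ 3 := by
      have a1 : l i₀ * P t ≤ E := by have := Real.add_one_le_exp (l i₀ * P t); linarith
      have a2 : β * P t ≤ E := le_trans (by gcongr) a1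
      have a3 : β * (P t * z) ≤ 16 / β ^ 2 := by nlinarith
      have a4 : 16 / β ^ 3 = 16 / β ^ 2 / β := by rw [div_div]; ring
      rw [a4, le_div_iff₀ hβ]; linarith
    -- The Euclidean norm of the homogeneous part: slow modes with `λ_i P ≤ 1` have not grown, the
    -- others have `λ_i` bounded below by `1 / P` or `β / 2`, so that their `Q`-norm controls them.
    have hterm : ∀ i, (Real.exp (l i * P t) * r i) ^ 2 ≤ Real.exp 2 * r i ^ 2
        + (P t * E + 2 / β * E ^ 2) * (l i * r i ^ 2) := by
      intro i
      have b0 := hl i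
      have hE2 : Real.exp (l i * P t) ^ 2 = Real.exp (2 * (l i * P t)) := by
        rw [← Real.exp_nat_mul]; norm_num
      have b1 : Real.exp (l i * P t) ^ 2 ≤ Real.exp 2 + (P t * E + 2 / β * E ^ 2) * l i := by
        have p1 := Real.exp_pos 2
        have p2 : 0 ≤ P t * E * l i := by positivity
        have p3 : 0 ≤ 2 / β * E ^ 2 * l i := by positivity
        rcases le_total (l i * P t) 1 with h1 | h1
        · have : Real.exp (l i * P t) ^ 2 ≤ Real.exp 2 := by
            rw [hE2]; exact Real.exp_le_exp.2 (by linarith)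
          linarith
        · rcases le_total (2 * l i) (l i₀) with h2 | h2
          · have : Real.exp (l i * P t) ^ 2 ≤ E := by
              rw [hE2, hE]; apply Real.exp_le_exp.2; nlinarith
            have : E ≤ P t * E * l i := by nlinarith
            linarith
          · have c1 : Real.exp (l i * P t) ^ 2 ≤ E ^ 2 := by
              have := hmax i
              rw [hE]; gcongr
            have c2 : 1 ≤ 2 / β * l i := by
              rw [div_mul_eq_mul_div, le_div_iff₀ hβ]; linarith
            nlinarith [sq_nonneg E]
      calc (Real.exp (l i * P t) * r i) ^ 2 = Real.exp (l i * P t) ^ 2 * r i ^ 2 := by ring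
        _ ≤ (Real.exp 2 + (P t * E + 2 / β * E ^ 2) * l i) * r i ^ 2 := by gcongr
        _ = _ := by ring
    have hsum := Finset.sum_le_sum fun i (_ : i ∈ Finset.univ) => hterm i
    rw [Finset.sum_add_distrib, ← Finset.mul_sum, ← Finset.mul_sum] at hsum
    refine hsum.trans ?_
    have f1 : Real.exp 2 * ∑ i, r i ^ 2 ≤ Real.exp 2 * R := by gcongr
    have f2 : (P t * E + 2 / β * E ^ 2) * ∑ i, l i * r i ^ 2 ≤
        (P t * E + 2 / β * E ^ 2) * (κ ^ 2 * z ^ 2) := by gcongr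
    have hκ2 : κ ^ 2 ≤ 1 / 256 := by
      have : κ ≤ 1 / 16 := by nlinarith
      calc κ ^ 2 ≤ (1 / 16) ^ 2 := by gcongr
        _ = _ := by norm_num
    have f3 : (P t * E + 2 / β * E ^ 2) * (κ ^ 2 * z ^ 2) ≤ 2 / β ^ 5 + 2 / β ^ 5 := by
      have g1 : (P t * z) * (E * z) ≤ 16 / β ^ 3 * (16 / β ^ 2) := by gcongr
      have g2 : (E * z) ^ 2 ≤ (16 / β ^ 2) ^ 2 := by gcongr
      have g3 : 0 ≤ (P t * z) * (E * z) + 2 / β * (E * z) ^ 2 := by positivity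
      calc (P t * E + 2 / β * E ^ 2) * (κ ^ 2 * z ^ 2)
          = κ ^ 2 * ((P t * z) * (E * z) + 2 / β * (E * z) ^ 2) := by ring
        _ ≤ 1 / 256 * (16 / β ^ 3 * (16 / β ^ 2) + 2 / β * (16 / β ^ 2) ^ 2) := by gcongr
        _ = 1 / β ^ 5 + 2 / β ^ 5 := by field_simp; ring
        _ ≤ _ := by gcongr; norm_num
    linarith

end Split

end PhaseRetrieval

namespace PhaseRetrieval

open MeasureTheory ProbabilityTheory Set Matrix

section Descent

variable {d : ℕ} {l v : Fin d → ℝ} {i₀ : Fin d} {μ : ℝ} {w q : ℝ → Fin d → ℝ} {P : ℝ → ℝ}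
  {r : Fin d → ℝ}

lemma statL_nonneg (hl : ∀ i, 0 < l i) (hv : ∑ i, l i * v i ^ 2 = 1) (w : Fin d → ℝ) :
    0 ≤ statL l v w := by
  have := statL_ge hl hv w
  have := sq_nonneg (1 - statS l w)
  linarith

/-- Below the loss `8/3` of the saddles, `u` is bounded away from zero. -/
lemma statU_sq_ge_of_statL (w : Fin d → ℝ) : 8 / 3 - statL l v w ≤ 4 * statU l v w ^ 2 := by
  unfold statL; nlinarith [sq_nonneg (3 * statS l w - 1)]

lemma IsFlow.statU_pos (h : IsFlow l v w) (hL : statL l v (w 0) < 8 / 3)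
    (hu : 0 < statU l v (w 0)) {t : ℝ} (ht : 0 ≤ t) : 0 < statU l v (w t) := by
  by_contra! hneg
  obtain ⟨x, hx, hx0⟩ := intermediate_value_Icc' ht h.continuous_statU.continuousOn
    (⟨hneg, hu.le⟩ : (0 : ℝ) ∈ Icc _ _)
  have h1 := h.statL_anti le_rfl hx.1
  have h2 := statU_sq_ge_of_statL (l := l) (v := v) (w x)
  have h3 : statU l v (w x) = 0 := hx0
  rw [h3] at h2
  linarith

lemma abs_one_sub_statS_le (hl : ∀ i, 0 < l i) (hv : ∑ i, l i * v i ^ 2 = 1) {w : Fin d → ℝ}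
    (hL : statL l v w ≤ 1 / 100) : |1 - statS l w| ≤ 3 / 50 := by
  have := statL_ge hl hv w
  refine abs_le_of_sq_le_sq ?_ (by norm_num)
  norm_num; linarith

lemma statU_le_of_statS (hl : ∀ i, 0 < l i) (hv : ∑ i, l i * v i ^ 2 = 1) {w : Fin d → ℝ} {c : ℝ}
    (hc : 0 ≤ c) (hs : statS l w ≤ c ^ 2) : |statU l v w| ≤ c :=
  abs_le_of_sq_le_sq ((statU_sq_le hl hv w).trans hs) hc

lemma IsSplit.abs_q_le (h : IsSplit l v w q P r) (hl : ∀ i, 0 < l i) (hv : ∑ i, l i * v i ^ 2 = 1)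
    {t : ℝ} (ht : 0 ≤ t) (hs : ∀ x ∈ Ico 0 t, statS l (w x) ≤ 2) (i : Fin d) :
    |q t i| ≤ Real.exp (4 * l i * t) * (|q 0 i| + l i * 12 * t) := by
  have := abs_le_of_linear_ode (hl i).le (F := 12) (by norm_num) (a := 0) (b := t)
    (h.cont i).continuousOn
    (p := fun t => 4 - 12 * statS l (w t)) (f := fun t => 8 * statU l v (w t))
    (fun x _ => h.derivq x i) (fun x _ => rfl)
    (fun x _ => by have := statS_nonneg hl (w x); linarith)
    (fun x hx => by
      have := statU_le_of_statS hl hv (c := 3 / 2) (by norm_num) ((hs x hx).trans (by norm_num))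
      rw [abs_mul, abs_of_pos (by norm_num : (0 : ℝ) < 8)]; linarith) (right_mem_Icc.2 ht)
  simpa using this

/-- Near the target the signal part stays bounded and the homogeneous part decays. -/
lemma IsFlow.settle (h : IsFlow l v w) (hl : ∀ i, 0 < l i) (hv : ∑ i, l i * v i ^ 2 = 1)
    (hL : statL l v (w 0) ≤ 1 / 100) (hu : 0 < statU l v (w 0)) {q₀ : Fin d → ℝ}
    (h0 : ∀ i, w 0 i = q₀ i * v i + r i) (hq₀ : ∀ i, 0 ≤ q₀ i) :
    ∃ q P, IsSplit l v w q P r ∧ (∀ i, q 0 i = q₀ i) ∧ ∀ t, 0 ≤ t → P t ≤ -4 * t ∧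
      ∀ i, 0 ≤ q t i ∧ q t i ≤ max (q₀ i) 3 ∧ q t i ≤ q₀ i + 9 * l i * t := by
  obtain ⟨q, P, hq, hq0⟩ := h.exists_isSplit hl h0
  have hs : ∀ t, 0 ≤ t → |1 - statS l (w t)| ≤ 3 / 50 := fun t ht =>
    abs_one_sub_statS_le hl hv ((h.statL_anti le_rfl ht).trans hL)
  have hpos : ∀ t, 0 ≤ t → 0 < statU l v (w t) := fun t ht => h.statU_pos (by linarith) hu ht
  have hu1 : ∀ t, 0 ≤ t → statU l v (w t) ≤ 9 / 8 := fun t ht =>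
    (le_abs_self _).trans (statU_le_of_statS hl hv (by norm_num)
      (by have := (abs_le.1 (hs t ht)).1; norm_num; linarith))
  have hqn : ∀ t, 0 ≤ t → ∀ i, 0 ≤ q t i := fun t ht i =>
    hq.q_nonneg hl (by rw [hq0]; exact hq₀ i) (fun x hx => hpos x hx.1) t (right_mem_Icc.2 ht)
  refine ⟨q, P, hq, hq0, fun t ht => ⟨?_, fun i => ⟨hqn t ht i, ?_, ?_⟩⟩⟩
  · have := le_add_mul_of_deriv_le (a := 0) (b := t) (-4)
      (continuous_iff_continuousAt.2 fun t => (hq.derivP t).continuousAt).continuousOn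
      (fun x _ => hq.derivP x) (fun x hx => by
        have := (abs_le.1 (hs x hx.1)).2; linarith) (right_mem_Icc.2 ht)
    rw [hq.P_zero] at this; linarith
  · have := nonneg_of_deriv_ge (K := 0) (f := fun t => max (q₀ i) 3 - q t i) (a := 0) (b := t)
      (continuous_const.sub (hq.cont i)).continuousOn (fun x _ => (hq.derivq x i).const_sub _)
      (by rw [hq0]; simp) (fun x hx hneg => by
        have h1 := (abs_le.1 (hs x hx.1)).2
        have h2 := hu1 x hx.1
        have h3 := le_max_right (q₀ i) 3
        have h5 : (4 - 12 * statS l (w x)) * q x i + 8 * statU l v (w x) ≤ 0 := by nlinarith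
        have := mul_nonpos_of_nonneg_of_nonpos (hl i).le h5
        linarith) t (right_mem_Icc.2 ht)
    linarith
  · have := le_add_mul_of_deriv_le (a := 0) (b := t) (9 * l i) (hq.cont i).continuousOn
      (fun x _ => hq.derivq x i) (fun x hx => by
        have h1 := (abs_le.1 (hs x hx.1)).2
        have h2 := hu1 x hx.1
        have h3 := hqn x hx.1 i
        have h4 : (4 - 12 * statS l (w x)) * q x i + 8 * statU l v (w x) ≤ 9 := by nlinarith
        have := mul_le_mul_of_nonneg_left h4 (hl i).le
        linarith) (right_mem_Icc.2 ht)
    rw [hq0] at this; linarith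

/-- From `s = 1/3` with `u` bounded below, the loss drops below `1/100` within a constant time,
provided the spectral tail of the target and the homogeneous part are small. -/
lemma IsFlow.descend (h : IsFlow l v w) (hl : ∀ i, 0 < l i) (hl1 : ∀ i, l i ≤ 1)
    (hv : ∑ i, l i * v i ^ 2 = 1) {β N M₁ τ ρ κ : ℝ} {q₀ : Fin d → ℝ}
    (hβ : 0 < β) (hβ1 : β ≤ 1) (hN : N = 300 * 81 / (8 * β ^ 4))
    (hM₁ : M₁ = Real.exp (4 * N) * (2 / β ^ 2 + 12 * N)) (hτ : 0 < τ)
    (hs : statS l (w 0) = 1 / 3) (hu : 0 < statU l v (w 0)) (hu2 : β ^ 4 / 27 ≤ statU l v (w 0) ^ 2)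
    (h0 : ∀ i, w 0 i = q₀ i * v i + r i) (hq₀ : ∀ i, 0 ≤ q₀ i) (hq₁ : ∀ i, q₀ i ≤ 2 / β ^ 2)
    (hκ : ∑ i, l i * r i ^ 2 ≤ κ) (hρ : ∑ i with l i * τ ≤ 1, l i * v i ^ 2 ≤ ρ)
    (hρ2 : (100 * M₁ ^ 2 + 16) * ρ ≤ β ^ 4 / 81 / 400)
    (hκ2 : 100 * Real.exp (8 * N) * κ ≤ β ^ 4 / 81 / 400) :
    statL l v (w (N * τ)) ≤ 1 / 100 ∧ 0 < statU l v (w (N * τ)) ∧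
    ∃ q n : Fin d → ℝ, (∀ i, w (N * τ) i = q i * v i + n i) ∧ (∀ i, 0 ≤ q i) ∧
      (∀ i, q i ≤ Real.exp (4 * (N * τ)) * (q₀ i + l i * 12 * (N * τ))) ∧
      ∑ i, n i ^ 2 ≤ Real.exp (8 * (N * τ)) * ∑ i, r i ^ 2 := by
  obtain ⟨q, P, hq, hq0⟩ := h.exists_isSplit hl h0
  have hL0 : statL l v (w 0) = 8 / 3 - 4 * statU l v (w 0) ^ 2 := by
    unfold statL; rw [hs]; ring
  have hL3 : ∀ t, 0 ≤ t → statL l v (w t) ≤ 3 := fun t ht => by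
    have := h.statL_anti le_rfl ht; have := sq_nonneg (statU l v (w 0)); linarith
  have hN0 : 0 < N := by rw [hN]; positivity
  have hs2 : ∀ t, 0 ≤ t → statS l (w t) ≤ 2 := fun t ht => statS_le_two hl hv (hL3 t ht)
  have hpos : ∀ t, 0 ≤ t → 0 < statU l v (w t) := fun t ht =>
    h.statU_pos (by have : 0 < statU l v (w 0) ^ 2 := by positivity
                    linarith) hu ht
  have hu2t : ∀ t, 0 ≤ t → β ^ 4 / 27 ≤ statU l v (w t) ^ 2 := fun t ht => by
    have h1 := h.statL_anti le_rfl ht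
    have h2 := statU_sq_ge_of_statL (l := l) (v := v) (w t)
    linarith
  have hqn : ∀ t, 0 ≤ t → ∀ i, 0 ≤ q t i := fun t ht i =>
    hq.q_nonneg hl (by rw [hq0]; exact hq₀ i) (fun x hx => hpos x hx.1) t (right_mem_Icc.2 ht)
  have hqt : ∀ t, 0 ≤ t → ∀ i, q t i ≤ Real.exp (4 * l i * t) * (q₀ i + l i * 12 * t) := by
    intro t ht i
    have := hq.abs_q_le hl hv ht (fun x hx => hs2 x hx.1) i
    rwa [abs_of_nonneg (hqn t ht i), hq0, abs_of_nonneg (hq₀ i)] at this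
  have hPt : ∀ t, 0 ≤ t → P t ≤ 4 * t := fun t ht => by
    have := le_add_mul_of_deriv_le (a := 0) (b := t) 4
      (continuous_iff_continuousAt.2 fun t => (hq.derivP t).continuousAt).continuousOn
      (fun x _ => hq.derivP x) (fun x hx => by
        have := statS_nonneg hl (w x); linarith) (right_mem_Icc.2 ht)
    rw [hq.P_zero] at this; linarith
  set T := N * τ with hT
  have hT0 : 0 < T := by positivity
  have hM₁0 : 0 ≤ M₁ := by rw [hM₁]; positivity
  refine ⟨?_, hpos T hT0.le, fun i => q T i, fun i => Real.exp (l i * P T) * r i, hq.eq T hT0.le,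
    hqn T hT0.le, fun i => ?_, ?_⟩
  · by_contra! hcon
    have hLt : ∀ t ∈ Ico 0 T, 1 / 100 ≤ statL l v (w t) := fun t ht =>
      hcon.le.trans (h.statL_anti ht.1 ht.2.le)
    -- the truncated modes contribute little to the gradient
    have htail : ∀ t ∈ Ico 0 T, ∑ i with l i * τ ≤ 1,
        l i * ((3 * statS l (w t) - 1) * w t i - 2 * statU l v (w t) * v i) ^ 2
          ≤ β ^ 4 / 81 / 200 := by
      intro t ht
      have hterm : ∀ i ∈ Finset.univ.filter fun i => l i * τ ≤ 1,
          l i * ((3 * statS l (w t) - 1) * w t i - 2 * statU l v (w t) * v i) ^ 2 ≤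
          (100 * M₁ ^ 2 + 16) * (l i * v i ^ 2) + 100 * Real.exp (8 * N) * (l i * r i ^ 2) := by
        intro i hi
        have hi' : l i * τ ≤ 1 := by simpa using hi
        have b0 := hl i
        have b1 : l i * t ≤ N := by
          have : l i * t ≤ l i * T := by have := ht.2.le; gcongr
          rw [hT] at this; nlinarith
        have b2 : q t i ≤ M₁ := by
          refine (hqt t ht.1 i).trans ?_
          rw [hM₁]
          have c1 : Real.exp (4 * l i * t) ≤ Real.exp (4 * N) := Real.exp_le_exp.2 (by linarith)
          have c2 : q₀ i + l i * 12 * t ≤ 2 / β ^ 2 + 12 * N := by have := hq₁ i; linarith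
          have c3 : 0 ≤ q₀ i + l i * 12 * t := by
            have := hq₀ i; have := mul_nonneg b0.le ht.1; linarith
          gcongr
        have b3 : Real.exp (l i * P t) ^ 2 ≤ Real.exp (8 * N) := by
          rw [← Real.exp_nat_mul]; apply Real.exp_le_exp.2
          have : l i * P t ≤ l i * (4 * t) := by have := hPt t ht.1; gcongr
          push_cast; linarith
        have b4 := residual_sq_le (x := w t i) (y := v i) (statS_nonneg hl (w t)) (hs2 t ht.1)
          (statU_sq_le hl hv (w t))
        have b5 : w t i ^ 2 ≤ 2 * (M₁ ^ 2 * v i ^ 2) + 2 * (Real.exp (8 * N) * r i ^ 2) := by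
          have c1 : q t i ^ 2 ≤ M₁ ^ 2 := pow_le_pow_left₀ (hqn t ht.1 i) b2 2
          have c2 := mul_le_mul_of_nonneg_right c1 (sq_nonneg (v i))
          have c3 := mul_le_mul_of_nonneg_right b3 (sq_nonneg (r i))
          rw [hq.eq t ht.1]
          nlinarith [sq_nonneg (q t i * v i - Real.exp (l i * P t) * r i)]
        calc _ ≤ l i * (50 * (2 * (M₁ ^ 2 * v i ^ 2) + 2 * (Real.exp (8 * N) * r i ^ 2))
              + 16 * v i ^ 2) := mul_le_mul_of_nonneg_left (by linarith) b0.le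
          _ = _ := by ring
      refine (Finset.sum_le_sum hterm).trans ?_
      rw [Finset.sum_add_distrib, ← Finset.mul_sum, ← Finset.mul_sum]
      have e1 : ∑ i with l i * τ ≤ 1, l i * r i ^ 2 ≤ κ :=
        (Finset.sum_le_sum_of_subset_of_nonneg (Finset.filter_subset _ _)
          fun i _ _ => mul_nonneg (hl i).le (sq_nonneg _)).trans hκ
      have e2 : (100 * M₁ ^ 2 + 16) * ∑ i with l i * τ ≤ 1, l i * v i ^ 2 ≤
        (100 * M₁ ^ 2 + 16) * ρ := by gcongr
      have e3 : 100 * Real.exp (8 * N) * ∑ i with l i * τ ≤ 1, l i * r i ^ 2 ≤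
        100 * Real.exp (8 * N) * κ := by gcongr
      linarith
    -- The loss, initially at most `3`, decreases at a definite rate of order `1 / τ`; the value of
    -- `N` makes the decrease over `[0, N τ]` equal to `3`.
    have := le_add_mul_of_deriv_le (a := 0) (b := T) (-16 * (β ^ 4 / 81 / 200 / τ))
      h.continuous_statL.continuousOn (fun t ht => h.hasDerivAt_statL ht.1) (fun t ht => by
        have a1 := gradSq_ge hl (v := v) (w t) hτ
        have a2 := residual_ge hl hv (c := β ^ 4 / 81) (by positivity)
          (by have : β ^ 4 ≤ 1 := pow_le_one₀ hβ.le hβ1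
              linarith) (by have := hu2t t ht.1; linarith) (hL3 t ht.1)
        have a3 := htail t ht
        have a4 := hLt t ht
        have a5 : β ^ 4 / 81 * (1 / 100) ≤ β ^ 4 / 81 * statL l v (w t) := by gcongr
        have a6 : β ^ 4 / 81 / 200 / τ ≤ gradSq l v (w t) := by
          refine le_trans ?_ a1
          gcongr; linarith
        linarith) (right_mem_Icc.2 hT0.le)
    have e : -16 * (β ^ 4 / 81 / 200 / τ) * (T - 0) = -3 := by
      rw [hT, hN]; field_simp; norm_num; ring
    rw [e] at this
    have := statL_nonneg hl hv (w T)
    have := hL3 0 le_rfl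
    linarith
  · refine (hqt T hT0.le i).trans ?_
    have := hq₀ i
    have b0 := hl i
    have : 4 * l i * T ≤ 4 * T := by nlinarith [hl1 i]
    gcongr
  · rw [Finset.mul_sum]
    refine Finset.sum_le_sum fun i _ => ?_
    rw [mul_pow]
    gcongr
    rw [← Real.exp_nat_mul]; apply Real.exp_le_exp.2
    have b0 := hl i
    have : l i * P T ≤ l i * (4 * T) := by have := hPt T hT0.le; gcongr
    push_cast
    nlinarith [hl1 i]

end Descent

end PhaseRetrieval

namespace PhaseRetrieval

open MeasureTheory ProbabilityTheory Set Matrix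

/-! ### Reaching the basin of the target -/

lemma topVec_neg {d : ℕ} (l v : Fin d → ℝ) (μ : ℝ) : topVec l (fun i => -v i) μ = -topVec l v μ := by
  ext i; simp only [topVec, Pi.neg_apply]; ring

lemma IsTop.neg {d : ℕ} {l v : Fin d → ℝ} {i₀ : Fin d} {μ : ℝ} (h : IsTop l v i₀ μ) :
    IsTop l (fun i => -v i) i₀ μ :=
  ⟨h.gap, by simpa only [mul_neg, neg_sq] using h.secular⟩

set_option maxHeartbeats 1600000 in
/-- In time `O(log D)` the flow leaves the saddle at the origin and enters the
basin of one of `±v`, split into a bounded multiple of the target and a homogeneous part. -/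
lemma IsFlow.reaches_basin {β A : ℝ} (hβ : 0 < β) (hβ1 : β ≤ 1) (hA : 1 ≤ A) :
    ∃ ρ : ℝ, 0 < ρ ∧ ∀ τ : ℝ, 0 < τ → ∃ C M D₀ : ℝ, 1 ≤ C ∧ 0 < M ∧ 3 ≤ D₀ ∧
      ∀ (d : ℕ) (l v : Fin d → ℝ) (i₀ : Fin d) (μ : ℝ) (w : ℝ → Fin d → ℝ) (D : ℝ),
      IsFlow l v w → (∀ i, 0 < l i) → (∀ i, l i ≤ l i₀) →
      l i₀ ≤ 1 → ∑ i, l i * v i ^ 2 = 1 → IsTop l v i₀ μ → β ≤ l i₀ → β ≤ v i₀ ^ 2 → D₀ ≤ D →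
      statS l (w 0) ≤ A / D →
      topVec l v μ ⬝ᵥ topVec l v μ ≤ A * D * (topVec l v μ ⬝ᵥ w 0) ^ 2 →
      ∑ i, w 0 i ^ 2 ≤ 1 → ∑ i with l i * τ ≤ 1, l i * v i ^ 2 ≤ ρ →
      ∃ v' : Fin d → ℝ, (v' = v ∨ v' = fun i => -v i) ∧
        statL l v' (w (C * Real.log D)) ≤ 1 / 100 ∧ 0 < statU l v' (w (C * Real.log D)) ∧
        ∃ q n : Fin d → ℝ, (∀ i, w (C * Real.log D) i = q i * v' i + n i) ∧ (∀ i, 0 ≤ q i) ∧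
          (∀ i, q i ≤ M) ∧ (∀ i, q i ≤ M * l i * (C * Real.log D)) ∧ ∑ i, n i ^ 2 ≤ M := by
  obtain ⟨N, hN⟩ : ∃ N : ℝ, N = 300 * 81 / (8 * β ^ 4) := ⟨_, rfl⟩
  obtain ⟨M₁, hM₁⟩ : ∃ M₁ : ℝ, M₁ = Real.exp (4 * N) * (2 / β ^ 2 + 12 * N) := ⟨_, rfl⟩
  have hN0 : 0 < N := by rw [hN]; positivity
  obtain ⟨κ, hκ0, hκβ, hκN⟩ : ∃ κ : ℝ, 0 < κ ∧ 16 * κ ≤ β ^ 2 ∧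
      100 * Real.exp (8 * N) * (16 * κ / β ^ 2) ^ 2 ≤ β ^ 4 / 81 / 400 := by
    set E := 100 * Real.exp (8 * N) with hE
    have hE0 : 0 < E := by positivity
    set y := min 1 (β ^ 4 / 81 / 400 / E) with hy
    have hy0 : 0 < y := lt_min one_pos (by positivity)
    have hy1 : y ≤ 1 := min_le_left _ _
    refine ⟨β ^ 2 / 16 * y, by positivity, by nlinarith [sq_nonneg β], ?_⟩
    have e : 16 * (β ^ 2 / 16 * y) / β ^ 2 = y := by field_simp
    rw [e]
    calc E * y ^ 2 ≤ E * y := by gcongr; nlinarith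
      _ ≤ E * (β ^ 4 / 81 / 400 / E) := by gcongr; exact min_le_right _ _
      _ = _ := by field_simp
  -- The tail tolerance `ρ` depends on `β` alone; the truncation scale `τ` may then be chosen.
  refine ⟨β ^ 4 / 81 / 400 / (100 * M₁ ^ 2 + 16), by positivity, fun τ hτ => ?_⟩
  obtain ⟨t₀, c, R, D₀, ht₀, hc, hR, hD₀, hlin⟩ := IsFlow.linear_phase hβ hA hκ0
  set C := t₀ + 1 / (4 * β ^ 3) + N * τ + 1 with hC
  set M := Real.exp (4 * (N * τ)) * (2 / β ^ 2 + 12 * (N * τ) + (1 + (8 / β ^ 2 + 8)) + 9) + 3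
    + Real.exp (8 * (N * τ)) * (Real.exp 2 * R + 2 / β ^ 5 + 2 / β ^ 5) with hM
  have hC0 : 1 ≤ C := by
    have : 0 ≤ t₀ + 1 / (4 * β ^ 3) + N * τ := by positivity
    linarith
  refine ⟨C, M, D₀ + 3 + 256 / β ^ 4 / c, hC0, by positivity, ?_, ?_⟩
  · have : 0 < 256 / β ^ 4 / c := by positivity
    linarith
  intro d l v i₀ μ w D h hl hmax hl1 hv hμ hβl hβv hD hs0 hX hw hρ
  have hDc : 0 < 256 / β ^ 4 / c := by positivity
  have hD3 : 3 ≤ D := by linarith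
  have hD2 : 256 / β ^ 4 < c * D := by
    have : 256 / β ^ 4 / c < D := by linarith
    rw [div_lt_iff₀ hc] at this; linarith
  have hlog : 1 ≤ Real.log D := by
    rw [Real.le_log_iff_exp_le (by linarith)]
    linarith [Real.exp_one_lt_d9]
  have hl1' : ∀ i, l i ≤ 1 := fun i => (hmax i).trans hl1
  obtain ⟨z, hzc, hzμ, hzκ, hzR, hs3⟩ := hlin d l v i₀ μ w D h hl hmax hl1 hv hμ hβl hβv
    (by linarith) hs0 hX hw
  -- choose the sign of the target so that the initial alignment is positive
  obtain ⟨v', hv', h', hv1, hμ', hβv', z', hz'0, hzc', hzμ', hzκ', hzR', hρ'⟩ :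
      ∃ v' : Fin d → ℝ, (v' = v ∨ v' = fun i => -v i) ∧ IsFlow l v' w ∧ ∑ i, l i * v' i ^ 2 = 1 ∧
        IsTop l v' i₀ μ ∧ β ≤ v' i₀ ^ 2 ∧ ∃ z' : ℝ, 0 < z' ∧ c ≤ D * z' ^ 2 ∧ z' ≤ μ - 4 * l i₀ ∧
        ∑ i, l i * (w t₀ i - z' * topVec l v' μ i) ^ 2 ≤ κ ^ 2 * z' ^ 2 ∧
        ∑ i, (w t₀ i - z' * topVec l v' μ i) ^ 2 ≤ R ∧ ∑ i with l i * τ ≤ 1, l i * v' i ^ 2 ≤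
          β ^ 4 / 81 / 400 / (100 * M₁ ^ 2 + 16) := by
    rcases lt_trichotomy z 0 with hz | hz | hz
    · refine ⟨fun i => -v i, Or.inr rfl, h.neg_target, by simpa using hv, hμ.neg, by simpa using hβv,
        -z, by linarith, by simpa using hzc, (neg_le_abs z).trans hzμ, ?_, ?_, by simpa using hρ⟩
      · simpa [topVec_neg] using hzκ
      · simpa [topVec_neg] using hzR
    · rw [hz] at hzc; norm_num at hzc; linarith
    · exact ⟨v, Or.inl rfl, h, hv, hμ, hβv, z, hz, hzc, (le_abs_self z).trans hzμ, hzκ, hzR, hρ⟩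
  obtain ⟨t₁, ht₁, ht₁D, hst₁, hut₁, hu2t₁, q₁, n₁, hw₁, hq₁n, hq₁M, hq₁l, hn₁Q, hn₁⟩ :=
    (h'.shift ht₀).escape hl hmax hl1 hv1 hμ' hβ hβl hβv' hκ0.le hκβ hz'0 hzμ' hzc' (by linarith)
      hD2 (by simpa using hzκ') (by simpa using hzR') (by simpa using hs3)
  obtain ⟨hL₂, hu₂, q₂, n₂, hw₂, hq₂n, hq₂, hn₂⟩ := ((h'.shift ht₀).shift ht₁).descend hl hl1' hv1
    (r := n₁) (q₀ := q₁) hβ hβ1 hN hM₁ hτ (by simpa using hst₁) (by simpa using hut₁)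
    (by simpa using hu2t₁) (by simpa using hw₁) hq₁n hq₁M hn₁Q hρ'
    (by rw [mul_div_cancel₀ _ (by positivity)]) hκN
  have hNτ : 0 ≤ N * τ := by positivity
  obtain ⟨q₃, P, hq₃, hq₃0, hset⟩ := (((h'.shift ht₀).shift ht₁).shift hNτ).settle hl hv1
    (r := n₂) (q₀ := q₂) (by simpa using hL₂) (by simpa using hu₂) (by simpa using hw₂) hq₂n
  set T := C * Real.log D with hT
  set t₂ := T - (N * τ + t₁ + t₀) with ht₂
  have ht₂0 : 0 ≤ t₂ := by
    have e1 : t₁ ≤ 1 / (4 * β ^ 3) * Real.log D := ht₁D.trans (le_of_eq (by ring))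
    have e2 : t₀ + N * τ ≤ (t₀ + N * τ) * Real.log D := le_mul_of_one_le_right (by positivity) hlog
    have e3 : T = (t₀ + N * τ) * Real.log D + 1 / (4 * β ^ 3) * Real.log D + Real.log D := by
      rw [hT, hC]; ring
    linarith
  have hTe : t₂ + N * τ + t₁ + t₀ = T := by rw [ht₂]; ring
  have hTl : T - t₂ = N * τ + t₁ + t₀ := by rw [ht₂]; ring
  have hT1 : 1 ≤ T := one_le_mul_of_one_le_of_one_le hC0 hlog
  obtain ⟨hP, hq₃b⟩ := hset t₂ ht₂0
  have hanti := ((((h'.shift ht₀).shift ht₁).shift hNτ).statL_anti le_rfl ht₂0)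
  have hpos := ((((h'.shift ht₀).shift ht₁).shift hNτ).statU_pos (by simpa using lt_of_le_of_lt hL₂ (by norm_num))
    (by simpa using hu₂) ht₂0)
  have heq := hq₃.eq t₂ ht₂0
  simp only [hTe, zero_add] at hanti hpos heq
  have hE0 := Real.exp_pos (4 * (N * τ))
  have hE1 : 1 ≤ Real.exp (4 * (N * τ)) := Real.one_le_exp (by positivity)
  have hM8 : 0 ≤ Real.exp (8 * (N * τ)) * (Real.exp 2 * R + 2 / β ^ 5 + 2 / β ^ 5) := by positivity
  have hb2 : 0 < 2 / β ^ 2 := by positivity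
  have hb8 : 0 < 8 / β ^ 2 := by positivity
  have hq₂M : ∀ i, q₂ i ≤ Real.exp (4 * (N * τ)) * (2 / β ^ 2 + 12 * (N * τ)) := fun i => by
    refine (hq₂ i).trans ?_
    have := hq₁M i
    have := hl1' i
    have : l i * 12 * (N * τ) ≤ 1 * 12 * (N * τ) := by gcongr
    gcongr; linarith
  refine ⟨v', hv', hanti.trans (by simpa using hL₂), hpos, fun i => q₃ t₂ i,
    fun i => Real.exp (l i * P t₂) * n₂ i, heq, fun i => (hq₃b i).1, fun i => ?_, fun i => ?_, ?_⟩
  · refine (hq₃b i).2.1.trans (max_le ((hq₂M i).trans ?_) ?_)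
    · have : 0 ≤ Real.exp (4 * (N * τ)) * ((1 + (8 / β ^ 2 + 8)) + 9) := by positivity
      rw [hM]; linarith
    · have : 0 ≤ Real.exp (4 * (N * τ)) * (2 / β ^ 2 + 12 * (N * τ) + (1 + (8 / β ^ 2 + 8)) + 9) := by
        positivity
      rw [hM]; linarith
  · have b0 := hl i
    have e1 : t₁ ≤ T := by linarith
    have e2 : t₂ ≤ T := by linarith
    have f1 : q₂ i ≤ Real.exp (4 * (N * τ)) * (l i * ((1 + (8 / β ^ 2 + 8)) * T) + l i * (12 * (N * τ)) * T) := by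
      refine (hq₂ i).trans (mul_le_mul_of_nonneg_left (add_le_add ((hq₁l i).trans ?_) ?_) hE0.le)
      · refine mul_le_mul_of_nonneg_left ?_ b0.le
        have := mul_le_mul_of_nonneg_left e1 (by linarith : 0 ≤ 8 / β ^ 2 + 8)
        rw [add_mul]; linarith
      · rw [mul_assoc (l i)]
        exact le_mul_of_one_le_right (by positivity) hT1
    have f2 : 9 * l i * t₂ ≤ Real.exp (4 * (N * τ)) * (9 * l i * T) := by
      have : 9 * l i * t₂ ≤ 9 * l i * T := by gcongr
      exact this.trans (le_mul_of_one_le_left (by positivity) hE1)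
    have f3 : Real.exp (4 * (N * τ)) * (12 * (N * τ) + (1 + (8 / β ^ 2 + 8)) + 9) ≤ M := by
      have : 0 ≤ Real.exp (4 * (N * τ)) * (2 / β ^ 2) := by positivity
      rw [hM]; linarith
    have f4 : 0 ≤ l i * T := by positivity
    have f5 := mul_le_mul_of_nonneg_right f3 f4
    have := (hq₃b i).2.2
    linarith
  · have e : ∑ i, (Real.exp (l i * P t₂) * n₂ i) ^ 2 ≤ ∑ i, n₂ i ^ 2 :=
      Finset.sum_le_sum fun i _ => by
        rw [mul_pow]
        have : Real.exp (l i * P t₂) ≤ 1 := Real.exp_le_one_iff.2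
          (mul_nonpos_of_nonneg_of_nonpos (hl i).le (by linarith))
        exact mul_le_of_le_one_left (sq_nonneg _) (pow_le_one₀ (Real.exp_pos _).le this)
    have e2 : Real.exp (8 * (N * τ)) * ∑ i, n₁ i ^ 2 ≤
        Real.exp (8 * (N * τ)) * (Real.exp 2 * R + 2 / β ^ 5 + 2 / β ^ 5) := by gcongr
    have : 0 ≤ Real.exp (4 * (N * τ)) * (2 / β ^ 2 + 12 * (N * τ) + (1 + (8 / β ^ 2 + 8)) + 9) := by
      positivity
    rw [hM]; linarith

end PhaseRetrieval

namespace PhaseRetrieval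

open MeasureTheory ProbabilityTheory Set Matrix

/-! ### The flow inside the basin of the target -/

section Basin

variable {d : ℕ} {l v : Fin d → ℝ} {w q : ℝ → Fin d → ℝ} {P : ℝ → ℝ} {n : Fin d → ℝ} {M T : ℝ}

/-- A flow started in the basin of `v`, split as `w_i = q_i v_i + e^{λ_i P} n_i` with `0 ≤ q ≤ M`.
The bound `q_i ≤ M λ_i (T + t)` says that a mode is learned only after time of order `1 / λ_i`,
where `T` is the time spent before entering the basin. -/
structure IsSettled (l v : Fin d → ℝ) (w q : ℝ → Fin d → ℝ) (P : ℝ → ℝ) (n : Fin d → ℝ)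
    (M T : ℝ) : Prop where
  flow : IsFlow l v w
  split : IsSplit l v w q P n
  pos : ∀ i, 0 < l i
  le_one : ∀ i, l i ≤ 1
  norm : ∑ i, l i * v i ^ 2 = 1
  statL_le : statL l v (w 0) ≤ 1 / 100
  statU_pos : 0 < statU l v (w 0)
  q_nonneg : ∀ t, 0 ≤ t → ∀ i, 0 ≤ q t i
  q_le : ∀ t, 0 ≤ t → ∀ i, q t i ≤ M
  q_le_mul : ∀ t, 0 ≤ t → ∀ i, q t i ≤ M * l i * (T + t)
  P_le : ∀ t, 0 ≤ t → P t ≤ -4 * t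
  n_le : ∑ i, n i ^ 2 ≤ M
  one_le : 1 ≤ M

lemma IsFlow.isSettled (h : IsFlow l v w) (hl : ∀ i, 0 < l i) (hl1 : ∀ i, l i ≤ 1)
    (hv : ∑ i, l i * v i ^ 2 = 1) (hL : statL l v (w 0) ≤ 1 / 100) (hu : 0 < statU l v (w 0))
    {q₀ : Fin d → ℝ} (h0 : ∀ i, w 0 i = q₀ i * v i + n i) (hq₀ : ∀ i, 0 ≤ q₀ i)
    (hqM : ∀ i, q₀ i ≤ M) (hqT : ∀ i, q₀ i ≤ M * l i * T) (hn : ∑ i, n i ^ 2 ≤ M) (hM : 9 ≤ M) :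
    ∃ q P, IsSettled l v w q P n M T := by
  obtain ⟨q, P, hq, -, hset⟩ := h.settle hl hv hL hu h0 hq₀
  refine ⟨q, P, h, hq, hl, hl1, hv, hL, hu, fun t ht i => ((hset t ht).2 i).1, fun t ht i =>
    ((hset t ht).2 i).2.1.trans (max_le (hqM i) (by linarith)), fun t ht i =>
    ((hset t ht).2 i).2.2.trans ?_, fun t ht => (hset t ht).1, hn, by linarith⟩
  have : 9 * l i * t ≤ M * l i * t := by have := hl i; gcongr
  have := hqT i
  linarith

namespace IsSettled

lemma M_pos (h : IsSettled l v w q P n M T) : 0 < M := by linarith [h.one_le]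

lemma statL_le_of_nonneg (h : IsSettled l v w q P n M T) {t : ℝ} (ht : 0 ≤ t) :
    statL l v (w t) ≤ 1 / 100 :=
  (h.flow.statL_anti le_rfl ht).trans h.statL_le

lemma abs_one_sub_statS (h : IsSettled l v w q P n M T) {t : ℝ} (ht : 0 ≤ t) :
    |1 - statS l (w t)| ≤ 3 / 50 :=
  abs_one_sub_statS_le h.pos h.norm (h.statL_le_of_nonneg ht)

lemma statU_pos_of_nonneg (h : IsSettled l v w q P n M T) {t : ℝ} (ht : 0 ≤ t) :
    0 < statU l v (w t) :=
  h.flow.statU_pos (by linarith [h.statL_le]) h.statU_pos ht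

lemma statU_sq_gap (h : IsSettled l v w q P n M T) {t : ℝ} (ht : 0 ≤ t) :
    4 * (statS l (w t) - statU l v (w t) ^ 2) ≤ 1 / 100 := by
  have := h.statL_le_of_nonneg ht
  unfold statL at this
  nlinarith [sq_nonneg (1 - statS l (w t))]

lemma statU_ge (h : IsSettled l v w q P n M T) {t : ℝ} (ht : 0 ≤ t) :
    24 / 25 ≤ statU l v (w t) := by
  have h1 := h.statU_sq_gap ht
  have h2 := (abs_le.1 (h.abs_one_sub_statS ht)).2
  have h3 := h.statU_pos_of_nonneg ht
  nlinarith

lemma err_le (h : IsSettled l v w q P n M T) {t : ℝ} (ht : 0 ≤ t) :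
    statS l (w t) - 2 * statU l v (w t) + 1 ≤ statL l v (w t) := by
  have h1 := h.statU_sq_gap ht
  have h3 := h.statU_ge ht
  have h4 := statU_sq_le h.pos h.norm (w t)
  unfold statL
  set s := statS l (w t)
  set u := statU l v (w t)
  -- `(1 - u)² ≤ (1 - u²)² ≤ 2 (1 - s)² + 2 (s - u²)²`
  have a1 : (1 - u) ^ 2 ≤ (1 - u ^ 2) ^ 2 := by
    have : (1 - u ^ 2) ^ 2 = (1 - u) ^ 2 * (1 + u) ^ 2 := by ring
    rw [this]; apply le_mul_of_one_le_right (sq_nonneg _); nlinarith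
  have a2 : (1 - u ^ 2) ^ 2 ≤ 2 * (1 - s) ^ 2 + 2 * (s - u ^ 2) ^ 2 := by
    nlinarith [sq_nonneg ((1 - s) - (s - u ^ 2))]
  nlinarith [sq_nonneg (1 - s)]

lemma err_nonneg (h : IsSettled l v w q P n M T) (t : ℝ) :
    0 ≤ statS l (w t) - 2 * statU l v (w t) + 1 := by
  have h4 := statU_sq_le h.pos h.norm (w t)
  nlinarith [sq_nonneg (1 - statU l v (w t))]

lemma sum_err (h : IsSettled l v w q P n M T) (t : ℝ) :
    ∑ i, l i * (w t i - v i) ^ 2 = statS l (w t) - 2 * statU l v (w t) + 1 := by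
  rw [← h.norm]; unfold statS statU
  rw [Finset.mul_sum, ← Finset.sum_sub_distrib, ← Finset.sum_add_distrib]
  exact Finset.sum_congr rfl fun i _ => by ring

lemma exp_sq_le (h : IsSettled l v w q P n M T) {t : ℝ} (ht : 0 ≤ t) (i : Fin d) :
    Real.exp (l i * P t) ≤ Real.exp (-(4 * l i * t)) := by
  apply Real.exp_le_exp.2
  have := mul_le_mul_of_nonneg_left (h.P_le t ht) (h.pos i).le
  linarith

lemma exp_le_one (h : IsSettled l v w q P n M T) {t : ℝ} (ht : 0 ≤ t) (i : Fin d) :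
    Real.exp (l i * P t) ≤ 1 :=
  (h.exp_sq_le ht i).trans (Real.exp_le_one_iff.2 (by have := h.pos i; have : 0 ≤ 4 * l i * t := by positivity
                                                      linarith))

lemma sq_le (h : IsSettled l v w q P n M T) {t : ℝ} (ht : 0 ≤ t) (i : Fin d) :
    w t i ^ 2 ≤ 2 * (M ^ 2 * v i ^ 2) + 2 * n i ^ 2 := by
  have c1 : q t i ^ 2 ≤ M ^ 2 := pow_le_pow_left₀ (h.q_nonneg t ht i) (h.q_le t ht i) 2
  have c2 := mul_le_mul_of_nonneg_right c1 (sq_nonneg (v i))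
  have c3 : Real.exp (l i * P t) ^ 2 ≤ 1 := pow_le_one₀ (Real.exp_pos _).le (h.exp_le_one ht i)
  have c4 := mul_le_mul_of_nonneg_right c3 (sq_nonneg (n i))
  rw [h.split.eq t ht]
  nlinarith [sq_nonneg (q t i * v i - Real.exp (l i * P t) * n i)]

end IsSettled

lemma min_one_pos_le {x : ℝ} (hx : 0 ≤ x) : 0 ≤ min 1 x := le_min zero_le_one hx

/-- Spectral decay of the loss: power-law learning. -/
lemma IsSettled.statL_decay (h : IsSettled l v w q P n M T) {α B : ℝ} (hα0 : 0 < α) (hα1 : α < 1)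
    (hB0 : 0 ≤ B) (hB : ∀ τ, 1 ≤ τ → ∑ i, min 1 (l i * τ) * v i ^ 2 ≤ B * τ ^ (1 - α)) {t : ℝ}
    (ht : 1 ≤ t) :
    statL l v (w t) ≤ (8 * ((100 * M ^ 2 + 16) * B + 100 * M) + 1) * t ^ (-α) := by
  have hM := h.M_pos
  set C₁ := (100 * M ^ 2 + 16) * B + 100 * M with hC₁
  have hC₁0 : 0 ≤ C₁ := by positivity
  have htail : ∀ t, 1 ≤ t → ∑ i with l i * t ≤ 1,
      l i * ((3 * statS l (w t) - 1) * w t i - 2 * statU l v (w t) * v i) ^ 2 ≤ C₁ * t ^ (-α) := by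
    intro t ht
    have ht0 : 0 < t := by linarith
    have hterm : ∀ i ∈ Finset.univ.filter fun i => l i * t ≤ 1,
        l i * ((3 * statS l (w t) - 1) * w t i - 2 * statU l v (w t) * v i) ^ 2 ≤
        ((100 * M ^ 2 + 16) * (min 1 (l i * t) * v i ^ 2) + 100 * n i ^ 2) / t := by
      intro i hi
      have hi' : l i * t ≤ 1 := by simpa using hi
      have b0 := h.pos i
      have b1 := (abs_le.1 (h.abs_one_sub_statS ht0.le)).1
      have b4 := residual_sq_le (x := w t i) (y := v i) (statS_nonneg h.pos (w t)) (by linarith)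
        (statU_sq_le h.pos h.norm (w t))
      have b5 := h.sq_le ht0.le i
      rw [min_eq_right hi', le_div_iff₀ ht0]
      have b6 : l i * t * ((3 * statS l (w t) - 1) * w t i - 2 * statU l v (w t) * v i) ^ 2 ≤
          l i * t * ((100 * M ^ 2 + 16) * v i ^ 2 + 100 * n i ^ 2) := by
        refine mul_le_mul_of_nonneg_left ?_ (by positivity); linarith
      have b7 : l i * t * (100 * n i ^ 2) ≤ 100 * n i ^ 2 := mul_le_of_le_one_left (by positivity) hi'
      linarith
    refine (Finset.sum_le_sum hterm).trans ((Finset.sum_le_sum_of_subset_of_nonneg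
      (Finset.filter_subset _ _) fun i _ _ => ?_).trans ?_)
    · have := min_one_pos_le (mul_nonneg (h.pos i).le ht0.le); positivity
    rw [← Finset.sum_div, Finset.sum_add_distrib, ← Finset.mul_sum, ← Finset.mul_sum,
      div_le_iff₀ ht0]
    have e1 : t ^ (-α) * t = t ^ (1 - α) := by
      rw [← Real.rpow_add_one ht0.ne']; ring_nf
    have e2 : 1 ≤ t ^ (1 - α) := Real.one_le_rpow ht (by linarith)
    have e3 := mul_le_mul_of_nonneg_left (hB t ht) (by positivity : 0 ≤ 100 * M ^ 2 + 16)
    have e4 := h.n_le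
    rw [mul_assoc, e1, hC₁]
    nlinarith
  have hd : ∀ x : ℝ, 1 ≤ x → HasDerivAt (fun x : ℝ => (8 * C₁ + 1) * x ^ (-α))
      ((8 * C₁ + 1) * (-α * x ^ (-α - 1))) x := fun x hx =>
    (Real.hasDerivAt_rpow_const (Or.inl (by linarith : x ≠ 0))).const_mul _
  refine image_le_of_deriv_right_lt_deriv_boundary' (a := 1) (b := t)
    (f := fun x => statL l v (w x)) (f' := fun x => -16 * gradSq l v (w x))
    (B := fun x : ℝ => (8 * C₁ + 1) * x ^ (-α)) (B' := fun x : ℝ => (8 * C₁ + 1) * (-α * x ^ (-α - 1)))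
    h.flow.continuous_statL.continuousOn
    (fun x hx => (h.flow.hasDerivAt_statL (by linarith [hx.1])).hasDerivWithinAt) ?_
    (fun x hx => (hd x hx.1).continuousAt.continuousWithinAt)
    (fun x hx => (hd x hx.1).hasDerivWithinAt) ?_ (right_mem_Icc.2 ht)
  · have := h.statL_le_of_nonneg zero_le_one
    rw [Real.one_rpow]; linarith
  · intro x hx heq
    have hx0 : 0 < x := by linarith [hx.1]
    have a1 := gradSq_ge h.pos (v := v) (w x) hx0
    have a2 := residual_ge h.pos h.norm (w := w x) (c := 1 / 4) (by norm_num) le_rfl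
      (by have := h.statU_ge hx0.le; nlinarith) (by have := h.statL_le_of_nonneg hx0.le; linarith)
    have a3 := htail x hx.1
    have e1 : x ^ (-α - 1) = x ^ (-α) / x := Real.rpow_sub_one hx0.ne' _
    have e0 : 0 < x ^ (-α) := Real.rpow_pos_of_pos hx0 _
    have a4 : (1 / 4 * ((8 * C₁ + 1) * x ^ (-α)) - C₁ * x ^ (-α)) / x ≤ gradSq l v (w x) := by
      refine le_trans ?_ a1
      rw [← heq]; gcongr
    rw [e1]
    have a5 : (1 / 4 * ((8 * C₁ + 1) * x ^ (-α)) - C₁ * x ^ (-α)) / x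
        = (C₁ + 1 / 4) * (x ^ (-α) / x) := by ring
    rw [a5] at a4
    set y := x ^ (-α) / x with hy
    have hy0 : 0 < y := by positivity
    nlinarith [mul_pos (by linarith : 0 < 8 * C₁ + 1) hy0]

/-- The loss is convex along the flow in the basin, so the gradient norm decreases. -/
lemma IsSettled.gradSq_anti (h : IsSettled l v w q P n M T) {r t : ℝ} (hr : 0 ≤ r) (hrt : r ≤ t) :
    gradSq l v (w t) ≤ gradSq l v (w r) := by
  let b : ℝ → Fin d → ℝ := fun t i => (3 * statS l (w t) - 1) * w t i - 2 * statU l v (w t) * v i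
  let m : ℝ → ℝ := fun t => ∑ i, l i ^ 2 * w t i * b t i
  let k : ℝ → ℝ := fun t => ∑ i, l i ^ 2 * v i * b t i
  have hw : ∀ t, 0 ≤ t → ∀ i, HasDerivAt (fun t => w t i) (-4 * l i * b t i) t := fun t ht i =>
    (h.flow.deriv t ht i).congr_deriv (by simp only [b]; ring)
  have hs : ∀ t, 0 ≤ t → HasDerivAt (fun t => statS l (w t)) (-8 * m t) t := fun t ht => by
    have := HasDerivAt.fun_sum (u := Finset.univ) fun i _ => ((hw t ht i).pow 2).const_mul (l i)
    refine this.congr_deriv ?_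
    simp only [m]; rw [Finset.mul_sum]
    exact Finset.sum_congr rfl fun i _ => by push_cast; ring
  have hu : ∀ t, 0 ≤ t → HasDerivAt (fun t => statU l v (w t)) (-4 * k t) t := fun t ht => by
    have := HasDerivAt.fun_sum (u := Finset.univ) fun i _ =>
      ((hw t ht i).const_mul (l i)).mul_const (v i)
    refine this.congr_deriv ?_
    simp only [k]; rw [Finset.mul_sum]
    exact Finset.sum_congr rfl fun i _ => by ring
  have hb : ∀ t, 0 ≤ t → ∀ i, HasDerivAt (fun t => b t i) (3 * (-8 * m t) * w t i
      + (3 * statS l (w t) - 1) * (-4 * l i * b t i) - 2 * (-4 * k t) * v i) t := fun t ht i =>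
    (((((hs t ht).const_mul 3).sub_const 1).mul (hw t ht i)).sub
      (((hu t ht).const_mul 2).mul_const (v i)))
  have hG : ∀ t, 0 ≤ t → HasDerivAt (fun t => gradSq l v (w t)) (2 * (-24 * m t ^ 2 + 8 * k t ^ 2
      - 4 * (3 * statS l (w t) - 1) * ∑ i, l i ^ 3 * b t i ^ 2)) t := fun t ht => by
    have := HasDerivAt.fun_sum (u := Finset.univ) fun i _ => ((hb t ht i).pow 2).const_mul (l i ^ 2)
    refine this.congr_deriv ?_
    have e : -24 * m t ^ 2 + 8 * k t ^ 2 - 4 * (3 * statS l (w t) - 1) * ∑ i, l i ^ 3 * b t i ^ 2 =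
        ∑ i, (-24 * m t * (l i ^ 2 * w t i * b t i) + 8 * k t * (l i ^ 2 * v i * b t i)
          - 4 * (3 * statS l (w t) - 1) * (l i ^ 3 * b t i ^ 2)) := by
      rw [Finset.sum_sub_distrib, Finset.sum_add_distrib, ← Finset.mul_sum, ← Finset.mul_sum,
        ← Finset.mul_sum]
      simp only [m, k]; ring
    rw [e]
    refine Eq.trans ?_ (Finset.mul_sum ..).symm
    exact Finset.sum_congr rfl fun i _ => by push_cast; ring
  have := le_add_mul_of_deriv_le (a := r) (b := t) 0
    (fun x hx => (hG x (hr.trans hx.1)).continuousAt.continuousWithinAt)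
    (fun x hx => hG x (hr.trans hx.1)) (fun x hx => ?_) (right_mem_Icc.2 hrt)
  · linarith
  have hx0 := hr.trans hx.1
  have h1 := (abs_le.1 (h.abs_one_sub_statS hx0)).2
  have h2 := h.err_le hx0
  have h3 := h.statL_le_of_nonneg hx0
  have h4 : (k x - m x) ^ 2 ≤ 1 / 100 * ∑ i, l i ^ 3 * b x i ^ 2 := by
    have e : m x - k x = ∑ i, l i * (w x i - v i) * (l i * b x i) := by
      simp only [m, k]; rw [← Finset.sum_sub_distrib]
      exact Finset.sum_congr rfl fun i _ => by ring
    have := weighted_sum_sq_le (fun i => (h.pos i).le) (fun i => w x i - v i) (fun i => l i * b x i)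
    rw [← e, h.sum_err] at this
    have e2 : ∑ i, l i * (l i * b x i) ^ 2 = ∑ i, l i ^ 3 * b x i ^ 2 :=
      Finset.sum_congr rfl fun i _ => by ring
    rw [e2] at this
    have hn : 0 ≤ ∑ i, l i ^ 3 * b x i ^ 2 := Finset.sum_nonneg fun i _ => by
      have := h.pos i; positivity
    nlinarith
  have h5 : 0 ≤ ∑ i, l i ^ 3 * b x i ^ 2 := Finset.sum_nonneg fun i _ => by
    have := h.pos i; positivity
  nlinarith [sq_nonneg (m x), sq_nonneg (k x - 2 * m x)]

lemma IsSettled.gradSq_decay (h : IsSettled l v w q P n M T) {α B' : ℝ} (hα0 : 0 < α) (hα1 : α < 1)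
    (hB0 : 0 ≤ B') (hL : ∀ t, 1 ≤ t → statL l v (w t) ≤ B' * t ^ (-α)) {t : ℝ} (ht : 2 ≤ t) :
    gradSq l v (w t) ≤ B' * t ^ (-α - 1) := by
  have h1 := le_add_mul_of_deriv_le (a := t / 2) (b := t) (-16 * gradSq l v (w t))
    h.flow.continuous_statL.continuousOn
    (fun x hx => h.flow.hasDerivAt_statL (by linarith [hx.1])) (fun x hx => by
      have := h.gradSq_anti (r := x) (t := t) (by linarith [hx.1]) hx.2.le
      linarith) (right_mem_Icc.2 (by linarith))
  have h2 := hL (t / 2) (by linarith)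
  have h3 := statL_nonneg h.pos h.norm (w t)
  have h4 : (t / 2) ^ (-α) ≤ 2 * t ^ (-α) := by
    rw [div_eq_mul_inv, Real.mul_rpow (by linarith) (by norm_num), Real.inv_rpow (by norm_num),
      ← Real.rpow_neg (by norm_num), neg_neg, mul_comm]
    gcongr
    calc (2 : ℝ) ^ α ≤ 2 ^ (1 : ℝ) := Real.rpow_le_rpow_of_exponent_le (by norm_num) hα1.le
      _ = 2 := Real.rpow_one 2
  have h5 : B' * (t / 2) ^ (-α) ≤ B' * (2 * t ^ (-α)) := by gcongr
  rw [Real.rpow_sub_one (by linarith), ← mul_div_assoc, le_div_iff₀ (by linarith)]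
  have : 0 ≤ B' * t ^ (-α) := by positivity
  nlinarith

end Basin

end PhaseRetrieval

namespace PhaseRetrieval

open MeasureTheory ProbabilityTheory Set Matrix

/-! ### Simultaneous convergence of the summary statistics -/

section Basin

variable {d : ℕ} {l v : Fin d → ℝ} {w q : ℝ → Fin d → ℝ} {P : ℝ → ℝ} {n : Fin d → ℝ} {M T : ℝ}

lemma mul_exp_neg_le_min {x : ℝ} (hx : 0 ≤ x) : x * Real.exp (-x) ≤ min 1 x := by
  have h1 := Real.add_one_le_exp x
  have h2 := Real.exp_pos x
  rw [Real.exp_neg, ← div_eq_mul_inv, div_le_iff₀ h2]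
  rcases le_total 1 x with h | h
  · rw [min_eq_left h]; linarith
  · rw [min_eq_right h]; nlinarith

namespace IsSettled

/-- Once the loss is small, the multiples `q_i` cannot exceed `1` by much: the overshoot of the fast
modes has decayed and the slow modes have not been learned yet. -/
lemma q_le_one_add (h : IsSettled l v w q P n M T) {θ ρ x₀ X : ℝ} (hx₀ : 0 < x₀) (hT : T ≤ x₀)
    (hθ0 : 0 ≤ θ) (hθ1 : θ ≤ 1) (hL : ∀ t, x₀ ≤ t → statL l v (w t) ≤ θ ^ 2)
    (hθρ : 40 * θ ≤ 7 * ρ) (hX : 4 * M ^ 2 * x₀ ≤ 7 * ρ * (X - x₀)) (hρ : 0 < ρ) (i : Fin d) :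
    q X i ≤ 1 + ρ := by
  have hM := h.M_pos
  have hXx : 0 < X - x₀ := by
    have : 0 < 4 * M ^ 2 * x₀ := by positivity
    by_contra! hneg
    nlinarith
  -- `c e^{-7 λ_i (t - x₀)}` is a barrier for `q_i - 1 - ρ / 2` on `[x₀, X]`
  set c := max (q x₀ i - 1 - ρ / 2) 0 with hc
  have hli := h.pos i
  have hE : ∀ t, HasDerivAt (fun t => c * Real.exp (-(7 * l i) * (t - x₀)))
      (-(7 * l i) * (c * Real.exp (-(7 * l i) * (t - x₀)))) t := fun t => by
    have h1 : HasDerivAt (fun t => -(7 * l i) * (t - x₀)) (-(7 * l i)) t := by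
      simpa using ((hasDerivAt_id t).sub_const x₀).const_mul (-(7 * l i))
    exact (h1.exp.const_mul c).congr_deriv (by ring)
  have hmain := nonneg_of_deriv_ge (K := -(7 * l i)) (a := x₀) (b := X)
    (f := fun t => c * Real.exp (-(7 * l i) * (t - x₀)) - (q t i - 1 - ρ / 2))
    (fun t _ => ((hE t).sub ((((h.split.derivq t i).sub_const 1).sub_const
      (ρ / 2)))).continuousAt.continuousWithinAt)
    (fun t _ => (hE t).sub ((((h.split.derivq t i).sub_const 1).sub_const (ρ / 2))))
    (by simp only [sub_self, mul_zero, Real.exp_zero, mul_one]; linarith [le_max_left (q x₀ i - 1 - ρ / 2) 0])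
    (fun t ht hneg => by
      have ht0 : 0 ≤ t := hx₀.le.trans ht.1
      have a1 := statL_ge h.pos h.norm (w t)
      have a2 := hL t ht.1
      have a3 := h.err_le ht0
      have a4 := h.err_nonneg t
      have a5 : |1 - statS l (w t)| ≤ θ := abs_le_of_sq_le_sq (by nlinarith [sq_nonneg (1 - statS l (w t))]) hθ0
      have a6 := (abs_le.1 a5)
      have a7 := (abs_le.1 (h.abs_one_sub_statS ht0)).2
      have hc0 : 0 ≤ c * Real.exp (-(7 * l i) * (t - x₀)) := by
        have : 0 ≤ c := le_max_right _ _
        positivity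
      have a8 : 0 < q t i - 1 - ρ / 2 := by linarith
      have a9 : (4 - 12 * statS l (w t)) * q t i + 8 * statU l v (w t)
          ≤ -7 * (q t i - 1 - ρ / 2) := by
        have b1 : (4 - 12 * statS l (w t)) * (q t i - 1) ≤ -7 * (q t i - 1) := by nlinarith
        nlinarith
      have := mul_le_mul_of_nonneg_left a9 hli.le
      nlinarith) X (right_mem_Icc.2 (by linarith))
  have hfin : c * Real.exp (-(7 * l i) * (X - x₀)) ≤ ρ / 2 := by
    rcases le_total (l i * (M * (T + x₀))) 1 with hs | hs
    · have h1 := h.q_le_mul x₀ hx₀.le i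
      have : c = 0 := max_eq_right (by nlinarith)
      rw [this, zero_mul]; positivity
    · have h1 : c ≤ M := max_le (by have := h.q_le x₀ hx₀.le i; linarith) hM.le
      have h2 : 1 ≤ l i * (2 * M * x₀) := hs.trans (by
        have : M * (T + x₀) ≤ 2 * M * x₀ := by nlinarith
        gcongr)
      have h3 : Real.exp (-(7 * l i) * (X - x₀)) * (7 * l i * (X - x₀)) ≤ 1 := by
        have := mul_exp_neg_le_min (x := 7 * l i * (X - x₀)) (by positivity)
        have := this.trans (min_le_left _ _)
        rw [mul_comm, neg_mul]; exact this
      have h0 := Real.exp_pos (-(7 * l i) * (X - x₀))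
      set E := Real.exp (-(7 * l i) * (X - x₀))
      have h4 : E * (7 * (X - x₀)) ≤ 2 * M * x₀ := by
        calc E * (7 * (X - x₀)) ≤ E * (7 * (X - x₀)) * (l i * (2 * M * x₀)) :=
              le_mul_of_one_le_right (by positivity) h2
          _ = E * (7 * l i * (X - x₀)) * (2 * M * x₀) := by ring
          _ ≤ 1 * (2 * M * x₀) := by gcongr
          _ = _ := one_mul _
      have h5 : M * E * (7 * (X - x₀)) ≤ ρ / 2 * (7 * (X - x₀)) := by
        have := mul_le_mul_of_nonneg_left h4 hM.le
        nlinarith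
      calc c * E ≤ M * E := by gcongr
        _ ≤ ρ / 2 := le_of_mul_le_mul_right h5 (by positivity)
  linarith

lemma P_ge (h : IsSettled l v w q P n M T) {t : ℝ} (ht : 0 ≤ t) : -9 * t ≤ P t := by
  have := le_add_mul_of_deriv_le (a := 0) (b := t) (f := fun t => -P t) 9
    (fun x _ => (h.split.derivP x).neg.continuousAt.continuousWithinAt)
    (fun x _ => (h.split.derivP x).neg) (fun x hx => by
      have := (abs_le.1 (h.abs_one_sub_statS hx.1)).1; linarith) (right_mem_Icc.2 ht)
  rw [h.split.P_zero] at this; linarith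

/-- In the Euclidean inner product with `v` the eigenvalues cancel from the evolution. -/
lemma hasDerivAt_dot (h : IsFlow l v w) (hv : ∑ i, l i * v i ^ 2 = 1) {t : ℝ} (ht : 0 ≤ t) :
    HasDerivAt (fun t => ∑ i, v i * w t i) (12 * statU l v (w t) * (1 - statS l (w t))) t := by
  have := HasDerivAt.fun_sum (u := Finset.univ) fun i _ => (h.deriv t ht i).const_mul (v i)
  refine this.congr_deriv ?_
  have e : 12 * statU l v (w t) * (1 - statS l (w t)) =
      (4 - 12 * statS l (w t)) * statU l v (w t) + 8 * statU l v (w t) * ∑ i, l i * v i ^ 2 := by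
    rw [hv]; ring
  have e2 : (4 - 12 * statS l (w t)) * statU l v (w t) + 8 * statU l v (w t) * ∑ i, l i * v i ^ 2 =
      ∑ i, ((4 - 12 * statS l (w t)) * (l i * w t i * v i)
        + 8 * statU l v (w t) * (l i * v i ^ 2)) := by
    rw [Finset.sum_add_distrib, ← Finset.mul_sum, ← Finset.mul_sum]; rfl
  rw [e, e2]
  exact Finset.sum_congr rfl fun i _ => by ring

/-- The increment of `⟨v, w⟩` over a time window only sees the slow modes, so `1 - s` cannot stay
above `ε`. -/
lemma exists_statS_ge (h : IsSettled l v w q P n M T) {α B ε X : ℝ} (hα : α < 1) (hTX : T ≤ X)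
    (hX1 : 1 ≤ X) (hB : ∑ i, min 1 (l i * X) * v i ^ 2 ≤ B * X ^ (1 - α))
    (hε0 : 0 < ε) (hε : ((3 * M + 18) * B + 18 * M) * X ^ (1 - α) < 10 * ε * X) :
    ∃ x ∈ Icc X (2 * X), 1 - statS l (w x) ≤ ε := by
  by_contra! hcon
  have hX0 : 0 < X := by linarith
  have hM := h.M_pos
  have h1 := le_add_mul_of_deriv_le (a := X) (b := 2 * X) (f := fun t => -∑ i, v i * w t i) (-(10 * ε))
    (fun x hx => (hasDerivAt_dot h.flow h.norm (by linarith [hx.1])).neg.continuousAt.continuousWithinAt)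
    (fun x hx => (hasDerivAt_dot h.flow h.norm (by linarith [hx.1])).neg) (fun x hx => by
      have a1 := hcon x (Ico_subset_Icc_self hx)
      have a2 := h.statU_ge (by linarith [hx.1] : 0 ≤ x)
      have : 24 / 25 * ε ≤ statU l v (w x) * (1 - statS l (w x)) := by gcongr
      linarith) (right_mem_Icc.2 (by linarith))
  have h2 : ∑ i, v i * w (2 * X) i - ∑ i, v i * w X i ≤
      (3 * M + 18) * (B * X ^ (1 - α)) + 18 * M := by
    rw [← Finset.sum_sub_distrib]
    have hterm : ∀ i, v i * w (2 * X) i - v i * w X i ≤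
        (3 * M + 18) * (min 1 (l i * X) * v i ^ 2) + 18 * n i ^ 2 := fun i => by
      have hli := h.pos i
      have hmn := min_one_pos_le (mul_nonneg hli.le hX0.le)
      have b1 : q (2 * X) i ≤ 3 * M * min 1 (l i * X) := by
        rcases le_total 1 (l i * X) with hs | hs
        · rw [min_eq_left hs]; have := h.q_le (2 * X) (by linarith) i; linarith
        · rw [min_eq_right hs]
          refine (h.q_le_mul (2 * X) (by linarith) i).trans ?_
          have : M * l i * (T + 2 * X) ≤ M * l i * (3 * X) := by gcongr; linarith
          linarith
      have b2 := h.q_nonneg X hX0.le i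
      have b3 : |Real.exp (l i * P (2 * X)) - Real.exp (l i * P X)| ≤ 18 * min 1 (l i * X) := by
        have c1 := h.exp_le_one (t := 2 * X) (by linarith) i
        have c2 := h.exp_le_one hX0.le i
        have c3 := Real.exp_pos (l i * P (2 * X))
        have c4 := Real.exp_pos (l i * P X)
        have c5 := Real.add_one_le_exp (l i * P (2 * X))
        have c6 := Real.add_one_le_exp (l i * P X)
        have c7 := mul_le_mul_of_nonneg_left (h.P_ge (t := 2 * X) (by linarith)) hli.le
        have c8 := mul_le_mul_of_nonneg_left (h.P_ge hX0.le) hli.le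
        rw [abs_le]
        have : 0 < l i * X := by positivity
        rcases le_total 1 (l i * X) with hs | hs
        · rw [min_eq_left hs]; constructor <;> linarith
        · rw [min_eq_right hs]; constructor <;> linarith
      have b4 : v i * n i * (Real.exp (l i * P (2 * X)) - Real.exp (l i * P X)) ≤
          18 * min 1 (l i * X) * v i ^ 2 + 18 * n i ^ 2 := by
        have d1 : |v i * n i| ≤ v i ^ 2 + n i ^ 2 := by
          rw [abs_le]; constructor <;> nlinarith [sq_nonneg (v i + n i), sq_nonneg (v i - n i), sq_nonneg (v i), sq_nonneg (n i)]
        calc _ ≤ |v i * n i| * |Real.exp (l i * P (2 * X)) - Real.exp (l i * P X)| := by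
              rw [← abs_mul]; exact le_abs_self _
          _ ≤ (v i ^ 2 + n i ^ 2) * (18 * min 1 (l i * X)) := by gcongr
          _ = 18 * min 1 (l i * X) * v i ^ 2 + 18 * n i ^ 2 * min 1 (l i * X) := by ring
          _ ≤ _ := by
            have : 18 * n i ^ 2 * min 1 (l i * X) ≤ 18 * n i ^ 2 :=
              mul_le_of_le_one_right (by positivity) (min_le_left _ _)
            linarith
      have b5 := mul_le_mul_of_nonneg_right (by linarith : q (2 * X) i - q X i ≤ 3 * M * min 1 (l i * X))
        (sq_nonneg (v i))
      rw [h.split.eq _ (by linarith : 0 ≤ 2 * X), h.split.eq _ hX0.le]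
      linarith
    refine (Finset.sum_le_sum fun i _ => hterm i).trans ?_
    rw [Finset.sum_add_distrib, ← Finset.mul_sum, ← Finset.mul_sum]
    have := h.n_le
    gcongr
  have e2 : 1 ≤ X ^ (1 - α) := Real.one_le_rpow hX1 (by linarith)
  have e3 : 18 * M ≤ 18 * M * X ^ (1 - α) := le_mul_of_one_le_right (by positivity) e2
  linarith

set_option maxHeartbeats 800000 in
/-- If the fast modes do not overshoot, then the unlearned slow modes keep `s` from staying
above `1`. -/
lemma exists_statS_le (h : IsSettled l v w q P n M T) {α B ρ c X : ℝ} (hTX : T ≤ X)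
    (hX0 : 0 < X) (hB : ∑ i, min 1 (l i * X) * v i ^ 2 ≤ B * X ^ (1 - α))
    (hρ0 : 0 < ρ) (hρ1 : ρ ≤ 1) (hq : ∀ i, q X i ≤ 1 + ρ) (hc0 : 0 < c)
    (hc : c * X ^ (-α) ≤ ∑ i with l i * X ≤ 1 / (6 * M), l i * v i ^ 2) (hρB : 16 * ρ * B ≤ c)
    (hX : 8 * ((M ^ 2 / ρ + 1) * M) ≤ c * X ^ (1 - α)) :
    ∃ x ∈ Icc X (2 * X), statS l (w x) ≤ 1 := by
  by_contra! hcon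
  have hM := h.M_pos
  have h2X : (0 : ℝ) ≤ 2 * X := by linarith
  -- where `s ≥ 1`, the excess of `q_i` over `1` decays at rate at least `8 λ_i`
  have hqd : ∀ i, q (2 * X) i - 1 ≤ ρ * Real.exp (-(8 * l i * X)) := by
    intro i
    have hli := h.pos i
    have hE : ∀ t, HasDerivAt (fun t => ρ * Real.exp (-(8 * l i) * (t - X)))
        (-(8 * l i) * (ρ * Real.exp (-(8 * l i) * (t - X)))) t := fun t => by
      have h1 : HasDerivAt (fun t => -(8 * l i) * (t - X)) (-(8 * l i)) t := by
        simpa using ((hasDerivAt_id t).sub_const X).const_mul (-(8 * l i))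
      exact (h1.exp.const_mul ρ).congr_deriv (by ring)
    have := nonneg_of_deriv_ge (K := -(8 * l i)) (a := X) (b := 2 * X)
      (f := fun t => ρ * Real.exp (-(8 * l i) * (t - X)) - (q t i - 1))
      (fun t _ => ((hE t).sub ((h.split.derivq t i).sub_const 1)).continuousAt.continuousWithinAt)
      (fun t _ => (hE t).sub ((h.split.derivq t i).sub_const 1))
      (by simp only [sub_self, mul_zero, Real.exp_zero, mul_one]; linarith [hq i])
      (fun t ht hneg => by
        have ht0 : 0 ≤ t := hX0.le.trans ht.1
        have a1 := hcon t (Ico_subset_Icc_self ht)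
        have a2 := statU_sq_le h.pos h.norm (w t)
        have a3 : 2 * statU l v (w t) ≤ 1 + statS l (w t) := by
          nlinarith [sq_nonneg (statU l v (w t) - 1)]
        have a4 : 0 < ρ * Real.exp (-(8 * l i) * (t - X)) := by positivity
        have a5 : 0 < q t i - 1 := by linarith
        have a9 : (4 - 12 * statS l (w t)) * q t i + 8 * statU l v (w t) ≤ -8 * (q t i - 1) := by
          nlinarith
        have := mul_le_mul_of_nonneg_left a9 hli.le
        nlinarith) (2 * X) (right_mem_Icc.2 (by linarith))
    have e : -(8 * l i) * (2 * X - X) = -(8 * l i * X) := by ring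
    rw [e] at this
    linarith
  -- Modes that are still unlearned contribute a deficit to `s - 1`, of the order `X^{-α}` in total;
  -- the excess of the others is smaller.
  have hterm : ∀ i, l i * w (2 * X) i ^ 2 ≤ l i * v i ^ 2
      + (4 * ρ * (min 1 (l i * X) * v i ^ 2) + (M ^ 2 / ρ + 1) * n i ^ 2) / X
      - 3 / 4 * (if l i * X ≤ 1 / (6 * M) then l i * v i ^ 2 else 0) := by
    intro i
    have hli := h.pos i
    have hlX : 0 < l i * X := by positivity
    set g := Real.exp (-(l i * X)) with hg
    have hg0 : 0 < g := Real.exp_pos _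
    have hg1 : g ≤ 1 := Real.exp_le_one_iff.2 (by linarith)
    have hg2 : g ^ 2 = Real.exp (-(2 * (l i * X))) := by
      rw [hg, ← Real.exp_nat_mul]; push_cast; ring_nf
    have hg8 : Real.exp (-(8 * l i * X)) ≤ g := Real.exp_le_exp.2 (by nlinarith)
    have hlg : l i * g ≤ min 1 (l i * X) / X := by
      rw [le_div_iff₀ hX0]
      have := mul_exp_neg_le_min hlX.le
      linarith
    have hlg1 : l i * g ≤ 1 / X := hlg.trans (by gcongr; exact min_le_left _ _)
    set m := Real.exp (l i * P (2 * X)) * n i with hm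
    have hE : Real.exp (l i * P (2 * X)) ≤ g ^ 2 := by
      rw [hg2]
      refine (h.exp_sq_le h2X i).trans (Real.exp_le_exp.2 (by nlinarith))
    have hE0 := Real.exp_pos (l i * P (2 * X))
    have hm2 : m ^ 2 ≤ g ^ 4 * n i ^ 2 := by
      rw [hm, mul_pow]
      have : Real.exp (l i * P (2 * X)) ^ 2 ≤ (g ^ 2) ^ 2 := by gcongr
      rw [← pow_mul] at this
      gcongr
    have hq0 := h.q_nonneg (2 * X) h2X i
    have hqM := h.q_le (2 * X) h2X i
    -- the cross term, by the inequality of arithmetic and geometric means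
    have hcross : 2 * (q (2 * X) i * v i) * m ≤ g * (ρ * v i ^ 2 + M ^ 2 / ρ * n i ^ 2) := by
      have b1 : 2 * (q (2 * X) i * v i) * m ≤ ρ * g ^ 2 * v i ^ 2 + q (2 * X) i ^ 2 * m ^ 2 / (ρ * g ^ 2) := by
        have e : ρ * g ^ 2 * v i ^ 2 + q (2 * X) i ^ 2 * m ^ 2 / (ρ * g ^ 2) - 2 * (q (2 * X) i * v i) * m
            = (ρ * g ^ 2 * v i - q (2 * X) i * m) ^ 2 / (ρ * g ^ 2) := by
          field_simp; ring
        have : 0 ≤ (ρ * g ^ 2 * v i - q (2 * X) i * m) ^ 2 / (ρ * g ^ 2) := by positivity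
        linarith
      have b2 : q (2 * X) i ^ 2 * m ^ 2 / (ρ * g ^ 2) ≤ M ^ 2 * (g ^ 4 * n i ^ 2) / (ρ * g ^ 2) := by
        gcongr
      have b3 : M ^ 2 * (g ^ 4 * n i ^ 2) / (ρ * g ^ 2) = g ^ 2 * (M ^ 2 / ρ * n i ^ 2) := by
        field_simp
      have b4 : g ^ 2 * (ρ * v i ^ 2 + M ^ 2 / ρ * n i ^ 2) ≤ g * (ρ * v i ^ 2 + M ^ 2 / ρ * n i ^ 2) := by
        gcongr; nlinarith
      linarith
    have hm3 : m ^ 2 ≤ g * n i ^ 2 := hm2.trans (by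
      gcongr; calc g ^ 4 = g * g ^ 3 := by ring
        _ ≤ g * 1 := by gcongr; exact pow_le_one₀ hg0.le hg1
        _ = g := mul_one g)
    have hqq : l i * (q (2 * X) i ^ 2 * v i ^ 2) ≤ l i * v i ^ 2 + l i * g * (3 * ρ * v i ^ 2)
        - 3 / 4 * (if l i * X ≤ 1 / (6 * M) then l i * v i ^ 2 else 0) := by
      have hlv : 0 ≤ l i * v i ^ 2 := by positivity
      have hpos : 0 ≤ l i * g * (3 * ρ * v i ^ 2) := by positivity
      split_ifs with hs
      · have c1 : q (2 * X) i ≤ 1 / 2 := by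
          refine (h.q_le_mul (2 * X) h2X i).trans ?_
          have : M * l i * (T + 2 * X) ≤ M * l i * (3 * X) := by gcongr; linarith
          rw [le_div_iff₀ (by positivity)] at hs
          linarith
        have c2 : q (2 * X) i ^ 2 ≤ (1 / 2) ^ 2 := pow_le_pow_left₀ hq0 c1 2
        have c3 := mul_le_mul_of_nonneg_right c2 hlv
        linarith
      · have c1 : q (2 * X) i ≤ 1 + ρ * g := by
          have := hqd i
          have : ρ * Real.exp (-(8 * l i * X)) ≤ ρ * g := by gcongr
          linarith
        have c2 : q (2 * X) i ^ 2 ≤ 1 + 3 * (ρ * g) := by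
          have d1 : ρ * g ≤ 1 := mul_le_one₀ hρ1 hg0.le hg1
          have d2 : 0 < ρ * g := by positivity
          calc q (2 * X) i ^ 2 ≤ (1 + ρ * g) ^ 2 := by gcongr
            _ = 1 + (2 + ρ * g) * (ρ * g) := by ring
            _ ≤ 1 + 3 * (ρ * g) := by gcongr; linarith
        have c3 := mul_le_mul_of_nonneg_right c2 hlv
        linarith
    rw [h.split.eq _ h2X, ← hm]
    have f1 : l i * (2 * (q (2 * X) i * v i) * m + m ^ 2) ≤
        l i * g * (ρ * v i ^ 2 + (M ^ 2 / ρ + 1) * n i ^ 2) := by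
      rw [mul_assoc (l i) g]
      refine mul_le_mul_of_nonneg_left ?_ hli.le
      linarith
    have f2 : l i * g * (4 * ρ * v i ^ 2) ≤ min 1 (l i * X) / X * (4 * ρ * v i ^ 2) := by gcongr
    have f3 : l i * g * ((M ^ 2 / ρ + 1) * n i ^ 2) ≤ 1 / X * ((M ^ 2 / ρ + 1) * n i ^ 2) := by gcongr
    have f4 : (4 * ρ * (min 1 (l i * X) * v i ^ 2) + (M ^ 2 / ρ + 1) * n i ^ 2) / X =
        min 1 (l i * X) / X * (4 * ρ * v i ^ 2) + 1 / X * ((M ^ 2 / ρ + 1) * n i ^ 2) := by ring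
    rw [f4]
    linarith
  have hsum := Finset.sum_le_sum fun i (_ : i ∈ Finset.univ) => hterm i
  rw [Finset.sum_sub_distrib, Finset.sum_add_distrib, h.norm, ← Finset.sum_div,
    Finset.sum_add_distrib, ← Finset.mul_sum, ← Finset.mul_sum, ← Finset.mul_sum,
    ← Finset.sum_filter] at hsum
  change statS l (w (2 * X)) ≤ _ at hsum
  have hgt := hcon (2 * X) ⟨by linarith, le_rfl⟩
  have e0 : 0 < X ^ (-α) := Real.rpow_pos_of_pos hX0 _
  have e1 : X ^ (1 - α) = X ^ (-α) * X := by
    rw [← Real.rpow_add_one hX0.ne']; ring_nf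
  rw [e1] at hB hX
  have g1 : (4 * ρ * ∑ i, min 1 (l i * X) * v i ^ 2 + (M ^ 2 / ρ + 1) * ∑ i, n i ^ 2) / X ≤
      (c / 4 + c / 8) * X ^ (-α) := by
    rw [div_le_iff₀ hX0]
    have k1 : 4 * ρ * ∑ i, min 1 (l i * X) * v i ^ 2 ≤ 4 * ρ * (B * (X ^ (-α) * X)) := by gcongr
    have k2 : (M ^ 2 / ρ + 1) * ∑ i, n i ^ 2 ≤ (M ^ 2 / ρ + 1) * M := by
      have := h.n_le; gcongr
    have k3 : 16 * ρ * B * (X ^ (-α) * X) ≤ c * (X ^ (-α) * X) := by gcongr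
    linarith
  have : 0 < c * X ^ (-α) := by positivity
  linarith

/-- Both summary statistics converge simultaneously at some time in `[X, 2 X]`. -/
lemma exists_converged (h : IsSettled l v w q P n M T) {α B ρ c ε X : ℝ} (hα : α < 1) (hTX : T ≤ X)
    (hX1 : 1 ≤ X) (hB : ∑ i, min 1 (l i * X) * v i ^ 2 ≤ B * X ^ (1 - α))
    (hρ0 : 0 < ρ) (hρ1 : ρ ≤ 1) (hq : ∀ i, q X i ≤ 1 + ρ) (hc0 : 0 < c)
    (hc : c * X ^ (-α) ≤ ∑ i with l i * X ≤ 1 / (6 * M), l i * v i ^ 2) (hρB : 16 * ρ * B ≤ c)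
    (hX : 8 * ((M ^ 2 / ρ + 1) * M) ≤ c * X ^ (1 - α))
    (hε0 : 0 < ε) (hε : ((3 * M + 18) * B + 18 * M) * X ^ (1 - α) < 10 * ε * X)
    (hL : statL l v (w X) ≤ ε) :
    ∃ x ∈ Icc X (2 * X), statU l v (w x) ∈ Icc (1 - ε) 1 ∧ statS l (w x) ∈ Icc (1 - ε) 1 := by
  have hX0 : 0 < X := by linarith
  obtain ⟨x₁, hx₁, hs₁⟩ := h.exists_statS_ge hα hTX hX1 hB hε0 hε
  obtain ⟨x₂, hx₂, hs₂⟩ := h.exists_statS_le hTX hX0 hB hρ0 hρ1 hq hc0 hc hρB hX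
  obtain ⟨x, hx, hs⟩ : ∃ x ∈ Icc X (2 * X), 1 - statS l (w x) ∈ Icc 0 ε := by
    by_cases h1 : 0 ≤ 1 - statS l (w x₁)
    · exact ⟨x₁, hx₁, h1, hs₁⟩
    · push Not at h1
      have hc : ContinuousOn (fun t => 1 - statS l (w t)) (uIcc x₁ x₂) :=
        (continuous_const.sub h.flow.continuous_statS).continuousOn
      obtain ⟨x, hx, hx0⟩ := intermediate_value_uIcc hc
        (mem_uIcc.2 (Or.inl ⟨h1.le, by linarith⟩) : (0 : ℝ) ∈ uIcc _ _)
      refine ⟨x, ⟨?_, ?_⟩, ?_⟩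
      · exact (le_min hx₁.1 hx₂.1).trans hx.1
      · exact hx.2.trans (max_le hx₁.2 hx₂.2)
      · simp only at hx0; rw [hx0]; exact ⟨le_rfl, hε0.le⟩
  have hx0 : 0 ≤ x := hX0.le.trans hx.1
  have e1 := h.err_le hx0
  have e2 := h.err_nonneg x
  have e3 := h.flow.statL_anti hX0.le hx.1
  exact ⟨x, hx, ⟨by linarith [hs.2], by linarith [hs.1]⟩, by linarith [hs.2], by linarith [hs.1]⟩

end IsSettled

end Basin

end PhaseRetrieval

namespace PhaseRetrieval

open MeasureTheory ProbabilityTheory Set Matrix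

/-! ### Learning of a single mode -/

section Modes

variable {d : ℕ} {l v : Fin d → ℝ} {w q : ℝ → Fin d → ℝ} {P : ℝ → ℝ} {n : Fin d → ℝ} {M T : ℝ}

lemma sum_err_eq (hv : ∑ i, l i * v i ^ 2 = 1) (w : Fin d → ℝ) :
    ∑ i, l i * (w i - v i) ^ 2 = statS l w - 2 * statU l v w + 1 := by
  rw [← hv]; unfold statS statU
  rw [Finset.mul_sum, ← Finset.sum_sub_distrib, ← Finset.sum_add_distrib]
  exact Finset.sum_congr rfl fun i _ => by ring

lemma IsFlow.statS_le_two (h : IsFlow l v w) (hl : ∀ i, 0 < l i) (hv : ∑ i, l i * v i ^ 2 = 1)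
    (hs : statS l (w 0) ≤ 2 / 3) {t : ℝ} (ht : 0 ≤ t) : statS l (w t) ≤ 2 := by
  refine PhaseRetrieval.statS_le_two hl hv ((h.statL_anti le_rfl ht).trans ?_)
  have h0 := statS_nonneg hl (w 0)
  unfold statL
  nlinarith [sq_nonneg (statU l v (w 0))]

lemma IsFlow.abs_coord_le (h : IsFlow l v w) (hl : ∀ i, 0 < l i) (hv : ∑ i, l i * v i ^ 2 = 1)
    (hs : statS l (w 0) ≤ 2 / 3) {t : ℝ} (ht : 0 ≤ t) (i : Fin d) :
    |w t i| ≤ Real.exp (4 * l i * t) * (|w 0 i| + l i * (12 * |v i|) * t) := by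
  have := abs_le_of_linear_ode (hl i).le (F := 12 * |v i|) (by positivity) (a := 0) (b := t)
    (h.cont i).continuousOn
    (p := fun t => 4 - 12 * statS l (w t)) (f := fun t => 8 * statU l v (w t) * v i)
    (fun x hx => h.deriv x hx.1 i) (fun x _ => rfl)
    (fun x _ => by have := statS_nonneg hl (w x); linarith)
    (fun x hx => by
      have := statU_le_of_statS hl hv (c := 3 / 2) (by norm_num)
        ((h.statS_le_two hl hv hs hx.1).trans (by norm_num))
      rw [abs_mul, abs_mul, abs_of_pos (by norm_num : (0 : ℝ) < 8)]
      have := abs_nonneg (v i)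
      gcongr; linarith) (right_mem_Icc.2 ht)
  simpa using this

/-- A mode with `λ_i t ≪ 1` has not been learned at time `t`. -/
lemma IsFlow.sq_le_sq_err (h : IsFlow l v w) (hl : ∀ i, 0 < l i) (hv : ∑ i, l i * v i ^ 2 = 1)
    (hs : statS l (w 0) ≤ 2 / 3) {t : ℝ} (ht : 0 ≤ t) {i : Fin d} (h2 : l i * t ≤ 1 / 96) :
    1 / 4 * v i ^ 2 ≤ (w t i - v i) ^ 2 + 4 * w 0 i ^ 2 := by
  have hli := hl i
  have h1 := h.abs_coord_le hl hv hs ht i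
  have h3 : Real.exp (4 * l i * t) ≤ 2 := by
    have : Real.exp (4 * l i * t) ≤ Real.exp (Real.log 2) := Real.exp_le_exp.2 (by
      linarith [Real.log_two_gt_d9])
    rwa [Real.exp_log (by norm_num)] at this
  have h4 : |w t i| ≤ 2 * |w 0 i| + 1 / 4 * |v i| := by
    have e1 : l i * (12 * |v i|) * t ≤ 1 / 8 * |v i| := by
      have := mul_le_mul_of_nonneg_right h2 (by positivity : 0 ≤ 12 * |v i|)
      linarith
    calc _ ≤ _ := h1
      _ ≤ 2 * (|w 0 i| + 1 / 8 * |v i|) := by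
        have : 0 ≤ |w 0 i| + l i * (12 * |v i|) * t := by positivity
        gcongr
      _ = _ := by ring
  have h5 : 3 / 4 * |v i| ≤ |w t i - v i| + 2 * |w 0 i| := by
    have := abs_sub_abs_le_abs_sub (v i) (w t i)
    rw [abs_sub_comm] at this; linarith
  rw [← sq_abs (v i), ← sq_abs (w t i - v i), ← sq_abs (w 0 i)]
  have := abs_nonneg (v i)
  have e1 : (3 / 4 * |v i|) ^ 2 ≤ (|w t i - v i| + 2 * |w 0 i|) ^ 2 := by gcongr
  nlinarith [sq_nonneg (|w t i - v i| - 2 * |w 0 i|), sq_nonneg (|v i|)]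

/-- The unlearned modes bound the error from below. -/
lemma IsFlow.err_ge (h : IsFlow l v w) (hl : ∀ i, 0 < l i) (hv : ∑ i, l i * v i ^ 2 = 1)
    (hs : statS l (w 0) ≤ 2 / 3) (hw : ∑ i, w 0 i ^ 2 ≤ 1) {t t' : ℝ} (ht : 0 ≤ t) (htt : t ≤ t')
    (ht' : 0 < t') :
    1 / 4 * (∑ i with l i * t' ≤ 1 / 96, l i * v i ^ 2) - 1 / (24 * t') ≤
      ∑ i, l i * (w t i - v i) ^ 2 := by
  have hterm : ∀ i ∈ Finset.univ.filter fun i => l i * t' ≤ 1 / 96,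
      1 / 4 * (l i * v i ^ 2) - w 0 i ^ 2 / (24 * t') ≤ l i * (w t i - v i) ^ 2 := by
    intro i hi
    have hi' : l i * t' ≤ 1 / 96 := by simpa using hi
    have hli := hl i
    have h6 := h.sq_le_sq_err hl hv hs ht (i := i) (le_trans (by gcongr) hi')
    have h7 : l i * (4 * w 0 i ^ 2) ≤ w 0 i ^ 2 / (24 * t') := by
      rw [le_div_iff₀ (by positivity)]
      have := mul_le_mul_of_nonneg_right hi' (by positivity : 0 ≤ 96 * w 0 i ^ 2)
      linarith
    have h8 := mul_le_mul_of_nonneg_left h6 hli.le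
    linarith
  have h1 := Finset.sum_le_sum hterm
  rw [Finset.sum_sub_distrib, ← Finset.mul_sum, ← Finset.sum_div] at h1
  have h2 : ∑ i with l i * t' ≤ 1 / 96, w 0 i ^ 2 ≤ 1 :=
    (Finset.sum_le_sum_of_subset_of_nonneg (Finset.filter_subset _ _)
      fun i _ _ => sq_nonneg _).trans hw
  have h3 : (∑ i with l i * t' ≤ 1 / 96, w 0 i ^ 2) / (24 * t') ≤ 1 / (24 * t') := by gcongr
  have h4 : ∑ i with l i * t' ≤ 1 / 96, l i * (w t i - v i) ^ 2 ≤ ∑ i, l i * (w t i - v i) ^ 2 :=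
    Finset.sum_le_sum_of_subset_of_nonneg (Finset.filter_subset _ _)
      fun i _ _ => mul_nonneg (hl i).le (sq_nonneg _)
  linarith

/-- A mode whose time scale `1 / λ_i` is at least of the order of `X` is not fully learned at
time `X`. -/
lemma IsSettled.q_le_one_sub (h : IsSettled l v w q P n M T) {θ x₀ X : ℝ} (hx₀ : 0 < x₀)
    (hX : x₀ ≤ X) (hθ0 : 0 ≤ θ) (hθ1 : θ ≤ 1) (hL : ∀ t, x₀ ≤ t → statL l v (w t) ≤ θ ^ 2)
    {i : Fin d} (hi : M * l i * (T + x₀) ≤ 1 / 2) (hθ : 80 * θ ≤ 9 * Real.exp (-(9 * l i * X))) :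
    q X i ≤ 1 - Real.exp (-(9 * l i * X)) / 4 := by
  have hli := h.pos i
  -- the barrier `f` for `1 - q_i` starts from `1/2` at `x₀` and solves `f' = -λ_i (9 f + 20 θ)`
  set b := 1 / 2 + 20 / 9 * θ with hb
  have hE : ∀ t, HasDerivAt (fun t => b * Real.exp (-(9 * l i) * (t - x₀)) - 20 / 9 * θ)
      (-(9 * l i) * (b * Real.exp (-(9 * l i) * (t - x₀)))) t := fun t => by
    have h1 : HasDerivAt (fun t => -(9 * l i) * (t - x₀)) (-(9 * l i)) t := by
      simpa using ((hasDerivAt_id t).sub_const x₀).const_mul (-(9 * l i))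
    exact ((h1.exp.const_mul b).sub_const _).congr_deriv (by ring)
  have hmono : ∀ t ∈ Icc x₀ X, Real.exp (-(9 * l i * X)) ≤ Real.exp (-(9 * l i) * (t - x₀)) :=
    fun t ht => Real.exp_le_exp.2 (by nlinarith [ht.2])
  have hlow : ∀ t ∈ Icc x₀ X, Real.exp (-(9 * l i * X)) / 4 ≤
      b * Real.exp (-(9 * l i) * (t - x₀)) - 20 / 9 * θ := fun t ht => by
    have h1 := hmono t ht
    have h2 := Real.exp_pos (-(9 * l i) * (t - x₀))
    have : 1 / 2 * Real.exp (-(9 * l i) * (t - x₀)) ≤ b * Real.exp (-(9 * l i) * (t - x₀)) := by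
      gcongr; linarith
    linarith
  have hmain := nonneg_of_deriv_ge (K := 0) (a := x₀) (b := X)
    (f := fun t => 1 - q t i - (b * Real.exp (-(9 * l i) * (t - x₀)) - 20 / 9 * θ))
    (fun t _ => (((h.split.derivq t i).const_sub 1).sub (hE t)).continuousAt.continuousWithinAt)
    (fun t _ => ((h.split.derivq t i).const_sub 1).sub (hE t))
    (by
      have := h.q_le_mul x₀ hx₀.le i
      simp only [sub_self, mul_zero, Real.exp_zero, mul_one, hb]; linarith)
    (fun t ht hneg => by
      have ht0 : 0 ≤ t := hx₀.le.trans ht.1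
      have a1 := statL_ge h.pos h.norm (w t)
      have a2 := hL t ht.1
      have a3 := h.err_le ht0
      have a4 := h.err_nonneg t
      have a5 : |1 - statS l (w t)| ≤ θ := abs_le_of_sq_le_sq (by nlinarith [sq_nonneg (1 - statS l (w t))]) hθ0
      have a6 := (abs_le.1 a5)
      have a7 := (abs_le.1 (h.abs_one_sub_statS ht0))
      have a8 := hlow t (Ico_subset_Icc_self ht)
      have a9 := Real.exp_pos (-(9 * l i * X))
      set Z := b * Real.exp (-(9 * l i) * (t - x₀)) with hZ
      have a10 : (4 - 12 * statS l (w t)) * q t i + 8 * statU l v (w t) ≤ 9 * Z := by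
        have e : (4 - 12 * statS l (w t)) * q t i + 8 * statU l v (w t) =
            (12 * statS l (w t) - 4) * (1 - q t i) + (4 - 12 * statS l (w t) + 8 * statU l v (w t)) := by
          ring
        have b1 : 4 - 12 * statS l (w t) + 8 * statU l v (w t) ≤ 20 * θ := by nlinarith
        have b2 : (12 * statS l (w t) - 4) * (1 - q t i) ≤ 9 * (Z - 20 / 9 * θ) := by
          rcases le_total 0 (1 - q t i) with hz | hz
          · nlinarith
          · have : (12 * statS l (w t) - 4) * (1 - q t i) ≤ 0 :=
              mul_nonpos_of_nonneg_of_nonpos (by linarith) hz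
            linarith
        rw [e]; linarith
      have := mul_le_mul_of_nonneg_left a10 hli.le
      linarith) X (right_mem_Icc.2 hX)
  have := hlow X (right_mem_Icc.2 hX)
  linarith

/-- Comparison of the squared error with independent exponential decay of the modes at rates
`16 λ_i`, when both summary statistics stay within `D` of `1`. -/
lemma IsFlow.sum_sq_err_sub_le (h : IsFlow l v w) (hl : ∀ i, 0 < l i) {D τ : ℝ} {W : Fin d → ℝ}
    (hτ : 0 ≤ τ) (hs : ∀ t, 0 ≤ t → |1 - statS l (w t)| ≤ D)
    (hu : ∀ t, 0 ≤ t → |1 - statU l v (w t)| ≤ D) (hv : ∀ i, |v i| ≤ W i)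
    (he : ∀ t, 0 ≤ t → ∀ i, |w t i - v i| ≤ W i) :
    |∑ i, (w τ i - v i) ^ 2 - ∑ i, (w 0 i - v i) ^ 2 * Real.exp (-16 * l i * τ)| ≤
      128 * D * ∑ i, min 1 (l i * τ) * W i ^ 2 := by
  rw [← Finset.sum_sub_distrib, Finset.mul_sum]
  refine (Finset.abs_sum_le_sum_abs _ _).trans (Finset.sum_le_sum fun i _ => ?_)
  have hli := hl i
  have hD : 0 ≤ D := (abs_nonneg _).trans (hs 0 le_rfl)
  have hW : 0 ≤ W i := (abs_nonneg _).trans (hv i)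
  set F := 32 * D * W i with hF
  have hF0 : 0 ≤ F := by positivity
  let f : ℝ → ℝ := fun t => 12 * (1 - statS l (w t)) * (w t i - v i)
    + (12 * (1 - statS l (w t)) - 8 * (1 - statU l v (w t))) * v i
  have hf : ∀ t, 0 ≤ t → |f t| ≤ F := by
    intro t ht
    have h1 := hs t ht
    have h2 := hu t ht
    have h3 := he t ht i
    have h4 := hv i
    have e1 : |12 * (1 - statS l (w t)) * (w t i - v i)| ≤ 12 * D * W i := by
      rw [abs_mul, abs_mul, abs_of_pos (by norm_num : (0 : ℝ) < 12)]; gcongr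
    have e2 : |(12 * (1 - statS l (w t)) - 8 * (1 - statU l v (w t))) * v i| ≤ 20 * D * W i := by
      rw [abs_mul]
      have : |12 * (1 - statS l (w t)) - 8 * (1 - statU l v (w t))| ≤ 20 * D := by
        rw [abs_le] at h1 h2 ⊢; constructor <;> linarith
      gcongr
    refine (abs_add_le _ _).trans ?_
    rw [hF]; linarith
  let E : ℝ → ℝ := fun t => Real.exp (-(8 * l i) * t)
  have hE : ∀ t, HasDerivAt E (-(8 * l i) * E t) t := fun t => by
    have h1 : HasDerivAt (fun t => -(8 * l i) * t) (-(8 * l i)) t := by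
      simpa using (hasDerivAt_id t).const_mul (-(8 * l i))
    exact h1.exp.congr_deriv (by simp only [E]; ring)
  let z : ℝ → ℝ := fun t => w t i - v i - (w 0 i - v i) * E t
  have hz : ∀ t, 0 ≤ t → HasDerivAt z (l i * (-8 * z t + f t)) t := fun t ht =>
    (((h.deriv t ht i).sub_const (v i)).sub ((hE t).const_mul _)).congr_deriv (by
      simp only [z, f]; ring)
  have hzc : ContinuousOn z (Icc 0 τ) := fun t ht => (hz t ht.1).continuousAt.continuousWithinAt
  have hz0 : z 0 = 0 := by simp [z, E]
  have hlin : ∀ x, HasDerivAt (fun t => l i * F * t) (l i * F) x := fun x => by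
    simpa using (hasDerivAt_id x).const_mul (l i * F)
  have hlinc : ContinuousOn (fun t => l i * F * t) (Icc 0 τ) := by fun_prop
  -- `z' = λ_i (-8 z + f)` with `|f| ≤ F` gives both `|z| ≤ λ_i F t` and `|z| ≤ F`
  have b1 := nonneg_of_deriv_ge (K := 0) (f := fun t => l i * F * t - z t) (hlinc.sub hzc)
    (fun t ht => (hlin t).sub (hz t ht.1)) (by simp [hz0]) (fun t ht hneg => by
      have c1 := (abs_le.1 (hf t ht.1)).2
      have c2 : 0 ≤ l i * F * t := by have := ht.1; positivity
      have c3 : -8 * z t + f t ≤ F := by linarith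
      have := mul_le_mul_of_nonneg_left c3 hli.le
      linarith) τ (right_mem_Icc.2 hτ)
  have b2 := nonneg_of_deriv_ge (K := 0) (f := fun t => l i * F * t + z t) (hlinc.add hzc)
    (fun t ht => (hlin t).add (hz t ht.1)) (by simp [hz0]) (fun t ht hneg => by
      have c1 := (abs_le.1 (hf t ht.1)).1
      have c2 : 0 ≤ l i * F * t := by have := ht.1; positivity
      have c3 : -F ≤ -8 * z t + f t := by linarith
      have := mul_le_mul_of_nonneg_left c3 hli.le
      linarith) τ (right_mem_Icc.2 hτ)
  have b3 := nonneg_of_deriv_ge (K := 0) (f := fun t => F - z t) (continuousOn_const.sub hzc)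
    (fun t ht => (hz t ht.1).const_sub F) (by simpa [hz0] using hF0) (fun t ht hneg => by
      have c1 := (abs_le.1 (hf t ht.1)).2
      have c3 : -8 * z t + f t ≤ 0 := by linarith
      have := mul_le_mul_of_nonneg_left c3 hli.le
      linarith) τ (right_mem_Icc.2 hτ)
  have b4 := nonneg_of_deriv_ge (K := 0) (f := fun t => F + z t) (continuousOn_const.add hzc)
    (fun t ht => (hz t ht.1).const_add F) (by simpa [hz0] using hF0) (fun t ht hneg => by
      have c1 := (abs_le.1 (hf t ht.1)).1
      have c3 : 0 ≤ -8 * z t + f t := by linarith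
      have := mul_le_mul_of_nonneg_left c3 hli.le
      linarith) τ (right_mem_Icc.2 hτ)
  have hzle : |z τ| ≤ F * min 1 (l i * τ) := by
    rw [abs_le]
    rcases le_total 1 (l i * τ) with hc | hc
    · rw [min_eq_left hc]; constructor <;> linarith
    · rw [min_eq_right hc]; constructor <;> linarith
  have hE0 : 0 < E τ := Real.exp_pos _
  have hE1 : E τ ≤ 1 := Real.exp_le_one_iff.2 (by nlinarith)
  have hE2 : Real.exp (-16 * l i * τ) = E τ ^ 2 := by
    simp only [E]; rw [← Real.exp_nat_mul]; push_cast; ring_nf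
  have k1 : |(w 0 i - v i) * E τ| ≤ W i := by
    rw [abs_mul, abs_of_pos hE0]
    calc _ ≤ W i * 1 := mul_le_mul (he 0 le_rfl i) hE1 hE0.le hW
      _ = W i := mul_one _
  have k2 := he τ hτ i
  have e : (w τ i - v i) ^ 2 - (w 0 i - v i) ^ 2 * Real.exp (-16 * l i * τ) =
      z τ * ((w τ i - v i) + (w 0 i - v i) * E τ) := by
    rw [hE2]; simp only [z]; ring
  rw [e, abs_mul]
  have k3 : |(w τ i - v i) + (w 0 i - v i) * E τ| ≤ 2 * W i := (abs_add_le _ _).trans (by linarith)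
  have hmn := min_one_pos_le (mul_nonneg hli.le hτ)
  calc _ ≤ F * min 1 (l i * τ) * (2 * W i) := by gcongr
    _ = 64 * D * (min 1 (l i * τ) * W i ^ 2) := by rw [hF]; ring
    _ ≤ _ := by gcongr; norm_num

end Modes

end PhaseRetrieval

namespace PhaseRetrieval

open MeasureTheory ProbabilityTheory Set Matrix

/-! ### Typical data -/

/-- Abel summation: if the partial sums of `x` are at most `A k`, then weighting with an antitone
`c ≥ 0` gives at most `A ∑ c`. -/
lemma sum_mul_le_of_partial_sums {A : ℝ} : ∀ {d : ℕ} {c x : Fin d → ℝ}, Antitone c → (∀ i, 0 ≤ c i) →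
    (∀ k : ℕ, k ≤ d → (∑ i : Fin d, if (i : ℕ) < k then x i else 0) ≤ A * k) →
    ∑ i, c i * x i ≤ A * ∑ i, c i := by
  have key : ∀ (d : ℕ) (c x : Fin d → ℝ), Antitone c →
      (∀ k : ℕ, k ≤ d → (∑ i : Fin d, if (i : ℕ) < k then x i else 0) ≤ A * k) →
      ∀ b, 0 ≤ b → (∀ i, b ≤ c i) → ∑ i, c i * (x i - A) ≤ b * (∑ i, x i - A * d) := by
    intro d
    induction d with
    | zero => intro c x _ _ b _ _; simp
    | succ d ih =>
      intro c x hc hx b hb hbc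
      have h1 := ih (fun i => c i.castSucc) (fun i => x i.castSucc)
        (fun i j hij => hc (Fin.castSucc_le_castSucc_iff.2 hij)) (fun k hk => by
          have := hx k (by omega)
          rw [Fin.sum_univ_castSucc] at this
          have hlast : ¬ ((Fin.last d : Fin (d + 1)) : ℕ) < k := by simp; omega
          rw [if_neg hlast, add_zero] at this
          simpa using this) (c (Fin.last d)) (hb.trans (hbc _)) (fun i => hc (Fin.le_last _))
      have h2 := hx (d + 1) le_rfl
      have h3 : (∑ i : Fin (d + 1), if (i : ℕ) < d + 1 then x i else 0) = ∑ i, x i :=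
        Finset.sum_congr rfl fun i _ => if_pos i.2
      rw [h3] at h2
      rw [Fin.sum_univ_castSucc (f := fun i => c i * (x i - A))]
      have h4 : c (Fin.last d) * (∑ i, x i - A * ((d + 1 : ℕ) : ℝ)) ≤
          b * (∑ i, x i - A * ((d + 1 : ℕ) : ℝ)) :=
        mul_le_mul_of_nonpos_right (hbc _) (by linarith)
      refine le_trans ?_ h4
      rw [Fin.sum_univ_castSucc (f := x)]
      push_cast
      linarith
  intro d c x hc hc0 hx
  have := key d c x hc hx 0 le_rfl hc0
  rw [zero_mul, Finset.sum_congr rfl fun i _ => mul_sub (c i) (x i) A, Finset.sum_sub_distrib,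
    ← Finset.sum_mul] at this
  linarith

/-- The mirror image of `sum_mul_le_of_partial_sums`. -/
lemma sum_mul_le_of_tail_sums {A : ℝ} {d : ℕ} {c x : Fin d → ℝ} (hc : Monotone c)
    (hc0 : ∀ i, 0 ≤ c i)
    (hx : ∀ k : ℕ, k ≤ d → (∑ i : Fin d, if d ≤ (i : ℕ) + k then x i else 0) ≤ A * k) :
    ∑ i, c i * x i ≤ A * ∑ i, c i := by
  have := sum_mul_le_of_partial_sums (A := A) (c := fun i => c i.rev) (x := fun i => x i.rev)
    (fun i j hij => hc (Fin.rev_le_rev.2 hij)) (fun i => hc0 _) (fun k hk => by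
      refine le_trans (le_of_eq ?_) (hx k hk)
      rw [← Equiv.sum_comp Fin.revPerm (fun i : Fin d => if d ≤ (i : ℕ) + k then x i else 0)]
      refine Finset.sum_congr rfl fun i _ => ?_
      have : ((i : ℕ) < k) ↔ (d ≤ ((Fin.revPerm i : Fin d) : ℕ) + k) := by
        have := i.2
        rw [Fin.revPerm_apply, Fin.val_rev]; omega
      simp only [this, Fin.revPerm_apply])
  rw [Equiv.sum_comp Fin.revPerm (fun i => c i * x i) |>.symm,
    (Equiv.sum_comp Fin.revPerm c).symm]
  simpa using this

/-- Properties of the target and the initialization that hold, for a constant `A`, with high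
probability: the energy of the target is spread evenly, and the initialization is small in the
`Q`-norm but not orthogonal to the top eigenvector of the linearized flow. -/
structure IsTypical (a : ℝ) (d : ℕ) (A : ℝ) (i₀ : Fin d) (μ : ℝ) (v w₀ : Fin d → ℝ) : Prop where
  index : (i₀ : ℕ) = 0
  norm : ∑ i, eigenvalue a d i * v i ^ 2 = 1
  top : 1 / A ≤ v i₀ ^ 2
  head : ∀ k : ℕ, k ≤ d → (∑ i : Fin d, if (i : ℕ) < k then v i ^ 2 else 0) ≤ A * k
  tail : ∀ k : ℕ, k ≤ d → (∑ i : Fin d, if d ≤ (i : ℕ) + k then v i ^ 2 else 0) ≤ A * k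
  block : ∀ k : ℕ, A ≤ k → 2 * k ≤ d →
    k / A ≤ ∑ i : Fin d, if k ≤ (i : ℕ) ∧ (i : ℕ) < 2 * k then v i ^ 2 else 0
  init : ∑ i, w₀ i ^ 2 ≤ 1
  init_small : statS (eigenvalue a d) w₀ ≤ A / d
  isTop : IsTop (eigenvalue a d) v i₀ μ
  align : topVec (eigenvalue a d) v μ ⬝ᵥ topVec (eigenvalue a d) v μ ≤
    A * d * (topVec (eigenvalue a d) v μ ⬝ᵥ w₀) ^ 2

namespace IsTypical

variable {a : ℝ} {d : ℕ} {A : ℝ} {i₀ : Fin d} {μ : ℝ} {v w₀ : Fin d → ℝ}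

lemma d_pos (_h : IsTypical a d A i₀ μ v w₀) : 0 < (d : ℝ) := by
  have := i₀.2
  exact_mod_cast (by omega : 0 < d)

lemma neg (h : IsTypical a d A i₀ μ v w₀) : IsTypical a d A i₀ μ (fun i => -v i) w₀ where
  index := h.index
  norm := by simpa using h.norm
  top := by simpa using h.top
  head := by simpa using h.head
  tail := by simpa using h.tail
  block := by simpa using h.block
  init := h.init
  init_small := h.init_small
  isTop := h.isTop.neg
  align := by simpa [topVec_neg] using h.align

lemma sum_min_le (h : IsTypical a d A i₀ μ v w₀) (ha : 1 < a) (hA : 0 ≤ A) {τ : ℝ} (hτ : 0 < τ) :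
    ∑ i, min 1 (eigenvalue a d i * τ) * v i ^ 2 ≤ A * (a / (a - 1)) * τ ^ (1 / a) := by
  refine (sum_mul_le_of_partial_sums (A := A) (fun i j hij => ?_) (fun i => ?_) h.head).trans ?_
  · have := eigenvalue_anti ha hij
    exact min_le_min_left _ (by gcongr)
  · exact min_one_pos_le (mul_nonneg (eigenvalue_pos i).le hτ.le)
  · rw [mul_assoc]
    exact mul_le_mul_of_nonneg_left (sum_min_eigenvalue_le ha d hτ) hA

lemma sum_tail_le (h : IsTypical a d A i₀ μ v w₀) (ha : 1 < a) (hA : 0 ≤ A) {τ : ℝ} (hτ : 0 < τ) :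
    ∑ i with eigenvalue a d i * τ ≤ 1, eigenvalue a d i * v i ^ 2 ≤
      A * (a / (a - 1)) * τ ^ (1 / a - 1) := by
  rw [Real.rpow_sub_one hτ.ne', ← mul_div_assoc, le_div_iff₀ hτ]
  refine le_trans ?_ (h.sum_min_le ha hA hτ)
  rw [Finset.sum_mul]
  refine (Finset.sum_le_sum fun i hi => ?_).trans (Finset.sum_le_sum_of_subset_of_nonneg
    (Finset.filter_subset _ _) fun i _ _ => mul_nonneg
      (min_one_pos_le (mul_nonneg (eigenvalue_pos i).le hτ.le)) (sq_nonneg _))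
  have : eigenvalue a d i * τ ≤ 1 := by simpa using hi
  rw [min_eq_right this]
  linarith

/-- The slow modes of a typical target carry a power-law share of its energy. -/
lemma sum_slow_ge (ha : 1 < a) (hA : 1 ≤ A) {c : ℝ} (hc : 0 < c) (hc1 : c ≤ 1) :
    ∃ c₂ c₃ t₁ : ℝ, 0 < c₂ ∧ 0 < c₃ ∧ 1 ≤ t₁ ∧ ∀ (d : ℕ) (i₀ : Fin d) (μ : ℝ) (v w₀ : Fin d → ℝ),
      IsTypical a d A i₀ μ v w₀ → ∀ t, t₁ ≤ t → t ≤ c₃ * (d : ℝ) ^ a →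
      c₂ * t ^ (-(1 - 1 / a)) ≤ ∑ i with eigenvalue a d i * t ≤ c, eigenvalue a d i * v i ^ 2 := by
  have ha0 : 0 < a := by linarith
  have ha1 : 0 < a - 1 := by linarith
  have hA0 : 0 < A := by linarith
  refine ⟨(a - 1) / a * 4 ^ (-a) / A * c ^ (1 - 1 / a), c / 4 ^ a, 1 + A ^ a, by positivity,
    by positivity, by have : 0 < A ^ a := by positivity
                      linarith, ?_⟩
  intro d i₀ μ v w₀ h t ht htd
  have ht1 : 1 ≤ t := by have : 0 < A ^ a := by positivity
                         linarith
  have ht0 : 0 < t := by linarith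
  have hd := h.d_pos
  set y := (t / c) ^ (1 / a) with hy
  have htc : t ≤ t / c := by rw [le_div_iff₀ hc]; nlinarith
  have hya : y ^ a = t / c := by
    rw [hy, ← Real.rpow_mul (by positivity), one_div_mul_cancel ha0.ne', Real.rpow_one]
  have hy1 : 1 ≤ y := Real.one_le_rpow (by linarith) (by positivity)
  have hy0 : 0 < y := by linarith
  have hyA : A ≤ y := by
    have : A ^ a ≤ y ^ a := by rw [hya]; linarith
    exact (Real.rpow_le_rpow_iff hA0.le hy0.le ha0).1 this
  have hyd : 4 * y ≤ d := by
    have : (4 * y) ^ a ≤ (d : ℝ) ^ a := by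
      rw [Real.mul_rpow (by norm_num) hy0.le, hya, ← mul_div_assoc, div_le_iff₀ hc]
      rw [div_mul_eq_mul_div, le_div_iff₀ (by positivity)] at htd
      linarith
    exact (Real.rpow_le_rpow_iff (by positivity) hd.le ha0).1 this
  set k := ⌈y⌉₊ with hk
  have hk1 : y ≤ k := Nat.le_ceil y
  have hk2 : (k : ℝ) ≤ 2 * y := by have := Nat.ceil_lt_add_one hy0.le; linarith
  have hkd : 2 * k ≤ d := by
    have : (2 * k : ℝ) ≤ d := by linarith
    exact_mod_cast this
  have hb := h.block k (hyA.trans hk1) hkd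
  have hlow : ∀ i : Fin d, (i : ℕ) < 2 * k → (a - 1) / a * 4 ^ (-a) * (c / t) ≤ eigenvalue a d i := by
    intro i hi
    refine le_trans ?_ (le_eigenvalue ha i)
    rw [mul_assoc]
    refine mul_le_mul_of_nonneg_left ?_ (by positivity)
    have h1 : (i : ℝ) + 1 ≤ 4 * y := by
      have : (i : ℝ) + 1 ≤ 2 * k := by exact_mod_cast hi
      linarith
    have h2 : (4 * y) ^ (-a) ≤ ((i : ℝ) + 1) ^ (-a) :=
      Real.rpow_le_rpow_of_nonpos (by positivity) h1 (by linarith)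
    refine le_trans (le_of_eq ?_) h2
    rw [Real.mul_rpow (by norm_num) hy0.le, Real.rpow_neg hy0.le, hya, inv_div]
  have hupp : ∀ i : Fin d, k ≤ (i : ℕ) → eigenvalue a d i * t ≤ c := by
    intro i hi
    have h1 : y ≤ (i : ℝ) + 1 := by
      have : (k : ℝ) ≤ (i : ℝ) := by exact_mod_cast hi
      linarith
    have h2 : ((i : ℝ) + 1) ^ (-a) ≤ y ^ (-a) :=
      Real.rpow_le_rpow_of_nonpos hy0 h1 (by linarith)
    rw [Real.rpow_neg hy0.le, hya, inv_div] at h2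
    have := (eigenvalue_le (a := a) i).trans h2
    rwa [le_div_iff₀ ht0] at this
  have hsum : (a - 1) / a * 4 ^ (-a) * (c / t) * (k / A) ≤
      ∑ i with eigenvalue a d i * t ≤ c, eigenvalue a d i * v i ^ 2 := by
    refine (mul_le_mul_of_nonneg_left hb (by positivity)).trans ?_
    rw [Finset.mul_sum, Finset.sum_filter]
    refine Finset.sum_le_sum fun i _ => ?_
    have hl := eigenvalue_pos (a := a) i
    split_ifs with h1 h2 h2
    · have := hlow i h1.2
      gcongr
    · exact absurd (hupp i h1.1) h2
    · rw [mul_zero]; positivity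
    · rw [mul_zero]
  refine le_trans ?_ hsum
  have e : c / t * y = t ^ (-(1 - 1 / a)) * c ^ (1 - 1 / a) := by
    have e1 : c / t = (t / c) ^ (-1 : ℝ) := by rw [Real.rpow_neg_one, inv_div]
    rw [e1, hy, ← Real.rpow_add (by positivity), show (-1 : ℝ) + 1 / a = -(1 - 1 / a) by ring,
      Real.div_rpow ht0.le hc.le, div_eq_mul_inv, ← Real.rpow_neg hc.le, neg_neg]
  calc (a - 1) / a * 4 ^ (-a) / A * c ^ (1 - 1 / a) * t ^ (-(1 - 1 / a))
      = (a - 1) / a * 4 ^ (-a) / A * (c / t * y) := by rw [e]; ring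
    _ ≤ (a - 1) / a * 4 ^ (-a) / A * (c / t * k) := by gcongr
    _ = _ := by ring

end IsTypical

end PhaseRetrieval

namespace PhaseRetrieval

open MeasureTheory ProbabilityTheory Set Matrix Filter Topology

/-! ### Convergence of the summary statistics -/

lemma tendsto_const_mul_log {C : ℝ} (hC : 0 < C) :
    Tendsto (fun d : ℕ => C * Real.log d) atTop atTop :=
  (Real.tendsto_log_atTop.comp tendsto_natCast_atTop_atTop).const_mul_atTop hC

lemma eventually_log_add_rpow_le {A B p r c : ℝ} (hc : 0 < c) (hr : 0 < r) (hpr : p < r) :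
    ∀ᶠ d : ℕ in atTop, A * Real.log d + B * (d : ℝ) ^ p ≤ c * (d : ℝ) ^ r := by
  have h0 : (fun x : ℝ => x ^ p) =o[atTop] fun x : ℝ => x ^ r := by
    refine (Asymptotics.isLittleO_iff_tendsto' ?_).2 ?_
    · filter_upwards [eventually_gt_atTop 0] with x hx h
      exact absurd h (Real.rpow_pos_of_pos hx r).ne'
    · refine (tendsto_rpow_neg_atTop (sub_pos.2 hpr)).congr' ?_
      filter_upwards [eventually_gt_atTop 0] with x hx
      rw [neg_sub, Real.rpow_sub hx]
  have h1 : (fun x : ℝ => A * Real.log x + B * x ^ p) =o[atTop] fun x : ℝ => x ^ r :=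
    ((isLittleO_log_rpow_atTop hr).const_mul_left A).add
      (h0.const_mul_left B)
  have h2 := h1.bound hc
  filter_upwards [tendsto_natCast_atTop_atTop.eventually h2] with d hd
  have : ‖(d : ℝ) ^ r‖ = (d : ℝ) ^ r := Real.norm_of_nonneg (by positivity)
  rw [this] at hd
  exact (le_abs_self _).trans hd

namespace IsTypical

variable {a A : ℝ}

/-- The flow started at typical data enters the basin of one of `±v` at time `C log d`. -/
lemma exists_isSettled (ha : 1 < a) (hA : 1 ≤ A) : ∃ C M : ℝ, 1 ≤ C ∧ 9 ≤ M ∧ ∃ d₀ : ℕ, ∀ d, d₀ ≤ d →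
    ∀ (i₀ : Fin d) (μ : ℝ) (v w₀ : Fin d → ℝ), IsTypical a d A i₀ μ v w₀ →
    ∀ w, IsFlow (eigenvalue a d) v w → w 0 = w₀ → 1 ≤ Real.log d ∧
    ∃ v' : Fin d → ℝ, (v' = v ∨ v' = fun i => -v i) ∧ ∃ q P n,
      IsSettled (eigenvalue a d) v' (fun t => w (t + C * Real.log d)) q P n M (C * Real.log d) := by
  have ha0 : 0 < a := by linarith
  have ha1 : 0 < a - 1 := by linarith
  have hA0 : 0 < A := by linarith
  have ht0 : (a - 1) / a ≤ 1 := by rw [div_le_one ha0]; linarith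
  set β := (a - 1) / a * (1 / A) with hβ
  have hA1 : 1 / A ≤ 1 := by rw [div_le_one hA0]; exact hA
  have hβa : β ≤ (a - 1) / a := mul_le_of_le_one_right (by positivity) hA1
  have hβA : β ≤ 1 / A := mul_le_of_le_one_left (by positivity) ht0
  obtain ⟨ρ, hρ, hreach⟩ := IsFlow.reaches_basin (β := β) (A := A) (by positivity) (hβa.trans ht0) hA
  obtain ⟨τ, hτ1, hτ⟩ : ∃ τ : ℝ, 0 < τ ∧ A * (a / (a - 1)) * τ ^ (1 / a - 1) ≤ ρ := by
    have : Tendsto (fun τ : ℝ => A * (a / (a - 1)) * τ ^ (-(1 - 1 / a))) atTop (𝓝 (A * (a / (a - 1)) * 0)) :=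
      (tendsto_rpow_neg_atTop (by rw [sub_pos, div_lt_one ha0]; exact ha)).const_mul _
    rw [mul_zero] at this
    obtain ⟨τ, h1, h2⟩ := ((this.eventually_le_const hρ).and (eventually_gt_atTop 0)).exists
    exact ⟨τ, h2, by rwa [neg_sub] at h1⟩
  obtain ⟨C, M, D₀, hC, hM, hD₀, hmain⟩ := hreach τ hτ1
  refine ⟨C, M + 9, hC, by linarith, ⌈D₀⌉₊, fun d hd i₀ μ v w₀ hty w hw hw0 => ?_⟩
  have hdD : D₀ ≤ d := Nat.ceil_le.1 hd
  have hlog : 1 ≤ Real.log d := by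
    rw [Real.le_log_iff_exp_le (by linarith)]
    linarith [Real.exp_one_lt_d9]
  have hl : ∀ i, 0 < eigenvalue a d i := fun i => eigenvalue_pos i
  have hl1 : ∀ i, eigenvalue a d i ≤ 1 := fun i => eigenvalue_le_one ha i
  have hβl : β ≤ eigenvalue a d i₀ := by
    have := le_eigenvalue ha i₀
    rw [hty.index] at this
    simp at this
    linarith
  subst hw0
  obtain ⟨v', hv', hL, hu, q, n, hqn, hq0, hqM, hqT, hn⟩ := hmain d (eigenvalue a d) v i₀ μ w d hw hl
    (fun i => eigenvalue_anti ha (Fin.le_def.2 (by rw [hty.index]; exact Nat.zero_le _))) (hl1 i₀) hty.norm hty.isTop hβl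
    (hβA.trans hty.top) hdD hty.init_small hty.align hty.init
    ((hty.sum_tail_le ha hA0.le hτ1).trans hτ)
  refine ⟨hlog, v', hv', ?_⟩
  have hT : 0 ≤ C * Real.log d := by positivity
  have hflow : IsFlow (eigenvalue a d) v' w := by
    rcases hv' with rfl | rfl
    · exact hw
    · exact hw.neg_target
  have hnorm : ∑ i, eigenvalue a d i * v' i ^ 2 = 1 := by
    rcases hv' with rfl | rfl
    · exact hty.norm
    · exact hty.neg.norm
  obtain ⟨q', P, hset⟩ := (hflow.shift hT).isSettled (n := n) (q₀ := q) (M := M + 9)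
    (T := C * Real.log d) hl hl1 hnorm (by simpa using hL) (by simpa using hu) (by simpa using hqn)
    hq0 (fun i => (hqM i).trans (by linarith))
    (fun i => (hqT i).trans (by have := hl i; gcongr; linarith)) (hn.trans (by linarith)) (by linarith)
  exact ⟨q', P, n, hset⟩

lemma of_sign {d : ℕ} {i₀ : Fin d} {μ : ℝ} {v v' w₀ : Fin d → ℝ} (h : IsTypical a d A i₀ μ v w₀)
    (hv' : v' = v ∨ v' = fun i => -v i) : IsTypical a d A i₀ μ v' w₀ := by
  rcases hv' with rfl | rfl
  · exact h
  · exact h.neg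

/-- Constants of the loss decay for typical data. -/
lemma statL_decay {d : ℕ} {i₀ : Fin d} {μ : ℝ} {v w₀ : Fin d → ℝ} (ha : 1 < a) (hA : 1 ≤ A)
    (h : IsTypical a d A i₀ μ v w₀) {w q : ℝ → Fin d → ℝ} {P : ℝ → ℝ} {n : Fin d → ℝ} {M T : ℝ}
    (hs : IsSettled (eigenvalue a d) v w q P n M T) {t : ℝ} (ht : 1 ≤ t) :
    statL (eigenvalue a d) v (w t) ≤
      (8 * ((100 * M ^ 2 + 16) * (A * (a / (a - 1))) + 100 * M) + 1) * t ^ (-(1 - 1 / a)) := by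
  have ha0 : 0 < a := by linarith
  have ha1 : 0 < a - 1 := by linarith
  have h1 : 0 < 1 / a := by positivity
  have h2 : 1 / a < 1 := by rw [div_lt_one ha0]; exact ha
  refine hs.statL_decay (by linarith) (by linarith) (by positivity) (fun τ hτ => ?_) ht
  rw [sub_sub_cancel]
  exact h.sum_min_le ha (by linarith) (by linarith)

/-- Existence of a convergence time of the order `log d + ε^{-a/(a-1)}`. -/
lemma exists_converged (ha : 1 < a) (hA : 1 ≤ A) {c K : ℝ} (hc : 0 < c) (hK : 0 < K) :
    ∃ C : ℝ, 0 < C ∧ ∃ d₀ : ℕ, ∀ d, d₀ ≤ d → ∀ (i₀ : Fin d) (μ : ℝ) (v w₀ : Fin d → ℝ),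
    IsTypical a d A i₀ μ v w₀ → ∀ ε, c * (d : ℝ) ^ (-(a - 1) / 2) ≤ ε → ε < 1 →
    ∀ w, IsFlow (eigenvalue a d) v w → w 0 = w₀ →
    ∃ v' : Fin d → ℝ, (v' = v ∨ v' = fun i => -v i) ∧ ∃ T, 0 ≤ T ∧
      statU (eigenvalue a d) v' (w T) ∈ Icc (1 - ε) 1 ∧ statS (eigenvalue a d) (w T) ∈ Icc (1 - ε) 1 ∧
      T ≤ C * (Real.log d + ε ^ (-(2 * a / (a - 1))) * Real.log (1 / ε)) ∧ T ≤ K * (d : ℝ) ^ a := by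
  have ha0 : 0 < a := by linarith
  have ha1 : 0 < a - 1 := by linarith
  have hA0 : 0 < A := by linarith
  obtain ⟨C, M, hC, hM, d₁, hset⟩ := exists_isSettled ha hA
  have hM0 : 0 < M := by linarith
  set α := 1 - 1 / a with hα
  have h1a : 1 / a < 1 := by rw [div_lt_one ha0]; exact ha
  have h1a0 : 0 < 1 / a := by positivity
  have hα0 : 0 < α := by linarith
  have hα1 : α < 1 := by linarith
  have hαa : 1 / α = a / (a - 1) := by rw [hα]; field_simp
  set B := A * (a / (a - 1)) with hB
  have hB0 : 0 < B := by positivity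
  set B' := 8 * ((100 * M ^ 2 + 16) * B + 100 * M) + 1 with hB'
  have hB'0 : 0 < B' := by positivity
  obtain ⟨c₂, c₃, t₁, hc₂, hc₃, ht₁, hslow⟩ := sum_slow_ge ha hA (c := 1 / (6 * M)) (by positivity)
    (by rw [div_le_one (by positivity)]; linarith)
  set ρ := min 1 (c₂ / (16 * B)) with hρ
  have hρ0 : 0 < ρ := lt_min one_pos (by positivity)
  have hρ1 : ρ ≤ 1 := min_le_left _ _
  have hρB : 16 * ρ * B ≤ c₂ := by
    have : ρ ≤ c₂ / (16 * B) := min_le_right _ _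
    rw [le_div_iff₀ (by positivity)] at this; linarith
  set θ := 7 * ρ / 40 with hθ
  have hθ0 : 0 < θ := by positivity
  set Γ := 1 + 4 * M ^ 2 / (7 * ρ) with hΓ
  have hΓ1 : 1 ≤ Γ := by have : 0 < 4 * M ^ 2 / (7 * ρ) := by positivity
                         linarith
  set CJ := (3 * M + 18) * B + 18 * M with hCJ
  have hCJ0 : 0 < CJ := by positivity
  set S := (B' + CJ) ^ (1 / α) with hS
  have hS0 : 0 < S := by positivity
  have hC0 : 0 < C := by linarith
  -- The convergence time is of the order `X = Γ T + S ε^{-1/α}`, where `T = C log d`: the first summand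
  -- lets the overshoot of the fast modes decay, the second brings the loss below `ε`.
  have hlim := tendsto_const_mul_log hC0
  have ev1 : ∀ᶠ d : ℕ in atTop, B' * (C * Real.log d) ^ (-α) ≤ θ ^ 2 := by
    have : Tendsto (fun d : ℕ => B' * (C * Real.log d) ^ (-α)) atTop (𝓝 (B' * 0)) :=
      ((tendsto_rpow_neg_atTop hα0).comp hlim).const_mul B'
    rw [mul_zero] at this
    exact this.eventually_le_const (by positivity)
  have ev2 := hlim.eventually_ge_atTop t₁
  have ev3 : ∀ᶠ d : ℕ in atTop, 8 * ((M ^ 2 / ρ + 1) * M) ≤ c₂ * (C * Real.log d) ^ (1 / a) :=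
    (((tendsto_rpow_atTop h1a0).comp hlim).const_mul_atTop hc₂).eventually_ge_atTop _
  have ev4 := eventually_log_add_rpow_le (A := Γ * C) (B := S * c ^ (-(1 / α))) (p := a / 2) (r := a)
    (c := min c₃ (K / 3)) (by positivity) ha0 (by linarith)
  obtain ⟨d₂, hd₂⟩ := eventually_atTop.1 (ev1.and (ev2.and (ev3.and ev4)))
  refine ⟨3 * (Γ * C) + 3 * S * Real.exp (1 / α), by positivity, max d₁ d₂, ?_⟩
  intro d hd i₀ μ v w₀ hty ε hεd hε1 w hw hw0
  obtain ⟨f1, f2, f3, f4⟩ := hd₂ d ((le_max_right _ _).trans hd)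
  obtain ⟨hlog, v', hv', q, P, n, h⟩ := hset d ((le_max_left _ _).trans hd) i₀ μ v w₀ hty w hw hw0
  have hty' := hty.of_sign hv'
  have hd0 := hty.d_pos
  have hε0 : 0 < ε := lt_of_lt_of_le (by positivity) hεd
  set T := C * Real.log d with hT
  have hT1 : 1 ≤ T := one_le_mul_of_one_le_of_one_le hC hlog
  set y := ε ^ (-(1 / α)) with hy
  have hy0 : 0 < y := by positivity
  set X := Γ * T + S * y with hX
  have hΓT : Γ * T = Γ * C * Real.log d := by rw [hT]; ring
  have hTX : T ≤ X := by
    have : 0 < S * y := by positivity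
    have : T ≤ Γ * T := le_mul_of_one_le_left (by linarith) hΓ1
    linarith
  have hX1 : 1 ≤ X := hT1.trans hTX
  have hX0 : 0 < X := by linarith
  have hyd : y ≤ c ^ (-(1 / α)) * (d : ℝ) ^ (a / 2) := by
    have h1 : y ≤ (c * (d : ℝ) ^ (-(a - 1) / 2)) ^ (-(1 / α)) :=
      Real.rpow_le_rpow_of_nonpos (by positivity) hεd (by have : 0 < 1 / α := by positivity
                                                          linarith)
    refine h1.trans (le_of_eq ?_)
    rw [Real.mul_rpow hc.le (by positivity), ← Real.rpow_mul hd0.le, hαa]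
    congr 2; field_simp
  have hXd : X ≤ min c₃ (K / 3) * (d : ℝ) ^ a := by
    refine le_trans ?_ f4
    rw [hX, hΓT, mul_assoc S]
    gcongr
  have hXα : (B' + CJ) * X ^ (-α) ≤ ε := by
    have h1 : X ^ (-α) ≤ (S * y) ^ (-α) := Real.rpow_le_rpow_of_nonpos (by positivity)
      (by have : 0 < Γ * T := by positivity
          linarith) (by linarith)
    have h2 : (S * y) ^ (-α) = (B' + CJ)⁻¹ * ε := by
      rw [Real.mul_rpow hS0.le hy0.le, hS, hy, ← Real.rpow_mul (by positivity),
        ← Real.rpow_mul hε0.le]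
      have e1 : 1 / α * -α = -1 := by field_simp
      have e2 : -(1 / α) * -α = 1 := by field_simp
      rw [e1, e2, Real.rpow_one, Real.rpow_neg_one]
    have h3 : 0 < B' + CJ := by positivity
    calc (B' + CJ) * X ^ (-α) ≤ (B' + CJ) * ((B' + CJ)⁻¹ * ε) := by rw [← h2]; gcongr
      _ = ε := by field_simp
  have hXp : 0 < X ^ (-α) := Real.rpow_pos_of_pos hX0 _
  have hLX : statL (eigenvalue a d) v' (w (X + T)) ≤ ε := by
    refine (statL_decay ha hA hty' h hX1).trans ?_
    have : B' * X ^ (-α) ≤ (B' + CJ) * X ^ (-α) := by gcongr; linarith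
    linarith
  have e1a : 1 - α = 1 / a := by rw [hα]; ring
  obtain ⟨x, hx, hu, hs⟩ := h.exists_converged (α := α) (B := B) (ρ := ρ) (c := c₂) (ε := ε) (X := X) hα1 hTX hX1
    (by rw [e1a]; exact hty'.sum_min_le ha hA0.le hX0) hρ0 hρ1
    (fun i => h.q_le_one_add (θ := θ) (x₀ := T) (by linarith) le_rfl hθ0.le
      (by rw [hθ]; linarith) (fun t ht => by
        refine (statL_decay ha hA hty' h (hT1.trans ht)).trans (le_trans ?_ f1)
        gcongr ?_ * ?_
        exact Real.rpow_le_rpow_of_nonpos (by linarith) ht (by linarith)) (by rw [hθ]; linarith)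
      (by
        have h1 : X - T ≥ 4 * M ^ 2 / (7 * ρ) * T := by
          have : 0 < S * y := by positivity
          rw [hX, hΓ]; linarith
        have h2 : 7 * ρ * (4 * M ^ 2 / (7 * ρ) * T) = 4 * M ^ 2 * T := by field_simp
        rw [← h2]; gcongr) hρ0 i)
    hc₂ (hslow d i₀ μ v' w₀ hty' X (f2.trans hTX) (hXd.trans (by gcongr; exact min_le_left _ _))) hρB
    (by rw [e1a]; refine f3.trans ?_; gcongr) hε0 (by
      have e2 : X ^ (1 - α) = X ^ (-α) * X := by
        rw [← Real.rpow_add_one hX0.ne']; ring_nf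
      rw [e2]
      have h1 : CJ * X ^ (-α) ≤ (B' + CJ) * X ^ (-α) := by gcongr; linarith
      have h2 : CJ * X ^ (-α) < 10 * ε := by linarith
      calc CJ * (X ^ (-α) * X) = CJ * X ^ (-α) * X := by ring
        _ < 10 * ε * X := by gcongr) hLX
  have hT2 : x + T ≤ 3 * X := by linarith [hx.2]
  refine ⟨v', hv', x + T, by linarith [hx.1], hu, hs, hT2.trans ?_, hT2.trans ?_⟩
  · have hlε : 0 ≤ Real.log (1 / ε) := Real.log_nonneg (by rw [le_div_iff₀ hε0]; linarith)
    have hz : 0 ≤ ε ^ (-(2 * a / (a - 1))) * Real.log (1 / ε) := by positivity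
    have he1 : 1 ≤ Real.exp (1 / α) := Real.one_le_exp (by positivity)
    -- `ε^{-1/α} ≤ ε^{-2/α} log (1/ε)` fails only for `ε > 1/e`, where `ε^{-1/α}` is bounded
    have hyb : y ≤ Real.exp (1 / α) * (Real.log d + ε ^ (-(2 * a / (a - 1))) * Real.log (1 / ε)) := by
      rcases le_total ε (Real.exp (-1)) with hle | hle
      · have h1 : 1 ≤ Real.log (1 / ε) := by
          rw [one_div, Real.log_inv]
          have := Real.log_le_log hε0 hle
          rw [Real.log_exp] at this; linarith
        have h2 : y ≤ ε ^ (-(2 * a / (a - 1))) := by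
          apply Real.rpow_le_rpow_of_exponent_ge hε0 hε1.le
          rw [hαa]
          have : 0 < a / (a - 1) := by positivity
          have e : 2 * a / (a - 1) = 2 * (a / (a - 1)) := by ring
          rw [e]; linarith
        have h3 : ε ^ (-(2 * a / (a - 1))) ≤ ε ^ (-(2 * a / (a - 1))) * Real.log (1 / ε) :=
          le_mul_of_one_le_right (by positivity) h1
        have h4 : Real.log d + ε ^ (-(2 * a / (a - 1))) * Real.log (1 / ε) ≤
          Real.exp (1 / α) * (Real.log d + ε ^ (-(2 * a / (a - 1))) * Real.log (1 / ε)) :=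
          le_mul_of_one_le_left (by linarith) he1
        linarith
      · have h1 : y ≤ Real.exp (1 / α) := by
          have := Real.rpow_le_rpow_of_nonpos (Real.exp_pos _) hle
            (by have : 0 < 1 / α := by positivity
                linarith : -(1 / α) ≤ 0)
          rw [← Real.exp_mul, show -1 * -(1 / α) = 1 / α by ring] at this
          exact this
        have h2 : Real.exp (1 / α) ≤ Real.exp (1 / α) * (Real.log d + ε ^ (-(2 * a / (a - 1))) * Real.log (1 / ε)) :=
          le_mul_of_one_le_right (Real.exp_pos _).le (by linarith)
        linarith
    have h5 : 3 * (Γ * C) * Real.log d ≤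
        3 * (Γ * C) * (Real.log d + ε ^ (-(2 * a / (a - 1))) * Real.log (1 / ε)) := by
      gcongr; linarith
    have h6 := mul_le_mul_of_nonneg_left hyb (by positivity : 0 ≤ 3 * S)
    rw [hX, hΓT]
    linarith
  · have : min c₃ (K / 3) * (d : ℝ) ^ a ≤ K / 3 * (d : ℝ) ^ a := by gcongr; exact min_le_right _ _
    linarith

end IsTypical

end PhaseRetrieval

namespace PhaseRetrieval

open MeasureTheory ProbabilityTheory Set Matrix Filter Topology

/-! ### Errors of typical flows -/

lemma eventually_log_rpow_le {C p r c : ℝ} (hc : 0 < c) (hr : 0 < r) :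
    ∀ᶠ d : ℕ in atTop, C * Real.log d ^ p ≤ c * (d : ℝ) ^ r := by
  have h1 : (fun x : ℝ => C * Real.log x ^ p) =o[atTop] fun x : ℝ => x ^ r :=
    (isLittleO_log_rpow_rpow_atTop p hr).const_mul_left C
  filter_upwards [tendsto_natCast_atTop_atTop.eventually (h1.bound hc)] with d hd
  have : ‖(d : ℝ) ^ r‖ = (d : ℝ) ^ r := Real.norm_of_nonneg (by positivity)
  rw [this] at hd
  exact (le_abs_self _).trans hd

lemma eigenvalue_mul_le_of_half_le {a : ℝ} (ha : 1 < a) {d : ℕ} {i : Fin d}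
    (hi : d ≤ 2 * ((i : ℕ) + 1)) : eigenvalue a d i * (d : ℝ) ^ a ≤ 2 ^ a := by
  have hd : 0 < (d : ℝ) := by have := i.2; exact_mod_cast (by omega : 0 < d)
  have h1 : (d : ℝ) / 2 ≤ (i : ℝ) + 1 := by
    have : (d : ℝ) ≤ 2 * ((i : ℝ) + 1) := by exact_mod_cast hi
    linarith
  have h2 : eigenvalue a d i ≤ ((d : ℝ) / 2) ^ (-a) := (eigenvalue_le i).trans
    (Real.rpow_le_rpow_of_nonpos (by positivity) h1 (by linarith))
  calc eigenvalue a d i * (d : ℝ) ^ a ≤ ((d : ℝ) / 2) ^ (-a) * (d : ℝ) ^ a := by gcongr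
    _ = 2 ^ a := by
      rw [Real.rpow_neg (by positivity), Real.div_rpow hd.le (by norm_num)]
      have : 0 < (d : ℝ) ^ a := by positivity
      field_simp

lemma half_sq_sub_sq_le (x y : ℝ) : x ^ 2 / 2 - y ^ 2 ≤ (x + y) ^ 2 := by
  nlinarith [sq_nonneg (x + 2 * y)]

lemma sq_sub_le_two_mul (x y : ℝ) : (x - y) ^ 2 ≤ 2 * x ^ 2 + 2 * y ^ 2 := by
  nlinarith [sq_nonneg (x + y)]

lemma sq_sub_le_of_abs_le {x y z : ℝ} (h : |x| ≤ Real.exp 4 * (|y| + 12 * |z|)) :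
    (x - z) ^ 2 ≤ 600 * Real.exp 8 * (z ^ 2 + y ^ 2) := by
  have e1 := pow_le_pow_left₀ (abs_nonneg _) h 2
  rw [sq_abs, mul_pow, ← Real.exp_nat_mul, show ((2 : ℕ) : ℝ) * 4 = 8 by norm_num] at e1
  have e2 : (|y| + 12 * |z|) ^ 2 ≤ 2 * y ^ 2 + 288 * z ^ 2 := by
    nlinarith [sq_nonneg (|y| - 12 * |z|), sq_abs y, sq_abs z]
  have e3 := mul_le_mul_of_nonneg_left e2 (Real.exp_pos 8).le
  have e4 : 1 * z ^ 2 ≤ Real.exp 8 * z ^ 2 := by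
    gcongr; exact Real.one_le_exp (by norm_num)
  have e5 := sq_sub_le_two_mul x z
  have e6 : 0 ≤ Real.exp 8 * y ^ 2 := by positivity
  have e7 : 0 ≤ Real.exp 8 * z ^ 2 := by positivity
  linarith

namespace IsTypical

variable {a A : ℝ}

/-- A bound for all squared errors along the whole flow. Only the modes with `λ_i T > 1`, where
`T` is the time needed to enter the basin, carry a logarithmic factor. -/
lemma exists_majorant (ha : 1 < a) (hA : 1 ≤ A) : ∃ K₁ : ℝ, 1 ≤ K₁ ∧ ∃ d₀ : ℕ, ∀ d, d₀ ≤ d →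
    ∀ (i₀ : Fin d) (μ : ℝ) (v w₀ : Fin d → ℝ), IsTypical a d A i₀ μ v w₀ →
    ∀ w, IsFlow (eigenvalue a d) v w → w 0 = w₀ → ∃ U : Fin d → ℝ,
      (∀ i, v i ^ 2 ≤ U i) ∧ (∀ t, 0 ≤ t → ∀ i, (w t i - v i) ^ 2 ≤ U i) ∧
      (∀ k : ℕ, k ≤ d → (∑ i : Fin d, if d ≤ (i : ℕ) + k then U i else 0) ≤ K₁ * k) ∧
      ∀ τ, 0 < τ → ∑ i, min 1 (eigenvalue a d i * τ) * U i ≤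
        K₁ * (τ ^ (1 / a) + (d : ℝ) ^ ((1 + 1 / a) / 2)) := by
  have ha0 : 0 < a := by linarith
  have ha1 : 0 < a - 1 := by linarith
  have hA0 : 0 < A := by linarith
  obtain ⟨C, M, hC, hM, d₁, hset⟩ := exists_isSettled ha hA
  have hC0 : 0 < C := by linarith
  set B := A * (a / (a - 1)) with hB
  have hB0 : 0 < B := by positivity
  set K := 600 * Real.exp 8 + 4 * M ^ 2 + 4 with hK
  have he8 := Real.exp_pos 8
  have hK1 : 1 ≤ K := by linarith [sq_nonneg M]
  have ev1 := eventually_log_rpow_le (C := 4 * (a / (a - 1)) * C ^ (1 + 1 / a)) (p := 1 + 1 / a)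
    (r := 1) (c := 1 / 2) (by norm_num) one_pos
  have ev2 := eventually_log_rpow_le (C := 4 * (a / (a - 1)) * C ^ (1 + 1 / a)) (p := 1 + 1 / a)
    (r := (1 + 1 / a) / 2) (c := 1) one_pos (by positivity)
  have ev3 := eventually_log_rpow_le (C := 2 ^ a * C) (p := 1) (r := a) (c := 1) one_pos ha0
  obtain ⟨d₂, hd₂⟩ := eventually_atTop.1 (ev1.and (ev2.and ev3))
  have hKAB : 0 < K * (A + B + 1 + M) := by positivity
  refine ⟨K * (A + B + 1 + M) + 1, by linarith, max (max d₁ d₂) ⌈2 * A⌉₊, ?_⟩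
  intro d hd i₀ μ v w₀ hty w hw hw0
  obtain ⟨f1, f2, f3⟩ := hd₂ d ((le_max_right _ _).trans ((le_max_left _ _).trans hd))
  obtain ⟨hlog, v', hv', q, P, n, h⟩ :=
    hset d ((le_max_left _ _).trans ((le_max_left _ _).trans hd)) i₀ μ v w₀ hty w hw hw0
  have hdA : 2 * A ≤ d := Nat.ceil_le.1 ((le_max_right _ _).trans hd)
  have hd0 := hty.d_pos
  have hd1 : 1 ≤ (d : ℝ) := by linarith
  set T := C * Real.log d with hT
  have hT1 : 1 ≤ T := one_le_mul_of_one_le_of_one_le hC hlog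
  have hT0 : 0 < T := by linarith
  have hl : ∀ i : Fin d, 0 < eigenvalue a d i := fun i => eigenvalue_pos i
  have hs0 : statS (eigenvalue a d) (w 0) ≤ 2 / 3 := by
    rw [hw0]; refine hty.init_small.trans ?_
    rw [div_le_iff₀ hd0]; linarith
  have hTp : T ^ (1 + 1 / a) = C ^ (1 + 1 / a) * Real.log d ^ (1 + 1 / a) :=
    Real.mul_rpow hC0.le (by linarith)
  have hv2 : ∀ i, v' i ^ 2 = v i ^ 2 := by rcases hv' with rfl | rfl <;> simp
  -- the modes learned before entering the basin
  let J : Fin d → ℝ := fun i => if 1 < eigenvalue a d i * T then 4 * T else 0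
  have hJ0 : ∀ i, 0 ≤ J i := fun i => by simp only [J]; split_ifs <;> positivity
  have hJsum : ∑ i, J i ≤ 4 * (a / (a - 1)) * T ^ (1 + 1 / a) := by
    have h1 : ∑ i, J i ≤ 4 * T * ∑ i, min 1 (eigenvalue a d i * T) := by
      rw [Finset.mul_sum]
      refine Finset.sum_le_sum fun i _ => ?_
      have := min_one_pos_le (mul_nonneg (hl i).le hT0.le)
      simp only [J]; split_ifs with hc
      · rw [min_eq_left hc.le, mul_one]
      · positivity
    refine h1.trans ?_
    have := mul_le_mul_of_nonneg_left (sum_min_eigenvalue_le ha d hT0) (by positivity : 0 ≤ 4 * T)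
    refine this.trans (le_of_eq ?_)
    rw [Real.rpow_add hT0, Real.rpow_one]; ring
  rw [hTp, ← mul_assoc] at hJsum
  let U : Fin d → ℝ := fun i => K * (v i ^ 2 + w₀ i ^ 2 + n i ^ 2) + J i
  refine ⟨U, fun i => ?_, fun t ht i => ?_, fun k hk => ?_, fun τ hτ => ?_⟩
  · have h1 : v i ^ 2 ≤ v i ^ 2 + w₀ i ^ 2 + n i ^ 2 := by
      linarith [sq_nonneg (w₀ i), sq_nonneg (n i)]
    have h2 := le_mul_of_one_le_left (by positivity : 0 ≤ v i ^ 2 + w₀ i ^ 2 + n i ^ 2) hK1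
    have := hJ0 i
    simp only [U]; linarith
  · have hE := sq_sub_le_two_mul (w t i) (v i)
    have p1 := sq_nonneg (v i)
    have p2 := sq_nonneg (w₀ i)
    have p3 := sq_nonneg (n i)
    have hJi := hJ0 i
    have hS : 0 ≤ v i ^ 2 + w₀ i ^ 2 + n i ^ 2 := by positivity
    -- After the time `T` the splitting bounds the mode; before it, a fast mode is bounded by
    -- `λ_i w_i² ≤ s ≤ 2`, and a slow one has moved by a bounded factor only.
    rcases le_total T t with htT | htT
    · have h1 := h.sq_le (t := t - T) (by linarith) i
      rw [hv2, sub_add_cancel] at h1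
      have h2 : (4 * M ^ 2 + 4) * (v i ^ 2 + w₀ i ^ 2 + n i ^ 2) ≤
          K * (v i ^ 2 + w₀ i ^ 2 + n i ^ 2) := by gcongr; linarith
      have h3 : 0 ≤ M ^ 2 * (w₀ i ^ 2 + n i ^ 2) := by positivity
      simp only [U]; linarith
    rcases lt_or_ge 1 (eigenvalue a d i * T) with hc | hc
    · have h1 := hw.statS_le_two hl hty.norm hs0 ht
      have h2 : eigenvalue a d i * w t i ^ 2 ≤ statS (eigenvalue a d) (w t) :=
        Finset.single_le_sum (f := fun i => eigenvalue a d i * w t i ^ 2)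
          (fun j _ => mul_nonneg (hl j).le (sq_nonneg _)) (Finset.mem_univ i)
      have h3 : w t i ^ 2 ≤ 2 * T := by
        have : eigenvalue a d i * w t i ^ 2 ≤ eigenvalue a d i * (2 * T) := by linarith
        exact le_of_mul_le_mul_left this (hl i)
      have hJe : J i = 4 * T := if_pos hc
      have h4 : 2 * (v i ^ 2 + w₀ i ^ 2 + n i ^ 2) ≤
          K * (v i ^ 2 + w₀ i ^ 2 + n i ^ 2) := by gcongr; linarith [sq_nonneg M]
      simp only [U]; linarith
    · have hli := hl i
      have hlt : eigenvalue a d i * t ≤ 1 := le_trans (by gcongr) hc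
      have h1 := hw.abs_coord_le hl hty.norm hs0 ht i
      rw [hw0] at h1
      have h2 : |w t i| ≤ Real.exp 4 * (|w₀ i| + 12 * |v i|) := by
        refine h1.trans ?_
        have e1 : eigenvalue a d i * (12 * |v i|) * t ≤ 12 * |v i| := by
          have := mul_le_mul_of_nonneg_right hlt (by positivity : 0 ≤ 12 * |v i|)
          linarith
        gcongr
        linarith
      have h3 := sq_sub_le_of_abs_le h2
      have h4 : 600 * Real.exp 8 * (v i ^ 2 + w₀ i ^ 2) ≤
          K * (v i ^ 2 + w₀ i ^ 2 + n i ^ 2) := 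
          mul_le_mul (by linarith [sq_nonneg M]) (by linarith) (by positivity) (by linarith)
      simp only [U]; linarith
  · have hsplit : (∑ i : Fin d, if d ≤ (i : ℕ) + k then U i else 0) =
        K * ((∑ i : Fin d, if d ≤ (i : ℕ) + k then v i ^ 2 else 0)
          + (∑ i : Fin d, if d ≤ (i : ℕ) + k then w₀ i ^ 2 else 0)
          + ∑ i : Fin d, if d ≤ (i : ℕ) + k then n i ^ 2 else 0)
        + ∑ i : Fin d, if d ≤ (i : ℕ) + k then J i else 0 := by
      rw [← Finset.sum_add_distrib, ← Finset.sum_add_distrib, Finset.mul_sum,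
        ← Finset.sum_add_distrib]
      refine Finset.sum_congr rfl fun i _ => ?_
      simp only [U]; split_ifs <;> ring
    rcases Nat.eq_zero_or_pos k with rfl | hk0
    · refine le_of_eq ?_
      simp only [Nat.cast_zero, mul_zero, add_zero]
      exact Finset.sum_eq_zero fun i _ => if_neg (by have := i.2; omega)
    have hk1 : (1 : ℝ) ≤ k := by exact_mod_cast hk0
    have hite : ∀ x : Fin d → ℝ, (∀ i, 0 ≤ x i) →
        (∑ i : Fin d, if d ≤ (i : ℕ) + k then x i else 0) ≤ ∑ i, x i := fun x hx =>
      Finset.sum_le_sum fun i _ => by split_ifs; exacts [le_rfl, hx i]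
    have b1 := hty.tail k hk
    have b2 := (hite _ fun i => sq_nonneg (w₀ i)).trans hty.init
    have b3 := (hite _ fun i => sq_nonneg (n i)).trans h.n_le
    -- `J` vanishes on the slower half of the modes, and its total mass is smaller than `d / 2`
    have b4 : (∑ i : Fin d, if d ≤ (i : ℕ) + k then J i else 0) ≤ k := by
      rcases le_or_gt d (2 * k) with hc | hc
      · refine ((hite J hJ0).trans hJsum).trans (f1.trans ?_)
        have : (d : ℝ) ≤ 2 * k := by exact_mod_cast hc
        rw [Real.rpow_one]; linarith
      · refine le_trans (le_of_eq (Finset.sum_eq_zero fun i _ => ?_)) (Nat.cast_nonneg k)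
        split_ifs with hi
        · refine if_neg (not_lt.2 ?_)
          have h1 := eigenvalue_mul_le_of_half_le ha (i := i) (by omega)
          rw [Real.rpow_one, one_mul, mul_assoc] at f3
          have h2 : eigenvalue a d i * T * (2 : ℝ) ^ a ≤ 1 * 2 ^ a := by
            calc _ = eigenvalue a d i * (2 ^ a * (C * Real.log d)) := by rw [hT]; ring
              _ ≤ eigenvalue a d i * (d : ℝ) ^ a := by have := hl i; gcongr
              _ ≤ 1 * 2 ^ a := by rw [one_mul]; exact h1
          exact le_of_mul_le_mul_right h2 (by positivity)
        · rfl
    rw [hsplit]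
    have c1 : (∑ i : Fin d, if d ≤ (i : ℕ) + k then v i ^ 2 else 0)
          + (∑ i : Fin d, if d ≤ (i : ℕ) + k then w₀ i ^ 2 else 0)
          + (∑ i : Fin d, if d ≤ (i : ℕ) + k then n i ^ 2 else 0) ≤ (A + B + 1 + M) * k := by
      have : M ≤ M * k := le_mul_of_one_le_right (by linarith) hk1
      have : 0 ≤ B * k := by positivity
      linarith
    have c2 := mul_le_mul_of_nonneg_left c1 (by linarith : 0 ≤ K)
    linarith
  · have hm0 : ∀ i : Fin d, 0 ≤ min 1 (eigenvalue a d i * τ) := fun i =>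
      min_one_pos_le (mul_nonneg (hl i).le hτ.le)
    have hmle : ∀ x : Fin d → ℝ, (∀ i, 0 ≤ x i) →
        ∑ i, min 1 (eigenvalue a d i * τ) * x i ≤ ∑ i, x i := fun x hx =>
      Finset.sum_le_sum fun i _ => mul_le_of_le_one_left (hx i) (min_le_left _ _)
    have hsplit : ∑ i, min 1 (eigenvalue a d i * τ) * U i =
        K * (∑ i, min 1 (eigenvalue a d i * τ) * v i ^ 2
          + ∑ i, min 1 (eigenvalue a d i * τ) * w₀ i ^ 2
          + ∑ i, min 1 (eigenvalue a d i * τ) * n i ^ 2)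
        + ∑ i, min 1 (eigenvalue a d i * τ) * J i := by
      rw [← Finset.sum_add_distrib, ← Finset.sum_add_distrib, Finset.mul_sum,
        ← Finset.sum_add_distrib]
      exact Finset.sum_congr rfl fun i _ => by simp only [U]; ring
    have b1 := hty.sum_min_le ha hA0.le hτ
    have b2 := (hmle _ fun i => sq_nonneg (w₀ i)).trans hty.init
    have b3 := (hmle _ fun i => sq_nonneg (n i)).trans h.n_le
    have b4 := ((hmle J hJ0).trans hJsum).trans f2
    set D := (d : ℝ) ^ ((1 + 1 / a) / 2) with hD
    have hD1 : 1 ≤ D := Real.one_le_rpow hd1 (by positivity)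
    have hτp : 0 < τ ^ (1 / a) := by positivity
    rw [hsplit]
    have c1 : ∑ i, min 1 (eigenvalue a d i * τ) * v i ^ 2
          + ∑ i, min 1 (eigenvalue a d i * τ) * w₀ i ^ 2
          + ∑ i, min 1 (eigenvalue a d i * τ) * n i ^ 2 ≤ (A + B + 1 + M) * (τ ^ (1 / a) + D) := by
      have e1 : 1 + M ≤ (1 + M) * D := le_mul_of_one_le_right (by linarith) hD1
      have e2 : 0 ≤ (A + B) * D := by positivity
      have e3 : 0 ≤ (A + 1 + M) * τ ^ (1 / a) := by positivity
      linarith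
    have c2 := mul_le_mul_of_nonneg_left c1 (by linarith : 0 ≤ K)
    linarith

/-- The slowest modes are not learned before times of the order `d^a`. -/
lemma exists_err_ge (ha : 1 < a) (hA : 1 ≤ A) {K R : ℝ} (hK : 0 < K) (hR : 0 < R) :
    ∃ c : ℝ, 0 < c ∧ ∃ d₀ : ℕ, ∀ d, d₀ ≤ d →
    ∀ (i₀ : Fin d) (μ : ℝ) (v w₀ : Fin d → ℝ), IsTypical a d A i₀ μ v w₀ →
    ∀ w, IsFlow (eigenvalue a d) v w → w 0 = w₀ → ∀ t, 0 ≤ t → t ≤ K * (d : ℝ) ^ a →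
    ∀ τ, 0 ≤ τ → τ ≤ R * (d : ℝ) ^ a →
      c * d ≤ ∑ i, (w t i - v i) ^ 2 * Real.exp (-16 * eigenvalue a d i * τ) := by
  have ha0 : 0 < a := by linarith
  have ha1 : 0 < a - 1 := by linarith
  have hA0 : 0 < A := by linarith
  obtain ⟨C, M, hC, hM, d₁, hset⟩ := exists_isSettled ha hA
  have hC0 : 0 < C := by linarith
  have hM0 : 0 < M := by linarith
  set α := 1 - 1 / a with hα
  have h1a : 1 / a < 1 := by rw [div_lt_one ha0]; exact ha
  have hα0 : 0 < α := by linarith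
  set B' := 8 * ((100 * M ^ 2 + 16) * (A * (a / (a - 1))) + 100 * M) + 1 with hB'
  set κ := Real.exp (-(9 * (2 ^ a * K))) / 4 with hκ
  have hκ0 : 0 < κ := by positivity
  have hκ1 : κ ≤ 1 / 4 := by
    have : Real.exp (-(9 * (2 ^ a * K))) ≤ 1 := Real.exp_le_one_iff.2 (by
      have : 0 < 9 * (2 ^ a * K) := by positivity
      linarith)
    rw [hκ]; linarith
  set θ := 9 / 20 * κ with hθ
  set r := Real.exp (-(16 * (2 ^ a * R))) with hr
  have hr0 : 0 < r := Real.exp_pos _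
  have hlim := tendsto_const_mul_log hC0
  have ev1 : ∀ᶠ d : ℕ in atTop, B' * (C * Real.log d) ^ (-α) ≤ θ ^ 2 := by
    have : Tendsto (fun d : ℕ => B' * (C * Real.log d) ^ (-α)) atTop (𝓝 (B' * 0)) :=
      ((tendsto_rpow_neg_atTop hα0).comp hlim).const_mul B'
    rw [mul_zero] at this
    exact this.eventually_le_const (by positivity)
  have ev2 := eventually_log_rpow_le (C := 192 * M * 2 ^ a * C) (p := 1) (r := a) (c := 1) one_pos ha0
  have ev3 := tendsto_natCast_atTop_atTop.eventually_ge_atTop (max (3 * A + 2)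
    ((4 + M) * (12 * A / κ ^ 2)))
  obtain ⟨d₂, hd₂⟩ := eventually_atTop.1 (ev1.and (ev2.and ev3))
  refine ⟨r * (κ ^ 2 / (12 * A)), by positivity, max d₁ d₂, ?_⟩
  intro d hd i₀ μ v w₀ hty w hw hw0 t ht htK τ hτ hτR
  obtain ⟨f1, f2, f3⟩ := hd₂ d ((le_max_right _ _).trans hd)
  obtain ⟨hlog, v', hv', q, P, n, h⟩ := hset d ((le_max_left _ _).trans hd) i₀ μ v w₀ hty w hw hw0
  have hd0 := hty.d_pos
  set T := C * Real.log d with hT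
  have hT1 : 1 ≤ T := one_le_mul_of_one_le_of_one_le hC hlog
  have hT0 : 0 < T := by linarith
  have hl : ∀ i : Fin d, 0 < eigenvalue a d i := fun i => eigenvalue_pos i
  have hdA : 3 * A + 2 ≤ (d : ℝ) := (le_max_left _ _).trans f3
  have hs0 : statS (eigenvalue a d) (w 0) ≤ 2 / 3 := by
    rw [hw0]; refine hty.init_small.trans ?_
    rw [div_le_iff₀ hd0]; linarith
  have hv2 : ∀ i, v' i ^ 2 = v i ^ 2 := by rcases hv' with rfl | rfl <;> simp
  have hda : 0 < (d : ℝ) ^ a := by positivity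
  -- the slower half of the modes
  set k := d / 2 with hk
  have hk3 : (d : ℝ) - 1 ≤ 2 * k := by
    have : d ≤ 2 * k + 1 := by omega
    have : (d : ℝ) ≤ 2 * k + 1 := by exact_mod_cast this
    linarith
  have hterm : ∀ i : Fin d, k ≤ (i : ℕ) → κ ^ 2 / 2 * v i ^ 2 - (4 * w₀ i ^ 2 + n i ^ 2) ≤
      (w t i - v i) ^ 2 := by
    intro i hi
    have hli := hl i
    have h1 := eigenvalue_mul_le_of_half_le ha (i := i) (by omega)
    have hTl : 192 * M * (eigenvalue a d i * T) ≤ 1 := by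
      rw [Real.rpow_one, one_mul] at f2
      have e1 : eigenvalue a d i * T * 192 * M * 2 ^ a ≤ 1 * 2 ^ a := by
        calc _ = eigenvalue a d i * (192 * M * 2 ^ a * C * Real.log d) := by rw [hT]; ring
          _ ≤ eigenvalue a d i * (d : ℝ) ^ a := by gcongr
          _ ≤ 1 * 2 ^ a := by rw [one_mul]; exact h1
      have := le_of_mul_le_mul_right e1 (by positivity)
      linarith
    have p1 := sq_nonneg (v i)
    have p2 := sq_nonneg (w₀ i)
    have p3 := sq_nonneg (n i)
    -- up to the time `2 T` such a mode has hardly moved; later `q_i` stays away from `1`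
    rcases le_total t (2 * T) with htT | htT
    · have hlT : 0 < eigenvalue a d i * T := by positivity
      have e2 : eigenvalue a d i * t ≤ 1 / 96 := by
        have e3 : eigenvalue a d i * t ≤ eigenvalue a d i * (2 * T) := by gcongr
        have e4 : 1 * (eigenvalue a d i * T) ≤ M * (eigenvalue a d i * T) := by gcongr; linarith
        linarith
      have e5 := hw.sq_le_sq_err hl hty.norm hs0 ht e2
      rw [hw0] at e5
      have e6 : κ ^ 2 / 2 * v i ^ 2 ≤ 1 / 4 * v i ^ 2 := by
        have := pow_le_pow_left₀ hκ0.le hκ1 2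
        exact mul_le_mul_of_nonneg_right (by linarith) p1
      linarith
    · have hlt : eigenvalue a d i * (t - T) ≤ 2 ^ a * K := by
        calc eigenvalue a d i * (t - T) ≤ eigenvalue a d i * (K * (d : ℝ) ^ a) := by
              gcongr; linarith
          _ = eigenvalue a d i * (d : ℝ) ^ a * K := by ring
          _ ≤ 2 ^ a * K := by gcongr
      have hexp : Real.exp (-(9 * (2 ^ a * K))) ≤
          Real.exp (-(9 * eigenvalue a d i * (t - T))) := Real.exp_le_exp.2 (by linarith)
      have hq := h.q_le_one_sub (θ := θ) (x₀ := T) (X := t - T) hT0 (by linarith) (by positivity)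
        (by rw [hθ]; linarith) (fun x hx => by
          refine (statL_decay ha hA (hty.of_sign hv') h (hT1.trans hx)).trans (le_trans ?_ f1)
          gcongr ?_ * ?_
          exact Real.rpow_le_rpow_of_nonpos hT0 hx (by linarith)) (i := i) (by linarith)
        (by refine le_trans (le_of_eq ?_) (mul_le_mul_of_nonneg_left hexp (by norm_num : (0:ℝ) ≤ 9))
            rw [hθ, hκ]; ring)
      have hq1 : q (t - T) i ≤ 1 - κ := by rw [hκ]; linarith
      have hq0 := h.q_nonneg (t - T) (by linarith) i
      have hE := h.exp_le_one (t := t - T) (by linarith) i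
      have hE2 : Real.exp (eigenvalue a d i * P (t - T)) ^ 2 ≤ 1 :=
        pow_le_one₀ (Real.exp_pos _).le hE
      have hw1 := h.split.eq (t - T) (by linarith) i
      simp only [sub_add_cancel] at hw1
      set E := Real.exp (eigenvalue a d i * P (t - T)) with hEdef
      have hEn : E ^ 2 * n i ^ 2 ≤ n i ^ 2 := mul_le_of_le_one_left p3 hE2
      have key : ∀ z : ℝ, κ ^ 2 ≤ z ^ 2 → κ ^ 2 / 2 * v i ^ 2 - n i ^ 2 ≤ (z * v' i + E * n i) ^ 2 := by
        intro z hz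
        have := mul_le_mul_of_nonneg_right hz p1
        have e := half_sq_sub_sq_le (z * v' i) (E * n i)
        rw [mul_pow, mul_pow, hv2 i] at e
        linarith
      rcases hv' with rfl | rfl
      · have := key (q (t - T) i - 1) (by
          rw [← neg_sq (_ - 1)]; exact pow_le_pow_left₀ hκ0.le (by linarith) 2)
        rw [hw1]
        have e : q (t - T) i * v' i + E * n i - v' i = (q (t - T) i - 1) * v' i + E * n i := by ring
        rw [e]; linarith
      · have := key (q (t - T) i + 1) (pow_le_pow_left₀ hκ0.le (by linarith) 2)
        rw [hw1]
        have e : q (t - T) i * -v i + E * n i - v i = (q (t - T) i + 1) * -v i + E * n i := by ring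
        rw [e]; linarith
  have hexp : ∀ i : Fin d, k ≤ (i : ℕ) → r ≤ Real.exp (-16 * eigenvalue a d i * τ) := by
    intro i hi
    have hli := hl i
    have h1 := eigenvalue_mul_le_of_half_le ha (i := i) (by omega)
    refine Real.exp_le_exp.2 ?_
    have : eigenvalue a d i * τ ≤ 2 ^ a * R := by
      calc eigenvalue a d i * τ ≤ eigenvalue a d i * (R * (d : ℝ) ^ a) := by gcongr
        _ = eigenvalue a d i * (d : ℝ) ^ a * R := by ring
        _ ≤ 2 ^ a * R := by gcongr
    linarith
  have hblock := hty.block k (by linarith) (by omega)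
  have hnn : ∑ i, (4 * w₀ i ^ 2 + n i ^ 2) ≤ 4 + M := by
    rw [Finset.sum_add_distrib, ← Finset.mul_sum]
    have := hty.init
    have := h.n_le
    linarith
  have hmain : r * (κ ^ 2 / 2 * (k / A) - (4 + M)) ≤
      ∑ i, (w t i - v i) ^ 2 * Real.exp (-16 * eigenvalue a d i * τ) := by
    calc r * (κ ^ 2 / 2 * (k / A) - (4 + M))
        ≤ r * (κ ^ 2 / 2 * (∑ i : Fin d, if k ≤ (i : ℕ) ∧ (i : ℕ) < 2 * k then v i ^ 2 else 0)
          - ∑ i, (4 * w₀ i ^ 2 + n i ^ 2)) := by gcongr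
      _ = ∑ i : Fin d, r * (κ ^ 2 / 2 * (if k ≤ (i : ℕ) ∧ (i : ℕ) < 2 * k then v i ^ 2 else 0)
          - (4 * w₀ i ^ 2 + n i ^ 2)) := by
        rw [← Finset.mul_sum, Finset.sum_sub_distrib, ← Finset.mul_sum]
      _ ≤ _ := by
        refine Finset.sum_le_sum fun i _ => ?_
        have hE0 := Real.exp_pos (-16 * eigenvalue a d i * τ)
        have p2 : 0 ≤ 4 * w₀ i ^ 2 + n i ^ 2 := by positivity
        split_ifs with hi
        · have h1 := hterm i hi.1
          have h2 := hexp i hi.1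
          calc _ ≤ r * (w t i - v i) ^ 2 := by gcongr
            _ = (w t i - v i) ^ 2 * r := mul_comm _ _
            _ ≤ _ := by gcongr
        · have : 0 ≤ (w t i - v i) ^ 2 * Real.exp (-16 * eigenvalue a d i * τ) := by positivity
          have : 0 ≤ r * (4 * w₀ i ^ 2 + n i ^ 2) := by positivity
          linarith
  refine le_trans ?_ hmain
  rw [mul_assoc]
  gcongr
  have g1 : (4 + M) ≤ κ ^ 2 / (12 * A) * d := by
    have := (le_max_right _ _).trans f3
    calc 4 + M = κ ^ 2 / (12 * A) * ((4 + M) * (12 * A / κ ^ 2)) := by field_simp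
      _ ≤ _ := by gcongr
  have g2 : κ ^ 2 / (12 * A) * d * 2 ≤ κ ^ 2 / 2 * (k / A) := by
    have : (d : ℝ) ≤ 3 * k := by linarith
    calc κ ^ 2 / (12 * A) * d * 2 ≤ κ ^ 2 / (12 * A) * (3 * k) * 2 := by gcongr
      _ = κ ^ 2 / 2 * (k / A) := by field_simp; ring
  linarith

end IsTypical

end PhaseRetrieval

namespace PhaseRetrieval

open MeasureTheory ProbabilityTheory Set Matrix Filter Topology

/-! ### Comparison of the mean squared error with its linearization -/

section Deviation

variable {d : ℕ} {l v : Fin d → ℝ} {w : ℝ → Fin d → ℝ}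

/-- Every flow of small loss with `u > 0` is in the basin, with the trivial splitting `q(0) = 0`.
The constant `M` is not uniform. -/
lemma IsFlow.exists_isSettled_zero (h : IsFlow l v w) (hl : ∀ i, 0 < l i) (hl1 : ∀ i, l i ≤ 1)
    (hv : ∑ i, l i * v i ^ 2 = 1) (hL : statL l v (w 0) ≤ 1 / 100) (hu : 0 < statU l v (w 0)) :
    ∃ q P n M, IsSettled l v w q P n M 0 := by
  obtain ⟨q, P, hs⟩ := h.isSettled (q₀ := 0) (n := w 0) (M := max 9 (∑ i, w 0 i ^ 2)) (T := 0)
    hl hl1 hv hL hu (fun i => by simp) (fun i => le_rfl)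
    (fun i => le_trans (by simp) (le_max_left _ _)) (fun i => by simp) (le_max_right _ _)
    (le_max_left _ _)
  exact ⟨q, P, w 0, _, hs⟩

lemma statL_le_of_mem_Icc {ε : ℝ} (hε0 : 0 ≤ ε) (hε1 : ε ≤ 1) {w : Fin d → ℝ}
    (hu : statU l v w ∈ Icc (1 - ε) 1) (hs : statS l w ∈ Icc (1 - ε) 1) :
    statL l v w ≤ 11 * ε := by
  obtain ⟨hu0, -⟩ := hu
  obtain ⟨hs0, hs1⟩ := hs
  have h1 : (1 - statS l w) ^ 2 ≤ ε := by nlinarith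
  have h2 : (1 - ε) ^ 2 ≤ statU l v w ^ 2 := pow_le_pow_left₀ (by linarith) hu0 2
  unfold statL
  nlinarith [sq_nonneg ε]

/-- `3 u (1 - s)` is the inner product of `v` with the rescaled gradient. -/
lemma sq_mul_one_sub_statS_le (hv : ∑ i, l i * v i ^ 2 = 1) (w : Fin d → ℝ) :
    (3 * statU l v w * (1 - statS l w)) ^ 2 ≤ (∑ i, v i ^ 2) * gradSq l v w := by
  have e : ∑ i, v i * (l i * ((3 * statS l w - 1) * w i - 2 * statU l v w * v i)) =
      -(3 * statU l v w * (1 - statS l w)) := by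
    have : ∀ A B : ℝ, ∑ i, v i * (l i * (A * w i - B * v i)) = A * statU l v w - B * 1 := by
      intro A B
      rw [← hv, statU, Finset.mul_sum, Finset.mul_sum, ← Finset.sum_sub_distrib]
      exact Finset.sum_congr rfl fun i _ => by ring
    rw [this]; ring
  have h := Finset.sum_mul_sq_le_sq_mul_sq Finset.univ v
    fun i => l i * ((3 * statS l w - 1) * w i - 2 * statU l v w * v i)
  rw [e, neg_sq] at h
  simp only [mul_pow (l _)] at h
  exact h

end Deviation

namespace IsTypical

variable {a A : ℝ}

lemma sum_sq_le {d : ℕ} {i₀ : Fin d} {μ : ℝ} {v w₀ : Fin d → ℝ}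
    (h : IsTypical a d A i₀ μ v w₀) : ∑ i, v i ^ 2 ≤ A * d := by
  refine le_trans (le_of_eq ?_) (h.head d le_rfl)
  exact Finset.sum_congr rfl fun i _ => (if_pos i.2).symm

/-- A typical flow can only be `ε`-converged after a time of the order `ε^{-a/(a-1)}`. -/
lemma exists_time_ge (ha : 1 < a) (hA : 1 ≤ A) {c : ℝ} (hc : 0 < c) :
    ∃ C₆ c₅ : ℝ, 0 < C₆ ∧ 0 < c₅ ∧ ∃ d₀ : ℕ, ∀ d, d₀ ≤ d →
    ∀ (i₀ : Fin d) (μ : ℝ) (v w₀ : Fin d → ℝ), IsTypical a d A i₀ μ v w₀ →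
    ∀ w, IsFlow (eigenvalue a d) v w → w 0 = w₀ →
    ∀ ε, c * (d : ℝ) ^ (-(a - 1) / 2) ≤ ε → ε ≤ (d : ℝ) ^ (-(1 - 1 / a)) → ∀ t, 0 ≤ t →
    ∑ i, eigenvalue a d i * (w t i - v i) ^ 2 ≤ 2 * ε →
      t ^ (-(1 - 1 / a)) ≤ C₆ * ε ∧ c₅ * d ≤ t := by
  have ha0 : 0 < a := by linarith
  have ha1 : 0 < a - 1 := by linarith
  have hA0 : 0 < A := by linarith
  set α := 1 - 1 / a with hα
  have h1a : 1 / a < 1 := by rw [div_lt_one ha0]; exact ha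
  have h1a0 : 0 < 1 / a := by positivity
  have hα0 : 0 < α := by linarith
  have haα : a * α = a - 1 := by rw [hα]; field_simp
  obtain ⟨c₂, c₃, t₁, hc₂, hc₃, ht₁, hslow⟩ := sum_slow_ge ha hA (c := 1 / 96) (by norm_num)
    (by norm_num)
  set t₂ := max t₁ ((1 / (3 * c₂)) ^ a) with ht₂
  set c₅' := (16 / c₂) ^ (-(1 / α)) with hc₅'
  have hc₅'0 : 0 < c₅' := by positivity
  have ev1 : ∀ᶠ d : ℕ in atTop, t₂ < c₅' * d :=
    (tendsto_natCast_atTop_atTop.const_mul_atTop hc₅'0).eventually_gt_atTop _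
  have ev2 : ∀ᶠ d : ℕ in atTop, t₂ < c₃ * (d : ℝ) ^ a :=
    (((tendsto_rpow_atTop ha0).comp tendsto_natCast_atTop_atTop).const_mul_atTop
      hc₃).eventually_gt_atTop _
  have ev3 := tendsto_natCast_atTop_atTop.eventually_ge_atTop (2 * A)
  obtain ⟨d₂, hd₂⟩ := eventually_atTop.1 (ev1.and (ev2.and ev3))
  refine ⟨16 / c₂ + c₃ ^ (-α) / c, min c₅' c₃, by positivity, by positivity, d₂, ?_⟩
  intro d hd i₀ μ v w₀ hty w hw hw0 ε hεd hε1 t ht herr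
  obtain ⟨f1, f2, f3⟩ := hd₂ d hd
  have hd0 := hty.d_pos
  have hd1 : 1 ≤ (d : ℝ) := by linarith
  have hε0 : 0 < ε := lt_of_lt_of_le (by positivity) hεd
  have hl : ∀ i : Fin d, 0 < eigenvalue a d i := fun i => eigenvalue_pos i
  have hs0 : statS (eigenvalue a d) (w 0) ≤ 2 / 3 := by
    rw [hw0]; refine hty.init_small.trans ?_
    rw [div_le_iff₀ hd0]; linarith
  have ht₂1 : 1 ≤ t₂ := ht₁.trans (le_max_left _ _)
  rcases le_or_gt (max t t₂) (c₃ * (d : ℝ) ^ a) with hle | hgt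
  · set t' := max t t₂ with ht'
    have ht'2 : t₂ ≤ t' := le_max_right _ _
    have ht'0 : 0 < t' := by linarith
    have h1 := hslow d i₀ μ v w₀ hty t' ((le_max_left _ _).trans ht'2) hle
    have h2 := hw.err_ge hl hty.norm hs0 (by rw [hw0]; exact hty.init) ht (le_max_left t t₂) ht'0
    have h3 : 1 / (24 * t') ≤ c₂ / 8 * t' ^ (-α) := by
      have e1 : 1 / (3 * c₂) ≤ t' ^ (1 / a) := by
        have : (1 / (3 * c₂)) ^ a ≤ t' := (le_max_right _ _).trans ht'2
        calc 1 / (3 * c₂) = ((1 / (3 * c₂)) ^ a) ^ (1 / a) := by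
              rw [← Real.rpow_mul (by positivity), mul_one_div_cancel ha0.ne', Real.rpow_one]
          _ ≤ _ := Real.rpow_le_rpow (by positivity) this h1a0.le
      have e2 : t' ^ (-α) = t' ^ (1 / a) / t' := by
        rw [← Real.rpow_sub_one ht'0.ne']; congr 1; rw [hα]; ring
      rw [e2]
      calc 1 / (24 * t') = c₂ / 8 * (1 / (3 * c₂) / t') := by field_simp; norm_num
        _ ≤ _ := by gcongr
    have h4 : t' ^ (-α) ≤ 16 / c₂ * ε := by
      rw [div_mul_eq_mul_div, le_div_iff₀ hc₂]
      linarith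
    have h5 : c₅' * d ≤ t' := by
      have e1 : t' ^ (-α) ≤ (c₅' * d) ^ (-α) := by
        rw [hc₅', Real.mul_rpow (by positivity) hd0.le, ← Real.rpow_mul (by positivity)]
        have : -(1 / α) * -α = 1 := by field_simp
        rw [this, Real.rpow_one]
        exact h4.trans (by gcongr)
      by_contra! hlt
      exact absurd e1 (not_le.2 (Real.rpow_lt_rpow_of_neg ht'0 hlt (by linarith)))
    have htt : t' = t := by
      rcases max_choice t t₂ with hm | hm
      · exact hm
      · rw [ht', hm] at h5; linarith
    rw [htt] at h4 h5
    refine ⟨h4.trans ?_, le_trans ?_ h5⟩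
    · gcongr; have : 0 < c₃ ^ (-α) / c := by positivity
      linarith
    · gcongr; exact min_le_left _ _
  · have htt : c₃ * (d : ℝ) ^ a < t := by
      rcases lt_max_iff.1 hgt with h | h
      · exact h
      · linarith
    have hda : (d : ℝ) ≤ (d : ℝ) ^ a := by
      nth_rewrite 1 [← Real.rpow_one (d : ℝ)]
      exact Real.rpow_le_rpow_of_exponent_le hd1 ha.le
    refine ⟨?_, ?_⟩
    · have e1 : t ^ (-α) ≤ (c₃ * (d : ℝ) ^ a) ^ (-α) :=
        Real.rpow_le_rpow_of_nonpos (by positivity) htt.le (by linarith)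
      rw [Real.mul_rpow hc₃.le (by positivity), ← Real.rpow_mul hd0.le] at e1
      have e2 : (d : ℝ) ^ (a * -α) ≤ (d : ℝ) ^ (-(a - 1) / 2) :=
        Real.rpow_le_rpow_of_exponent_le hd1 (by linarith)
      have e3 : (d : ℝ) ^ (-(a - 1) / 2) ≤ ε / c := by rw [le_div_iff₀ hc]; linarith
      calc t ^ (-α) ≤ c₃ ^ (-α) * (ε / c) := e1.trans (by gcongr; exact e2.trans e3)
        _ = c₃ ^ (-α) / c * ε := by ring
        _ ≤ _ := by
          gcongr; have : 0 < 16 / c₂ := by positivity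
          linarith
    · refine le_trans ?_ htt.le
      gcongr
      exact min_le_right _ _

/-- Deviation of the summary statistics from their limit after an `ε`-convergence time. For
`ε ≥ d^{-(1 - 1/a)}` it follows from the monotonicity of the loss, for smaller `ε` from the decay
of the gradient. -/
lemma exists_deviation_le (ha : 1 < a) (hA : 1 ≤ A) {c : ℝ} (hc : 0 < c) :
    ∃ C : ℝ, 0 < C ∧ ∃ d₀ : ℕ, ∀ d, d₀ ≤ d →
    ∀ (i₀ : Fin d) (μ : ℝ) (v w₀ : Fin d → ℝ), IsTypical a d A i₀ μ v w₀ →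
    ∀ w, IsFlow (eigenvalue a d) v w → w 0 = w₀ →
    ∀ ε, c * (d : ℝ) ^ (-(a - 1) / 2) ≤ ε → ε ≤ 1 / 1100 → ∀ T₂, 0 ≤ T₂ →
    statU (eigenvalue a d) v (w T₂) ∈ Icc (1 - ε) 1 → statS (eigenvalue a d) (w T₂) ∈ Icc (1 - ε) 1 →
    ∀ t, T₂ ≤ t → |1 - statS (eigenvalue a d) (w t)| ≤ C * ε * (d : ℝ) ^ ((1 - 1 / a) / 2) ∧
      |1 - statU (eigenvalue a d) v (w t)| ≤ C * ε * (d : ℝ) ^ ((1 - 1 / a) / 2) := by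
  have ha0 : 0 < a := by linarith
  have ha1 : 0 < a - 1 := by linarith
  have hA0 : 0 < A := by linarith
  obtain ⟨C, M, hC, hM, d₁, hset⟩ := exists_isSettled ha hA
  obtain ⟨C₆, c₅, hC₆, hc₅, d₂, htime⟩ := exists_time_ge ha hA hc
  set α := 1 - 1 / a with hα
  have h1a : 1 / a < 1 := by rw [div_lt_one ha0]; exact ha
  have h1a0 : 0 < 1 / a := by positivity
  have hα0 : 0 < α := by linarith
  have hα1 : α < 1 := by linarith
  set B' := 8 * ((100 * M ^ 2 + 16) * (A * (a / (a - 1))) + 100 * M) + 1 with hB'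
  have hB'0 : 0 < B' := by positivity
  set C₇ := A * (4 * B' * (C₆ ^ 2 * c₅ ^ (-(1 - α)))) with hC₇
  have hC₇0 : 0 < C₇ := by positivity
  have ev := eventually_log_add_rpow_le (A := 2 * C) (B := 4) (p := 0) (r := 1) (c := c₅) hc₅
    one_pos one_pos
  obtain ⟨d₃, hd₃⟩ := eventually_atTop.1 ev
  refine ⟨C₇ + 2 + 11, by positivity, max (max d₁ d₂) d₃, ?_⟩
  intro d hd i₀ μ v w₀ hty w hw hw0 ε hεd hε1 T₂ hT₂ hu hs t ht
  have f1 := hd₃ d ((le_max_right _ _).trans hd)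
  obtain ⟨hlog, v', hv', q, P, n, h⟩ :=
    hset d ((le_max_left _ _).trans ((le_max_left _ _).trans hd)) i₀ μ v w₀ hty w hw hw0
  have hd0 := hty.d_pos
  have hd1 : 1 ≤ (d : ℝ) := by exact_mod_cast (by exact_mod_cast hd0 : 0 < d)
  have hε0 : 0 < ε := lt_of_lt_of_le (by positivity) hεd
  set T := C * Real.log d with hT
  have hT1 : 1 ≤ T := one_le_mul_of_one_le_of_one_le hC hlog
  have hl : ∀ i : Fin d, 0 < eigenvalue a d i := fun i => eigenvalue_pos i
  have hL2 := statL_le_of_mem_Icc hε0.le (by linarith) hu hs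
  have hup : 0 < statU (eigenvalue a d) v (w T₂) := by linarith [hu.1]
  obtain ⟨q', P', n', M', hz⟩ := (hw.shift hT₂).exists_isSettled_zero hl
    (fun i => eigenvalue_le_one ha i) hty.norm (by rw [zero_add]; linarith) (by rwa [zero_add])
  have hLt : statL (eigenvalue a d) v (w t) ≤ 11 * ε := (hw.statL_anti hT₂ ht).trans hL2
  have hLge := statL_ge hl hty.norm (w t)
  have herr := hz.err_le (t := t - T₂) (by linarith)
  have herr0 := hz.err_nonneg (t - T₂)
  have hut := hz.statU_ge (t := t - T₂) (by linarith)
  rw [sub_add_cancel] at herr herr0 hut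
  set D := (d : ℝ) ^ (α / 2) with hD
  have hD1 : 1 ≤ D := Real.one_le_rpow hd1 (by positivity)
  have hD2 : D ^ 2 = (d : ℝ) ^ α := by
    rw [hD, ← Real.rpow_natCast, ← Real.rpow_mul hd0.le]; congr 1; push_cast; ring
  have hεD : ε ≤ ε * D := le_mul_of_one_le_right hε0.le hD1
  have hkey : |1 - statS (eigenvalue a d) (w t)| ≤ (C₇ + 2) * ε * D := by
    rcases le_total ((d : ℝ) ^ (-α)) ε with hcase | hcase
    · -- here `1 ≤ ε d^α`, so `|1 - s| ≤ 2 √ε ≤ 2 ε d^{α/2}`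
      have e1 : 1 ≤ ε * D ^ 2 := by
        rw [hD2]
        calc 1 = (d : ℝ) ^ (-α) * (d : ℝ) ^ α := by
              rw [← Real.rpow_add hd0, neg_add_cancel, Real.rpow_zero]
          _ ≤ _ := by gcongr
      have e2 : |1 - statS (eigenvalue a d) (w t)| ≤ 2 * (ε * D) := by
        refine abs_le_of_sq_le_sq ?_ (by positivity)
        have e3 : ε ≤ ε * (ε * D ^ 2) := le_mul_of_one_le_right hε0.le e1
        calc _ ≤ 4 * (ε * (ε * D ^ 2)) := by linarith
          _ = _ := by ring
      have : 0 ≤ C₇ * ε * D := by positivity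
      linarith
    · -- Here `T₂` is at least of the order `ε^{-1/α}` and `d`, far beyond the time of entering the
      -- basin, so that `|∇L|²` is of the order `T₂^{-α-1}`.
      have herr2 : ∑ i, eigenvalue a d i * (w T₂ i - v i) ^ 2 ≤ 2 * ε := by
        rw [sum_err_eq hty.norm]; linarith [hu.1, hs.2]
      obtain ⟨g1, g2⟩ := htime d ((le_max_right _ _).trans ((le_max_left _ _).trans hd)) i₀ μ v w₀
        hty w hw hw0 ε hεd hcase T₂ hT₂ herr2
      have g3 : 2 * T + 4 ≤ T₂ := by
        rw [Real.rpow_zero, Real.rpow_one] at f1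
        have : 2 * C * Real.log d = 2 * T := by rw [hT]; ring
        linarith
      have hT₂0 : 0 < T₂ := by linarith only [g3, hT1]
      have g3' : 2 ≤ T₂ - T := by linarith only [g3, hT1]
      have g3'' : T₂ / 2 ≤ T₂ - T := by linarith only [g3, hT1]
      have g3t : T₂ - T ≤ t - T := by linarith only [ht]
      -- the flow is in the basin of one sign only
      have hvv : v' = v := by
        rcases hv' with h1 | h1
        · exact h1
        · have h2 := h.statU_pos_of_nonneg (t := T₂ - T) (by linarith only [g3'])
          rw [sub_add_cancel, h1] at h2
          have : statU (eigenvalue a d) (fun i => -v i) (w T₂) = -statU (eigenvalue a d) v (w T₂) := by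
            simp [statU]
          linarith
      rw [hvv] at h
      have g4 := h.gradSq_decay hα0 hα1 hB'0.le
        (fun x hx => statL_decay ha hA hty h hx) (t := T₂ - T) g3'
      have g5 := h.gradSq_anti (r := T₂ - T) (t := t - T) (by linarith only [g3']) g3t
      rw [sub_add_cancel] at g4 g5
      rw [sub_add_cancel] at g5
      have g6 : (T₂ - T) ^ (-α - 1) ≤ 4 * T₂ ^ (-α - 1) := by
        have e1 : (T₂ - T) ^ (-α - 1) ≤ (T₂ / 2) ^ (-α - 1) :=
          Real.rpow_le_rpow_of_nonpos (by positivity) g3'' (by linarith only [hα0])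
        have e2 : (2 : ℝ) ^ (α + 1) ≤ 4 := by
          calc (2 : ℝ) ^ (α + 1) ≤ 2 ^ (2 : ℝ) :=
                Real.rpow_le_rpow_of_exponent_le (by norm_num) (by linarith)
            _ = 4 := by norm_num
        have e3 : (T₂ / 2) ^ (-α - 1) = 2 ^ (α + 1) * T₂ ^ (-α - 1) := by
          rw [Real.div_rpow hT₂0.le (by norm_num), div_eq_mul_inv, ← Real.rpow_neg (by norm_num),
            mul_comm]
          congr 2; ring
        rw [e3] at e1
        exact e1.trans (by gcongr)
      have g7 : T₂ ^ (-α - 1) ≤ C₆ ^ 2 * ε ^ 2 * (c₅ ^ (-(1 - α)) * (d : ℝ) ^ (-(1 - α))) := by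
        have e1 : T₂ ^ (-α - 1) = (T₂ ^ (-α)) ^ 2 * T₂ ^ (-(1 - α)) := by
          rw [← Real.rpow_natCast, ← Real.rpow_mul hT₂0.le, ← Real.rpow_add hT₂0]
          congr 1; push_cast; ring
        have e2 : T₂ ^ (-(1 - α)) ≤ (c₅ * d) ^ (-(1 - α)) :=
          Real.rpow_le_rpow_of_nonpos (by positivity) g2 (by linarith)
        have e3 : (T₂ ^ (-α)) ^ 2 ≤ (C₆ * ε) ^ 2 := pow_le_pow_left₀ (by positivity) g1 2
        rw [Real.mul_rpow hc₅.le hd0.le] at e2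
        rw [mul_pow] at e3
        rw [e1]; gcongr
      have g8 : gradSq (eigenvalue a d) v (w t) ≤ B' * (4 * (C₆ ^ 2 * ε ^ 2 *
          (c₅ ^ (-(1 - α)) * (d : ℝ) ^ (-(1 - α))))) := by
        refine g5.trans (g4.trans ?_)
        gcongr
        exact g6.trans (by gcongr)
      have g9 := sq_mul_one_sub_statS_le hty.norm (w t)
      have hG0 : 0 ≤ gradSq (eigenvalue a d) v (w t) := Finset.sum_nonneg fun i _ => by positivity
      have g10 : (1 - statS (eigenvalue a d) (w t)) ^ 2 ≤ A * d * gradSq (eigenvalue a d) v (w t) := by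
        have e1 := mul_le_mul_of_nonneg_right hty.sum_sq_le hG0
        have e2 : 1 * (1 - statS (eigenvalue a d) (w t)) ^ 2 ≤
            (3 * statU (eigenvalue a d) v (w t)) ^ 2 * (1 - statS (eigenvalue a d) (w t)) ^ 2 := by
          gcongr; exact one_le_pow₀ (by linarith)
        rw [mul_pow] at g9
        linarith
      have g11 : (d : ℝ) * (d : ℝ) ^ (-(1 - α)) = D ^ 2 := by
        rw [hD2, ← Real.rpow_one_add' hd0.le (by linarith)]; congr 1; ring
      have g12 : (1 - statS (eigenvalue a d) (w t)) ^ 2 ≤ ((C₇ + 1) * (ε * D)) ^ 2 := by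
        calc _ ≤ A * d * (B' * (4 * (C₆ ^ 2 * ε ^ 2 *
              (c₅ ^ (-(1 - α)) * (d : ℝ) ^ (-(1 - α)))))) := g10.trans (by gcongr)
          _ = C₇ * (ε ^ 2 * (d * (d : ℝ) ^ (-(1 - α)))) := by rw [hC₇]; ring
          _ = C₇ * (ε * D) ^ 2 := by rw [g11]; ring
          _ ≤ (C₇ + 1) ^ 2 * (ε * D) ^ 2 := by
            have : C₇ ≤ (C₇ + 1) ^ 2 := by linarith [sq_nonneg C₇]
            gcongr
          _ = _ := by ring
      have g13 := abs_le_of_sq_le_sq g12 (by positivity)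
      have : 0 ≤ ε * D := by positivity
      linarith
  have h0 : 0 ≤ ε * D := by positivity
  refine ⟨hkey.trans (by linarith), ?_⟩
  have hk := abs_le.1 hkey
  have hC0 : 0 ≤ C₇ * (ε * D) := by positivity
  rw [abs_le]; constructor <;> linarith

/-- Comparison of the squared error with its spectral linearization. -/
lemma exists_mse_comparison (ha : 1 < a) (hA : 1 ≤ A) {c K : ℝ} (hc : 0 < c) (hK : 0 < K) :
    ∃ C : ℝ, 0 < C ∧ ∃ d₀ : ℕ, ∀ d, d₀ ≤ d →
    ∀ (i₀ : Fin d) (μ : ℝ) (v w₀ : Fin d → ℝ), IsTypical a d A i₀ μ v w₀ →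
    ∀ w, IsFlow (eigenvalue a d) v w → w 0 = w₀ →
    ∀ ε, c * (d : ℝ) ^ (-(a - 1) / 2) ≤ ε → ε < 1 → ∀ T₂, 0 ≤ T₂ → T₂ ≤ K * (d : ℝ) ^ a →
    statU (eigenvalue a d) v (w T₂) ∈ Icc (1 - ε) 1 → statS (eigenvalue a d) (w T₂) ∈ Icc (1 - ε) 1 →
    ∀ τ, 0 ≤ τ →
      |∑ i, (w (T₂ + τ) i - v i) ^ 2
          - ∑ i, (w T₂ i - v i) ^ 2 * Real.exp (-16 * eigenvalue a d i * τ)| ≤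
        C * ε * ∑ i, (w T₂ i - v i) ^ 2 * Real.exp (-16 * eigenvalue a d i * τ)
          + C * (ε ^ 2 * τ ^ 2 / d * ∑ i, eigenvalue a d i ^ 2 * v i ^ 2) ∧
      0 < ∑ i, (w T₂ i - v i) ^ 2 ∧
      (∑ i, (w T₂ i - v i) ^ 2 * Real.exp (-16 * eigenvalue a d i * τ)) * d ≤
        C * (∑ i, (w T₂ i - v i) ^ 2) * ∑ i, Real.exp (-16 * eigenvalue a d i * τ) := by
  have ha0 : 0 < a := by linarith
  have ha1 : 0 < a - 1 := by linarith
  have hA0 : 0 < A := by linarith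
  have h1a : 1 / a < 1 := by rw [div_lt_one ha0]; exact ha
  have h1a0 : 0 < 1 / a := by positivity
  obtain ⟨K₁, hK₁, d₁, hmaj⟩ := exists_majorant ha hA
  obtain ⟨r, hr, d₂, hlow⟩ := exists_err_ge ha hA hK (R := 1 / c) (by positivity)
  obtain ⟨D, hD, d₃, hdev⟩ := exists_deviation_le ha hA hc
  have hK₁0 : 0 < K₁ := by linarith
  set c₀ := ((a - 1) / a) ^ 2 / A with hc₀
  have hc₀0 : 0 < c₀ := by positivity
  set k := c ^ (-(1 / a)) with hk
  have hk0 : 0 < k := by positivity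
  set C₁ := 128 * D * K₁ * (k + 1) / r with hC₁
  set C₂ := 1100 * K₁ / r with hC₂
  set C₃ := K₁ / c₀ with hC₃
  set C₄ := K₁ / r with hC₄
  have p1 : 0 < C₁ := by positivity
  have p2 : 0 < C₂ := by positivity
  have p3 : 0 < C₃ := by positivity
  have p4 : 0 < C₄ := by positivity
  refine ⟨C₁ + C₂ + C₃ + C₄, by positivity, max (max d₁ d₂) d₃, ?_⟩
  intro d hd i₀ μ v w₀ hty w hw hw0 ε hεd hε1 T₂ hT₂ hT₂K hu hs τ hτ
  obtain ⟨U, hU1, hU2, hU3, hU4⟩ :=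
    hmaj d ((le_max_left _ _).trans ((le_max_left _ _).trans hd)) i₀ μ v w₀ hty w hw hw0
  have hlow' := hlow d ((le_max_right _ _).trans ((le_max_left _ _).trans hd)) i₀ μ v w₀ hty w hw
    hw0 T₂ hT₂ hT₂K
  have hdev' := hdev d ((le_max_right _ _).trans hd) i₀ μ v w₀ hty w hw hw0 ε hεd
  have hd0 := hty.d_pos
  have hd1 : 1 ≤ (d : ℝ) := by exact_mod_cast (by exact_mod_cast hd0 : 0 < d)
  have hε0 : 0 < ε := lt_of_lt_of_le (by positivity) hεd
  have hl : ∀ i : Fin d, 0 < eigenvalue a d i := fun i => eigenvalue_pos i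
  have hexp1 : ∀ i : Fin d, Real.exp (-16 * eigenvalue a d i * τ) ≤ 1 := fun i =>
    Real.exp_le_one_iff.2 (by have := hl i
                              have : 0 ≤ eigenvalue a d i * τ := by positivity
                              linarith)
  have hUsum : ∑ i, U i ≤ K₁ * d := by
    refine le_trans (le_of_eq ?_) (hU3 d le_rfl)
    exact Finset.sum_congr rfl fun i _ => (if_pos (Nat.le_add_left _ _)).symm
  set E := ∑ i, (w T₂ i - v i) ^ 2 with hE
  set X := ∑ i, (w T₂ i - v i) ^ 2 * Real.exp (-16 * eigenvalue a d i * τ) with hX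
  set Y := ∑ i, (w (T₂ + τ) i - v i) ^ 2 with hY
  set V := ∑ i, eigenvalue a d i ^ 2 * v i ^ 2 with hV
  have hV0 : c₀ ≤ V := by
    have h1 : eigenvalue a d i₀ ^ 2 * v i₀ ^ 2 ≤ V :=
      Finset.single_le_sum (f := fun i => eigenvalue a d i ^ 2 * v i ^ 2)
        (fun i _ => by positivity) (Finset.mem_univ i₀)
    have h2 := le_eigenvalue ha i₀
    rw [hty.index] at h2
    simp only [Nat.cast_zero, zero_add, Real.one_rpow, mul_one] at h2
    refine le_trans ?_ h1
    rw [hc₀, div_eq_mul_one_div]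
    have := hty.top
    gcongr
  have hX0 : 0 ≤ X := Finset.sum_nonneg fun i _ => by positivity
  have hY0 : 0 ≤ Y := Finset.sum_nonneg fun i _ => by positivity
  have hXU : X ≤ K₁ * d := le_trans (Finset.sum_le_sum fun i _ => by
    exact (mul_le_of_le_one_right (sq_nonneg _) (hexp1 i)).trans (hU2 T₂ hT₂ i)) hUsum
  have hYU : Y ≤ K₁ * d := le_trans (Finset.sum_le_sum fun i _ => by
    exact hU2 (T₂ + τ) (by linarith) i) hUsum
  have hElow : r * d ≤ E := by
    have := hlow' 0 le_rfl (by positivity)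
    simpa using this
  refine ⟨?_, lt_of_lt_of_le (by positivity) hElow, ?_⟩
  · have hYX : |Y - X| ≤ K₁ * d := by rw [abs_le]; constructor <;> linarith
    set Z := ε ^ 2 * τ ^ 2 / d * V with hZ
    have hZ0 : 0 ≤ Z := by positivity
    rcases le_total (d / ε) τ with hcase | hcase
    · -- the quadratic term alone dominates
      have h1 : (d : ℝ) ≤ ε * τ := by rw [div_le_iff₀ hε0] at hcase; linarith
      have h2 : (d : ℝ) * c₀ ≤ Z := by
        have h3 : (d : ℝ) ^ 2 ≤ (ε * τ) ^ 2 := pow_le_pow_left₀ hd0.le h1 2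
        calc (d : ℝ) * c₀ = (d : ℝ) ^ 2 / d * c₀ := by field_simp
          _ ≤ (ε * τ) ^ 2 / d * V := by gcongr
          _ = Z := by rw [hZ, mul_pow]
      have h4 : K₁ * d ≤ C₃ * Z := by
        calc K₁ * d = C₃ * (d * c₀) := by rw [hC₃]; field_simp
          _ ≤ _ := by gcongr
      have h5 : 0 ≤ (C₁ + C₂ + C₃ + C₄) * ε * X := by positivity
      have h6 : 0 ≤ (C₁ + C₂ + C₄) * Z := by positivity
      linarith
    -- otherwise `τ ≤ d / ε` is small enough for the slowest modes to keep the linearization `X`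
    -- of order `d`
    have hτ1 : τ ≤ 1 / c * (d : ℝ) ^ ((a + 1) / 2) := by
      refine hcase.trans ?_
      rw [div_le_iff₀ hε0]
      calc (d : ℝ) = 1 / c * (d : ℝ) ^ ((a + 1) / 2) * (c * (d : ℝ) ^ (-(a - 1) / 2)) := by
            have : (d : ℝ) ^ ((a + 1) / 2) * (d : ℝ) ^ (-(a - 1) / 2) = d := by
              rw [← Real.rpow_add hd0]
              nth_rewrite 2 [← Real.rpow_one (d : ℝ)]
              congr 1; ring
            calc (d : ℝ) = (d : ℝ) ^ ((a + 1) / 2) * (d : ℝ) ^ (-(a - 1) / 2) := this.symm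
              _ = _ := by field_simp
        _ ≤ _ := by gcongr
    have hXlow : r * d ≤ X := by
      refine hlow' τ hτ (hτ1.trans ?_)
      gcongr
      linarith
    have hZC : 0 ≤ (C₁ + C₂ + C₃ + C₄) * Z := by positivity
    rcases le_total (1 / 1100) ε with hbig | hsmall
    · have h1 : K₁ * d ≤ C₂ * ε * X := by
        calc K₁ * d = C₂ * (1 / 1100) * (r * d) := by rw [hC₂]; field_simp
          _ ≤ _ := by gcongr
      have h2 : 0 ≤ (C₁ + C₃ + C₄) * ε * X := by positivity
      linarith
    · -- the powers `d^{(1 - 1/a)/2}` of the deviation and `d^{(1 + 1/a)/2}` of the modes that move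
      -- multiply to `d`
      have hkey := (hw.shift hT₂).sum_sq_err_sub_le (W := fun i => √(U i)) hl hτ
        (D := D * ε * (d : ℝ) ^ ((1 - 1 / a) / 2))
        (fun t ht => (hdev' hsmall T₂ hT₂ hu hs (t + T₂) (by linarith)).1)
        (fun t ht => (hdev' hsmall T₂ hT₂ hu hs (t + T₂) (by linarith)).2)
        (fun i => Real.abs_le_sqrt (hU1 i))
        (fun t ht i => Real.abs_le_sqrt (hU2 _ (by linarith) i))
      have hUnn : ∀ i, 0 ≤ U i := fun i => (sq_nonneg _).trans (hU1 i)
      have e1 : ∑ i, min 1 (eigenvalue a d i * τ) * √(U i) ^ 2 =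
          ∑ i, min 1 (eigenvalue a d i * τ) * U i :=
        Finset.sum_congr rfl fun i _ => by rw [Real.sq_sqrt (hUnn i)]
      rw [e1, zero_add, add_comm τ] at hkey
      have e2 : ∑ i, min 1 (eigenvalue a d i * τ) * U i ≤
          K₁ * ((k + 1) * (d : ℝ) ^ ((1 + 1 / a) / 2)) := by
        rcases hτ.eq_or_lt with h0 | h0
        · rw [← h0]
          simp only [mul_zero, min_eq_right (zero_le_one' ℝ), zero_mul, Finset.sum_const_zero]
          positivity
        · refine (hU4 τ h0).trans ?_
          have : τ ^ (1 / a) ≤ k * (d : ℝ) ^ ((1 + 1 / a) / 2) := by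
            refine (Real.rpow_le_rpow hτ hτ1 h1a0.le).trans (le_of_eq ?_)
            rw [Real.mul_rpow (by positivity) (by positivity), ← Real.rpow_mul hd0.le, hk,
              one_div c, Real.inv_rpow hc.le, ← Real.rpow_neg hc.le]
            congr 2; field_simp
          rw [add_mul, one_mul]
          gcongr
      have e3 : (d : ℝ) ^ ((1 - 1 / a) / 2) * (d : ℝ) ^ ((1 + 1 / a) / 2) = d := by
        rw [← Real.rpow_add hd0]
        nth_rewrite 2 [← Real.rpow_one (d : ℝ)]
        congr 1; ring
      have e4 : |Y - X| ≤ C₁ * ε * X := by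
        calc |Y - X| ≤ 128 * (D * ε * (d : ℝ) ^ ((1 - 1 / a) / 2)) *
              ∑ i, min 1 (eigenvalue a d i * τ) * U i := hkey
          _ ≤ 128 * (D * ε * (d : ℝ) ^ ((1 - 1 / a) / 2)) *
              (K₁ * ((k + 1) * (d : ℝ) ^ ((1 + 1 / a) / 2))) := by gcongr
          _ = 128 * D * ε * K₁ * (k + 1) *
              ((d : ℝ) ^ ((1 - 1 / a) / 2) * (d : ℝ) ^ ((1 + 1 / a) / 2)) := by ring
          _ = C₁ * ε * (r * d) := by rw [e3, hC₁]; field_simp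
          _ ≤ _ := by gcongr
      have h2 : 0 ≤ (C₂ + C₃ + C₄) * ε * X := by positivity
      linarith
  · -- summation by parts: the weights `e^{-16 λ_i τ}` increase in `i`
    have h1 : X ≤ K₁ * ∑ i, Real.exp (-16 * eigenvalue a d i * τ) := by
      refine le_trans (Finset.sum_le_sum fun i _ => ?_) (sum_mul_le_of_tail_sums
        (c := fun i => Real.exp (-16 * eigenvalue a d i * τ)) (x := U) (fun i j hij => ?_)
        (fun i => (Real.exp_pos _).le) hU3)
      · rw [mul_comm]
        have := hU2 T₂ hT₂ i
        gcongr
      · refine Real.exp_le_exp.2 ?_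
        have := mul_le_mul_of_nonneg_right (eigenvalue_anti ha hij) hτ
        linarith
    set S := ∑ i, Real.exp (-16 * eigenvalue a d i * τ) with hS
    have hS0 : 0 ≤ S := Finset.sum_nonneg fun i _ => (Real.exp_pos _).le
    calc X * d ≤ K₁ * S * d := by gcongr
      _ = C₄ * (r * d) * S := by rw [hC₄]; field_simp
      _ ≤ C₄ * E * S := by gcongr
      _ ≤ (C₁ + C₂ + C₃ + C₄) * E * S := by
        have : 0 ≤ E := le_trans (by positivity) hElow
        gcongr; linarith

end IsTypical

end PhaseRetrieval

namespace PhaseRetrieval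

open MeasureTheory ProbabilityTheory Set Matrix Filter Topology

/-! ### Sums of squares of Gaussian coordinates -/

section Chernoff

lemma integrable_exp_mul_sq_gaussianReal {t : ℝ} (ht : t < 1 / 2) :
    Integrable (fun x : ℝ => Real.exp (t * x ^ 2)) (gaussianReal 0 1) := by
  rw [gaussianReal_of_var_ne_zero _ one_ne_zero,
    integrable_withDensity_iff_integrable_smul' (measurable_gaussianPDF 0 1)
      (ae_of_all _ fun _ => ENNReal.ofReal_lt_top)]
  refine ((integrable_exp_neg_mul_sq (b := 1 / 2 - t) (by linarith)).const_mul
    (√(2 * Real.pi))⁻¹).congr (ae_of_all _ fun x => ?_)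
  simp only [toReal_gaussianPDF, gaussianPDFReal_def, smul_eq_mul, NNReal.coe_one, mul_one, sub_zero]
  rw [mul_assoc, ← Real.exp_add]
  congr 2; ring

lemma integral_exp_mul_sq_gaussianReal {t : ℝ} (ht : t < 1 / 2) :
    ∫ x : ℝ, Real.exp (t * x ^ 2) ∂(gaussianReal 0 1) = (√(1 - 2 * t))⁻¹ := by
  rw [integral_gaussianReal_eq_integral_smul one_ne_zero]
  have e : ∀ x : ℝ, gaussianPDFReal 0 1 x • Real.exp (t * x ^ 2) =
      (√(2 * Real.pi))⁻¹ * Real.exp (-(1 / 2 - t) * x ^ 2) := fun x => by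
    simp only [gaussianPDFReal_def, smul_eq_mul, NNReal.coe_one, mul_one, sub_zero]
    rw [mul_assoc, ← Real.exp_add]
    congr 2; ring
  simp_rw [e]
  rw [integral_const_mul, integral_gaussian, ← Real.sqrt_inv, ← Real.sqrt_inv, ← Real.sqrt_mul
    (by positivity)]
  congr 1
  have := Real.pi_pos
  have h1 : 1 / 2 - t ≠ 0 := by linarith
  have h2 : 1 - 2 * t ≠ 0 := by linarith
  field_simp

variable {d : ℕ}

lemma mgf_sum_sq_pi (S : Finset (Fin d)) {t : ℝ} (ht : t < 1 / 2) :
    Integrable (fun x => Real.exp (t * (∑ i ∈ S, fun x : Fin d → ℝ => x i ^ 2) x))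
      (Measure.pi fun _ : Fin d => gaussianReal 0 1) ∧
    mgf (∑ i ∈ S, fun x : Fin d → ℝ => x i ^ 2) (Measure.pi fun _ : Fin d => gaussianReal 0 1) t =
      (√(1 - 2 * t))⁻¹ ^ S.card := by
  have hind : iIndepFun (fun (i : Fin d) (x : Fin d → ℝ) => x i ^ 2)
      (Measure.pi fun _ : Fin d => gaussianReal 0 1) :=
    iIndepFun_pi (X := fun _ (y : ℝ) => y ^ 2) fun i => by fun_prop
  have hev := fun i : Fin d => measurePreserving_eval (fun _ : Fin d => gaussianReal 0 1) i
  refine ⟨hind.integrable_exp_mul_sum (fun i => by fun_prop) fun i _ => ?_, ?_⟩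
  · exact (hev i).integrable_comp_of_integrable (integrable_exp_mul_sq_gaussianReal ht)
  · rw [hind.mgf_sum (fun i => by fun_prop), Finset.prod_congr rfl fun i _ => ?_,
      Finset.prod_const]
    have h := integral_map (μ := Measure.pi fun _ : Fin d => gaussianReal 0 1)
      (hev i).measurable.aemeasurable (f := fun y : ℝ => Real.exp (t * y ^ 2))
      (by fun_prop)
    rw [(hev i).map_eq, integral_exp_mul_sq_gaussianReal ht] at h
    exact h.symm

lemma stdGaussian_real_preimage {s : Set (Fin d → ℝ)} (hs : MeasurableSet s) :
    (stdGaussian (Vec d)).real {x | (fun i => x i) ∈ s} =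
      (Measure.pi fun _ : Fin d => gaussianReal 0 1).real s := by
  have hm : Measurable fun x : Vec d => fun i => x i := by fun_prop
  change (stdGaussian (Vec d)).real ((fun x : Vec d => fun i => x i) ⁻¹' s) = _
  rw [← map_pi_eq_stdGaussian, map_measureReal_apply (by fun_prop) (hm hs)]
  rfl

/-- Chernoff bound for the upper tail, from `E e^{g² / 4} = √2`. -/
lemma stdGaussian_sum_sq_ge_le (S : Finset (Fin d)) (c : ℝ) :
    (stdGaussian (Vec d)).real {x | c ≤ ∑ i ∈ S, x i ^ 2} ≤ Real.exp (-(c / 4)) * √2 ^ S.card := by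
  have hs : MeasurableSet {x : Fin d → ℝ | c ≤ (∑ i ∈ S, fun x : Fin d → ℝ => x i ^ 2) x} := by
    simp only [Finset.sum_apply]
    exact measurableSet_le measurable_const (by fun_prop)
  obtain ⟨h1, h2⟩ := mgf_sum_sq_pi S (t := 1 / 4) (by norm_num)
  have h3 := measure_ge_le_exp_mul_mgf c (by norm_num) h1
  rw [← stdGaussian_real_preimage hs, h2] at h3
  simp only [mem_ofPred_eq, Finset.sum_apply] at h3
  refine h3.trans (le_of_eq ?_)
  rw [← Real.sqrt_inv]
  norm_num
  ring_nf

/-- Chernoff bound for the lower tail. -/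
lemma stdGaussian_sum_sq_le_le (S : Finset (Fin d)) (c : ℝ) {t : ℝ} (ht : 0 ≤ t) :
    (stdGaussian (Vec d)).real {x | ∑ i ∈ S, x i ^ 2 ≤ c} ≤
      Real.exp (t * c) * (√(1 + 2 * t))⁻¹ ^ S.card := by
  have hs : MeasurableSet {x : Fin d → ℝ | (∑ i ∈ S, fun x : Fin d → ℝ => x i ^ 2) x ≤ c} := by
    simp only [Finset.sum_apply]
    exact measurableSet_le (by fun_prop) measurable_const
  obtain ⟨h1, h2⟩ := mgf_sum_sq_pi S (t := -t) (by linarith)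
  have h3 := measure_le_le_exp_mul_mgf c (by linarith) h1
  rw [← stdGaussian_real_preimage hs, h2] at h3
  simp only [mem_ofPred_eq, Finset.sum_apply, neg_neg] at h3
  refine h3.trans (le_of_eq ?_)
  congr 4; ring

lemma gaussianReal_sq_le_le {c : ℝ} (hc : 0 < c) :
    (gaussianReal 0 1).real {x | x ^ 2 ≤ c} ≤ 3 * √c := by
  have h := measure_le_le_exp_mul_mgf (μ := gaussianReal 0 1) (X := fun x : ℝ => x ^ 2)
    (t := -(1 / c)) c (by have : 0 < 1 / c := by positivity
                          linarith)
    (integrable_exp_mul_sq_gaussianReal (by have : 0 < 1 / c := by positivity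
                                            linarith))
  refine h.trans ?_
  have e1 : mgf (fun x : ℝ => x ^ 2) (gaussianReal 0 1) (-(1 / c)) = (√(1 - 2 * -(1 / c)))⁻¹ :=
    integral_exp_mul_sq_gaussianReal (by have : 0 < 1 / c := by positivity
                                         linarith)
  rw [e1, neg_neg, one_div_mul_cancel hc.ne', ← Real.sqrt_inv]
  have e2 : √(1 - 2 * -(1 / c))⁻¹ ≤ √c := by
    apply Real.sqrt_le_sqrt
    rw [inv_le_comm₀ (by have : 0 < 1 / c := by positivity
                         linarith) hc]
    have : c⁻¹ = 1 / c := by ring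
    have : 0 < 1 / c := by positivity
    linarith
  have := Real.exp_one_lt_d9
  have := Real.sqrt_nonneg c
  gcongr
  linarith

/-- Projections of a standard Gaussian vector are standard Gaussian. -/
lemma stdGaussian_sq_inner_le {ξ : Vec d} (hξ : ξ ≠ 0) {c : ℝ} (hc : 0 < c) :
    (stdGaussian (Vec d)).real {x | (inner ℝ ξ x) ^ 2 ≤ c * ‖ξ‖ ^ 2} ≤ 3 * √c := by
  set L : StrongDual ℝ (Vec d) := innerSL ℝ (‖ξ‖⁻¹ • ξ) with hL
  have hn : 0 < ‖ξ‖ := norm_pos_iff.2 hξ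
  have hLn : ‖L‖ = 1 := by
    rw [hL, innerSL_apply_norm, norm_smul, norm_inv, norm_norm, inv_mul_cancel₀ hn.ne']
  have hmap : (stdGaussian (Vec d)).map L = gaussianReal 0 1 := by
    rw [IsGaussian.map_eq_gaussianReal, variance_dual_stdGaussian,
      integral_strongDual_stdGaussian, hLn]
    simp
  have h := gaussianReal_sq_le_le hc
  rw [← hmap, map_measureReal_apply (by fun_prop) (measurableSet_le (by fun_prop) (by fun_prop))] at h
  refine le_trans (le_of_eq ?_) h
  congr 1
  ext x
  simp only [mem_ofPred_eq, mem_preimage, hL, innerSL_apply_apply, real_inner_smul_left, mul_pow,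
    inv_pow]
  rw [inv_mul_le_iff₀ (by positivity), mul_comm]

end Chernoff

end PhaseRetrieval

namespace PhaseRetrieval

open MeasureTheory ProbabilityTheory Set Matrix Filter Topology

/-! ### The uniform measure on the sphere as a normalized Gaussian -/

section Sphere

variable {d : ℕ}

/-- The density of the standard Gaussian, identified through its characteristic function. The value
of the normalizing constant is not needed. -/
lemma exists_stdGaussian_eq_withDensity (d : ℕ) : ∃ K : ℝ, 0 < K ∧ stdGaussian (Vec d) =
    volume.withDensity fun x => ENNReal.ofReal (K * Real.exp (-(1 / 2) * ‖x‖ ^ 2)) := by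
  have hZ := GaussianFourier.integral_rexp_neg_mul_sq_norm (V := Vec d) (b := 1 / 2) (by norm_num)
  set Z : ℝ := ∫ x : Vec d, Real.exp (-(1 / 2) * ‖x‖ ^ 2) with hZdef
  have hZ0 : 0 < Z := by rw [hZ]; positivity
  have hint : Integrable fun x : Vec d => Real.exp (-(1 / 2) * ‖x‖ ^ 2) := by
    by_contra h
    rw [hZdef, integral_undef h] at hZ0
    exact lt_irrefl _ hZ0
  refine ⟨Z⁻¹, by positivity, ?_⟩
  have : IsFiniteMeasure ((volume : Measure (Vec d)).withDensity fun x =>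
      ENNReal.ofReal (Z⁻¹ * Real.exp (-(1 / 2) * ‖x‖ ^ 2))) :=
    isFiniteMeasure_withDensity_ofReal (hint.const_mul _).2
  apply Measure.ext_of_charFun
  ext t
  rw [charFun_stdGaussian, charFun_apply, integral_withDensity_eq_integral_toReal_smul
    (by fun_prop) (ae_of_all _ fun _ => ENNReal.ofReal_lt_top)]
  have hb : (0 : ℝ) < ((1 / 2 : ℝ) : ℂ).re := by norm_num
  have h1 := GaussianFourier.integral_cexp_neg_mul_sq_norm_add hb Complex.I t
  have h0 := GaussianFourier.integral_cexp_neg_mul_sq_norm_add hb 0 t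
  have hZc : (Z : ℂ) = ∫ v : Vec d, Complex.exp (-((1 / 2 : ℝ) : ℂ) * (‖v‖ : ℂ) ^ 2
      + 0 * ((inner ℝ t v : ℝ) : ℂ)) := by
    rw [hZdef, ← integral_complex_ofReal]
    refine integral_congr_ae (ae_of_all _ fun x => ?_)
    push_cast; ring_nf
  rw [h0] at hZc
  have e : ∀ x : Vec d, (ENNReal.ofReal (Z⁻¹ * Real.exp (-(1 / 2) * ‖x‖ ^ 2))).toReal •
      Complex.exp ((inner ℝ x t : ℝ) * Complex.I) =
      (Z : ℂ)⁻¹ * Complex.exp (-((1 / 2 : ℝ) : ℂ) * (‖x‖ : ℂ) ^ 2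
        + Complex.I * ((inner ℝ t x : ℝ) : ℂ)) := fun x => by
    rw [ENNReal.toReal_ofReal (by positivity), Complex.real_smul, Complex.exp_add,
      real_inner_comm]
    push_cast; ring_nf
  simp_rw [e]
  rw [integral_const_mul, h1, hZc]
  have hZc0 : (Z : ℂ) ≠ 0 := by exact_mod_cast hZ0.ne'
  rw [hZc] at hZc0
  have h2 : ((Real.pi : ℂ) / ((1 / 2 : ℝ) : ℂ)) ^ ((Module.finrank ℝ (Vec d) : ℂ) / 2) ≠ 0 :=
    left_ne_zero_of_mul hZc0
  have h3 : Complex.exp (0 ^ 2 * (‖t‖ : ℂ) ^ 2 / (4 * ((1 / 2 : ℝ) : ℂ))) = 1 := by simp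
  rw [h3, mul_one, ← mul_assoc, inv_mul_cancel₀ h2, one_mul, Complex.I_sq]
  congr 1; push_cast; ring

/-- Polar coordinates: cones have the same mass for the sphere and the Gaussian measure. -/
lemma sphereUniform_le_stdGaussian (hd : 0 < d) {B : Set (Vec d)} (hB : MeasurableSet B)
    (hcone : ∀ r : ℝ, 0 < r → ∀ x, r • x ∈ B → x ∈ B) :
    sphereUniform d {θ | (θ : Vec d) ∈ B} ≤ stdGaussian (Vec d) B := by
  have : Nonempty (Fin d) := ⟨⟨0, hd⟩⟩
  obtain ⟨K, hK, hγ⟩ := exists_stdGaussian_eq_withDensity d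
  set ρ : ℝ → ENNReal := fun r => ENNReal.ofReal (K * Real.exp (-(1 / 2) * r ^ 2)) with hρ
  have hρm : Measurable ρ := by fun_prop
  set I : ENNReal := ∫⁻ r : Ioi (0 : ℝ), ρ r
    ∂(Measure.volumeIoiPow (Module.finrank ℝ (Vec d) - 1)) with hI
  have hρn : Measurable fun x : Vec d => ρ ‖x‖ := hρm.comp measurable_norm
  have key : ∀ B : Set (Vec d), MeasurableSet B → (∀ r : ℝ, 0 < r → ∀ x, r • x ∈ B → x ∈ B) →
      stdGaussian (Vec d) (B ∩ {0}ᶜ) =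
        (volume : Measure (Vec d)).toSphere {θ | (θ : Vec d) ∈ B} * I := by
    intro B hB hcone
    have hBs : MeasurableSet {θ : Metric.sphere (0 : Vec d) 1 | (θ : Vec d) ∈ B} :=
      measurable_subtype_coe hB
    have h0m : MeasurableSet ({0}ᶜ : Set (Vec d)) := (measurableSet_singleton 0).compl
    have e1 : stdGaussian (Vec d) (B ∩ {0}ᶜ) =
        ∫⁻ x in ({0}ᶜ : Set (Vec d)), B.indicator (fun x => ρ ‖x‖) x := by
      rw [hγ, withDensity_apply _ (hB.inter h0m), ← setLIntegral_indicator hB]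
    rw [e1, ← lintegral_subtype_comap h0m]
    have e2 : ∀ x : ({0}ᶜ : Set (Vec d)), B.indicator (fun x => ρ ‖x‖) (x : Vec d) =
        (fun p : Metric.sphere (0 : Vec d) 1 × Ioi (0 : ℝ) =>
          ({θ : Metric.sphere (0 : Vec d) 1 | (θ : Vec d) ∈ B}.indicator 1 p.1) * ρ p.2)
          (homeomorphUnitSphereProd (Vec d) x) := fun x => by
      have hx : 0 < ‖(x : Vec d)‖ := norm_pos_iff.2 x.2
      have hiff : ‖(x : Vec d)‖⁻¹ • (x : Vec d) ∈ B ↔ (x : Vec d) ∈ B := by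
        refine ⟨hcone _ (inv_pos.2 hx) _, fun h => hcone ‖(x : Vec d)‖ hx _ ?_⟩
        rwa [smul_smul, mul_inv_cancel₀ hx.ne', one_smul]
      by_cases h : (x : Vec d) ∈ B
      · rw [indicator_of_mem h]
        simp only [homeomorphUnitSphereProd_apply_snd_coe]
        rw [indicator_of_mem (by simpa [homeomorphUnitSphereProd_apply_fst_coe] using hiff.2 h)]
        simp
      · rw [indicator_of_notMem h]
        simp only
        rw [indicator_of_notMem (by
          simpa [homeomorphUnitSphereProd_apply_fst_coe] using fun h' => h (hiff.1 h'))]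
        simp
    simp_rw [e2]
    have hm := (volume : Measure (Vec d)).measurePreserving_homeomorphUnitSphereProd
    rw [hm.lintegral_comp (f := fun p : Metric.sphere (0 : Vec d) 1 × Ioi (0 : ℝ) =>
      ({θ : Metric.sphere (0 : Vec d) 1 | (θ : Vec d) ∈ B}.indicator 1 p.1) * ρ p.2)
      (by
        refine Measurable.mul ?_ (hρm.comp (measurable_subtype_coe.comp measurable_snd))
        exact (measurable_one.indicator hBs).comp measurable_fst)]
    rw [lintegral_prod_mul (f := {θ : Metric.sphere (0 : Vec d) 1 | (θ : Vec d) ∈ B}.indicator 1)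
      (g := fun r : Ioi (0 : ℝ) => ρ r) (measurable_one.indicator hBs).aemeasurable
      (hρm.comp measurable_subtype_coe).aemeasurable, lintegral_indicator_one hBs]
  have huniv := key univ MeasurableSet.univ fun _ _ _ _ => mem_univ _
  have h0 : stdGaussian (Vec d) {0} = 0 := by
    rw [hγ]; exact withDensity_absolutelyContinuous _ _ (measure_singleton _)
  have hone : stdGaussian (Vec d) (univ ∩ {0}ᶜ) = 1 := by
    rw [univ_inter, measure_compl (measurableSet_singleton _) (measure_ne_top _ _), h0]; simp
  rw [hone] at huniv
  simp only [mem_univ, ofPred_true] at huniv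
  have hinv : ((volume : Measure (Vec d)).toSphere univ)⁻¹ = I := by
    rw [eq_comm]; exact ENNReal.eq_inv_of_mul_eq_one_left (by rw [mul_comm]; exact huniv.symm)
  calc sphereUniform d {θ | (θ : Vec d) ∈ B}
      = (volume : Measure (Vec d)).toSphere {θ | (θ : Vec d) ∈ B} * I := by
        rw [sphereUniform, Measure.smul_apply, hinv, smul_eq_mul, mul_comm]
    _ = stdGaussian (Vec d) (B ∩ {0}ᶜ) := (key B hB hcone).symm
    _ ≤ _ := measure_mono inter_subset_left

end Sphere

end PhaseRetrieval

namespace PhaseRetrieval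

open MeasureTheory ProbabilityTheory Set Matrix Filter Topology

/-! ### Regularity of Gaussian vectors -/

section Regular

variable {d : ℕ}

/-- The blocks of coordinates of `x` have a mass comparable to their length, and the coordinate of
the top eigenvalue is bounded away from zero. -/
structure IsRegular (A : ℝ) (x : Fin d → ℝ) : Prop where
  first : ∀ i : Fin d, (i : ℕ) = 0 → 1 / A ≤ x i ^ 2
  head : ∀ k : ℕ, k ≤ d → (∑ i : Fin d, if (i : ℕ) < k then x i ^ 2 else 0) ≤ A * k
  tail : ∀ k : ℕ, k ≤ d → (∑ i : Fin d, if d ≤ (i : ℕ) + k then x i ^ 2 else 0) ≤ A * k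
  block : ∀ k : ℕ, A ≤ k → 2 * k ≤ d →
    (k : ℝ) / 4 ≤ ∑ i : Fin d, if k ≤ (i : ℕ) ∧ (i : ℕ) < 2 * k then x i ^ 2 else 0

lemma card_filter_fin (p : ℕ → Prop) [DecidablePred p] :
    (Finset.univ.filter fun i : Fin d => p i).card = ((Finset.range d).filter p).card := by
  rw [Finset.card_filter, Finset.card_filter,
    Fin.sum_univ_eq_sum_range (fun i => if p i then 1 else 0) d]

lemma card_head {k : ℕ} (hk : k ≤ d) : (Finset.univ.filter fun i : Fin d => (i : ℕ) < k).card = k := by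
  rw [card_filter_fin fun i => i < k]
  have : (Finset.range d).filter (fun i => i < k) = Finset.range k := by
    ext i; simp only [Finset.mem_filter, Finset.mem_range]; omega
  rw [this, Finset.card_range]

lemma card_tail {k : ℕ} (hk : k ≤ d) :
    (Finset.univ.filter fun i : Fin d => d ≤ (i : ℕ) + k).card = k := by
  rw [card_filter_fin fun i => d ≤ i + k]
  have : (Finset.range d).filter (fun i => d ≤ i + k) = Finset.Ico (d - k) d := by
    ext i; simp only [Finset.mem_filter, Finset.mem_range, Finset.mem_Ico]; omega
  rw [this, Nat.card_Ico]; omega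

lemma card_block {k : ℕ} (hk : 2 * k ≤ d) :
    (Finset.univ.filter fun i : Fin d => k ≤ (i : ℕ) ∧ (i : ℕ) < 2 * k).card = k := by
  rw [card_filter_fin fun i => k ≤ i ∧ i < 2 * k]
  have : (Finset.range d).filter (fun i => k ≤ i ∧ i < 2 * k) = Finset.Ico k (2 * k) := by
    ext i; simp only [Finset.mem_filter, Finset.mem_range, Finset.mem_Ico]; omega
  rw [this, Nat.card_Ico]; omega

/-- A Gaussian vector is regular with probability close to one, uniformly in the dimension. -/
lemma exists_isRegular {η : ℝ} (hη : 0 < η) : ∃ A : ℝ, 1 ≤ A ∧ ∀ d : ℕ,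
    (stdGaussian (Vec d)).real {x | ¬ IsRegular A fun i => x i} ≤ η := by
  set ρ : ℝ := Real.exp (1 / 4) * (√3)⁻¹ with hρ
  have hρ0 : 0 < ρ := by positivity
  have hρ1 : ρ < 1 := by
    have h1 : Real.exp (1 / 4) < 3 / 2 := by
      have h2 : Real.exp (1 / 4) ^ 4 = Real.exp 1 := by rw [← Real.exp_nat_mul]; norm_num
      by_contra! h
      have := pow_le_pow_left₀ (by norm_num) h 4
      rw [h2] at this
      linarith [Real.exp_one_lt_d9]
    have h2 : 3 / 2 < √3 := Real.lt_sqrt_of_sq_lt (by norm_num)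
    rw [hρ, ← div_eq_mul_inv, div_lt_one (by positivity)]
    linarith
  let r : ℝ → ℝ := fun A => Real.exp (-(A / 4)) * √2
  have hr0 : ∀ A, 0 < r A := fun A => by positivity
  have t1 : Tendsto (fun A : ℝ => Real.exp 1 * (√(1 + 2 * A))⁻¹) atTop (𝓝 0) := by
    rw [← mul_zero (Real.exp 1)]
    refine (Tendsto.comp tendsto_inv_atTop_zero (Real.tendsto_sqrt_atTop.comp ?_)).const_mul _
    exact tendsto_atTop_add_const_left _ _ (tendsto_id.const_mul_atTop (by norm_num))
  have t2 : Tendsto r atTop (𝓝 0) := by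
    rw [← zero_mul (√2)]
    refine Tendsto.mul_const _ (Real.tendsto_exp_neg_atTop_nhds_zero.comp ?_)
    exact tendsto_id.atTop_div_const (by norm_num)
  have t3 : Tendsto (fun A : ℝ => ρ ^ ⌈A⌉₊ / (1 - ρ)) atTop (𝓝 0) := by
    rw [← zero_div (1 - ρ)]
    exact ((tendsto_pow_atTop_nhds_zero_of_lt_one hρ0.le hρ1).comp
      tendsto_nat_ceil_atTop).div_const _
  obtain ⟨A, hA1, hA2, hA3, hA4, hA5⟩ := ((eventually_ge_atTop (1 : ℝ)).and
    ((t1.eventually_le_const (by linarith : 0 < η / 4)).and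
    ((t2.eventually_le_const (by linarith : 0 < η / 8)).and
    ((t2.eventually_le_const (by norm_num : (0 : ℝ) < 1 / 2)).and
    (t3.eventually_le_const (by linarith : 0 < η / 4)))))).exists
  refine ⟨A, hA1, fun d => ?_⟩
  have hA0 : 0 < A := by linarith
  set γ := stdGaussian (Vec d)
  -- a union bound over the first coordinate and over all initial, final and dyadic blocks, whose
  -- failure probabilities decay geometrically in the length
  let E₁ : Set (Vec d) := {x | ¬ ∀ i : Fin d, (i : ℕ) = 0 → 1 / A ≤ x i ^ 2}
  let E₂ : ℕ → Set (Vec d) := fun k => {x | A * k ≤ ∑ i ∈ Finset.univ.filter fun i : Fin d => (i : ℕ) < k, x i ^ 2}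
  let E₃ : ℕ → Set (Vec d) := fun k => {x | A * k ≤ ∑ i ∈ Finset.univ.filter fun i : Fin d => d ≤ (i : ℕ) + k, x i ^ 2}
  let E₄ : ℕ → Set (Vec d) := fun k =>
    {x | ∑ i ∈ Finset.univ.filter fun i : Fin d => k ≤ (i : ℕ) ∧ (i : ℕ) < 2 * k, x i ^ 2 ≤ (k : ℝ) / 4}
  have hsub : {x : Vec d | ¬ IsRegular A fun i => x i} ⊆ E₁ ∪ ((⋃ k ∈ Finset.Ico 1 (d + 1), E₂ k) ∪
      ((⋃ k ∈ Finset.Ico 1 (d + 1), E₃ k) ∪ ⋃ k ∈ Finset.Ico ⌈A⌉₊ (d / 2 + 1), E₄ k)) := by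
    intro x hx
    by_contra hcon
    simp only [mem_union, not_or, mem_iUnion, not_exists, Finset.mem_Ico] at hcon
    obtain ⟨c1, c2, c3, c4⟩ := hcon
    refine hx ⟨not_not.1 c1, fun k hk => ?_, fun k hk => ?_, fun k hk hkd => ?_⟩
    · rw [← Finset.sum_filter]
      rcases Nat.eq_zero_or_pos k with rfl | h0
      · simp
      · exact (not_le.1 (c2 k ⟨h0, by omega⟩)).le
    · rw [← Finset.sum_filter]
      rcases Nat.eq_zero_or_pos k with rfl | h0
      · refine le_of_eq ?_
        simp only [Nat.cast_zero, mul_zero, add_zero]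
        exact Finset.sum_eq_zero fun i hi => by
          have := i.2
          have := (Finset.mem_filter.1 hi).2
          omega
      · exact (not_le.1 (c3 k ⟨h0, by omega⟩)).le
    · rw [← Finset.sum_filter]
      exact (not_le.1 (c4 k ⟨Nat.ceil_le.2 hk, by omega⟩)).le
  have b1 : γ.real E₁ ≤ η / 4 := by
    refine le_trans ?_ hA2
    rcases Nat.eq_zero_or_pos d with hd | hd
    · have : E₁ = ∅ := by
        ext x
        simp only [E₁, mem_ofPred_eq, mem_empty_iff_false, iff_false, not_not]
        exact fun i => absurd i.2 (by omega)
      rw [this, measureReal_empty]; positivity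
    · have h := stdGaussian_sum_sq_le_le {(⟨0, hd⟩ : Fin d)} (1 / A) hA0.le
      rw [mul_one_div_cancel hA0.ne', Finset.card_singleton, pow_one] at h
      refine le_trans (measureReal_mono fun x hx => ?_) h
      simp only [E₁, mem_ofPred_eq, not_forall, not_le] at hx
      obtain ⟨i, hi, hlt⟩ := hx
      have : i = ⟨0, hd⟩ := Fin.ext hi
      subst this
      simpa using hlt.le
  have hgeom : ∀ (x : ℝ) (m n : ℕ), 0 ≤ x → x < 1 → ∑ k ∈ Finset.Ico m n, x ^ k ≤ x ^ m / (1 - x) :=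
    fun x m n h0 h1 => geom_sum_Ico_le_of_lt_one h0 h1
  have hpow : ∀ k : ℕ, Real.exp (-(A * k / 4)) * √2 ^ k = r A ^ k := fun k => by
    simp only [r]; rw [mul_pow, ← Real.exp_nat_mul]; ring_nf
  have hrsum : ∑ k ∈ Finset.Ico 1 (d + 1), r A ^ k ≤ η / 4 := by
    refine (hgeom (r A) 1 (d + 1) (hr0 A).le (by linarith)).trans ?_
    rw [pow_one, div_le_iff₀ (by linarith)]
    have : η / 4 * (1 / 2) ≤ η / 4 * (1 - r A) := by gcongr; linarith
    linarith
  have b2 : γ.real (⋃ k ∈ Finset.Ico 1 (d + 1), E₂ k) ≤ η / 4 := by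
    refine (measureReal_biUnion_finset_le _ _).trans (le_trans (Finset.sum_le_sum fun k hk => ?_) hrsum)
    have := stdGaussian_sum_sq_ge_le (d := d) (Finset.univ.filter fun i : Fin d => (i : ℕ) < k) (A * k)
    rwa [card_head (by have := Finset.mem_Ico.1 hk; omega), hpow] at this
  have b3 : γ.real (⋃ k ∈ Finset.Ico 1 (d + 1), E₃ k) ≤ η / 4 := by
    refine (measureReal_biUnion_finset_le _ _).trans (le_trans (Finset.sum_le_sum fun k hk => ?_) hrsum)
    have := stdGaussian_sum_sq_ge_le (d := d) (Finset.univ.filter fun i : Fin d => d ≤ (i : ℕ) + k) (A * k)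
    rwa [card_tail (by have := Finset.mem_Ico.1 hk; omega), hpow] at this
  have b4 : γ.real (⋃ k ∈ Finset.Ico ⌈A⌉₊ (d / 2 + 1), E₄ k) ≤ η / 4 := by
    refine (measureReal_biUnion_finset_le _ _).trans (le_trans (Finset.sum_le_sum fun k hk => ?_)
      ((hgeom ρ ⌈A⌉₊ (d / 2 + 1) hρ0.le hρ1).trans hA5))
    have := stdGaussian_sum_sq_le_le (d := d)
      (Finset.univ.filter fun i : Fin d => k ≤ (i : ℕ) ∧ (i : ℕ) < 2 * k) ((k : ℝ) / 4) zero_le_one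
    rw [card_block (by have := Finset.mem_Ico.1 hk; omega)] at this
    refine this.trans (le_of_eq ?_)
    rw [hρ, mul_pow, ← Real.exp_nat_mul]
    ring_nf
  have u1 := measureReal_union_le (μ := γ) E₁ ((⋃ k ∈ Finset.Ico 1 (d + 1), E₂ k) ∪
      ((⋃ k ∈ Finset.Ico 1 (d + 1), E₃ k) ∪ ⋃ k ∈ Finset.Ico ⌈A⌉₊ (d / 2 + 1), E₄ k))
  have u2 := measureReal_union_le (μ := γ) (⋃ k ∈ Finset.Ico 1 (d + 1), E₂ k)
      ((⋃ k ∈ Finset.Ico 1 (d + 1), E₃ k) ∪ ⋃ k ∈ Finset.Ico ⌈A⌉₊ (d / 2 + 1), E₄ k)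
  have u3 := measureReal_union_le (μ := γ) (⋃ k ∈ Finset.Ico 1 (d + 1), E₃ k)
      (⋃ k ∈ Finset.Ico ⌈A⌉₊ (d / 2 + 1), E₄ k)
  have u0 := measureReal_mono (μ := γ) hsub
  linarith

namespace IsRegular

variable {a A : ℝ} {x : Fin d → ℝ}

lemma sum_eigenvalue_le (h : IsRegular A x) (ha : 1 < a) (hd : 1 ≤ d) :
    ∑ i, eigenvalue a d i * x i ^ 2 ≤ A := by
  have := sum_mul_le_of_partial_sums (A := A) (c := eigenvalue a d)
    (fun i j hij => eigenvalue_anti ha hij) (fun i => (eigenvalue_pos i).le) h.head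
  rwa [sum_eigenvalue hd, mul_one] at this

lemma sum_eigenvalue_ge (h : IsRegular A x) (ha : 1 < a) (hA : 0 < A) (hd : 1 ≤ d) :
    (a - 1) / a / A ≤ ∑ i, eigenvalue a d i * x i ^ 2 := by
  have h1 := Finset.single_le_sum (f := fun i => eigenvalue a d i * x i ^ 2)
    (fun i _ => mul_nonneg (eigenvalue_pos i).le (sq_nonneg _)) (Finset.mem_univ (⟨0, hd⟩ : Fin d))
  have h2 := le_eigenvalue ha (⟨0, hd⟩ : Fin d)
  have h3 := h.first ⟨0, hd⟩ rfl
  simp only [Nat.cast_zero, zero_add, Real.one_rpow, mul_one] at h2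
  refine le_trans ?_ h1
  rw [div_eq_mul_one_div ((a - 1) / a)]
  exact mul_le_mul h2 h3 (by positivity) (eigenvalue_pos _).le

lemma sum_sq_le (h : IsRegular A x) : ∑ i, x i ^ 2 ≤ A * d := by
  refine le_trans (le_of_eq ?_) (h.head d le_rfl)
  exact Finset.sum_congr rfl fun i _ => (if_pos i.2).symm

lemma sum_sq_ge (h : IsRegular A x) (hd : 3 * A + 2 ≤ d) (hA : 1 ≤ A) :
    (d : ℝ) / 12 ≤ ∑ i, x i ^ 2 := by
  have hk : (d : ℝ) ≤ 2 * (d / 2 : ℕ) + 1 := by exact_mod_cast (by omega : d ≤ 2 * (d / 2) + 1)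
  have h1 := h.block (d / 2) (by linarith) (by omega)
  have h2 : (∑ i : Fin d, if d / 2 ≤ (i : ℕ) ∧ (i : ℕ) < 2 * (d / 2) then x i ^ 2 else 0) ≤
      ∑ i, x i ^ 2 := Finset.sum_le_sum fun i _ => by
    split_ifs
    exacts [le_rfl, sq_nonneg _]
  linarith

end IsRegular

end Regular

end PhaseRetrieval

namespace PhaseRetrieval

open MeasureTheory ProbabilityTheory Set Matrix Filter Topology

/-! ### Typical initial data -/

section TopRoot

variable {d : ℕ} {l : Fin d → ℝ} {i₀ : Fin d}

lemma sub_four_mul_pos (hle : ∀ i, l i ≤ l i₀) {z : ℝ} (hz : 4 * l i₀ < z) (i : Fin d) :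
    0 < z - 4 * l i := by linarith [hle i]

/-- The secular function is strictly decreasing above the spectrum of `4 Q`. -/
lemma secular_lt (hl : ∀ i, 0 < l i) (hle : ∀ i, l i ≤ l i₀) {v : Fin d → ℝ} (hv : v i₀ ≠ 0)
    {y z : ℝ} (hy : 4 * l i₀ < y) (hyz : y < z) :
    8 * ∑ i, (l i * v i) ^ 2 / (z - 4 * l i) < 8 * ∑ i, (l i * v i) ^ 2 / (y - 4 * l i) := by
  refine mul_lt_mul_of_pos_left (Finset.sum_lt_sum (fun i _ => ?_) ⟨i₀, Finset.mem_univ _, ?_⟩)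
    (by norm_num)
  · have := sub_four_mul_pos hle hy i
    gcongr
  · have := sub_four_mul_pos hle hy i₀
    have := hl i₀
    gcongr

lemma exists_isTop (hl : ∀ i, 0 < l i) (hle : ∀ i, l i ≤ l i₀) {v : Fin d → ℝ} (hv : v i₀ ≠ 0) :
    ∃ μ, IsTop l v i₀ μ := by
  set b := (l i₀ * v i₀) ^ 2 with hb
  set S := ∑ i, (l i * v i) ^ 2 with hS
  have hb0 : 0 < b := by have := hl i₀; positivity
  have hbS : b ≤ S := Finset.single_le_sum (f := fun i => (l i * v i) ^ 2)
    (fun i _ => sq_nonneg _) (Finset.mem_univ i₀)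
  have hcont : ContinuousOn (fun z => 8 * ∑ i, (l i * v i) ^ 2 / (z - 4 * l i))
      (Icc (4 * l i₀ + 8 * b) (4 * l i₀ + 8 * S)) := by
    refine ContinuousOn.mul continuousOn_const (continuousOn_finsetSum _ fun i _ => ?_)
    refine continuousOn_const.div (by fun_prop) fun z hz => ?_
    exact (sub_four_mul_pos hle (by linarith [hz.1]) i).ne'
  have h1 : 1 ≤ 8 * ∑ i, (l i * v i) ^ 2 / (4 * l i₀ + 8 * b - 4 * l i) := by
    have := Finset.single_le_sum (f := fun i => (l i * v i) ^ 2 / (4 * l i₀ + 8 * b - 4 * l i))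
      (fun i _ => div_nonneg (sq_nonneg _) (sub_four_mul_pos hle (by linarith) i).le)
      (Finset.mem_univ i₀)
    have e : (l i₀ * v i₀) ^ 2 / (4 * l i₀ + 8 * b - 4 * l i₀) = 1 / 8 := by
      rw [← hb, add_sub_cancel_left]; field_simp
    rw [e] at this
    linarith
  have h2 : 8 * ∑ i, (l i * v i) ^ 2 / (4 * l i₀ + 8 * S - 4 * l i) ≤ 1 := by
    have hle2 : ∑ i, (l i * v i) ^ 2 / (4 * l i₀ + 8 * S - 4 * l i) ≤ ∑ i, (l i * v i) ^ 2 / (8 * S) :=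
      Finset.sum_le_sum fun i _ => by
        have := hle i
        exact div_le_div_of_nonneg_left (sq_nonneg _) (by linarith) (by linarith)
    rw [← Finset.sum_div, ← hS] at hle2
    have e : S / (8 * S) = 1 / 8 := by
      have : S ≠ 0 := by linarith
      field_simp
    rw [e] at hle2
    linarith
  obtain ⟨z, hz, hz1⟩ := intermediate_value_Icc' (by linarith) hcont ⟨h2, h1⟩
  exact ⟨z, by linarith [hz.1], hz1⟩

open Classical in
/-- The root of the secular equation above the spectrum of `4 Q`, or `0` if `v` has no component
along the top eigenvector of `Q`. -/
noncomputable def topRoot (l : Fin d → ℝ) (i₀ : Fin d) (v : Fin d → ℝ) : ℝ :=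
  if h : v i₀ ≠ 0 ∧ ∃ μ, IsTop l v i₀ μ then h.2.choose else 0

lemma isTop_topRoot (hl : ∀ i, 0 < l i) (hle : ∀ i, l i ≤ l i₀) {v : Fin d → ℝ} (hv : v i₀ ≠ 0) :
    IsTop l v i₀ (topRoot l i₀ v) := by
  have h : v i₀ ≠ 0 ∧ ∃ μ, IsTop l v i₀ μ := ⟨hv, exists_isTop hl hle hv⟩
  rw [topRoot, dif_pos h]
  exact h.2.choose_spec

lemma topRoot_le_iff (hl : ∀ i, 0 < l i) (hle : ∀ i, l i ≤ l i₀) {v : Fin d → ℝ} (hv : v i₀ ≠ 0)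
    {z : ℝ} : topRoot l i₀ v ≤ z ↔
      4 * l i₀ < z ∧ 8 * ∑ i, (l i * v i) ^ 2 / (z - 4 * l i) ≤ 1 := by
  obtain ⟨h1, h2⟩ := isTop_topRoot hl hle hv
  constructor
  · intro h
    refine ⟨by linarith, ?_⟩
    rcases h.eq_or_lt with h | h
    · rw [← h, h2]
    · exact (secular_lt hl hle hv (by linarith) h).le.trans h2.le
  · rintro ⟨h3, h4⟩
    by_contra! h
    have := secular_lt hl hle hv h3 h
    linarith

lemma measurable_topRoot (hl : ∀ i, 0 < l i) (hle : ∀ i, l i ≤ l i₀) : Measurable (topRoot l i₀) := by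
  refine measurable_of_Iic fun z => ?_
  have h0 : MeasurableSet {v : Fin d → ℝ | v i₀ = 0} :=
    measurableSet_eq_fun (by fun_prop) measurable_const
  have e : topRoot l i₀ ⁻¹' Iic z = ({v : Fin d → ℝ | v i₀ = 0} ∩ {_v | 0 ≤ z}) ∪
      ({v : Fin d → ℝ | v i₀ = 0}ᶜ ∩ ({_v | 4 * l i₀ < z} ∩
        {v | 8 * ∑ i, (l i * v i) ^ 2 / (z - 4 * l i) ≤ 1})) := by
    ext v
    by_cases hv : v i₀ = 0
    · have : topRoot l i₀ v = 0 := dif_neg fun h => h.1 hv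
      simp [hv, this]
    · simp only [mem_preimage, mem_Iic, topRoot_le_iff hl hle hv, mem_union, mem_inter_iff,
        mem_ofPred_eq, hv, false_and, mem_compl_iff, not_false_eq_true, true_and, false_or]
  rw [e]
  refine (h0.inter (MeasurableSet.const _)).union (h0.compl.inter ?_)
  exact (MeasurableSet.const _).inter (measurableSet_le (by fun_prop) measurable_const)

end TopRoot

section Typical

variable {a : ℝ} {d : ℕ}

lemma target_apply (g : Vec d) (i : Fin d) :
    target a d g i = (√(∑ j, eigenvalue a d j * g j ^ 2))⁻¹ * g i := by
  have : qInner a d g g = ∑ j, eigenvalue a d j * g j ^ 2 :=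
    Finset.sum_congr rfl fun j _ => by ring
  rw [target, this]; rfl

lemma measurable_target : Measurable fun g : Vec d => fun i => target a d g i := by
  simp_rw [target_apply]
  fun_prop

/-- A target with regular Gaussian direction and a well-aligned small initial point are typical. -/
lemma IsRegular.isTypical {A₀ A : ℝ} (ha : 1 < a) (hA₀ : 1 ≤ A₀) (hA : 4 * A₀ ^ 2 * (a / (a - 1)) ≤ A)
    (hAA : A₀ ≤ A) {g : Vec d} (h : IsRegular A₀ fun i => g i) {i₀ : Fin d} (hi₀ : (i₀ : ℕ) = 0)
    {w₀ : Fin d → ℝ} (hw : ∑ i, w₀ i ^ 2 ≤ 1) (hs : statS (eigenvalue a d) w₀ ≤ A / d)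
    {μ : ℝ} (hμ : IsTop (eigenvalue a d) (fun i => target a d g i) i₀ μ)
    (halign : topVec (eigenvalue a d) (fun i => target a d g i) μ ⬝ᵥ
        topVec (eigenvalue a d) (fun i => target a d g i) μ ≤
      A * d * (topVec (eigenvalue a d) (fun i => target a d g i) μ ⬝ᵥ w₀) ^ 2) :
    IsTypical a d A i₀ μ (fun i => target a d g i) w₀ := by
  have ha0 : 0 < a := by linarith
  have ha1 : 0 < a - 1 := by linarith
  have hd : 1 ≤ d := by have := i₀.2; omega
  have hA0 : 0 < A₀ := by linarith
  set N := ∑ j, eigenvalue a d j * g j ^ 2 with hN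
  have hN1 : N ≤ A₀ := h.sum_eigenvalue_le ha hd
  have hN2 : (a - 1) / a / A₀ ≤ N := h.sum_eigenvalue_ge ha hA0 hd
  have hN0 : 0 < N := lt_of_lt_of_le (by positivity) hN2
  have hNi : N⁻¹ ≤ A₀ * (a / (a - 1)) := by
    rw [inv_le_comm₀ hN0 (by positivity)]
    refine le_trans (le_of_eq ?_) hN2
    field_simp
  have hNi' : A₀⁻¹ ≤ N⁻¹ := inv_anti₀ hN0 hN1
  have hsq : ∀ i, target a d g i ^ 2 = N⁻¹ * g i ^ 2 := fun i => by
    rw [target_apply, mul_pow, inv_pow, Real.sq_sqrt hN0.le]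
  have ht0 : 1 ≤ a / (a - 1) := by rw [le_div_iff₀ ha1]; linarith
  have hAsq : A₀ * (a / (a - 1)) * A₀ ≤ A := by
    refine le_trans ?_ hA
    have : 0 ≤ A₀ ^ 2 * (a / (a - 1)) := by positivity
    linarith
  have hA4 : 4 * A₀ ≤ A := by
    refine le_trans ?_ hA
    have h1 : A₀ * 1 ≤ A₀ * A₀ := by gcongr
    have h2 : A₀ ^ 2 * 1 ≤ A₀ ^ 2 * (a / (a - 1)) := by gcongr
    linarith
  have hite : ∀ (p : Fin d → Prop) [DecidablePred p], (∑ i, if p i then target a d g i ^ 2 else 0) =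
      N⁻¹ * ∑ i, if p i then g i ^ 2 else 0 := fun p _ => by
    rw [Finset.mul_sum]
    exact Finset.sum_congr rfl fun i _ => by split_ifs <;> simp [hsq]
  have hup : ∀ (x : ℝ) (k : ℕ), 0 ≤ x → x ≤ A₀ * k → N⁻¹ * x ≤ A * k := fun x k hx0 hx => by
    calc N⁻¹ * x ≤ A₀ * (a / (a - 1)) * (A₀ * k) := by gcongr
      _ = A₀ * (a / (a - 1)) * A₀ * k := by ring
      _ ≤ A * k := by gcongr
  refine ⟨hi₀, ?_, ?_, fun k hk => ?_, fun k hk => ?_, fun k hk hkd => ?_, hw, hs, hμ, halign⟩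
  · simp_rw [hsq]
    calc ∑ i, eigenvalue a d i * (N⁻¹ * g i ^ 2) = N⁻¹ * N := by
          rw [hN, Finset.mul_sum]; exact Finset.sum_congr rfl fun i _ => by ring
      _ = 1 := inv_mul_cancel₀ hN0.ne'
  · rw [hsq]
    have h1 := h.first i₀ hi₀
    have h2 : A₀ * A₀ ≤ A := by
      refine le_trans ?_ hAsq
      have : A₀ * 1 ≤ A₀ * (a / (a - 1)) := by gcongr
      rw [mul_one] at this
      gcongr
    calc 1 / A ≤ 1 / (A₀ * A₀) := by gcongr
      _ = A₀⁻¹ * (1 / A₀) := by field_simp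
      _ ≤ N⁻¹ * g i₀ ^ 2 := by gcongr
  · rw [hite]
    exact hup _ k (Finset.sum_nonneg fun i _ => by split_ifs; exacts [sq_nonneg _, le_rfl]) (h.head k hk)
  · rw [hite]
    exact hup _ k (Finset.sum_nonneg fun i _ => by split_ifs; exacts [sq_nonneg _, le_rfl]) (h.tail k hk)
  · rw [hite]
    have h1 := h.block k (hAA.trans hk) hkd
    calc (k : ℝ) / A ≤ k / (4 * A₀) := by gcongr
      _ = A₀⁻¹ * (k / 4) := by field_simp
      _ ≤ _ := by gcongr

lemma IsRegular.target_norm {A₀ : ℝ} (ha : 1 < a) (hA₀ : 1 ≤ A₀) (hd : 1 ≤ d) {g : Vec d}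
    (h : IsRegular A₀ fun i => g i) (i₀ : Fin d) (hi₀ : (i₀ : ℕ) = 0) : target a d g i₀ ≠ 0 := by
  have ha1 : 0 < a - 1 := by linarith
  have hN : 0 < ∑ j, eigenvalue a d j * g j ^ 2 :=
    lt_of_lt_of_le (by positivity) (h.sum_eigenvalue_ge ha (by linarith) hd)
  have h1 := h.first i₀ hi₀
  have h2 : g i₀ ≠ 0 := fun h0 => by
    simp only [h0] at h1
    have : 0 < 1 / A₀ := by positivity
    norm_num at h1
    linarith
  rw [target_apply]
  positivity

lemma sphereUniform_univ_le (hd : 0 < d) : sphereUniform d univ ≤ 1 := by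
  have := sphereUniform_le_stdGaussian hd MeasurableSet.univ fun _ _ _ _ => mem_univ _
  simpa using this

/-- Initial data are typical with probability close to one. -/
lemma exists_isTypical (ha : 1 < a) {η : ℝ} (hη : 0 < η) : ∃ A : ℝ, 1 ≤ A ∧ ∃ d₀ : ℕ, ∀ d, d₀ ≤ d →
    initialLaw d {p | ¬ ∃ (i₀ : Fin d) (μ : ℝ),
      IsTypical a d A i₀ μ (fun i => target a d p.1 i) fun i => (p.2 : Vec d) i} ≤ ENNReal.ofReal η := by
  have ha0 : 0 < a := by linarith
  have ha1 : 0 < a - 1 := by linarith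
  obtain ⟨A₀, hA₀, hreg⟩ := exists_isRegular (show 0 < η / 4 by linarith)
  have hA0 : 0 < A₀ := by linarith
  set c := (η / 12) ^ 2 with hc
  have hc0 : 0 < c := by positivity
  have hsc : 3 * √c = η / 4 := by rw [hc, Real.sqrt_sq (by linarith)]; ring
  set A := 12 * A₀ + 4 * A₀ ^ 2 * (a / (a - 1)) + A₀ / c with hA
  have q1 : 0 < 4 * A₀ ^ 2 * (a / (a - 1)) := by positivity
  have q2 : 0 < A₀ / c := by positivity
  have hAp : 0 < A := by positivity
  refine ⟨A, by linarith, ⌈3 * A₀ + 2⌉₊, fun d hd => ?_⟩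
  have hd3 : 3 * A₀ + 2 ≤ (d : ℝ) := Nat.ceil_le.1 hd
  have hd0 : (0 : ℝ) < d := by linarith
  have hdn : 0 < d := by exact_mod_cast hd0
  set i₀ : Fin d := ⟨0, hdn⟩ with hi₀
  set l := eigenvalue a d with hl
  have hlp : ∀ i, 0 < l i := fun i => eigenvalue_pos i
  have hle : ∀ i, l i ≤ l i₀ := fun i => eigenvalue_anti ha (Fin.le_def.2 (Nat.zero_le _))
  set γ := stdGaussian (Vec d) with hγ
  set ν := sphereUniform d with hν
  have hν1 : ν univ ≤ 1 := sphereUniform_univ_le hdn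
  have : IsFiniteMeasure ν := ⟨lt_of_le_of_lt hν1 ENNReal.one_lt_top⟩
  set R : Set (Vec d) := {x | ¬ IsRegular A₀ fun i => x i} with hR
  have hRle : γ R ≤ ENNReal.ofReal (η / 4) := by
    rw [← ofReal_measureReal]
    exact ENNReal.ofReal_le_ofReal (hreg d)
  -- smallness of the initial statistic
  let B : Set (Vec d) := {x | A * ∑ i, x i ^ 2 < d * ∑ i, l i * x i ^ 2}
  have hBle : ν {θ | (θ : Vec d) ∈ B} ≤ ENNReal.ofReal (η / 4) := by
    refine (sphereUniform_le_stdGaussian hdn (measurableSet_lt (by fun_prop) (by fun_prop)) ?_).trans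
      ((measure_mono fun x hx => ?_).trans hRle)
    · intro r hr x hx
      simp only [mem_ofPred_eq, PiLp.smul_apply, smul_eq_mul, mul_pow, mul_left_comm (l _),
        ← Finset.mul_sum] at hx ⊢
      rw [mul_left_comm A, mul_left_comm (d : ℝ)] at hx
      exact lt_of_mul_lt_mul_left hx (sq_nonneg r)
    · intro hx'
      have h1 := hx'.sum_sq_ge hd3 hA₀
      have h2 := hx'.sum_eigenvalue_le ha hdn
      simp only [mem_ofPred_eq] at hx
      have h3 : (12 * A₀) * (d / 12) ≤ A * ∑ i, x i ^ 2 := by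
        gcongr; linarith
      have h4 : (d : ℝ) * ∑ i, l i * x i ^ 2 ≤ d * A₀ := by gcongr
      linarith
  -- Alignment of the initial point with the top eigenvector `ξ`. The target determines `ξ`, so
  -- independence allows estimating the bad event `E` section by section; its sections are cones.
  let ξ : Vec d → Fin d → ℝ := fun g =>
    topVec l (fun i => target a d g i) (topRoot l i₀ fun i => target a d g i)
  have hξm : Measurable ξ := by
    refine measurable_pi_lambda _ fun i => ?_
    have h1 : Measurable fun g : Vec d => target a d g i :=
      (measurable_pi_apply i).comp measurable_target
    have h2 : Measurable fun g : Vec d => topRoot l i₀ fun i => target a d g i :=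
      (measurable_topRoot hlp hle).comp measurable_target
    exact (h1.const_mul _).div (h2.sub_const _)
  let E : Set (Vec d × Metric.sphere (0 : Vec d) 1) := {p | target a d p.1 i₀ = 0}ᶜ ∩
    {p | A * d * (∑ i, ξ p.1 i * (p.2 : Vec d) i) ^ 2 < ∑ i, ξ p.1 i * ξ p.1 i}
  have hEm : MeasurableSet E := by
    have h1 : Measurable fun p : Vec d × Metric.sphere (0 : Vec d) 1 => target a d p.1 i₀ :=
      ((measurable_pi_apply i₀).comp measurable_target).comp measurable_fst
    have h2 : ∀ i, Measurable fun p : Vec d × Metric.sphere (0 : Vec d) 1 => ξ p.1 i := fun i =>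
      ((measurable_pi_apply i).comp hξm).comp measurable_fst
    have h3 : ∀ i, Measurable fun p : Vec d × Metric.sphere (0 : Vec d) 1 => (p.2 : Vec d) i :=
      fun i => by fun_prop
    refine (measurableSet_eq_fun h1 measurable_const).compl.inter (measurableSet_lt ?_ ?_)
    · exact ((Finset.measurable_sum _ fun i _ => (h2 i).mul (h3 i)).pow_const 2).const_mul _
    · exact Finset.measurable_sum _ fun i _ => (h2 i).mul (h2 i)
  have hsec : ∀ g, ν (Prod.mk g ⁻¹' E) ≤ ENNReal.ofReal (η / 2) := by
    intro g
    by_cases hg : target a d g i₀ = 0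
    · have : Prod.mk g ⁻¹' E = ∅ := by
        ext θ; simp [E, hg]
      rw [this, measure_empty]; exact zero_le
    set ζ : Vec d := WithLp.toLp 2 (ξ g) with hζ
    have htop := isTop_topRoot (v := fun i => target a d g i) hlp hle hg
    have hζ0 : ζ ≠ 0 := fun h => by
      have h1 : ξ g i₀ = 0 := by
        have := congrArg (fun x : Vec d => x i₀) h
        simpa [hζ] using this
      have h2 : ξ g i₀ = l i₀ * target a d g i₀ /
        (topRoot l i₀ (fun i => target a d g i) - 4 * l i₀) := rfl
      rw [h2] at h1
      have h3 := hlp i₀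
      have h4 := htop.gap
      have : l i₀ * target a d g i₀ /
        (topRoot l i₀ (fun i => target a d g i) - 4 * l i₀) ≠ 0 := by positivity
      exact this h1
    have hin : ∀ x : Vec d, inner ℝ ζ x = ∑ i, ξ g i * x i := fun x => by
      simp only [hζ, PiLp.inner_apply, RCLike.inner_apply, conj_trivial]
      exact Finset.sum_congr rfl fun i _ => mul_comm _ _
    have hn : ‖ζ‖ ^ 2 = ∑ i, ξ g i * ξ g i := by
      rw [← real_inner_self_eq_norm_sq, hin]
    let F : Set (Vec d) := {x | A * d * (inner ℝ ζ x) ^ 2 < ‖ζ‖ ^ 2 * ∑ i, x i ^ 2}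
    have hFE : Prod.mk g ⁻¹' E ⊆ {θ | (θ : Vec d) ∈ F} := fun θ hθ => by
      have h1 : ∑ i, (θ : Vec d) i ^ 2 = 1 := by
        rw [← EuclideanSpace.real_norm_sq_eq, norm_eq_of_mem_sphere]; norm_num
      have h2 : A * d * (∑ i, ξ g i * (θ : Vec d) i) ^ 2 < ∑ i, ξ g i * ξ g i := hθ.2
      simp only [F, mem_ofPred_eq, h1, mul_one, hin, hn]
      exact h2
    have hFR : F ⊆ R ∪ {x | (inner ℝ ζ x) ^ 2 ≤ c * ‖ζ‖ ^ 2} := fun x hx => by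
      by_cases hx' : IsRegular A₀ fun i => x i
      · right
        simp only [F, mem_ofPred_eq] at hx ⊢
        have h1 := hx'.sum_sq_le
        have h2 : ‖ζ‖ ^ 2 * ∑ i, x i ^ 2 ≤ ‖ζ‖ ^ 2 * (A₀ * d) := by gcongr
        have h3 : A₀ / c * d * (inner ℝ ζ x) ^ 2 ≤ A * d * (inner ℝ ζ x) ^ 2 := by
          gcongr; linarith
        have h4 : (A₀ * d / c) * (inner ℝ ζ x) ^ 2 ≤ (A₀ * d / c) * (c * ‖ζ‖ ^ 2) := by
          have e : (A₀ * d / c) * (c * ‖ζ‖ ^ 2) = ‖ζ‖ ^ 2 * (A₀ * d) := by field_simp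
          have e2 : (A₀ * d / c) * (inner ℝ ζ x) ^ 2 = A₀ / c * d * (inner ℝ ζ x) ^ 2 := by ring
          rw [e, e2]; linarith
        exact le_of_mul_le_mul_left h4 (by positivity)
      · exact Or.inl hx'
    have hγ2 : γ {x | (inner ℝ ζ x) ^ 2 ≤ c * ‖ζ‖ ^ 2} ≤ ENNReal.ofReal (η / 4) := by
      rw [← ofReal_measureReal]
      exact ENNReal.ofReal_le_ofReal ((stdGaussian_sq_inner_le hζ0 hc0).trans hsc.le)
    calc ν (Prod.mk g ⁻¹' E) ≤ ν {θ | (θ : Vec d) ∈ F} := measure_mono hFE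
      _ ≤ γ F := by
        refine sphereUniform_le_stdGaussian hdn (measurableSet_lt (by fun_prop) (by fun_prop)) ?_
        intro r hr x hx
        simp only [F, mem_ofPred_eq, PiLp.smul_apply, smul_eq_mul, mul_pow, real_inner_smul_right,
          ← Finset.mul_sum] at hx ⊢
        rw [mul_left_comm (A * d), mul_left_comm (‖ζ‖ ^ 2)] at hx
        exact lt_of_mul_lt_mul_left hx (sq_nonneg r)
      _ ≤ γ R + γ {x | (inner ℝ ζ x) ^ 2 ≤ c * ‖ζ‖ ^ 2} :=
        (measure_mono hFR).trans (measure_union_le _ _)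
      _ ≤ ENNReal.ofReal (η / 4) + ENNReal.ofReal (η / 4) := add_le_add hRle hγ2
      _ = ENNReal.ofReal (η / 2) := by
        rw [← ENNReal.ofReal_add (by linarith) (by linarith)]; congr 1; ring
  have hsub : {p : Vec d × Metric.sphere (0 : Vec d) 1 | ¬ ∃ (i₀ : Fin d) (μ : ℝ),
      IsTypical a d A i₀ μ (fun i => target a d p.1 i) fun i => (p.2 : Vec d) i} ⊆
      (R ×ˢ univ) ∪ ((univ ×ˢ {θ : Metric.sphere (0 : Vec d) 1 | (θ : Vec d) ∈ B}) ∪ E) := by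
    rintro ⟨g, θ⟩ hp
    by_contra hcon
    simp only [mem_union, mem_prod, mem_univ, and_true, true_and, not_or] at hcon
    obtain ⟨c1, c2, c3⟩ := hcon
    have hg : IsRegular A₀ fun i => g i := not_not.1 c1
    have hg0 := hg.target_norm ha hA₀ hdn i₀ rfl
    have hθ : ∑ i, (θ : Vec d) i ^ 2 = 1 := by
      rw [← EuclideanSpace.real_norm_sq_eq, norm_eq_of_mem_sphere]; norm_num
    refine hp ⟨i₀, topRoot l i₀ fun i => target a d g i, hg.isTypical ha hA₀ (by linarith)
      (by linarith) rfl hθ.le ?_ (isTop_topRoot hlp hle hg0) ?_⟩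
    · simp only [B, mem_ofPred_eq, not_lt, hθ, mul_one] at c2
      rw [statS, le_div_iff₀ hd0, mul_comm]
      exact c2
    · by_contra! hlt
      exact c3 ⟨hg0, hlt⟩
  have m1 : (γ.prod ν) (R ×ˢ univ) ≤ ENNReal.ofReal (η / 4) := by
    rw [Measure.prod_prod]
    calc γ R * ν univ ≤ ENNReal.ofReal (η / 4) * 1 := mul_le_mul' hRle hν1
      _ = _ := mul_one _
  have m2 : (γ.prod ν) (univ ×ˢ {θ : Metric.sphere (0 : Vec d) 1 | (θ : Vec d) ∈ B}) ≤ ENNReal.ofReal (η / 4) := by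
    rw [Measure.prod_prod, measure_univ, one_mul]
    exact hBle
  have m3 : (γ.prod ν) E ≤ ENNReal.ofReal (η / 2) := by
    rw [Measure.prod_apply hEm]
    calc ∫⁻ g, ν (Prod.mk g ⁻¹' E) ∂γ ≤ ∫⁻ _, ENNReal.ofReal (η / 2) ∂γ := lintegral_mono hsec
      _ = _ := by rw [lintegral_const, measure_univ, mul_one]
  rw [initialLaw]
  calc (γ.prod ν) _ ≤ (γ.prod ν) ((R ×ˢ univ) ∪ ((univ ×ˢ {θ : Metric.sphere (0 : Vec d) 1 | (θ : Vec d) ∈ B}) ∪ E)) :=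
        measure_mono hsub
    _ ≤ ENNReal.ofReal (η / 4) + (ENNReal.ofReal (η / 4) + ENNReal.ofReal (η / 2)) :=
      (measure_union_le _ _).trans (add_le_add m1 ((measure_union_le _ _).trans (add_le_add m2 m3)))
    _ = ENNReal.ofReal η := by
      rw [← ENNReal.ofReal_add (by linarith) (by linarith),
        ← ENNReal.ofReal_add (by linarith) (by linarith)]
      congr 1; ring

end Typical

end PhaseRetrieval

namespace PhaseRetrieval

/-! ### The spectral-tail theorem -/

section Assembly

variable {a : ℝ} {d : ℕ}

lemma qInner_eq_statU (v w : Vec d) :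
    qInner a d w v = statU (eigenvalue a d) (fun i => v i) fun i => w i := rfl

lemma qInner_self_eq_statS (w : Vec d) :
    qInner a d w w = statS (eigenvalue a d) fun i => w i :=
  Finset.sum_congr rfl fun i _ => by ring

lemma mse_mul_weightedAverage {v w : Vec d} (hE : 0 < ∑ i, (w i - v i) ^ 2) (τ : ℝ) :
    mse d v w * weightedAverage a d v w τ =
      1 / (d : ℝ) * ∑ i, (w i - v i) ^ 2 * Real.exp (-16 * eigenvalue a d i * τ) := by
  unfold mse weightedAverage errorWeight
  rw [mul_assoc, Finset.mul_sum]
  congr 1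
  exact Finset.sum_congr rfl fun i _ => by field_simp

lemma weightedAverage_le {v w : Vec d} {C τ : ℝ} (hd : 0 < (d : ℝ))
    (hE : 0 < ∑ i, (w i - v i) ^ 2)
    (h : (∑ i, (w i - v i) ^ 2 * Real.exp (-16 * eigenvalue a d i * τ)) * d ≤
      C * (∑ i, (w i - v i) ^ 2) * ∑ i, Real.exp (-16 * eigenvalue a d i * τ)) :
    weightedAverage a d v w τ ≤ C * uniformAverage a d τ := by
  have e : weightedAverage a d v w τ =
      (∑ i, (w i - v i) ^ 2 * Real.exp (-16 * eigenvalue a d i * τ)) / ∑ i, (w i - v i) ^ 2 := by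
    unfold weightedAverage errorWeight
    rw [Finset.sum_div]
    exact Finset.sum_congr rfl fun i _ => by ring
  rw [e, uniformAverage, div_le_iff₀ hE]
  have e2 : C * (1 / (d : ℝ) * ∑ i, Real.exp (-16 * eigenvalue a d i * τ)) *
      ∑ i, (w i - v i) ^ 2 = C * (∑ i, (w i - v i) ^ 2) *
        (∑ i, Real.exp (-16 * eigenvalue a d i * τ)) / d := by ring
  rw [e2, le_div_iff₀ hd]
  exact h

end Assembly

end PhaseRetrieval

open PhaseRetrieval in
theorem theorem2 (a : ℝ) (ha : 1 < a) :
    -- the MSE after `T₂`, and the comparison of the weighted and the uniform average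
    (∀ η : ℝ, 0 < η → ∀ c : ℝ, 0 < c → ∀ K : ℝ, 0 < K →
      ∃ C : ℝ, 0 < C ∧ ∃ d₀ : ℕ, ∀ d : ℕ, d₀ ≤ d →
        ∀ ε : ℝ, c * (d : ℝ) ^ (-(a - 1) / 2) ≤ ε → ε < 1 →
          initialLaw d {p | ¬ (
            (∃ w : ℝ → Vec d, IsGradientFlow (loss a d (target a d p.1)) p.2 w) ∧
            ∀ w : ℝ → Vec d, IsGradientFlow (loss a d (target a d p.1)) p.2 w →
              (∃ v : Vec d, (v = target a d p.1 ∨ v = -target a d p.1) ∧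
                ∃ T₂ : ℝ, 0 ≤ T₂ ∧ StatsConverged a d ε v (w T₂) ∧
                  T₂ ≤ C * (Real.log d + ε ^ (-(2 * a / (a - 1))) * Real.log (1 / ε)) ∧
                  T₂ ≤ K * (d : ℝ) ^ a) ∧
              ∀ v : Vec d, (v = target a d p.1 ∨ v = -target a d p.1) →
                ∀ T₂ : ℝ, 0 ≤ T₂ → T₂ ≤ K * (d : ℝ) ^ a → StatsConverged a d ε v (w T₂) →
                  ∀ τ : ℝ, 0 ≤ τ →
                    |mse d v (w (T₂ + τ)) - mse d v (w T₂) * weightedAverage a d v (w T₂) τ|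
                        ≤ C * ε * (mse d v (w T₂) * weightedAverage a d v (w T₂) τ)
                          + C * (ε ^ 2 * τ ^ 2 * (1 / (d : ℝ)) * sStarTwo a d v) ∧
                    weightedAverage a d v (w T₂) τ ≤ C * uniformAverage a d τ)}
            ≤ ENNReal.ofReal η) ∧
    -- `S_d` for `β_d τ ≪ 1`
    (∃ C : ℝ, ∀ d : ℕ, 1 ≤ d → ∀ τ : ℝ, 0 ≤ τ → betaRate a d * τ ≤ 1 →
      |uniformAverage a d τ - (1 - 16 / (d : ℝ) * τ)| ≤ C * (τ ^ 2 / d)) ∧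
    -- `S_d` for `1 ≪ x_d ≪ d`
    (∀ δ : ℝ, 0 < δ → ∃ M : ℝ, 0 < M ∧ ∃ κ : ℝ, 0 < κ ∧ ∀ d : ℕ, 1 ≤ d → ∀ τ : ℝ, 0 ≤ τ →
      M ≤ xScale a d τ → xScale a d τ ≤ κ * d →
        |uniformAverage a d τ - (1 - Real.Gamma (1 - 1 / a) * (xScale a d τ / d))|
          ≤ δ * (xScale a d τ / d)) ∧
    -- `S_d` for `x_d ≳ d`
    (∀ c : ℝ, 0 < c → ∀ d : ℕ, 1 ≤ d → ∀ τ : ℝ, 0 ≤ τ → c * d ≤ xScale a d τ →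
      uniformAverage a d τ ≤ Real.exp (-(betaRate a d * τ * (d : ℝ) ^ (-a)))) := by
  refine ⟨fun η hη c hc K hK => ?_, ⟨128, fun d hd τ hτ _ => uniformAverage_small_time ha hd hτ⟩,
    fun δ hδ => uniformAverage_middle_time ha hδ,
    fun c _ d hd τ hτ _ => uniformAverage_large_time ha hd hτ⟩
  obtain ⟨A, hA, d₁, htyp⟩ := exists_isTypical ha hη
  obtain ⟨C₁, hC₁, d₂, hconv⟩ := IsTypical.exists_converged ha hA hc hK
  obtain ⟨C₂, hC₂, d₃, hmse⟩ := IsTypical.exists_mse_comparison ha hA hc hK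
  refine ⟨C₁ + C₂, by positivity, max (max d₁ d₂) d₃, fun d hd ε hε hε1 => ?_⟩
  have hd₁ : d₁ ≤ d := (le_max_left _ _).trans ((le_max_left _ _).trans hd)
  have hd₂ : d₂ ≤ d := (le_max_right _ _).trans ((le_max_left _ _).trans hd)
  have hd₃ : d₃ ≤ d := (le_max_right _ _).trans hd
  refine (MeasureTheory.measure_mono fun p hp => ?_).trans (htyp d hd₁)
  rintro ⟨i₀, μ, hty⟩
  refine hp ⟨exists_gradientFlow a d _ _, fun w hw => ?_⟩
  have hd0 := hty.d_pos
  have hε0 : 0 < ε := lt_of_lt_of_le (by positivity) hε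
  have hv1 : qInner a d (target a d p.1) (target a d p.1) = 1 := by
    rw [qInner_self_eq_statS]; exact hty.norm
  obtain ⟨x, hx, hx0, hxw⟩ := hw.exists_isFlow hv1
  have hx0' : x 0 = fun i => (p.2 : Vec d) i := funext hx0
  have hxw' : ∀ t, 0 ≤ t → x t = fun i => w t i := fun t ht => funext (hxw t ht)
  refine ⟨?_, fun v hv T₂ hT₂ hT₂K hstat τ hτ => ?_⟩
  · obtain ⟨v', hv', T, hT, hu, hs, hT1, hT2⟩ :=
      hconv d hd₂ i₀ μ _ _ hty ε hε hε1 x hx hx0'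
    rw [hxw' T hT] at hu hs
    have hlog : 0 ≤ Real.log d := Real.log_natCast_nonneg d
    have hlogε : 0 ≤ Real.log (1 / ε) :=
      Real.log_nonneg (by rw [le_div_iff₀ hε0]; linarith)
    have hT3 : T ≤ (C₁ + C₂) *
        (Real.log d + ε ^ (-(2 * a / (a - 1))) * Real.log (1 / ε)) := by
      refine hT1.trans ?_
      gcongr
      linarith
    refine ⟨WithLp.toLp 2 v', ?_, T, hT, ⟨?_, ?_⟩, hT3, hT2⟩
    · rcases hv' with rfl | rfl
      · exact Or.inl rfl
      · exact Or.inr rfl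
    · rw [qInner_eq_statU]; exact hu
    · rw [qInner_self_eq_statS]; exact hs
  · have hsign : ∃ v' : Fin d → ℝ, (fun i => v i) = v' ∧ IsTypical a d A i₀ μ v' (fun i => (p.2 : Vec d) i) ∧
        IsFlow (eigenvalue a d) v' x := by
      rcases hv with rfl | rfl
      · exact ⟨_, rfl, hty, hx⟩
      · exact ⟨_, rfl, hty.neg, hx.neg_target⟩
    obtain ⟨v', hvv, hty', hx'⟩ := hsign
    subst hvv
    obtain ⟨hu, hs⟩ := hstat
    rw [qInner_eq_statU, ← hxw' T₂ hT₂] at hu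
    rw [qInner_self_eq_statS, ← hxw' T₂ hT₂] at hs
    obtain ⟨h1, h2, h3⟩ := hmse d hd₃ i₀ μ _ _ hty' x hx' hx0' ε hε hε1 T₂ hT₂ hT₂K hu hs τ hτ
    simp only [hxw' T₂ hT₂, hxw' (T₂ + τ) (by linarith)] at h1 h2 h3
    refine ⟨?_, ?_⟩
    · rw [mse_mul_weightedAverage h2, mse, ← mul_sub, abs_mul, abs_of_pos (by positivity)]
      refine (mul_le_mul_of_nonneg_left h1 (by positivity)).trans ?_
      set X := ∑ i, (w T₂ i - v i) ^ 2 * Real.exp (-16 * eigenvalue a d i * τ) with hX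
      have hX0 : 0 ≤ X := Finset.sum_nonneg fun i _ => by positivity
      have hV0 : 0 ≤ ∑ i, eigenvalue a d i ^ 2 * v i ^ 2 :=
        Finset.sum_nonneg fun i _ => by positivity
      have e : (C₁ + C₂) * ε * (1 / (d : ℝ) * X)
          + (C₁ + C₂) * (ε ^ 2 * τ ^ 2 * (1 / (d : ℝ)) * sStarTwo a d v) =
          1 / (d : ℝ) * ((C₁ + C₂) * ε * X
            + (C₁ + C₂) * (ε ^ 2 * τ ^ 2 / d * ∑ i, eigenvalue a d i ^ 2 * v i ^ 2)) := by
        rw [sStarTwo]; ring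
      rw [e]
      gcongr <;> linarith
    · refine weightedAverage_le hd0 h2 (h3.trans ?_)
      gcongr
      linarith
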